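/- **Theorem (threshold for local non-Markovian noise).** *Circuits.* Fix a finite set of unitary gates. A circuit is a set of locations, each executed in one time step, qubits taking part in at most one location per step; a location is a gate (possibly the identity on a resting qubit), the preparation of a fresh qubit in $|0\rangle$ (always the first location on it), or a measurement in the computational basis (always the last location on its qubit). Let $M_0$ be a circuit that prepares all its qubits. *Rectangles.* Let $C$ be a code encoding one qubit into $m$ qubits (a block) that corrects arbitrary errors on a single qubit: for all operators $E,E'$ each acting on one qubit and all codewords $\phi\perp\psi$, $\langle\phi|E^*E'|\psi\rangle=0$. Let a 1-EC (an error-correction circuit on a block), for every gate of arity $n$ a 1-Ga (a circuit on $n$ blocks), a preparation circuit for an encoded $|0\rangle$, and a classical function $\mathrm{dec}:\{0,1\}^m\to\{0,1\}$ be given; the circuits may use ancillas, which they prepare and finally discard, and contain no measurements. The 1-Rec of a gate or of a preparation is its circuit followed by a 1-EC on each block; the 1-Rec of a measurement measures every qubit of the block, and the outcome is obtained by $\mathrm{dec}$. The 1-exRec of a location is its 1-Rec together with the 1-ECs immediately preceding it, one on each input block. $M_{k+1}$ is obtained from $M_k$ by replacing each qubit by a block and each location by its 1-Rec; outcomes of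 $M_k$ are decoded recursively by $\mathrm{dec}$. A fault is the replacement of the operation of a location by an arbitrary operator on its qubits, and "at most one error" means being a linear combination of states obtained by letting an operator act on one qubit of the block (one qubit of each block). Assume: 1. a 1-EC takes any input into the code space if it has no fault, and to a state with at most one error relative to the code space if it has at most one fault; 2. a 1-EC without faults takes an encoded state with at most one error to that encoded state; 3. a 1-EC with at most one fault takes an encoded state to that state with at most one error; 4. a 1-Ga without faults implements its gate on encoded states, and takes an input with at most one error to the correct output with at most one error in each block; 5. a 1-Ga with at most one fault takes an encoded state to the correct output with at most one error in each block; 6. the preparation circuit yields the encoded $|0\rangle$ if it has no fault, and the encoded $|0\rangle$ with at most one error if it has at most one; and when an encoded basis state $|b\rangle$ with at most one error is measured, every possible outcome is decoded by $\mathrm{dec}$ to $b$. *Noise.* The register is coupled to a bath with an arbitrary Hilbert space $\mathcal B$. Every time step is divided into finitely many intervals of length $\Delta>0$. A pair $(a,t)$ of a location and an interval of its time step is a microlocation; it carries a bounded self-adjoint operator $H_{SB,a,t}$ on the qubits of $a$ and the bath. In the interval $t$ the system and bath evolve by $$U_S(t)\,U_B(t)\prod_{a}\bigl(I+F_{a,t}\bigr)$$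 (in some order of the locations $a$ of the time step), where $U_B(t)$ is a unitary on the bath, $U_S(t)$ is a product of unitaries of the individual locations which over the whole time step generate the ideal operations, and $F_{a,t}=-i\Delta H_{SB,a,t}$ throughout (first-order expansion), or $F_{a,t}=e^{-i\Delta H_{SB,a,t}}-I$ throughout (no truncation). A fault path is a term of the expansion of the total evolution in which, at every microlocation, $I$ or $F_{a,t}$ has been chosen; it has a fault at a location if $F_{a,t}$ has been chosen at at least one of its microlocations. For a set $\mathcal I_R$ of locations, $E(\mathcal I_R)$ is the sum of all fault paths with faults at all locations in $\mathcal I_R$. The noise has strength $\eta$ if $\|E(\mathcal I_R)\|\le\eta^r$ for all $r\ge1$ and all $\mathcal I_R$ with $|\mathcal I_R|=r$. *Claim.* Let $A$ be the maximum number of locations in any 1-exRec. If $$\eta<\frac1{\binom A2e^{(A-2)\eta}},$$ then for every $\delta>0$ there is a level $k$ such that, for every noise of strength $\eta$ on $M_k$ and every initial unit state of the bath, the $L_1$-distance between the distribution of the decoded measurement outcome of the noisy execution of $M_k$ (given by Born's rule for the normalised final state) and the distribution of the measurement outcome of the noiseless circuit $M_0$ is at most $\delta$. -/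

import Mathlib

open scoped BigOperators

noncomputable section

/-! ## States and operators

A register is a finite type `W` of qubits, and a computational basis state of it is a function
`W → Bool`.  The Hilbert space of the register together with a bath `B` is `(ℂ²)^{⊗ W} ⊗ B`,
realised as the Hilbert sum of copies of `B` indexed by the basis states. -/

/-- Computational basis states (equivalently, classical configurations) of the register `W`. -/
abbrev Config (W : Type) : Type := W → Bool

/-- The Hilbert space `(ℂ²)^{⊗ W} ⊗ B`; the register on its own is the case `B = ℂ`. -/
def QState (W : Type) [Fintype W] [DecidableEq W] (B : Type*) [NormedAddCommGroup B] : Type _ :=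
  PiLp 2 (fun _ : Config W => B)

namespace QState

variable {W : Type} [Fintype W] [DecidableEq W] {B : Type*} [NormedAddCommGroup B]

instance : NormedAddCommGroup (QState W B) :=
  inferInstanceAs (NormedAddCommGroup (PiLp 2 (fun _ : Config W => B)))

instance [InnerProductSpace ℂ B] : InnerProductSpace ℂ (QState W B) :=
  inferInstanceAs (InnerProductSpace ℂ (PiLp 2 (fun _ : Config W => B)))

instance [CompleteSpace B] : CompleteSpace (QState W B) :=
  inferInstanceAs (CompleteSpace (PiLp 2 (fun _ : Config W => B)))

/-- The state with given components. -/
def mk (f : Config W → B) : QState W B := WithLp.toLp 2 f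

/-- The components of a state. -/
def amp (ψ : QState W B) : Config W → B := WithLp.ofLp ψ

instance : CoeFun (QState W B) (fun _ => Config W → B) := ⟨amp⟩

@[simp] theorem mk_apply (f : Config W → B) (x : Config W) : mk f x = f x := rfl

@[simp] theorem add_apply (ψ φ : QState W B) (x : Config W) : (ψ + φ) x = ψ x + φ x := rfl

@[simp] theorem smul_apply [InnerProductSpace ℂ B] (c : ℂ) (ψ : QState W B) (x : Config W) :
    (c • ψ) x = c • ψ x := rfl

@[ext] theorem ext {ψ φ : QState W B} (h : ∀ x, ψ x = φ x) : ψ = φ := by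
  have h' : amp ψ = amp φ := funext h
  exact WithLp.ofLp_injective 2 h'

theorem norm_sq_eq (ψ : QState W B) : ‖ψ‖ ^ 2 = ∑ x, ‖ψ x‖ ^ 2 :=
  PiLp.norm_sq_eq_of_L2 (fun _ : Config W => B) ψ

@[fun_prop] theorem continuous_apply (x : Config W) : Continuous fun ψ : QState W B => ψ x :=
  (_root_.continuous_apply x).comp (PiLp.continuous_ofLp 2 (fun _ : Config W => B))

theorem continuous_mk {X : Type*} [TopologicalSpace X] {f : X → Config W → B}
    (hf : ∀ x, Continuous fun t => f t x) : Continuous fun t => mk (f t) :=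
  (PiLp.continuous_toLp 2 (fun _ : Config W => B)).comp (continuous_pi hf)

end QState

/-- Matrices acting on `n` qubits. -/
abbrev QMatrix (n : ℕ) : Type := Matrix (Config (Fin n)) (Config (Fin n)) ℂ

section Operators

variable {W : Type} [Fintype W] [DecidableEq W]
variable {B : Type*} [NormedAddCommGroup B] [InnerProductSpace ℂ B]

/-- A matrix on `n` qubits, acting as `M ⊗ 1` on these qubits and the bath. -/
def matrixOp {n : ℕ} (M : QMatrix n) : QState (Fin n) B →L[ℂ] QState (Fin n) B where
  toFun ψ := QState.mk (fun x => ∑ y, M x y • ψ y)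
  map_add' ψ φ := by
    ext x
    simp [Finset.sum_add_distrib]
  map_smul' c ψ := by
    ext x
    simp [Finset.smul_sum, smul_comm c]
  cont := QState.continuous_mk fun x => by fun_prop

/-- An operator on `n` qubits and the bath, applied to the qubits `e 0, …, e (n - 1)` of the
register and to the bath, with the identity on all other qubits.  (Here
`Function.extend e y x` is the configuration `x` with its values at the `e i` replaced by `y i`.) -/
def localOp {n : ℕ} (e : Fin n → W) (T : QState (Fin n) B →L[ℂ] QState (Fin n) B) :
    QState W B →L[ℂ] QState W B where
  toFun ψ := QState.mk (fun x =>
    T (QState.mk (fun y => ψ (Function.extend e y x))) (x ∘ e))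
  map_add' ψ φ := by
    ext x
    have h : (QState.mk (fun y : Config (Fin n) => (ψ + φ) (Function.extend e y x)) :
        QState (Fin n) B) = QState.mk (fun y => ψ (Function.extend e y x)) +
          QState.mk (fun y => φ (Function.extend e y x)) := rfl
    rw [QState.mk_apply, h, map_add]
    rfl
  map_smul' c ψ := by
    ext x
    have h : (QState.mk (fun y : Config (Fin n) => (c • ψ) (Function.extend e y x)) :
        QState (Fin n) B) = c • QState.mk (fun y => ψ (Function.extend e y x)) := rfl
    rw [QState.mk_apply, h, map_smul]
    rfl
  cont := QState.continuous_mk fun x => (QState.continuous_apply _).comp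
    (T.continuous.comp (QState.continuous_mk fun y => QState.continuous_apply _))

/-- An operator on the bath alone. -/
def bathOp (u : B →L[ℂ] B) : QState W B →L[ℂ] QState W B where
  toFun ψ := QState.mk (fun x => u (ψ x))
  map_add' ψ φ := by
    ext x
    simp
  map_smul' c ψ := by
    ext x
    simp
  cont := QState.continuous_mk fun x => by fun_prop

/-- The state `|0…0⟩ ⊗ β`. -/
def zeroState (W : Type) [Fintype W] [DecidableEq W] (β : B) : QState W B :=
  QState.mk (fun x => if x = fun _ => false then β else 0)

/-- The tensor product `φ ⊗ χ` of states of two registers. -/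
def tensorState {V : Type} [Fintype V] [DecidableEq V] (φ : QState W ℂ) (χ : QState V ℂ) :
    QState (W ⊕ V) ℂ :=
  QState.mk (fun x => φ (x ∘ Sum.inl) * χ (x ∘ Sum.inr))

end Operators

/-- The product of a chronological list of operators (the head of the list acts first). -/
def timeOrdered {R : Type*} [Monoid R] (l : List R) : R := l.reverse.prod

/-! ## Circuits -/

/-- A finite set of unitary gates. -/
structure GateSet where
  Gate : Type
  [gateFintype : Fintype Gate]
  arity : Gate → ℕ
  mat : (g : Gate) → QMatrix (arity g)
  unitary : ∀ g, mat g ∈ unitary (QMatrix (arity g))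

attribute [instance] GateSet.gateFintype

/-- The kinds of location: a gate (possibly the identity gate on a resting qubit), the
preparation of a qubit in the state `|0⟩`, and a measurement in the computational basis. -/
inductive LocKind (S : GateSet) where
  | gate (g : S.Gate)
  | prep
  | meas

namespace LocKind

variable {S : GateSet}

/-- Number of qubits involved in a location. -/
def arity : LocKind S → ℕ
  | gate g => S.arity g
  | prep => 1
  | meas => 1

/-- Number of qubits entering a location. -/
def inputs : LocKind S → ℕ
  | gate g => S.arity g
  | prep => 0
  | meas => 1

/-- The ideal operation of a location.  A prepared qubit is fresh (`WellFormedOn` below) and the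
register starts in `|0…0⟩`, and measured qubits are read out at the end of the computation, so
that preparations and measurements act as the identity; they are locations because noise can
act on them. -/
def ideal : (κ : LocKind S) → QMatrix κ.arity
  | gate g => S.mat g
  | prep => (1 : QMatrix 1)
  | meas => (1 : QMatrix 1)

end LocKind

/-- A circuit on the register `W`: locations, each with a kind, a time step `layer` in which it is
executed, and the list of qubits on which it acts. -/
structure Circuit (S : GateSet) (W : Type) where
  Loc : Type
  [locFintype : Fintype Loc]
  [locDecEq : DecidableEq Loc]
  depth : ℕ
  layer : Loc → ℕ
  kind : Loc → LocKind S
  wire : (ℓ : Loc) → Fin (kind ℓ).arity → W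

attribute [instance] Circuit.locFintype Circuit.locDecEq

namespace Circuit

variable {S : GateSet} {W : Type}

/-- The number of locations. -/
def size (C : Circuit S W) : ℕ := Fintype.card C.Loc

/-- The location `ℓ` acts on the qubit `q`. -/
def Touches (C : Circuit S W) (ℓ : C.Loc) (q : W) : Prop := ∃ i, C.wire ℓ i = q

/-- Well-formedness of a circuit in which the qubits satisfying `fresh` are supplied by the
circuit itself, and the other qubits are its inputs. -/
structure WellFormedOn (C : Circuit S W) (fresh : W → Prop) : Prop where
  layer_lt : ∀ ℓ, C.layer ℓ < C.depth
  wire_injective : ∀ ℓ, Function.Injective (C.wire ℓ)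
  /-- No qubit takes part in two locations at the same time. -/
  disjoint : ∀ ℓ ℓ' q, C.layer ℓ = C.layer ℓ' → C.Touches ℓ q → C.Touches ℓ' q → ℓ = ℓ'
  /-- A location is a preparation if it is the first one on a fresh qubit … -/
  prep_of_first : ∀ ℓ q, fresh q → C.Touches ℓ q →
    (∀ ℓ', C.Touches ℓ' q → C.layer ℓ ≤ C.layer ℓ') → C.kind ℓ = LocKind.prep
  /-- … and only then. -/
  first_of_prep : ∀ ℓ q, C.kind ℓ = LocKind.prep → C.Touches ℓ q →
    fresh q ∧ ∀ ℓ', C.Touches ℓ' q → C.layer ℓ ≤ C.layer ℓ'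
  /-- A qubit is not used any more after it has been measured. -/
  last_of_meas : ∀ ℓ q, C.kind ℓ = LocKind.meas → C.Touches ℓ q →
    ∀ ℓ', C.Touches ℓ' q → C.layer ℓ' ≤ C.layer ℓ

/-- The circuit contains no measurements. -/
def NoMeas (C : Circuit S W) : Prop := ∀ ℓ, C.kind ℓ ≠ LocKind.meas

/-- The locations executed in time step `t` (they act on disjoint sets of qubits, so their order
in the list is immaterial). -/
def layerLocs (C : Circuit S W) (t : ℕ) : List C.Loc :=
  (Finset.univ.filter (fun ℓ => C.layer ℓ = t)).toList

/-- The evolution in which each location `ℓ` performs the operation `ops ℓ` on its qubits. -/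
def run [Fintype W] [DecidableEq W] (C : Circuit S W)
    (ops : (ℓ : C.Loc) → QMatrix (C.kind ℓ).arity) : QState W ℂ →L[ℂ] QState W ℂ :=
  timeOrdered ((List.range C.depth).flatMap fun t =>
    (C.layerLocs t).map fun ℓ => localOp (C.wire ℓ) (matrixOp (ops ℓ)))

/-- The ideal operations. -/
def idealOps (C : Circuit S W) (ℓ : C.Loc) : QMatrix (C.kind ℓ).arity := (C.kind ℓ).ideal

/-- The operations `ops` have at most `r` faults: at all but at most `r` locations they are the
ideal ones, and at the others they are arbitrary. -/
def AtMostFaults (C : Circuit S W) (r : ℕ) (ops : (ℓ : C.Loc) → QMatrix (C.kind ℓ).arity) : Prop :=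
  {ℓ | ops ℓ ≠ C.idealOps ℓ}.ncard ≤ r

end Circuit

/-- A complete computation: a circuit without input, together with its register. -/
structure Program (S : GateSet) where
  Qubit : Type
  [qubitFintype : Fintype Qubit]
  [qubitDecEq : DecidableEq Qubit]
  circ : Circuit S Qubit

attribute [instance] Program.qubitFintype Program.qubitDecEq

namespace Program

variable {S : GateSet}

/-- All qubits of a program are prepared by the program itself. -/
def WellFormed (P : Program S) : Prop := P.circ.WellFormedOn (fun _ => True)

/-- The qubits that are measured by the program. -/
def Measured (P : Program S) : Type :=
  {q : P.Qubit // ∃ ℓ, P.circ.kind ℓ = LocKind.meas ∧ P.circ.Touches ℓ q}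

open Classical in
instance (P : Program S) : Fintype P.Measured :=
  inferInstanceAs (Fintype {q : P.Qubit // ∃ ℓ, P.circ.kind ℓ = LocKind.meas ∧ P.circ.Touches ℓ q})

/-- Possible outcomes of the measurement. -/
abbrev Outcome (P : Program S) : Type := P.Measured → Bool

open Classical in
instance (P : Program S) : Fintype P.Outcome := inferInstance

/-- The final state of the noiseless execution. -/
def idealState (P : Program S) : QState P.Qubit ℂ :=
  P.circ.run P.circ.idealOps (zeroState P.Qubit (1 : ℂ))

end Program

/-! ## Rectangles and concatenation -/

/-- A circuit acting on `n` blocks of `m` qubits each and on additional ancilla qubits. -/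
structure Gadget (S : GateSet) (n m : ℕ) where
  Anc : Type
  [ancFintype : Fintype Anc]
  [ancDecEq : DecidableEq Anc]
  circ : Circuit S ((Fin n × Fin m) ⊕ Anc)

attribute [instance] Gadget.ancFintype Gadget.ancDecEq

namespace Gadget

variable {S : GateSet} {n m : ℕ}

/-- The ancillas of a gadget are prepared in it; `blocksFresh` says whether the same holds for its
blocks (as in the preparation of an encoded qubit) or whether these are inputs. -/
def WellFormed (G : Gadget S n m) (blocksFresh : Prop) : Prop :=
  G.circ.WellFormedOn (Sum.elim (fun _ => blocksFresh) (fun _ => True))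

/-- The state of blocks and ancillas after running the gadget, with the operation `ops ℓ` at each
location `ℓ`, on the state `φ` of the blocks. -/
def output (G : Gadget S n m) (ops : (ℓ : G.circ.Loc) → QMatrix (G.circ.kind ℓ).arity)
    (φ : QState (Fin n × Fin m) ℂ) : QState ((Fin n × Fin m) ⊕ G.Anc) ℂ :=
  G.circ.run ops (tensorState φ (zeroState G.Anc (1 : ℂ)))

/-- The gadget `G` followed by a copy of `ec` on each of its blocks. -/
def withEC (G : Gadget S n m) (ec : Gadget S 1 m) : Gadget S n m where
  Anc := G.Anc ⊕ (Fin n × ec.Anc)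
  circ :=
    { Loc := G.circ.Loc ⊕ (Fin n × ec.circ.Loc)
      depth := G.circ.depth + ec.circ.depth
      layer := Sum.elim G.circ.layer (fun p => G.circ.depth + ec.circ.layer p.2)
      kind := Sum.elim G.circ.kind (fun p => ec.circ.kind p.2)
      wire := fun ℓ => match ℓ with
        | Sum.inl ℓ => fun i => Sum.map id Sum.inl (G.circ.wire ℓ i)
        | Sum.inr (b, ℓ) => fun i =>
            Sum.elim (fun p => Sum.inl (b, p.2)) (fun a => Sum.inr (Sum.inr (b, a)))
              (ec.circ.wire ℓ i) }

/-- The measurement of each of the `m` qubits of a block. -/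
def measureBlock (S : GateSet) (m : ℕ) : Gadget S 1 m where
  Anc := Empty
  circ :=
    { Loc := Fin m
      depth := 1
      layer := fun _ => 0
      kind := fun _ => LocKind.meas
      wire := fun ℓ _ => Sum.inl (0, ℓ) }

end Gadget

/-- The data of a fault-tolerance scheme: a code with one logical and `m` physical qubits, an
error-correction gadget (1-EC), for each gate and for the preparation of `|0⟩` a gadget that
implements it on encoded qubits (1-Ga), and a classical function `dec` that derives the logical
outcome from the outcomes of measuring the `m` qubits of a block. -/
structure Scheme (S : GateSet) where
  m : ℕ
  /-- Column `b` is the codeword that encodes the basis state `b`. -/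
  enc : Matrix (Config (Fin m)) Bool ℂ
  ec : Gadget S 1 m
  ga : (g : S.Gate) → Gadget S (S.arity g) m
  prepGa : Gadget S 1 m
  dec : Config (Fin m) → Bool

namespace Scheme

variable {S : GateSet} (F : Scheme S)

/-- The rectangle (1-Rec) of each kind of location. -/
def rec1 : (κ : LocKind S) → Gadget S κ.arity F.m
  | .gate g => (F.ga g).withEC F.ec
  | .prep => F.prepGa.withEC F.ec
  | .meas => Gadget.measureBlock S F.m

/-- The number of locations in the extended rectangle (1-exRec) of a location: its 1-Rec together
with the 1-ECs immediately preceding it, one on each input block. -/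
def exRecSize (κ : LocKind S) : ℕ := κ.inputs * F.ec.circ.size + (F.rec1 κ).circ.size

/-- The maximum number of locations in any 1-exRec. -/
def maxExRecSize : ℕ :=
  max (Finset.univ.sup fun g : S.Gate => F.exRecSize (.gate g))
    (max (F.exRecSize .prep) (F.exRecSize .meas))

/-- The number of time steps allotted to a 1-Rec. -/
def recDepth : ℕ :=
  max (Finset.univ.sup fun g : S.Gate => (F.rec1 (.gate g)).circ.depth)
    (max (F.rec1 .prep).circ.depth (F.rec1 .meas).circ.depth)

/-- The program in which every qubit is replaced by a block of `m` qubits and every location by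
its 1-Rec. -/
def encode (P : Program S) : Program S where
  Qubit := (P.Qubit × Fin F.m) ⊕ (Σ ℓ : P.circ.Loc, (F.rec1 (P.circ.kind ℓ)).Anc)
  circ :=
    { Loc := Σ ℓ : P.circ.Loc, (F.rec1 (P.circ.kind ℓ)).circ.Loc
      depth := P.circ.depth * F.recDepth
      layer := fun p => P.circ.layer p.1 * F.recDepth + (F.rec1 (P.circ.kind p.1)).circ.layer p.2
      kind := fun p => (F.rec1 (P.circ.kind p.1)).circ.kind p.2
      wire := fun p i =>
        Sum.elim (fun q => Sum.inl (P.circ.wire p.1 q.1, q.2)) (fun a => Sum.inr ⟨p.1, a⟩)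
          ((F.rec1 (P.circ.kind p.1)).circ.wire p.2 i) }

/-- The level-`k` simulation `M_k` of the program `M_0 = P`. -/
def level (P : Program S) : ℕ → Program S
  | 0 => P
  | k + 1 => F.encode (level P k)

/-- The recursive classical decoding of the configurations of the qubits of `M_k` to
configurations of the qubits of `M_0`. -/
def decode (P : Program S) : (k : ℕ) → Config (F.level P k).Qubit → Config P.Qubit
  | 0 => fun x => x
  | k + 1 => fun x => decode P k (fun q => F.dec (fun j => x (Sum.inl (q, j))))

open Classical in
/-- The probability of the outcome `z` of the program `P` when the level-`k` simulation of `P`,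
with final state `ψ`, is measured and decoded: Born's rule.  Only the values at the
measured qubits of `P` are used, which depend on measured qubits of `M_k` only. -/
def outcomeProb (P : Program S) (k : ℕ) {B : Type*} [NormedAddCommGroup B] [InnerProductSpace ℂ B]
    (ψ : QState (F.level P k).Qubit B) (z : P.Outcome) : ℝ :=
  (∑ x : Config (F.level P k).Qubit,
    if (∀ q : P.Measured, F.decode P k x q.1 = z q) then ‖ψ x‖ ^ 2 else 0) / ‖ψ‖ ^ 2

/-- The computation error: the `L₁`-distance between the distribution of the decoded outcome of
the level-`k` simulation with final state `ψ`, and that of the noiseless program `P`. -/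
def computationError (P : Program S) (k : ℕ) {B : Type*} [NormedAddCommGroup B]
    [InnerProductSpace ℂ B] (ψ : QState (F.level P k).Qubit B) : ℝ :=
  ∑ z : P.Outcome, |F.outcomeProb P k ψ z - F.outcomeProb P 0 P.idealState z|

/-! ### Fault tolerance -/

/-- The encoding of the state `c` of `n` qubits into `n` blocks. -/
def encodeState {n : ℕ} (c : QState (Fin n) ℂ) : QState (Fin n × Fin F.m) ℂ :=
  QState.mk (fun x => ∑ l : Config (Fin n), (∏ b, F.enc (fun j => x (b, j)) (l b)) * c l)

/-- The operator `E` applied to the `i`-th qubit of block `b`. -/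
def errorAt {n : ℕ} (b : Fin n) (i : Fin F.m) (E : QMatrix 1) :
    QState (Fin n × Fin F.m) ℂ →L[ℂ] QState (Fin n × Fin F.m) ℂ :=
  localOp (fun _ : Fin 1 => (b, i)) (matrixOp E)

/-- States in which the blocks are in the encoded state `c` without errors; the second factor is
the final state of the ancillas, which are discarded. -/
def noError {n : ℕ} (Anc : Type) [Fintype Anc] [DecidableEq Anc] (c : QState (Fin n) ℂ) :
    Set (QState ((Fin n × Fin F.m) ⊕ Anc) ℂ) :=
  {v | ∃ χ, v = tensorState (F.encodeState c) χ}

/-- States in which the blocks are in the encoded state `c`, with at most one error in each block: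
superpositions of states obtained by letting an operator act on one qubit of each block. -/
def oneError {n : ℕ} (Anc : Type) [Fintype Anc] [DecidableEq Anc] (c : QState (Fin n) ℂ) :
    Set (QState ((Fin n × Fin F.m) ⊕ Anc) ℂ) :=
  Submodule.span ℂ {v | ∃ (i : Fin n → Fin F.m) (E : QMatrix n) (χ : QState Anc ℂ),
    v = localOp (fun b => Sum.inl (b, i b)) (matrixOp E) (tensorState (F.encodeState c) χ)}

/-- The conditions on the code and on the gadgets. -/
structure FaultTolerant : Prop where
  /-- The encoding is isometric. -/
  enc_isometry : F.enc.conjTranspose * F.enc = 1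
  /-- The code corrects errors on a single qubit. -/
  corrects : ∀ (i j : Fin F.m) (E E' : QMatrix 1) (c c' : QState (Fin 1) ℂ),
    inner ℂ (F.encodeState c) (F.encodeState c') = 0 →
    inner ℂ (F.errorAt 0 i E (F.encodeState c)) (F.errorAt 0 j E' (F.encodeState c')) = 0
  ec_wf : F.ec.WellFormed False
  ec_noMeas : F.ec.circ.NoMeas
  ga_wf : ∀ g, (F.ga g).WellFormed False
  ga_noMeas : ∀ g, (F.ga g).circ.NoMeas
  prep_wf : F.prepGa.WellFormed True
  prep_noMeas : F.prepGa.circ.NoMeas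
  /-- The preparation gadget prepares all qubits of its block. -/
  prep_all : ∀ q : Fin 1 × Fin F.m, ∃ ℓ, F.prepGa.circ.Touches ℓ (Sum.inl q)
  /-- A 1-EC without faults takes any input into the code space. -/
  ec_project : ∀ φ, F.ec.output F.ec.circ.idealOps φ ∈
    Submodule.span ℂ (⋃ c, F.noError F.ec.Anc c)
  /-- A 1-EC with at most one fault takes any input to a state with at most one error. -/
  ec_filter : ∀ ops, F.ec.circ.AtMostFaults 1 ops → ∀ φ,
    F.ec.output ops φ ∈ Submodule.span ℂ (⋃ c, F.oneError F.ec.Anc c)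
  /-- A 1-EC without faults corrects one error. -/
  ec_correct : ∀ (i : Fin F.m) (E : QMatrix 1) (c : QState (Fin 1) ℂ),
    F.ec.output F.ec.circ.idealOps (F.errorAt 0 i E (F.encodeState c)) ∈ F.noError F.ec.Anc c
  /-- A 1-EC with at most one fault takes an input without errors to an output with at most one
  error. -/
  ec_fault : ∀ ops, F.ec.circ.AtMostFaults 1 ops → ∀ c : QState (Fin 1) ℂ,
    F.ec.output ops (F.encodeState c) ∈ F.oneError F.ec.Anc c
  /-- A 1-Ga without faults implements its gate on encoded states. -/
  ga_ideal : ∀ (g : S.Gate) (c : QState (Fin (S.arity g)) ℂ),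
    (F.ga g).output (F.ga g).circ.idealOps (F.encodeState c) ∈
      F.noError (F.ga g).Anc (matrixOp (S.mat g) c)
  /-- A 1-Ga without faults takes an input with at most one error to an output with at most one
  error in each block. -/
  ga_propagate : ∀ (g : S.Gate) (b : Fin (S.arity g)) (i : Fin F.m) (E : QMatrix 1)
      (c : QState (Fin (S.arity g)) ℂ),
    (F.ga g).output (F.ga g).circ.idealOps (F.errorAt b i E (F.encodeState c)) ∈
      F.oneError (F.ga g).Anc (matrixOp (S.mat g) c)
  /-- A 1-Ga with at most one fault takes an input without errors to an output with at most one
  error in each block. -/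
  ga_fault : ∀ (g : S.Gate) ops, (F.ga g).circ.AtMostFaults 1 ops →
    ∀ c : QState (Fin (S.arity g)) ℂ,
      (F.ga g).output ops (F.encodeState c) ∈ F.oneError (F.ga g).Anc (matrixOp (S.mat g) c)
  /-- Without faults, the preparation gadget prepares an encoded `|0⟩`. -/
  prep_ideal : F.prepGa.output F.prepGa.circ.idealOps (zeroState _ (1 : ℂ)) ∈
    F.noError F.prepGa.Anc (zeroState (Fin 1) (1 : ℂ))
  /-- With at most one fault, it prepares an encoded `|0⟩` with at most one error. -/
  prep_fault : ∀ ops, F.prepGa.circ.AtMostFaults 1 ops →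
    F.prepGa.output ops (zeroState _ (1 : ℂ)) ∈
      F.oneError F.prepGa.Anc (zeroState (Fin 1) (1 : ℂ))
  /-- If an encoded basis state with at most one error is measured, then `dec` derives the logical
  value from the outcomes. -/
  meas_correct : ∀ (i : Fin F.m) (E : QMatrix 1) (b : Bool) (x : Config (Fin 1 × Fin F.m)),
    F.errorAt 0 i E (F.encodeState (QState.mk (fun l => if l 0 = b then 1 else 0))) x ≠ 0 →
      F.dec (fun j => x (0, j)) = b

end Scheme

/-! ## Local non-Markovian noise -/

/-- The two usual ways of splitting the evolution `exp (-iΔH)` generated by an interaction term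
into "no fault" plus "fault": to first order, `1 + (-iΔH)`, or exactly,
`1 + (exp (-iΔH) - 1)`. -/
inductive FaultSplitting where
  | firstOrder
  | exact

/-- Local non-Markovian noise in the execution of a program, with bath `B`.  Every time step (the
fundamental gate time) is divided into `steps` intervals of length `Δ`.  A pair of a location and an
interval of its time step is a microlocation; there the qubits of the location interact with the bath
through the Hamiltonian `HSB`.  In each interval, the evolution is the product of the interactions
at the microlocations (in some order `order`), of the evolution `exp (-iΔH_B)` of the bath, and of the
evolution `exp (-iΔH_S)` of the system, which is the product of the unitaries `gateStep` of the
locations and which over the whole time step generates the ideal operations. -/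
structure Noise {S : GateSet} (P : Program S) (B : Type*) [NormedAddCommGroup B]
    [InnerProductSpace ℂ B] [CompleteSpace B] where
  steps : ℕ
  steps_pos : 0 < steps
  Δ : ℝ
  Δ_pos : 0 < Δ
  splitting : FaultSplitting
  order : ℕ → Fin steps → List P.circ.Loc
  order_nodup : ∀ t s, (order t s).Nodup
  mem_order : ∀ t s ℓ, ℓ ∈ order t s ↔ P.circ.layer ℓ = t
  gateStep : (ℓ : P.circ.Loc) → Fin steps → QMatrix (P.circ.kind ℓ).arity
  gateStep_unitary : ∀ ℓ s, gateStep ℓ s ∈ unitary (QMatrix (P.circ.kind ℓ).arity)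
  gateStep_prod : ∀ ℓ, timeOrdered (List.ofFn (gateStep ℓ)) = (P.circ.kind ℓ).ideal
  bathStep : ℕ → Fin steps → (B ≃ₗᵢ[ℂ] B)
  HSB : (ℓ : P.circ.Loc) → Fin steps →
    (QState (Fin (P.circ.kind ℓ).arity) B →L[ℂ] QState (Fin (P.circ.kind ℓ).arity) B)
  HSB_selfAdjoint : ∀ ℓ s, IsSelfAdjoint (HSB ℓ s)

namespace Noise

variable {S : GateSet} {P : Program S} {B : Type*} [NormedAddCommGroup B]
  [InnerProductSpace ℂ B] [CompleteSpace B] (N : Noise P B)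

/-- The operator that acts at a microlocation at which a fault path has a fault. -/
def fault (ℓ : P.circ.Loc) (s : Fin N.steps) :
    QState (Fin (P.circ.kind ℓ).arity) B →L[ℂ] QState (Fin (P.circ.kind ℓ).arity) B :=
  match N.splitting with
  | .firstOrder => (-(Complex.I * (N.Δ : ℂ))) • N.HSB ℓ s
  | .exact => NormedSpace.exp ((-(Complex.I * (N.Δ : ℂ))) • N.HSB ℓ s) - 1

/-- The evolution in which the interaction factor at each microlocation `(ℓ, s)` is
`factor ℓ s`. -/
def evolveWith (factor : (ℓ : P.circ.Loc) → Fin N.steps →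
    (QState (Fin (P.circ.kind ℓ).arity) B →L[ℂ] QState (Fin (P.circ.kind ℓ).arity) B)) :
    QState P.Qubit B →L[ℂ] QState P.Qubit B :=
  timeOrdered ((List.range P.circ.depth).flatMap fun t =>
    (List.finRange N.steps).flatMap fun s =>
      ((N.order t s).map fun ℓ => localOp (P.circ.wire ℓ) (factor ℓ s)) ++
      [bathOp (N.bathStep t s : B →L[ℂ] B)] ++
      ((N.order t s).map fun ℓ => localOp (P.circ.wire ℓ) (matrixOp (N.gateStep ℓ s))))

/-- The noisy evolution. -/
def evolution : QState P.Qubit B →L[ℂ] QState P.Qubit B :=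
  N.evolveWith fun ℓ s => 1 + N.fault ℓ s

/-- The fault path with faults exactly at the microlocations in `p`. -/
def faultPath (p : Finset (P.circ.Loc × Fin N.steps)) : QState P.Qubit B →L[ℂ] QState P.Qubit B :=
  N.evolveWith fun ℓ s => if (ℓ, s) ∈ p then N.fault ℓ s else 1

/-- The sum `E(R)` of all fault paths with faults at all locations in `R`; a fault path has a fault at
a location if it has one at some microlocation of that location. -/
def E (R : Finset P.circ.Loc) : QState P.Qubit B →L[ℂ] QState P.Qubit B :=
  ∑ p ∈ (Finset.univ : Finset (Finset (P.circ.Loc × Fin N.steps))).filter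
    (fun p => ∀ ℓ ∈ R, ∃ s, (ℓ, s) ∈ p), N.faultPath p

/-- `‖E(R)‖ ≤ η ^ r` for every `r ≥ 1` and every set `R` of `r` locations.  (For `r = 0`, `E(R)` is the
total evolution.) -/
def HasStrength (η : ℝ) : Prop :=
  ∀ R : Finset P.circ.Loc, R.Nonempty → ‖N.E R‖ ≤ η ^ R.card

end Noise

end

/-! The proof is a level reduction for families of vectors rather than for noise models. The final
state of a noisy execution is a sum of vectors `Φ c`, where `c` is the set of locations at which a
fault path has faults. Two properties are all that is kept: `Φ c` lies in (bath) ⊗ (states the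
program reaches when the operations at `c` are arbitrary), and the sum of `Φ c` over all `c ⊇ J` has
norm at most `η ^ #J` for nonempty `J`. `Noise.evolveWith_mem` and `Noise.sum_faultSum` give both
for local non-Markovian noise.

One level is removed by an isometry that decodes every block into a qubit and puts syndromes and
ancillas into an enlarged bath (`decodeMap`). It is built from a complete family of decoders
(`FaultTolerant.exists_decoders`). A decoder maps encoded states with one error back to the encoded
qubit, up to a factor that depends on the error alone, and the family is compatible with `dec`, so
decoding before measuring gives the same statistics as `dec` after measuring. Decoders are pulled
back through the circuit, one rectangle at a time (`FaultTolerant.sim_step`). A rectangle whose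
extended rectangle is good acts, up to a scalar, as its ideal location; a bad one acts as some
linear combination of arbitrary operations. Hence `Φ c` is decoded to a state of the lower level
with faults exactly in the set of bad locations (`FaultTolerant.decodeMap_mem`).

Overlapping extended rectangles are handled by partitioning the physical locations: an error
correction between two rectangles belongs to the later one. Badness is decided from later to earlier
locations. A location is bad if its region has two faults, or one fault together with a fault in a
following error correction that leads to a location which is not bad. The indicator that all
locations of a set `R` are bad is expanded into indicators `[S ⊆ c]`, because sums over supersets
are the only ones whose norms are controlled. If the absolute values of the coefficients, weighted
by `η ^ #S`, add up to at most `f ^ #R`, then so does the norm (`HasBound.norm_sum_le`,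
`FaultRegions.norm_sum_bad_le`). The recursion creates chains of single faults, whose weight `w` is
slightly larger than `η`.

That `f` may be taken to be `(A choose 2) e^((A-2)η) η²`, with no loss in the constant, is the
estimate `bad_weight_le`. Pairs of faults inside the following error corrections are counted in `A
choose 2` but do not make the location bad; this slack pays for the chains. It suffices because an
error correction has at least five locations (`FaultTolerant.five_le_ec_size`), which in turn rests
on the fact that a code correcting one error has at least five qubits (`FaultTolerant.five_le_m`).

With `ρ = (A choose 2) e^((A-2)η) η < 1` each level multiplies the strength by at most `ρ`, so after
`k` levels it is at most `ρ^k η`. At level 0 inclusion and exclusion bounds the distance of the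
decoded state from its fault-free part by `2^n ρ^k η`, with `n` the number of locations of the
original program. The fault-free part is the ideal state tensored with a bath vector. Since no
factor of the noisy evolution decreases norms, normalisation costs only a constant factor. -/

set_option linter.unusedSectionVars false

noncomputable section

/-! ## Expansions in fault indicators -/

section Expansion

variable {Λ : Type} [DecidableEq Λ]

/-- `h` is a linear combination of the indicators `[S i ⊆ c]` with `S i ⊆ D`, and the sum of the
absolute values of the coefficients, weighted by `η ^ #(S i)`, is at most `B`. -/
def HasBound (η : ℝ) (D : Finset Λ) (h : Finset Λ → ℝ) (B : ℝ) : Prop :=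
  ∃ (ι : Type) (_ : Fintype ι) (k : ι → ℝ) (S : ι → Finset Λ), (∀ i, S i ⊆ D) ∧
    (∀ c, h c = ∑ i, k i * if S i ⊆ c then 1 else 0) ∧ ∑ i, |k i| * η ^ (S i).card ≤ B

namespace HasBound

variable {η : ℝ} {D D' : Finset Λ} {h h' : Finset Λ → ℝ} {B B' : ℝ}

theorem mono (H : HasBound η D h B) (hD : D ⊆ D') (hB : B ≤ B') : HasBound η D' h B' := by
  obtain ⟨ι, i, k, S, h1, h2, h3⟩ := H
  exact ⟨ι, i, k, S, fun i => (h1 i).trans hD, h2, h3.trans hB⟩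

theorem congr (H : HasBound η D h B) (e : ∀ c, h' c = h c) : HasBound η D h' B := by
  have : h' = h := funext e
  rwa [this]

theorem zero (η : ℝ) (D : Finset Λ) : HasBound η D (fun _ => 0) 0 :=
  ⟨Empty, inferInstance, fun _ => 0, fun _ => ∅, by simp, by simp, by simp⟩

theorem one (η : ℝ) (D : Finset Λ) : HasBound η D (fun _ => 1) 1 :=
  ⟨Unit, inferInstance, fun _ => 1, fun _ => ∅, by simp, by simp, by simp⟩

theorem mem (η : ℝ) (x : Λ) : HasBound η {x} (fun c => if x ∈ c then 1 else 0) η :=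
  ⟨Unit, inferInstance, fun _ => 1, fun _ => {x}, by simp, by simp, by simp⟩

theorem add (H : HasBound η D h B) (H' : HasBound η D h' B') :
    HasBound η D (fun c => h c + h' c) (B + B') := by
  obtain ⟨ι, i, k, S, h1, h2, h3⟩ := H
  obtain ⟨ι', i', k', S', h1', h2', h3'⟩ := H'
  refine ⟨ι ⊕ ι', inferInstance, Sum.elim k k', Sum.elim S S', ?_, ?_, ?_⟩
  · rintro (j | j)
    · exact h1 j
    · exact h1' j
  · intro c
    simp only [h2, h2', Fintype.sum_sum_type, Sum.elim_inl, Sum.elim_inr]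
    rfl
  · simp only [Fintype.sum_sum_type, Sum.elim_inl, Sum.elim_inr]
    exact add_le_add h3 h3'

theorem smul (H : HasBound η D h B) (r : ℝ) : HasBound η D (fun c => r * h c) (|r| * B) := by
  obtain ⟨ι, i, k, S, h1, h2, h3⟩ := H
  refine ⟨ι, i, fun j => r * k j, S, h1, ?_, ?_⟩
  · intro c
    simp only [h2, Finset.mul_sum, mul_assoc]
  · calc ∑ j, |r * k j| * η ^ (S j).card = |r| * ∑ j, |k j| * η ^ (S j).card := by
          simp only [abs_mul, Finset.mul_sum, mul_assoc]
      _ ≤ |r| * B := mul_le_mul_of_nonneg_left h3 (abs_nonneg r)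

theorem sum {κ : Type} (s : Finset κ) {f : κ → Finset Λ → ℝ} {b : κ → ℝ}
    (H : ∀ i ∈ s, HasBound η D (f i) (b i)) :
    HasBound η D (fun c => ∑ i ∈ s, f i c) (∑ i ∈ s, b i) := by
  classical
  induction s using Finset.induction_on with
  | empty => simpa using zero η D
  | insert a s ha ih =>
    have h1 := (H a (Finset.mem_insert_self a s)).add
      (ih fun i hi => H i (Finset.mem_insert_of_mem hi))
    rw [Finset.sum_insert ha]
    exact h1.congr fun c => by rw [Finset.sum_insert ha]

/-- Disjoint supports make the cardinalities of unions additive, so the weights `η ^ #S` multiply.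
Every later expansion is arranged so that its factors live on disjoint regions. -/
theorem mul (hη : 0 ≤ η) (H : HasBound η D h B) (H' : HasBound η D' h' B')
    (hd : Disjoint D D') : HasBound η (D ∪ D') (fun c => h c * h' c) (B * B') := by
  obtain ⟨ι, i, k, S, h1, h2, h3⟩ := H
  obtain ⟨ι', i', k', S', h1', h2', h3'⟩ := H'
  refine ⟨ι × ι', inferInstance, fun p => k p.1 * k' p.2, fun p => S p.1 ∪ S' p.2, ?_, ?_, ?_⟩
  · exact fun p => Finset.union_subset_union (h1 p.1) (h1' p.2)
  · intro c
    simp only [h2, h2']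
    rw [Finset.sum_mul_sum, ← Finset.univ_product_univ, Finset.sum_product]
    refine Finset.sum_congr rfl fun a _ => Finset.sum_congr rfl fun b _ => ?_
    by_cases ha : S a ⊆ c <;> by_cases hb : S' b ⊆ c <;> simp [Finset.union_subset_iff, ha, hb]
  · have e : ∑ p : ι × ι', |k p.1 * k' p.2| * η ^ (S p.1 ∪ S' p.2).card
        = (∑ j, |k j| * η ^ (S j).card) * ∑ j, |k' j| * η ^ (S' j).card := by
      rw [Finset.sum_mul_sum, ← Finset.univ_product_univ, Finset.sum_product]
      refine Finset.sum_congr rfl fun a _ => Finset.sum_congr rfl fun b _ => ?_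
      rw [Finset.card_union_of_disjoint
        (Finset.disjoint_of_subset_left (h1 a) (Finset.disjoint_of_subset_right (h1' b) hd)),
        abs_mul, pow_add]
      ring
    rw [e]
    have p1 : 0 ≤ ∑ j, |k j| * η ^ (S j).card := Finset.sum_nonneg fun j _ => by positivity
    have p2 : 0 ≤ ∑ j, |k' j| * η ^ (S' j).card := Finset.sum_nonneg fun j _ => by positivity
    exact mul_le_mul h3 h3' p2 (p1.trans h3)

/-- No fault in `D`. -/
theorem none (hη : 0 ≤ η) (D : Finset Λ) :
    HasBound η D (fun c => if c ∩ D = ∅ then 1 else 0) ((1 + η) ^ D.card) := by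
  induction D using Finset.induction_on with
  | empty => simpa using one η (∅ : Finset Λ)
  | insert a s ha ih =>
    -- The absence of one fault is `1 - [a ∈ c]`, of weight `1 + η`.
    have h1 : HasBound η {a} (fun c => 1 + (-1) * if a ∈ c then 1 else 0) (1 + |(-1 : ℝ)| * η) :=
      (one η {a}).add ((mem η a).smul (-1))
    have h2 := h1.mul hη ih (by simpa using ha)
    rw [Finset.card_insert_of_notMem ha, pow_succ']
    refine (h2.mono (by rw [Finset.insert_eq]) (by simp)).congr fun c => ?_
    by_cases hc : a ∈ c
    · have : c ∩ insert a s ≠ ∅ := by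
        intro h
        have := Finset.mem_inter.2 ⟨hc, Finset.mem_insert_self a s⟩
        rw [h] at this
        simp at this
      simp [hc]
    · simp [hc, Finset.inter_insert_of_notMem]

/-- Exactly the fault `x` in `D`. -/
theorem single (hη : 0 ≤ η) {x : Λ} (hx : x ∈ D) :
    HasBound η D (fun c => if c ∩ D = {x} then 1 else 0) (η * (1 + η) ^ (D.card - 1)) := by
  have h2 := (mem η x).mul hη (none hη (D.erase x)) (by simp)
  rw [Finset.card_erase_of_mem hx] at h2
  refine (h2.mono ?_ le_rfl).congr fun c => ?_
  · rw [← Finset.insert_eq, Finset.insert_erase hx]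
  · have e : c ∩ D = {x} ↔ x ∈ c ∧ c ∩ D.erase x = ∅ := by
      constructor
      · intro h
        have : x ∈ c ∩ D := by simp [h]
        refine ⟨(Finset.mem_inter.1 this).1, ?_⟩
        rw [Finset.inter_erase, h]
        simp
      · rintro ⟨h1, h2⟩
        rw [Finset.inter_erase] at h2
        have : x ∈ c ∩ D := Finset.mem_inter.2 ⟨h1, hx⟩
        rw [← Finset.insert_erase this, h2]
        simp
    by_cases h1 : x ∈ c <;> by_cases h2 : c ∩ D.erase x = ∅ <;> simp [e, h1, h2]

/-- Exactly one fault in `D`. -/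
theorem exactly_one (hη : 0 ≤ η) (D : Finset Λ) :
    HasBound η D (fun c => if (c ∩ D).card = 1 then 1 else 0)
      (D.card * (η * (1 + η) ^ (D.card - 1))) := by
  have h := sum (D := D) D (f := fun x c => if c ∩ D = {x} then 1 else 0)
    (b := fun _ => η * (1 + η) ^ (D.card - 1)) fun x hx => single hη hx
  rw [Finset.sum_const, nsmul_eq_mul] at h
  refine h.congr fun c => ?_
  by_cases hc : (c ∩ D).card = 1
  · obtain ⟨x, hx⟩ := Finset.card_eq_one.1 hc
    have hxD : x ∈ D := (Finset.mem_inter.1 (by simp [hx] : x ∈ c ∩ D)).2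
    simp [hx, hxD]
  · rw [if_neg hc]
    symm
    refine Finset.sum_eq_zero fun x _ => if_neg fun h => hc (by simp [h])

/-- At least two faults in `D`. -/
theorem two_le (hη : 0 ≤ η) (D : Finset Λ) :
    HasBound η D (fun c => if 2 ≤ (c ∩ D).card then 1 else 0)
      (D.card.choose 2 * (η ^ 2 * (1 + η) ^ (D.card - 2))) := by
  induction D using Finset.induction_on with
  | empty => simpa using zero η (∅ : Finset Λ)
  | insert a s ha ih =>
    -- Two faults in `insert a s` means two in `s`, or `a` together with exactly one in `s`. The
    -- counts combine by Pascal's rule.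
    have h2 := (mem η a).mul hη (exactly_one hη s) (by simpa using ha)
    have h3 := (ih.mono (D' := insert a s) (Finset.subset_insert a s) le_rfl).add
      (h2.mono (by rw [Finset.insert_eq]) le_rfl)
    refine (h3.mono subset_rfl ?_).congr fun c => ?_
    · rw [Finset.card_insert_of_notMem ha]
      rcases Nat.lt_or_ge s.card 2 with hs | hs
      · interval_cases s.card <;> simp
        nlinarith
      · obtain ⟨n, hn⟩ := Nat.exists_eq_add_of_le' hs
        rw [hn]
        have e1 : ((n + 2 + 1).choose 2 : ℝ) = (n + 2) + (n + 2).choose 2 := by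
          rw [Nat.choose_succ_succ' (n + 2) 1]
          push_cast [Nat.choose_one_right]
          ring
        have e2 : n + 2 + 1 - 2 = n + 1 := by omega
        have e3 : n + 2 - 1 = n + 1 := by omega
        rw [e1, e2, e3, Nat.add_sub_cancel]
        push_cast
        have : (1 + η) ^ n ≤ (1 + η) ^ (n + 1) := pow_le_pow_right₀ (by linarith) (by omega)
        have : ((n + 2).choose 2 : ℝ) * (η ^ 2 * (1 + η) ^ n) ≤
            ((n + 2).choose 2 : ℝ) * (η ^ 2 * (1 + η) ^ (n + 1)) := by gcongr
        nlinarith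
    · by_cases hc : a ∈ c
      · rw [Finset.inter_insert_of_mem hc, Finset.card_insert_of_notMem (by simp [ha])]
        rcases lt_trichotomy (c ∩ s).card 1 with h | h | h
        · have h' : (c ∩ s).card = 0 := by omega
          rw [h']; simp
        · rw [h]; simp [hc]
        · have : 2 ≤ (c ∩ s).card + 1 := by omega
          have h' : (c ∩ s).card ≠ 1 := by omega
          have h'' : 2 ≤ (c ∩ s).card := by omega
          simp [this, h', h'']
      · rw [Finset.inter_insert_of_notMem hc]
        simp [hc]

/-- The bound for a sum over fault configurations of vectors. -/
theorem norm_sum_le [Fintype Λ] {E : Type*} [NormedAddCommGroup E] [NormedSpace ℝ E]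
    (H : HasBound η D h B) (hη : 0 ≤ η) (h0 : h ∅ = 0) (Φ : Finset Λ → E)
    (hΦ : ∀ J : Finset Λ, J.Nonempty →
      ‖∑ c ∈ Finset.univ.filter (fun c => J ⊆ c), Φ c‖ ≤ η ^ J.card) :
    ‖∑ c, h c • Φ c‖ ≤ B := by
  obtain ⟨ι, i, k, S, h1, h2, h3⟩ := H
  have e1 : ∑ c, h c • Φ c = ∑ j, k j • ∑ c ∈ Finset.univ.filter (fun c => S j ⊆ c), Φ c := by
    simp only [h2, Finset.sum_smul, Finset.smul_sum, Finset.sum_filter]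
    rw [Finset.sum_comm]
    refine Finset.sum_congr rfl fun j _ => Finset.sum_congr rfl fun c _ => ?_
    by_cases hc : S j ⊆ c <;> simp [hc]
  -- The total sum of `Φ` is not small, so terms with `S j = ∅` must disappear. Evaluating the
  -- expansion at `∅` shows that their coefficients add up to `h ∅ = 0`.
  have e2 : ∑ j ∈ Finset.univ.filter (fun j => S j = ∅), k j = 0 := by
    have := h2 ∅
    rw [h0] at this
    rw [this, Finset.sum_filter]
    refine Finset.sum_congr rfl fun j _ => ?_
    by_cases hj : S j = ∅ <;> simp [hj, Finset.subset_empty]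
  rw [e1, ← Finset.sum_filter_add_sum_filter_not Finset.univ (fun j => S j = ∅)]
  have e3 : ∑ j ∈ Finset.univ.filter (fun j => S j = ∅),
      k j • ∑ c ∈ Finset.univ.filter (fun c => S j ⊆ c), Φ c = 0 := by
    have : ∀ j ∈ Finset.univ.filter (fun j => S j = ∅),
        k j • ∑ c ∈ Finset.univ.filter (fun c => S j ⊆ c), Φ c = k j • ∑ c, Φ c := by
      intro j hj
      rw [(Finset.mem_filter.1 hj).2]
      simp
    rw [Finset.sum_congr rfl this, ← Finset.sum_smul, e2, zero_smul]
  rw [e3, zero_add]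
  refine (_root_.norm_sum_le _ _).trans (le_trans ?_ h3)
  refine (Finset.sum_le_sum (g := fun j => |k j| * η ^ (S j).card) fun j hj => ?_).trans
    (Finset.sum_le_sum_of_subset_of_nonneg (Finset.filter_subset _ _)
      fun j _ _ => by positivity)
  rw [norm_smul, Real.norm_eq_abs]
  exact mul_le_mul_of_nonneg_left
    (hΦ _ (Finset.nonempty_iff_ne_empty.2 (Finset.mem_filter.1 hj).2)) (abs_nonneg _)

end HasBound

end Expansion

/-! ## Bad rectangles -/

/-- A partition of the physical locations `Λ` into regions indexed by the simulated locations `α`;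
`par x = some a` means that `x` is in an error correction between `a` and the later location
`reg x`, to whose region it belongs. -/
structure FaultRegions (Λ α : Type) where
  reg : Λ → α
  par : Λ → Option α
  rank : α → ℕ
  rank_lt : ∀ x a, par x = some a → rank a < rank (reg x)

namespace FaultRegions

open Classical in
/-- The region of `a`. -/
def cell {Λ α : Type} [Fintype Λ] (G : FaultRegions Λ α) (a : α) : Finset Λ :=
  Finset.univ.filter fun x => G.reg x = a

variable {Λ α : Type} [Fintype Λ] (G : FaultRegions Λ α)

theorem mem_cell {x : Λ} {a : α} : x ∈ G.cell a ↔ G.reg x = a := by simp [cell]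

/-- Induction from later to earlier locations. -/
theorem rank_induction {p : α → Prop}
    (h : ∀ a, (∀ x, G.par x = some a → p (G.reg x)) → p a) (a : α) : p a := by
  generalize hn : (Finset.univ.sup fun x => G.rank (G.reg x)) - G.rank a = n
  induction n using Nat.strong_induction_on generalizing a with
  | _ n ih =>
    refine h a fun x hx => ih _ ?_ _ rfl
    have h1 := G.rank_lt x a hx
    have h2 : G.rank (G.reg x) ≤ Finset.univ.sup fun x => G.rank (G.reg x) :=
      Finset.le_sup (f := fun x => G.rank (G.reg x)) (Finset.mem_univ x)
    omega

variable [DecidableEq Λ]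

/-- `a` is bad for the fault configuration `c` if its region contains two faults, or one fault and
there is a fault between `a` and a later location that is not bad; the members of `R` count as bad. -/
def Bad (R : Finset α) (c : Finset Λ) (a : α) : Prop :=
  a ∈ R ∨ 2 ≤ (c ∩ G.cell a).card ∨ ((c ∩ G.cell a).card = 1 ∧
    ∃ x : {x : Λ // x ∈ c ∧ G.par x = some a}, ¬ Bad R c (G.reg x.1))
termination_by (Finset.univ.sup fun x => G.rank (G.reg x)) - G.rank a
decreasing_by
  have h1 := G.rank_lt x.1 a x.2.2
  have h2 : G.rank (G.reg x.1) ≤ Finset.univ.sup fun x => G.rank (G.reg x) :=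
    Finset.le_sup (f := fun x => G.rank (G.reg x)) (Finset.mem_univ x.1)
  omega

/-- The condition that makes `a` bad, without the exception for members of `R`. -/
def BadCond (R : Finset α) (c : Finset Λ) (a : α) : Prop :=
  2 ≤ (c ∩ G.cell a).card ∨ ((c ∩ G.cell a).card = 1 ∧
    ∃ x ∈ c, G.par x = some a ∧ ¬ G.Bad R c (G.reg x))

theorem bad_iff (R : Finset α) (c : Finset Λ) (a : α) :
    G.Bad R c a ↔ a ∈ R ∨ G.BadCond R c a := by
  rw [Bad, BadCond]
  simp [and_assoc]

theorem bad_empty_iff (c : Finset Λ) (a : α) : G.Bad ∅ c a ↔ G.BadCond ∅ c a := by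
  simp [bad_iff]

/-- Either side forces `Bad R` and `Bad ∅` to agree everywhere, by induction on the rank: outside
`R` the recursions coincide, and on `R` both hold. So the event that all of `R` is bad can be
evaluated with the recursion cut off at `R`, where the members of `R` no longer depend on each
other. -/
theorem forall_badCond_iff (R : Finset α) (c : Finset Λ) :
    (∀ a ∈ R, G.BadCond R c a) ↔ ∀ a ∈ R, G.Bad ∅ c a := by
  have key : ((∀ a ∈ R, G.BadCond R c a) ∨ ∀ a ∈ R, G.Bad ∅ c a) →
      ∀ b, (G.Bad R c b ↔ G.Bad ∅ c b) := by
    intro h b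
    refine G.rank_induction (p := fun b => G.Bad R c b ↔ G.Bad ∅ c b) (fun b ih => ?_) b
    have e : G.BadCond R c b ↔ G.BadCond ∅ c b := by
      unfold BadCond
      refine or_congr Iff.rfl (and_congr Iff.rfl (exists_congr fun x =>
        and_congr Iff.rfl ?_))
      constructor
      · rintro ⟨h1, h2⟩
        exact ⟨h1, by rwa [← ih x h1]⟩
      · rintro ⟨h1, h2⟩
        exact ⟨h1, by rwa [ih x h1]⟩
    by_cases hb : b ∈ R
    · have : G.Bad ∅ c b := by
        rcases h with h | h
        · rw [bad_empty_iff, ← e]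
          exact h b hb
        · exact h b hb
      simp [this, bad_iff G R c b, hb]
    · rw [bad_iff, bad_empty_iff, e]
      simp [hb]
  have conv : (∀ b, (G.Bad R c b ↔ G.Bad ∅ c b)) →
      ∀ a, (G.BadCond R c a ↔ G.BadCond ∅ c a) := by
    intro h a
    unfold BadCond
    simp only [h]
  constructor
  · intro h a ha
    rw [bad_empty_iff, ← conv (key (Or.inl h))]
    exact h a ha
  · intro h a ha
    rw [conv (key (Or.inr h)), ← bad_empty_iff]
    exact h a ha

open Classical in
/-- The locations outside the regions of `R` between `a` and a later location. -/
def children (R : Finset α) (a : α) : Finset Λ :=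
  Finset.univ.filter fun x => G.par x = some a ∧ G.reg x ∉ R

open Classical in
/-- Indicator of: `x` is the only fault in its region, and the region is not bad. -/
def goodInd (R : Finset α) (x : Λ) (c : Finset Λ) : ℝ :=
  if c ∩ G.cell (G.reg x) = {x} ∧ ¬ G.Bad R c (G.reg x) then 1 else 0

theorem goodInd_sq (R : Finset α) (x : Λ) (c : Finset Λ) :
    G.goodInd R x c * G.goodInd R x c = G.goodInd R x c := by
  unfold goodInd
  split_ifs <;> simp

/-- A region that contains a fault and is not bad contains exactly that fault, so such a fault makes
its own factor vanish. Faults leading to members of `R` may be left out of the product since these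
count as bad. -/
theorem prod_one_sub_goodInd (R : Finset α) (a : α) (c : Finset Λ) [Decidable
    (∃ x ∈ c, G.par x = some a ∧ ¬ G.Bad R c (G.reg x))] :
    ∏ x ∈ G.children R a, (1 - G.goodInd R x c) =
      if ∃ x ∈ c, G.par x = some a ∧ ¬ G.Bad R c (G.reg x) then 0 else 1 := by
  split_ifs with h
  · obtain ⟨x, hx, hp, hb⟩ := h
    have hb' := hb
    rw [bad_iff, BadCond] at hb'
    push Not at hb'
    obtain ⟨h1, h2, -⟩ := hb'
    refine Finset.prod_eq_zero (i := x) (by simp [children, hp, h1]) ?_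
    have hx' : x ∈ c ∩ G.cell (G.reg x) := by simp [hx, mem_cell]
    have : c ∩ G.cell (G.reg x) = {x} := by
      have hc : (c ∩ G.cell (G.reg x)).card = 1 := by
        have := Finset.card_pos.2 ⟨x, hx'⟩
        omega
      obtain ⟨y, hy⟩ := Finset.card_eq_one.1 hc
      rw [hy] at hx' ⊢
      rw [Finset.mem_singleton.1 hx']
    simp [goodInd, this, hb]
  · push Not at h
    refine Finset.prod_eq_one fun x hx => ?_
    have hp : G.par x = some a := by
      simp only [children, Finset.mem_filter] at hx
      exact hx.2.1
    have : G.goodInd R x c = 0 := by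
      unfold goodInd
      refine if_neg ?_
      rintro ⟨h1, h2⟩
      have : x ∈ c ∩ G.cell (G.reg x) := by simp [h1]
      exact h2 (h x (Finset.mem_inter.1 this).1 hp)
    simp [this]

/-- With a single fault `x` in its region, the region is bad exactly if some child is a good fault.
This is the recursion along which chains of single faults are expanded. -/
theorem goodInd_eq (R : Finset α) (x : Λ) (hx : G.reg x ∉ R) (c : Finset Λ) :
    G.goodInd R x c = (if c ∩ G.cell (G.reg x) = {x} then 1 else 0) *
      ∏ y ∈ G.children R (G.reg x), (1 - G.goodInd R y c) := by
  classical
  rw [prod_one_sub_goodInd]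
  by_cases h : c ∩ G.cell (G.reg x) = {x}
  · have hb : G.Bad R c (G.reg x) ↔
        ∃ y ∈ c, G.par y = some (G.reg x) ∧ ¬ G.Bad R c (G.reg y) := by
      rw [bad_iff, BadCond]
      simp [hx, h]
    unfold goodInd
    rw [hb]
    by_cases h' : ∃ y ∈ c, G.par y = some (G.reg x) ∧ ¬ G.Bad R c (G.reg y)
    · simp only [h']; simp
    · simp only [h', h]; simp
  · simp [goodInd, h]

theorem goodInd_mul_eq_zero (R : Finset α) {x y : Λ} (hxy : x ≠ y) (hr : G.reg x = G.reg y)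
    (c : Finset Λ) : G.goodInd R x c * G.goodInd R y c = 0 := by
  unfold goodInd
  rw [hr]
  by_cases h1 : c ∩ G.cell (G.reg y) = {x}
  · have : c ∩ G.cell (G.reg y) ≠ {y} := by
      rw [h1]
      simpa using hxy
    simp [this]
  · simp [h1]

theorem prod_one_sub_eq_sum {ι : Type} [DecidableEq ι] (s : Finset ι) (f : ι → ℝ) :
    ∏ i ∈ s, (1 - f i) = ∑ V ∈ s.powerset, (-1) ^ V.card * ∏ i ∈ V, f i := by
  have : ∀ i, 1 - f i = -f i + 1 := fun i => by ring
  simp only [this]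
  rw [Finset.prod_add]
  refine Finset.sum_congr rfl fun V _ => ?_
  rw [Finset.prod_const_one, mul_one, Finset.prod_neg]

open Classical in
/-- The regions of rank above `r`, and those of rank `r` that meet `X`. -/
def support (R : Finset α) (r : ℕ) (X : Finset Λ) : Finset Λ :=
  Finset.univ.filter fun x => G.reg x ∉ R ∧ (r < G.rank (G.reg x) ∨
    (G.rank (G.reg x) = r ∧ ∃ y ∈ X, G.reg y = G.reg x))

variable {G} {η w : ℝ}

/-- Induction over the ranks from the highest down to `r` and, within rank `r`, over the number of
members of `X` of that rank. One member `x` is removed by `goodInd_eq`, and the product over its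
children is expanded over subsets `V`; these children have higher rank, so `V ∪ X.erase x` is
covered by the induction. The factor at `x` has weight `η (1 + η)^(t-1)` and the expansion sums to
`(1 + w)^e`, for a region of `t` locations with `e` children; `hb` says that this is at most one
factor `w`. -/
theorem hasBound_prod_goodInd (hη : 0 ≤ η) (hw : 0 ≤ w) (R : Finset α)
    (hb : ∀ x, η * (1 + η) ^ ((G.cell (G.reg x)).card - 1) *
      (1 + w) ^ (G.children R (G.reg x)).card ≤ w)
    (r : ℕ) (X : Finset Λ) (hX : ∀ x ∈ X, G.reg x ∉ R ∧ r ≤ G.rank (G.reg x)) :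
    HasBound η (G.support R r X) (fun c => ∏ x ∈ X, G.goodInd R x c) (w ^ X.card) := by
  classical
  generalize hn : (Finset.univ.sup fun x => G.rank (G.reg x)) + 1 - r = n
  induction n generalizing r X with
  | zero =>
    have : X = ∅ := by
      refine Finset.eq_empty_of_forall_notMem fun x hx => ?_
      have h1 := (hX x hx).2
      have h2 : G.rank (G.reg x) ≤ Finset.univ.sup fun x => G.rank (G.reg x) :=
        Finset.le_sup (f := fun x => G.rank (G.reg x)) (Finset.mem_univ x)
      omega
    subst this
    simpa using HasBound.one η _
  | succ n ihn =>
    generalize hk : (X.filter fun x => G.rank (G.reg x) = r).card = k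
    induction k generalizing X with
    | zero =>
      have hX' : ∀ x ∈ X, G.reg x ∉ R ∧ r + 1 ≤ G.rank (G.reg x) := by
        intro x hx
        refine ⟨(hX x hx).1, ?_⟩
        have h1 := (hX x hx).2
        have h2 : G.rank (G.reg x) ≠ r := by
          have := Finset.card_eq_zero.1 hk
          intro h
          have hm : x ∈ X.filter fun x => G.rank (G.reg x) = r := by simp [hx, h]
          rw [this] at hm
          simp at hm
        omega
      refine (ihn (r + 1) X hX' (by omega)).mono ?_ le_rfl
      intro x hx
      simp only [support, Finset.mem_filter, Finset.mem_univ, true_and] at hx ⊢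
      refine ⟨hx.1, Or.inl ?_⟩
      rcases hx.2 with h | h <;> omega
    | succ k ihk =>
      obtain ⟨x, hx⟩ : (X.filter fun x => G.rank (G.reg x) = r).Nonempty :=
        Finset.card_pos.1 (by omega)
      have hxX := (Finset.mem_filter.1 hx).1
      have hxr := (Finset.mem_filter.1 hx).2
      have hX1 : ∀ c, ∏ y ∈ X, G.goodInd R y c =
          G.goodInd R x c * ∏ y ∈ X.erase x, G.goodInd R y c := fun c =>
        (Finset.mul_prod_erase X (fun y => G.goodInd R y c) hxX).symm
      by_cases hsame : ∃ y ∈ X.erase x, G.reg y = G.reg x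
      · obtain ⟨y, hy, hyr⟩ := hsame
        refine ((HasBound.zero η _).mono subset_rfl (pow_nonneg hw _)).congr fun c => ?_
        rw [hX1, ← Finset.mul_prod_erase (X.erase x) (fun y => G.goodInd R y c) hy, ← mul_assoc,
          G.goodInd_mul_eq_zero R (Finset.ne_of_mem_erase hy).symm hyr.symm, zero_mul]
      -- A good fault at a child makes the region of `x` bad, which the factor `(1 - g) g = 0`
      -- expresses. Excluding this case keeps every `V` disjoint from the rest of `X`.
      by_cases hch : ∃ y ∈ X.erase x, y ∈ G.children R (G.reg x)
      · obtain ⟨y, hy, hyc⟩ := hch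
        refine ((HasBound.zero η _).mono subset_rfl (pow_nonneg hw _)).congr fun c => ?_
        rw [hX1, ← Finset.mul_prod_erase (X.erase x) (fun y => G.goodInd R y c) hy,
          G.goodInd_eq R x (hX x hxX).1,
          ← Finset.mul_prod_erase (G.children R (G.reg x)) (fun y => 1 - G.goodInd R y c) hyc]
        have := G.goodInd_sq R y c
        have e : (1 - G.goodInd R y c) * G.goodInd R y c = 0 := by rw [sub_mul, this]; ring
        generalize G.goodInd R y c = g at e
        linear_combination (if c ∩ G.cell (G.reg x) = {x} then (1 : ℝ) else 0) *
          (∏ y ∈ (G.children R (G.reg x)).erase y, (1 - G.goodInd R y c)) *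
          (∏ y ∈ (X.erase x).erase y, G.goodInd R y c) * e
      push Not at hsame hch
      have hdisj : ∀ V ∈ (G.children R (G.reg x)).powerset, Disjoint V (X.erase x) := by
        intro V hV
        rw [Finset.disjoint_left]
        intro y hyV hyX
        exact hch y hyX (Finset.mem_powerset.1 hV hyV)
      have hVr : ∀ V ∈ (G.children R (G.reg x)).powerset, ∀ y ∈ V,
          G.reg y ∉ R ∧ r < G.rank (G.reg y) := by
        intro V hV y hy
        have := Finset.mem_powerset.1 hV hy
        simp only [children, Finset.mem_filter] at this
        refine ⟨this.2.2, ?_⟩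
        have := G.rank_lt y _ this.2.1
        omega
      -- The remaining product does not involve the region of `x`, since no other member of `X` lies
      -- there and the new members have higher rank. So its expansion is disjoint from that of the
      -- factor at `x`.
      let D' : Finset Λ := (G.support R r X) \ G.cell (G.reg x)
      have hsub : G.cell (G.reg x) ⊆ G.support R r X := by
        intro y hy
        rw [mem_cell] at hy
        simp only [support, Finset.mem_filter, Finset.mem_univ, true_and]
        rw [hy]
        exact ⟨(hX x hxX).1, Or.inr ⟨hxr, x, hxX, rfl⟩⟩
      have hterm : ∀ V ∈ (G.children R (G.reg x)).powerset,
          HasBound η D' (fun c => (-1) ^ V.card * ∏ y ∈ V ∪ X.erase x, G.goodInd R y c)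
            (w ^ V.card * w ^ (X.erase x).card) := by
        intro V hV
        have hXV : ∀ y ∈ V ∪ X.erase x, G.reg y ∉ R ∧ r ≤ G.rank (G.reg y) := by
          intro y hy
          rcases Finset.mem_union.1 hy with hy | hy
          · exact ⟨(hVr V hV y hy).1, (hVr V hV y hy).2.le⟩
          · exact hX y (Finset.mem_of_mem_erase hy)
        have hfil : (V ∪ X.erase x).filter (fun x => G.rank (G.reg x) = r) =
            (X.filter fun x => G.rank (G.reg x) = r).erase x := by
          ext y
          simp only [Finset.mem_filter, Finset.mem_union, Finset.mem_erase]
          constructor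
          · rintro ⟨h | h, hr⟩
            · have := (hVr V hV y h).2
              omega
            · exact ⟨h.1, h.2, hr⟩
          · rintro ⟨h1, h2, h3⟩
            exact ⟨Or.inr ⟨h1, h2⟩, h3⟩
        have h := ihk (V ∪ X.erase x) hXV (by
          rw [hfil, Finset.card_erase_of_mem hx, hk]; rfl)
        have h' := (h.smul ((-1) ^ V.card)).mono (D' := D')
          (B' := w ^ V.card * w ^ (X.erase x).card) ?_ ?_
        · exact h'
        · intro y hy
          simp only [D', support, Finset.mem_sdiff, Finset.mem_filter, Finset.mem_univ,
            true_and, mem_cell] at hy ⊢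
          obtain ⟨h1, h2⟩ := hy
          rcases h2 with h2 | ⟨h2, z, hz, hzr⟩
          · exact ⟨⟨h1, Or.inl h2⟩, fun h => by rw [h] at h2; omega⟩
          · rcases Finset.mem_union.1 hz with hz | hz
            · have := (hVr V hV z hz).2
              rw [hzr] at this
              omega
            · refine ⟨⟨h1, Or.inr ⟨h2, z, Finset.mem_of_mem_erase hz, hzr⟩⟩, fun h => ?_⟩
              exact hsame z hz (hzr.trans h)
        · rw [Finset.card_union_of_disjoint (hdisj V hV), pow_add]
          simp
      have hsum := HasBound.sum _ hterm
      have hmul := (HasBound.single hη (D := G.cell (G.reg x)) (x := x)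
        (G.mem_cell.2 rfl)).mul hη hsum (Finset.disjoint_sdiff)
      refine (hmul.mono ?_ ?_).congr fun c => ?_
      · exact Finset.union_subset hsub Finset.sdiff_subset
      · rw [← Finset.sum_mul]
        have hpow : ∑ V ∈ (G.children R (G.reg x)).powerset, w ^ V.card =
            (1 + w) ^ (G.children R (G.reg x)).card := by
          have := Finset.prod_add (fun _ : Λ => w) (fun _ => (1 : ℝ)) (G.children R (G.reg x))
          simp only [Finset.prod_const, one_pow, mul_one] at this
          rw [add_comm, this]
        rw [hpow, ← mul_assoc, ← Finset.card_erase_add_one hxX, pow_succ']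
        exact mul_le_mul_of_nonneg_right (hb x) (pow_nonneg hw _)
      · rw [hX1, G.goodInd_eq R x (hX x hxX).1, prod_one_sub_eq_sum, mul_assoc, Finset.sum_mul]
        congr 1
        refine Finset.sum_congr rfl fun V hV => ?_
        rw [Finset.prod_union (hdisj V hV), mul_assoc]

-- The condition at `a` equals `[≥ 2 faults] + [1 fault] (1 - ∏ (1 - g))`, the product running over
-- the children of `a`. Expanding it leaves a sum over nonempty `V`, of total weight `(1 + w)^e -
-- 1`. The members of `T` are treated one after another while `X` collects the children chosen so
-- far; a child has only one parent, hence the sets `V` chosen for different members are disjoint.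
open Classical in
theorem hasBound_prod_bad (hη : 0 ≤ η) (hw : 0 ≤ w) (R : Finset α)
    (hb : ∀ x, η * (1 + η) ^ ((G.cell (G.reg x)).card - 1) *
      (1 + w) ^ (G.children R (G.reg x)).card ≤ w)
    {f : ℝ} (hf : ∀ a, (G.cell a).card.choose 2 * (η ^ 2 * (1 + η) ^ ((G.cell a).card - 2)) +
      (G.cell a).card * (η * (1 + η) ^ ((G.cell a).card - 1)) *
        ((1 + w) ^ (G.children R a).card - 1) ≤ f)
    (T : Finset α) (hT : T ⊆ R) (X : Finset Λ)
    (hX : ∀ x ∈ X, G.reg x ∉ R ∧ ∀ a ∈ T, G.par x ≠ some a) :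
    HasBound η (Finset.univ.filter fun x => G.reg x ∈ T ∨ G.reg x ∉ R)
      (fun c => (∏ a ∈ T, if G.BadCond R c a then 1 else 0) * ∏ x ∈ X, G.goodInd R x c)
      (f ^ T.card * w ^ X.card) := by
  induction T using Finset.induction_on generalizing X with
  | empty =>
    refine ((hasBound_prod_goodInd hη hw R hb 0 X fun x hx => ⟨(hX x hx).1, zero_le⟩).mono
      ?_ ?_).congr fun c => ?_
    · intro x hx
      simp only [support, Finset.mem_filter, Finset.mem_univ, true_and] at hx ⊢
      exact Or.inr hx.1
    · simp
    · simp
  | insert a T ha ih =>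
    have hf0 : 0 ≤ f := by
      refine le_trans ?_ (hf a)
      have : 1 ≤ (1 + w) ^ (G.children R a).card := one_le_pow₀ (by linarith)
      have h2 : 0 ≤ (1 + w) ^ (G.children R a).card - 1 := by linarith
      positivity
    have hTR : T ⊆ R := (Finset.subset_insert a T).trans hT
    have haR : a ∈ R := hT (Finset.mem_insert_self a T)
    set D' : Finset Λ := Finset.univ.filter fun x => G.reg x ∈ T ∨ G.reg x ∉ R with hD'
    have hdis : Disjoint (G.cell a) D' := by
      rw [Finset.disjoint_left]
      intro y hy hy'
      rw [mem_cell] at hy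
      simp only [hD', Finset.mem_filter, Finset.mem_univ, true_and, hy] at hy'
      rcases hy' with h | h
      · exact ha h
      · exact h haR
    have h1 := (HasBound.two_le hη (G.cell a)).mul hη
      (ih hTR X fun x hx => ⟨(hX x hx).1, fun b hb' => (hX x hx).2 b
        (Finset.mem_insert_of_mem hb')⟩) hdis
    have hdX : ∀ V ∈ (G.children R a).powerset.erase ∅, Disjoint V X := by
      intro V hV
      rw [Finset.disjoint_left]
      intro y hyV hyX
      have := Finset.mem_powerset.1 (Finset.mem_of_mem_erase hV) hyV
      simp only [children, Finset.mem_filter] at this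
      exact (hX y hyX).2 a (Finset.mem_insert_self a T) this.2.1
    have h2 : ∀ V ∈ (G.children R a).powerset.erase ∅,
        HasBound η D' (fun c => (-((-1) ^ V.card)) * ((∏ a ∈ T, if G.BadCond R c a then 1 else 0) *
          ∏ x ∈ V ∪ X, G.goodInd R x c)) (f ^ T.card * w ^ X.card * w ^ V.card) := by
      intro V hV
      have hc := hdX V hV
      refine ((ih hTR (V ∪ X) ?_).smul (-((-1) ^ V.card))).mono subset_rfl ?_
      · intro y hy
        rcases Finset.mem_union.1 hy with hy | hy
        · have := Finset.mem_powerset.1 (Finset.mem_of_mem_erase hV) hy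
          simp only [children, Finset.mem_filter] at this
          refine ⟨this.2.2, fun b hb' h => ?_⟩
          rw [this.2.1] at h
          exact ha (by rw [Option.some.inj h]; exact hb')
        · exact ⟨(hX y hy).1, fun b hb' => (hX y hy).2 b (Finset.mem_insert_of_mem hb')⟩
      · rw [Finset.card_union_of_disjoint hc, pow_add]
        simp only [abs_neg, abs_pow, abs_one, one_pow, one_mul]
        exact le_of_eq (by ring)
    -- The case of a single fault in the region of `a`, together with at least one good fault among
    -- its children.
    have h3 := (HasBound.exactly_one hη (G.cell a)).mul hη (HasBound.sum _ h2) hdis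
    have hsub : G.cell a ∪ D' ⊆
        Finset.univ.filter fun x => G.reg x ∈ insert a T ∨ G.reg x ∉ R := by
      intro y hy
      simp only [hD', Finset.mem_union, mem_cell, Finset.mem_filter, Finset.mem_univ,
        true_and, Finset.mem_insert] at hy ⊢
      tauto
    refine ((h1.add h3).mono hsub ?_).congr fun c => ?_
    · rw [Finset.card_insert_of_notMem ha, ← Finset.mul_sum]
      have hpow : ∑ V ∈ (G.children R a).powerset.erase ∅, w ^ V.card =
          (1 + w) ^ (G.children R a).card - 1 := by
        have := Finset.prod_add (fun _ : Λ => w) (fun _ => (1 : ℝ)) (G.children R a)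
        simp only [Finset.prod_const, one_pow, mul_one] at this
        rw [add_comm 1 w, this, Finset.sum_erase_eq_sub (by simp)]
        simp
      rw [hpow]
      have hp : 0 ≤ f ^ T.card * w ^ X.card := by positivity
      have := mul_le_mul_of_nonneg_right (hf a) hp
      rw [pow_succ' f]
      linarith
    · rw [Finset.prod_insert ha]
      have hV : ∀ V ∈ (G.children R a).powerset.erase ∅,
          (-((-1) ^ V.card)) * ((∏ a ∈ T, if G.BadCond R c a then 1 else 0) *
          ∏ x ∈ V ∪ X, G.goodInd R x c) =
          (-1 : ℝ) ^ V.card * (∏ x ∈ V, G.goodInd R x c) *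
            (-((∏ a ∈ T, if G.BadCond R c a then 1 else 0) * ∏ x ∈ X, G.goodInd R x c)) := by
        intro V hV
        rw [Finset.prod_union (hdX V hV)]
        ring
      rw [Finset.sum_congr rfl hV, ← Finset.sum_mul, Finset.sum_erase_eq_sub (by simp),
        ← prod_one_sub_eq_sum, prod_one_sub_goodInd]
      unfold BadCond
      by_cases ht : 2 ≤ (c ∩ G.cell a).card
      · have : (c ∩ G.cell a).card ≠ 1 := by omega
        simp [ht, this]
      · by_cases ho : (c ∩ G.cell a).card = 1
        · by_cases he : ∃ x ∈ c, G.par x = some a ∧ ¬ G.Bad R c (G.reg x)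
          · simp only [ho, he]; simp
          · simp only [ho, he]; simp
        · simp [ht, ho]

/-- The indicator that all of `R` is bad is the product of the cut-off conditions, by
`forall_badCond_iff`. It vanishes for the empty fault configuration because `R` is nonempty, as
`HasBound.norm_sum_le` requires. -/
theorem norm_sum_bad_le {E : Type*} [NormedAddCommGroup E] [NormedSpace ℝ E]
    [DecidableEq α] (hη : 0 ≤ η) (hw : 0 ≤ w) {f : ℝ} {e : α → ℕ}
    (hch : ∀ R a, (G.children R a).card ≤ e a)
    (hb : ∀ x, η * (1 + η) ^ ((G.cell (G.reg x)).card - 1) * (1 + w) ^ e (G.reg x) ≤ w)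
    (hf : ∀ a, (G.cell a).card.choose 2 * (η ^ 2 * (1 + η) ^ ((G.cell a).card - 2)) +
      (G.cell a).card * (η * (1 + η) ^ ((G.cell a).card - 1)) * ((1 + w) ^ e a - 1) ≤ f)
    (Φ : Finset Λ → E)
    (hΦ : ∀ J : Finset Λ, J.Nonempty →
      ‖∑ c ∈ Finset.univ.filter (fun c => J ⊆ c), Φ c‖ ≤ η ^ J.card)
    (R : Finset α) (hR : R.Nonempty) [DecidablePred fun c : Finset Λ => ∀ a ∈ R, G.Bad ∅ c a] :
    ‖∑ c ∈ Finset.univ.filter (fun c => ∀ a ∈ R, G.Bad ∅ c a), Φ c‖ ≤ f ^ R.card := by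
  classical
  have hpow : ∀ a, (1 + w) ^ (G.children R a).card ≤ (1 + w) ^ e a := fun a =>
    pow_le_pow_right₀ (by linarith) (hch R a)
  have hb' : ∀ x, η * (1 + η) ^ ((G.cell (G.reg x)).card - 1) *
      (1 + w) ^ (G.children R (G.reg x)).card ≤ w :=
    fun x => (mul_le_mul_of_nonneg_left (hpow _) (by positivity)).trans (hb x)
  have hf' : ∀ a, (G.cell a).card.choose 2 * (η ^ 2 * (1 + η) ^ ((G.cell a).card - 2)) +
      (G.cell a).card * (η * (1 + η) ^ ((G.cell a).card - 1)) *
        ((1 + w) ^ (G.children R a).card - 1) ≤ f := by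
    intro a
    refine le_trans ?_ (hf a)
    have := mul_le_mul_of_nonneg_left (sub_le_sub_right (hpow a) 1)
      (by positivity : 0 ≤ (G.cell a).card * (η * (1 + η) ^ ((G.cell a).card - 1)))
    linarith
  have H := hasBound_prod_bad hη hw R hb' hf' R subset_rfl ∅ (by simp)
  simp only [Finset.prod_empty, mul_one, Finset.card_empty, pow_zero] at H
  have h0 : ∏ a ∈ R, (if G.BadCond R ∅ a then (1 : ℝ) else 0) = 0 := by
    obtain ⟨a, ha⟩ := hR
    refine Finset.prod_eq_zero ha (if_neg ?_)
    simp [BadCond]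
  have := H.norm_sum_le hη h0 Φ hΦ
  refine le_trans (le_of_eq ?_) this
  congr 1
  rw [Finset.sum_filter]
  refine Finset.sum_congr rfl fun c _ => ?_
  have e : (∏ a ∈ R, if G.BadCond R c a then (1 : ℝ) else 0) =
      if ∀ a ∈ R, G.Bad ∅ c a then 1 else 0 := by
    rw [Finset.prod_ite_zero, Finset.prod_const_one]
    simp only [G.forall_badCond_iff R c]
  rw [e]
  split_ifs <;> simp

end FaultRegions
end

noncomputable section

/-! ## Numerical estimates -/

/-- For `x ≤ 3/10` the terms beyond `x²/2` in the Taylor bound of order four add less than `(3/50)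
x²`. -/
theorem exp_le_quadratic {x : ℝ} (h0 : 0 ≤ x) (h1 : x ≤ 3 / 10) :
    Real.exp x ≤ 1 + x + (14 / 25) * x ^ 2 := by
  have h := Real.exp_bound' h0 (by linarith) (n := 4) (by norm_num)
  simp only [Finset.sum_range_succ, Finset.sum_range_zero, Nat.factorial] at h
  norm_num at h
  have h3 : x ^ 3 ≤ (3 / 10) * x ^ 2 := by nlinarith [sq_nonneg x]
  have h4 : x ^ 4 ≤ (9 / 100) * x ^ 2 := by nlinarith [sq_nonneg x]
  nlinarith

theorem pow_one_add_le_exp {x : ℝ} (hx : 0 ≤ x) (n : ℕ) : (1 + x) ^ n ≤ Real.exp (n * x) := by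
  rw [Real.exp_nat_mul]
  exact pow_le_pow_left₀ (by linarith) (by linarith [Real.add_one_le_exp x]) n

/-- The ratio `w / η` of the weight of a chain of single faults to `η`, in terms of
`h = (A - 1) η`. -/
def chainRatio (h : ℝ) : ℝ := 1 + h + (13 / 5) * h ^ 2

/-- With `w = lη`, the chain condition `η (1 + η)^(t-1) (1 + w)^e ≤ w` follows from `exp (l h) ≤ l`.
The coefficient `13/5` in `l` works because on `h ≤ 1/5` the exponential has second-order
coefficient at most `1 + 13/25 + (14/25)(131/100)²`, which is below `13/5`. -/
theorem exp_chainRatio_le {h : ℝ} (h0 : 0 ≤ h) (h1 : h ≤ 1 / 5) :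
    Real.exp (chainRatio h * h) ≤ chainRatio h := by
  have hl : chainRatio h ≤ 131 / 100 := by unfold chainRatio; nlinarith
  have hl0 : 1 ≤ chainRatio h := by unfold chainRatio; nlinarith
  have e := exp_le_quadratic (x := chainRatio h * h) (by positivity) (by nlinarith)
  refine e.trans ?_
  have h2 : (chainRatio h * h) ^ 2 ≤ (131 / 100) ^ 2 * h ^ 2 := by
    rw [mul_pow]
    have : chainRatio h ^ 2 ≤ (131 / 100) ^ 2 := pow_le_pow_left₀ (by linarith) hl 2
    exact mul_le_mul_of_nonneg_right this (sq_nonneg h)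
  have h5 : chainRatio h = 1 + h + (13 / 5) * h ^ 2 := rfl
  have h3 : chainRatio h * h = h + h ^ 2 + (13 / 5) * h ^ 3 := by rw [h5]; ring
  have h4 : h ^ 3 ≤ (1 / 5) * h ^ 2 := by nlinarith [sq_nonneg h]
  linarith [sq_nonneg h]

section

variable {A : ℕ} {η : ℝ}

theorem threshold_mul_lt (hA : 10 ≤ A) (hη : 0 ≤ η)
    (hC : (A.choose 2 : ℝ) * Real.exp (((A : ℝ) - 2) * η) * η < 1) :
    (A : ℝ) * (((A : ℝ) - 1) * η) * (1 + ((A : ℝ) - 2) * η) ≤ 2 := by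
  have hA' : (10 : ℝ) ≤ A := by exact_mod_cast hA
  rw [Nat.cast_choose_two] at hC
  have h1 : 1 + ((A : ℝ) - 2) * η ≤ Real.exp (((A : ℝ) - 2) * η) := by
    linarith [Real.add_one_le_exp (((A : ℝ) - 2) * η)]
  have h2 : 0 ≤ (A : ℝ) * ((A : ℝ) - 1) / 2 * η := by
    have : 0 ≤ (A : ℝ) - 1 := by linarith
    positivity
  nlinarith [mul_le_mul_of_nonneg_left h1 h2]

/-- Being below the threshold bounds `A (A - 1) η` by 2, and `A ≥ 10`. -/
theorem threshold_small (hA : 10 ≤ A) (hη : 0 ≤ η)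
    (hC : (A.choose 2 : ℝ) * Real.exp (((A : ℝ) - 2) * η) * η < 1) :
    ((A : ℝ) - 1) * η ≤ 1 / 5 := by
  have hA' : (10 : ℝ) ≤ A := by exact_mod_cast hA
  have h := threshold_mul_lt hA hη hC
  have h0 : 0 ≤ ((A : ℝ) - 1) * η := mul_nonneg (by linarith) hη
  have h1 : 0 ≤ ((A : ℝ) - 2) * η := mul_nonneg (by linarith) hη
  nlinarith [mul_nonneg (mul_nonneg (by linarith : (0:ℝ) ≤ A) h0) h1]

/-- The exponent `(t - 1) η + e l η` is at most `l (A - 1) η = l h`, because `l ≥ 1` and `t + e ≤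
A`; then `exp_chainRatio_le` applies. -/
theorem chain_weight_le (hA : 10 ≤ A) (hη : 0 ≤ η)
    (hC : (A.choose 2 : ℝ) * Real.exp (((A : ℝ) - 2) * η) * η < 1) {t : ℕ} (ht : 0 < t) (e : ℕ)
    (hte : t + e ≤ A) :
    η * (1 + η) ^ (t - 1) * (1 + chainRatio (((A : ℝ) - 1) * η) * η) ^ e ≤
      chainRatio (((A : ℝ) - 1) * η) * η := by
  have hA' : (10 : ℝ) ≤ A := by exact_mod_cast hA
  set h := ((A : ℝ) - 1) * η with hh
  have h0 : 0 ≤ h := mul_nonneg (by linarith) hη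
  have h1 : h ≤ 1 / 5 := threshold_small hA hη hC
  have hl0 : 1 ≤ chainRatio h := by unfold chainRatio; nlinarith
  have hexp := exp_chainRatio_le h0 h1
  set l := chainRatio h
  rw [mul_assoc, mul_comm l η]
  refine mul_le_mul_of_nonneg_left (le_trans ?_ hexp) hη
  have e1 := pow_one_add_le_exp hη (t - 1)
  have e2 := pow_one_add_le_exp (by positivity : 0 ≤ η * l) e
  calc _ ≤ Real.exp (((t - 1 : ℕ) : ℝ) * η) * Real.exp (e * (η * l)) :=
        mul_le_mul e1 e2 (by positivity) (Real.exp_nonneg _)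
    _ ≤ _ := by
        rw [← Real.exp_add]
        refine Real.exp_le_exp.2 ?_
        rw [Nat.cast_sub ht]
        have : (t : ℝ) + e ≤ A := by exact_mod_cast hte
        have ht' : (1 : ℝ) ≤ t := by exact_mod_cast ht
        have a1 : ((t : ℝ) - 1) * η ≤ l * (((t : ℝ) - 1) * η) := by
          have : 0 ≤ ((t : ℝ) - 1) * η := mul_nonneg (by linarith) hη
          nlinarith
        have a2 : ((t : ℝ) - 1 + e) * η ≤ h := by
          rw [hh]
          exact mul_le_mul_of_nonneg_right (by linarith) hη
        have a3 := mul_le_mul_of_nonneg_left a2 (by linarith : 0 ≤ l)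
        push_cast
        nlinarith

/-- Here `a` stands for `A`. At leading order `a h` is at most 2 and the inequality reads `2 ≤ (e -
1) / 2`, which `e ≥ 5` just allows: this is where the five locations of an error correction enter.
The other terms are of order `h`; the factor `1 + (8/9) h`, retained from the exponential in the
threshold, helps to absorb them. -/
theorem chain_excess_polynomial {a h μ e : ℝ} (h0 : 0 ≤ h)
    (hah : a * h * (1 + (8 / 9) * h) ≤ 2) (hμ : μ = 1 + (13 / 5) * h) (he : 5 ≤ e) :
    (a * h) * μ - e * h * μ + (139 / 100) * (h + (38 / 25) * (e * h ^ 2)) ≤ (e - 1) / 2 := by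
  have hμ1 : 0 ≤ μ := by rw [hμ]; positivity
  have d1 : (a * h) * μ ≤ 2 + (367 / 100) * h := by
    have hp : 0 < 1 + (8 / 9) * h := by positivity
    have : a * h ≤ 2 / (1 + (8 / 9) * h) := by rw [le_div_iff₀ hp]; exact hah
    calc (a * h) * μ ≤ 2 / (1 + (8 / 9) * h) * μ := mul_le_mul_of_nonneg_right this hμ1
      _ ≤ 2 + (367 / 100) * h := by
          rw [div_mul_eq_mul_div, div_le_iff₀ hp, hμ]
          nlinarith [sq_nonneg h]
  have d2 : e * h * μ = e * h + (13 / 5) * (e * h ^ 2) := by rw [hμ]; ring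
  have d3 : 0 ≤ e * h ^ 2 := by positivity
  rw [d2]
  nlinarith [mul_nonneg (sub_nonneg.2 he) h0]

theorem chain_excess_exp {h μ x : ℝ} (h0 : 0 ≤ h) (h1 : h * μ ≤ 38 / 125) (hμ : 0 ≤ μ)
    (hx0 : 0 ≤ x) (hx1 : x ≤ 1 / 10) :
    (1 + h * μ) * Real.exp x - 1 ≤ h * μ + (139 / 100) * x := by
  have hexp : Real.exp x ≤ 1 + (53 / 50) * x := by
    refine (exp_le_quadratic hx0 (by linarith)).trans ?_
    nlinarith
  have : (1 + h * μ) * Real.exp x ≤ (1 + h * μ) * (1 + (53 / 50) * x) :=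
    mul_le_mul_of_nonneg_left hexp (by positivity)
  nlinarith [mul_le_mul_of_nonneg_right h1 hx0]

/-- A pair of a fault in the region and a fault at a child weighs up to `l z` times its share `η²
e^((A-2)η)`, where `z` is the exponential in the statement. Per child the excess over `t` pairs has
to fit into `(e - 1) / 2`, the child's part of the `e (e - 1) / 2` pairs of children. The proof
linearises the exponential and replaces `t` by `a - e`. -/
theorem chain_excess_real {a h η t e : ℝ} (ha : 10 ≤ a) (hη : 0 ≤ η) (hh : h = (a - 1) * η)
    (h1 : h ≤ 1 / 5) (hthr : a * h * (1 + (a - 2) * η) ≤ 2) (ht : 1 ≤ t)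
    (he : 5 ≤ e) (hte : t + e ≤ a) :
    t * (chainRatio h * Real.exp (η + (chainRatio h - 1) * (e * η)) - 1) ≤ (e - 1) / 2 := by
  have h0 : 0 ≤ h := by rw [hh]; exact mul_nonneg (by linarith) hη
  have hη9 : η ≤ h / 9 := by
    rw [hh]
    nlinarith
  have haη : (a - 2) * η ≥ (8 / 9) * h := by
    have : (a - 2) * η = h - η := by rw [hh]; ring
    linarith
  have hah : a * h * (1 + (8 / 9) * h) ≤ 2 := by
    refine le_trans ?_ hthr
    exact mul_le_mul_of_nonneg_left (by linarith) (by positivity)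
  have heη : e * η ≤ h := by
    rw [hh]
    exact mul_le_mul_of_nonneg_right (by linarith) hη
  have heη0 : 0 ≤ e * η := by positivity
  obtain ⟨μ, hμ⟩ : ∃ μ, μ = 1 + (13 / 5) * h := ⟨_, rfl⟩
  have hμ1 : 1 ≤ μ := by rw [hμ]; linarith
  have hμ2 : μ ≤ 38 / 25 := by rw [hμ]; linarith
  have hl : chainRatio h = 1 + h * μ := by unfold chainRatio; rw [hμ]; ring
  rw [hl]
  obtain ⟨x, hx⟩ : ∃ x, x = η + (1 + h * μ - 1) * (e * η) := ⟨_, rfl⟩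
  rw [← hx]
  have hx' : x = η + h * μ * (e * η) := by rw [hx]; ring
  have hx0 : 0 ≤ x := by rw [hx']; positivity
  have hhμ : h * μ ≤ 38 / 125 := by
    have := mul_le_mul h1 hμ2 (by linarith) (by norm_num)
    linarith
  have hx1 : x ≤ 1 / 10 := by
    rw [hx']
    have := mul_le_mul hhμ (heη.trans h1) heη0 (by norm_num)
    linarith
  have b1 := chain_excess_exp h0 hhμ (by linarith) hx0 hx1
  have hpos : 0 ≤ h * μ + (139 / 100) * x := by positivity
  have haeη : (a - e) * η ≤ h := by
    rw [hh]
    exact mul_le_mul_of_nonneg_right (by linarith) hη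
  have c1 : (a - e) * x ≤ h + (38 / 25) * (e * h ^ 2) := by
    have c0 : (a - e) * x = (a - e) * η + (μ * (e * h)) * ((a - e) * η) := by
      rw [hx']; ring
    have c2 : (μ * (e * h)) * ((a - e) * η) ≤ (μ * (e * h)) * h :=
      mul_le_mul_of_nonneg_left haeη (by positivity)
    have c3 : (μ * (e * h)) * h ≤ (38 / 25) * (e * h ^ 2) := by
      have := mul_le_mul_of_nonneg_right hμ2 (by positivity : 0 ≤ e * h ^ 2)
      linarith [(by ring : (μ * (e * h)) * h = μ * (e * h ^ 2))]
    linarith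
  calc t * ((1 + h * μ) * Real.exp x - 1) ≤ t * (h * μ + (139 / 100) * x) :=
        mul_le_mul_of_nonneg_left b1 (by linarith)
    _ ≤ (a - e) * (h * μ + (139 / 100) * x) := mul_le_mul_of_nonneg_right (by linarith) hpos
    _ = (a * h) * μ - e * h * μ + (139 / 100) * ((a - e) * x) := by ring
    _ ≤ (a * h) * μ - e * h * μ + (139 / 100) * (h + (38 / 25) * (e * h ^ 2)) := by linarith
    _ ≤ (e - 1) / 2 := chain_excess_polynomial h0 hah hμ he

/-- Compare `A choose 2` with `(t choose 2) + t e + (e choose 2)`. Pairs within the region account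
for the first summand and pairs of region and child for the second. Pairs of children are not
needed, and they compensate for the chains behind a child by `chain_excess_real`. For `e = 0` there
is nothing to compensate. -/
theorem bad_weight_le (hA : 10 ≤ A) (hη : 0 ≤ η)
    (hC : (A.choose 2 : ℝ) * Real.exp (((A : ℝ) - 2) * η) * η < 1) (t e : ℕ) (hte : t + e ≤ A)
    (he : e = 0 ∨ 5 ≤ e) :
    t.choose 2 * (η ^ 2 * (1 + η) ^ (t - 2)) + t * (η * (1 + η) ^ (t - 1)) *
        ((1 + chainRatio (((A : ℝ) - 1) * η) * η) ^ e - 1) ≤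
      A.choose 2 * Real.exp (((A : ℝ) - 2) * η) * η ^ 2 := by
  have hA' : (10 : ℝ) ≤ A := by exact_mod_cast hA
  have hte' : (t : ℝ) + e ≤ A := by exact_mod_cast hte
  have hexp2 : 1 ≤ Real.exp (((A : ℝ) - 2) * η) :=
    Real.one_le_exp (mul_nonneg (by linarith) hη)
  have hpair : (t.choose 2 : ℝ) * (η ^ 2 * (1 + η) ^ (t - 2)) ≤
      t.choose 2 * Real.exp (((A : ℝ) - 2) * η) * η ^ 2 := by
    rcases Nat.lt_or_ge t 2 with ht | ht
    · rw [Nat.choose_eq_zero_of_lt ht]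
      simp
    · have : (1 + η) ^ (t - 2) ≤ Real.exp (((A : ℝ) - 2) * η) := by
        refine (pow_one_add_le_exp hη (t - 2)).trans (Real.exp_le_exp.2 ?_)
        rw [Nat.cast_sub ht]
        push_cast
        exact mul_le_mul_of_nonneg_right (by linarith [(Nat.cast_nonneg e : (0 : ℝ) ≤ e)]) hη
      calc _ = (t.choose 2 : ℝ) * η ^ 2 * (1 + η) ^ (t - 2) := by ring
        _ ≤ (t.choose 2 : ℝ) * η ^ 2 * Real.exp (((A : ℝ) - 2) * η) :=
          mul_le_mul_of_nonneg_left this (by positivity)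
        _ = _ := by ring
  rcases Nat.eq_zero_or_pos t with ht | ht
  · subst ht
    simp
    positivity
  rcases he with he | he
  · subst he
    simp only [pow_zero, sub_self, mul_zero, add_zero]
    refine hpair.trans ?_
    have : (t.choose 2 : ℝ) ≤ A.choose 2 := by
      exact_mod_cast Nat.choose_le_choose 2 (by omega)
    gcongr
  have ht' : (1 : ℝ) ≤ t := by exact_mod_cast ht
  have he' : (5 : ℝ) ≤ e := by exact_mod_cast he
  have hexc := chain_excess_real hA' hη rfl (threshold_small hA hη hC)
    (threshold_mul_lt hA hη hC) ht' he' hte'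
  have h0 : 0 ≤ ((A : ℝ) - 1) * η := mul_nonneg (by linarith) hη
  have hl0 : 1 ≤ chainRatio (((A : ℝ) - 1) * η) := by unfold chainRatio; nlinarith
  set l := chainRatio (((A : ℝ) - 1) * η)
  set Y := Real.exp (((A : ℝ) - 2) * η)
  set z := Real.exp (η + (l - 1) * (e * η))
  -- This is `exp y - 1 ≤ y exp y` with `y = e l η`.
  have h1 : (1 + l * η) ^ e - 1 ≤ e * (l * η) * Real.exp (e * (l * η)) := by
    refine (sub_le_sub_right (pow_one_add_le_exp (by positivity : 0 ≤ l * η) e) 1).trans ?_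
    have := Real.add_one_le_exp (-(e * (l * η)))
    have h2 : Real.exp (e * (l * η)) * Real.exp (-(e * (l * η))) = 1 := by
      rw [← Real.exp_add]; simp
    nlinarith [Real.exp_pos (e * (l * η))]
  -- The exponent `(t - 1) η + e l η` is at most `(A - 2) η` plus the remainder `η + (l - 1) e η`,
  -- which `z` contains.
  have h2 : (1 + η) ^ (t - 1) * Real.exp (e * (l * η)) ≤ z * Y := by
    calc _ ≤ Real.exp (((t - 1 : ℕ) : ℝ) * η) * Real.exp (e * (l * η)) :=
          mul_le_mul_of_nonneg_right (pow_one_add_le_exp hη (t - 1)) (Real.exp_nonneg _)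
      _ ≤ z * Y := by
          rw [← Real.exp_add, ← Real.exp_add]
          refine Real.exp_le_exp.2 ?_
          rw [Nat.cast_sub ht]
          push_cast
          nlinarith [mul_le_mul_of_nonneg_right hte' hη]
  have h3 : (t : ℝ) * (η * (1 + η) ^ (t - 1)) * ((1 + l * η) ^ e - 1) ≤
      e * (t * (l * z)) * Y * η ^ 2 := by
    calc _ ≤ (t : ℝ) * (η * (1 + η) ^ (t - 1)) * (e * (l * η) * Real.exp (e * (l * η))) :=
          mul_le_mul_of_nonneg_left h1 (by positivity)
      _ = (t * e * l * η ^ 2) * ((1 + η) ^ (t - 1) * Real.exp (e * (l * η))) := by ring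
      _ ≤ (t * e * l * η ^ 2) * (z * Y) := mul_le_mul_of_nonneg_left h2 (by positivity)
      _ = _ := by ring
  have h4 : (e : ℝ) * (t * (l * z)) ≤ t * e + e * (e - 1) / 2 := by
    nlinarith [mul_le_mul_of_nonneg_left hexc (by linarith : (0 : ℝ) ≤ e)]
  have h5 : (t.choose 2 : ℝ) + (t * e + e * (e - 1) / 2) ≤ A.choose 2 := by
    have : (((t + e).choose 2 : ℕ) : ℝ) ≤ A.choose 2 := by
      exact_mod_cast Nat.choose_le_choose 2 hte
    refine le_trans (le_of_eq ?_) this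
    rw [Nat.cast_choose_two, Nat.cast_choose_two]
    push_cast
    ring
  calc _ ≤ t.choose 2 * Y * η ^ 2 + e * (t * (l * z)) * Y * η ^ 2 := add_le_add hpair h3
    _ = (t.choose 2 + e * (t * (l * z))) * (Y * η ^ 2) := by ring
    _ ≤ A.choose 2 * (Y * η ^ 2) :=
        mul_le_mul_of_nonneg_right (by linarith) (by positivity)
    _ = _ := by ring

end
end

noncomputable section

/-! ## Products of operators -/

section TimeOrdered

variable {R : Type*} [Monoid R]

@[simp] theorem timeOrdered_nil : timeOrdered ([] : List R) = 1 := rfl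

@[simp] theorem timeOrdered_cons (a : R) (l : List R) :
    timeOrdered (a :: l) = timeOrdered l * a := by
  simp [timeOrdered]

theorem timeOrdered_append (l l' : List R) :
    timeOrdered (l ++ l') = timeOrdered l' * timeOrdered l := by
  simp [timeOrdered]

theorem timeOrdered_flatMap {ι : Type*} (l : List ι) (f : ι → List R) :
    timeOrdered (l.flatMap f) = timeOrdered (l.map fun i => timeOrdered (f i)) := by
  induction l with
  | nil => simp
  | cons a l ih => simp [timeOrdered_append, ih]

/-- Two orderings of operators, such that operators which are ordered differently commute, have the
same product. -/
theorem timeOrdered_eq_of_perm {ι : Type*} (f : ι → R) {r r' : ι → ι → Prop} {l l' : List ι}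
    (hp : l.Perm l') (h : l.Pairwise r) (h' : l'.Pairwise r')
    (hc : ∀ x y, r x y → r' y x → Commute (f x) (f y)) :
    timeOrdered (l.map f) = timeOrdered (l'.map f) := by
  induction l generalizing l' with
  | nil => simp [List.Perm.eq_nil hp.symm]
  | cons x l ih =>
    -- The operators in `u` precede `x` in one ordering and follow it in the other, so `x` commutes
    -- past them to the front.
    obtain ⟨u, v, rfl⟩ := List.append_of_mem (hp.subset List.mem_cons_self)
    have hp' : l.Perm (u ++ v) := (hp.trans List.perm_middle).cons_inv
    rw [List.pairwise_cons] at h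
    rw [List.pairwise_append, List.pairwise_cons] at h'
    have hux : ∀ y ∈ u, Commute (f x) (f y) := fun y hy =>
      hc x y (h.1 y (hp'.symm.subset (List.mem_append_left v hy)))
        (h'.2.2 y hy x List.mem_cons_self)
    have hcom : ∀ u : List ι, (∀ y ∈ u, Commute (f x) (f y)) →
        Commute (f x) (timeOrdered (u.map f)) := by
      intro u hu
      induction u with
      | nil => simp
      | cons y u ihu =>
        simp only [List.map_cons, timeOrdered_cons]
        exact (ihu fun z hz => hu z (List.mem_cons_of_mem y hz)).mul_right
          (hu y List.mem_cons_self)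
    have hpw : (u ++ v).Pairwise r' := by
      rw [List.pairwise_append]
      exact ⟨h'.1, h'.2.1.2, fun a ha b hb => h'.2.2 a ha b (List.mem_cons_of_mem x hb)⟩
    rw [List.map_cons, timeOrdered_cons, ih hp' h.2 hpw]
    simp only [List.map_append, List.map_cons, timeOrdered_append, timeOrdered_cons]
    rw [mul_assoc, mul_assoc, (hcom u hux).eq]

end TimeOrdered

/-! ## Operators on registers -/

section Sites

variable {V V' Q : Type} [Fintype V] [Fintype V'] [Fintype Q] {α β γ : Type}

/-- The tensor product of operators on the sites. -/
def siteProd (L : Q → Matrix α β ℂ) : Matrix (Q → α) (Q → β) ℂ :=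
  Matrix.of fun y x => ∏ q, L q (y q) (x q)

/-- The sites that are not of the form `w v`. -/
def Outside (w : V → Q) : Type := {q // q ∉ Set.range w}

open Classical in
instance (w : V → Q) : Fintype (Outside w) := inferInstanceAs (Fintype {q // q ∉ Set.range w})

open Classical in
instance (w : V → Q) : DecidableEq (Outside w) := inferInstance

/-- The operator `Z` on the sites `w v`, tensored with the operators `L q` on the other sites. -/
def locProd (w : V → Q) (Z : Matrix (V → α) (V → β) ℂ) (L : Q → Matrix α β ℂ) :
    Matrix (Q → α) (Q → β) ℂ :=
  Matrix.of fun y x => Z (y ∘ w) (x ∘ w) * ∏ q : Outside w, L q.1 (y q.1) (x q.1)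

/-- The operator `Z` on the sites `w v`. -/
def embed [DecidableEq α] (w : V → Q) (Z : Matrix (V → α) (V → α) ℂ) :
    Matrix (Q → α) (Q → α) ℂ :=
  locProd w Z fun _ => 1

open Classical in
/-- Splitting a configuration along an injection. -/
def splitEquiv (β : Type) {w : V → Q} (hw : Function.Injective w) :
    (Q → β) ≃ (V → β) × (Outside w → β) :=
  (Equiv.piEquivPiSubtypeProd (fun q => q ∈ Set.range w) (fun _ => β)).trans
    (Equiv.prodCongr ((Equiv.ofInjective w hw).arrowCongr (Equiv.refl β)).symm (Equiv.refl _))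

theorem splitEquiv_apply {w : V → Q} (hw : Function.Injective w) (x : Q → β) :
    splitEquiv β hw x = (x ∘ w, fun q => x q.1) := rfl

theorem prod_split {w : V → Q} (hw : Function.Injective w) (f : Q → ℂ) :
    ∏ q, f q = (∏ v, f (w v)) * ∏ q : Outside w, f q.1 := by
  rw [← Fintype.prod_sumElim]
  refine (Fintype.prod_bijective (fun s : V ⊕ Outside w => Sum.elim w (fun q => q.1) s) ⟨?_, ?_⟩
    _ _ ?_).symm
  · rintro (v | q) (v' | q') h
    · exact congrArg Sum.inl (hw h)
    · exact absurd ⟨v, h⟩ q'.2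
    · exact absurd ⟨v', h.symm⟩ q.2
    · exact congrArg Sum.inr (Subtype.ext h)
  · intro q
    by_cases hq : q ∈ Set.range w
    · obtain ⟨v, rfl⟩ := hq
      exact ⟨Sum.inl v, rfl⟩
    · exact ⟨Sum.inr ⟨q, hq⟩, rfl⟩
  · rintro (v | q) <;> rfl

variable [DecidableEq V] [DecidableEq Q] [Fintype β]

theorem siteProd_mul (L : Q → Matrix α β ℂ) (L' : Q → Matrix β γ ℂ) :
    siteProd L * siteProd L' = siteProd fun q => L q * L' q := by
  ext y x
  simp only [siteProd, Matrix.mul_apply, Matrix.of_apply]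
  rw [Finset.prod_univ_sum, Fintype.piFinset_univ]
  exact Finset.sum_congr rfl fun z _ => (Finset.prod_mul_distrib).symm

theorem siteProd_one [DecidableEq β] : siteProd (fun _ : Q => (1 : Matrix β β ℂ)) = 1 := by
  ext y x
  simp only [siteProd, Matrix.of_apply, Matrix.one_apply]
  rw [Finset.prod_ite_zero, Finset.prod_const_one]
  simp [funext_iff]

theorem locProd_mul {w : V → Q} (hw : Function.Injective w) (Z : Matrix (V → α) (V → β) ℂ)
    (Z' : Matrix (V → β) (V → γ) ℂ) (L : Q → Matrix α β ℂ) (L' : Q → Matrix β γ ℂ) :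
    locProd w Z L * locProd w Z' L' = locProd w (Z * Z') fun q => L q * L' q := by
  ext y x
  simp only [locProd, Matrix.mul_apply, Matrix.of_apply]
  rw [Finset.prod_univ_sum, Fintype.piFinset_univ, Finset.sum_mul_sum,
    ← Fintype.sum_prod_type', ← (splitEquiv β hw).sum_comp]
  refine Finset.sum_congr rfl fun z _ => ?_
  simp only [splitEquiv_apply]
  rw [Finset.prod_mul_distrib]
  ring

omit [DecidableEq V] [Fintype β] in
theorem locProd_siteProd {w : V → Q} (hw : Function.Injective w) (L : Q → Matrix α β ℂ) :
    locProd w (siteProd fun v => L (w v)) L = siteProd L := by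
  ext y x
  exact (prod_split hw fun q => L q (y q) (x q)).symm

omit [DecidableEq V] [DecidableEq Q] [Fintype β] in
theorem locProd_congr {w : V → Q} (Z : Matrix (V → α) (V → β) ℂ) {L L' : Q → Matrix α β ℂ}
    (h : ∀ q, q ∉ Set.range w → L q = L' q) : locProd w Z L = locProd w Z L' := by
  ext y x
  simp only [locProd, Matrix.of_apply]
  congr 1
  exact Finset.prod_congr rfl fun q _ => by rw [h q.1 q.2]

variable [DecidableEq α]

open Classical in
theorem embed_apply (w : V → Q) (Z : Matrix (V → α) (V → α) ℂ) (y x : Q → α) :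
    embed w Z y x = if ∀ q, q ∉ Set.range w → y q = x q then Z (y ∘ w) (x ∘ w) else 0 := by
  simp only [embed, locProd, Matrix.of_apply, Matrix.one_apply]
  rw [Finset.prod_ite_zero, Finset.prod_const_one]
  have : (∀ q : Outside w, y q.1 = x q.1) ↔ ∀ q, q ∉ Set.range w → y q = x q :=
    ⟨fun h q hq => h ⟨q, hq⟩, fun h q => h q.1 q.2⟩
  simp only [Finset.mem_univ, true_implies, mul_ite, mul_one, mul_zero]
  exact if_congr this rfl rfl

theorem embed_mul [Fintype α] {w : V → Q} (hw : Function.Injective w)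
    (Z Z' : Matrix (V → α) (V → α) ℂ) : embed w Z * embed w Z' = embed w (Z * Z') := by
  simp only [embed, locProd_mul hw, mul_one]

theorem embed_one (w : V → Q) : embed w (1 : Matrix (V → α) (V → α) ℂ) = 1 := by
  classical
  ext y x
  rw [embed_apply, Matrix.one_apply, Matrix.one_apply, ← ite_and]
  refine if_congr ?_ rfl rfl
  constructor
  · rintro ⟨h1, h2⟩
    funext q
    by_cases hq : q ∈ Set.range w
    · obtain ⟨v, rfl⟩ := hq
      exact congrFun h2 v
    · exact h1 q hq
  · rintro rfl
    simp

theorem embed_embed {e : V' → V} {w : V → Q} (hw : Function.Injective w)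
    (M : Matrix (V' → α) (V' → α) ℂ) : embed w (embed e M) = embed (w ∘ e) M := by
  classical
  ext y x
  rw [embed_apply, embed_apply, embed_apply, ← ite_and]
  refine if_congr ?_ rfl rfl
  constructor
  · rintro ⟨h1, h2⟩ q hq
    by_cases hq' : q ∈ Set.range w
    · obtain ⟨v, rfl⟩ := hq'
      refine h2 v fun ⟨u, hu⟩ => hq ⟨u, by simp [hu]⟩
    · exact h1 q hq'
  · intro h
    refine ⟨fun q hq => h q fun ⟨u, hu⟩ => hq ⟨e u, hu⟩, fun v hv => h (w v) ?_⟩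
    rintro ⟨u, hu⟩
    exact hv ⟨u, hw hu⟩

theorem embed_mulVec [Fintype α] {w : V → Q} (hw : Function.Injective w)
    (Z : Matrix (V → α) (V → α) ℂ) (ψ : (Q → α) → ℂ) (y : Q → α) :
    (embed w Z).mulVec ψ y = ∑ u, Z (y ∘ w) u * ψ (Function.extend w u y) := by
  classical
  simp only [Matrix.mulVec, dotProduct, embed_apply, ite_mul, zero_mul]
  rw [← Finset.sum_filter]
  refine Finset.sum_bij' (fun x _ => x ∘ w) (fun u _ => Function.extend w u y) (by simp) ?_ ?_ ?_ ?_
  · intro u _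
    simp only [Finset.mem_filter, Finset.mem_univ, true_and]
    intro q hq
    rw [Function.extend_apply' _ _ _ (by simpa using hq)]
  · intro x hx
    simp only [Finset.mem_filter, Finset.mem_univ, true_and] at hx
    funext q
    by_cases hq : q ∈ Set.range w
    · obtain ⟨v, rfl⟩ := hq
      rw [hw.extend_apply]
      rfl
    · rw [Function.extend_apply' _ _ _ (by simpa using hq), hx q hq]
  · intro u _
    funext v
    simp [hw.extend_apply]
  · intro x hx
    simp only [Finset.mem_filter, Finset.mem_univ, true_and] at hx
    congr 2
    funext q
    by_cases hq : q ∈ Set.range w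
    · obtain ⟨v, rfl⟩ := hq
      rw [hw.extend_apply]
      rfl
    · rw [Function.extend_apply' _ _ _ (by simpa using hq), hx q hq]

theorem embed_commute [Fintype α] {w : V → Q} {w' : V' → Q} [DecidableEq V']
    (hw : Function.Injective w) (hw' : Function.Injective w') (hd : ∀ v v', w v ≠ w' v')
    (Z : Matrix (V → α) (V → α) ℂ) (Z' : Matrix (V' → α) (V' → α) ℂ) :
    Commute (embed w Z) (embed w' Z') := by
  have hx : ∀ (u : V → α) (u' : V' → α) (y : Q → α),
      Function.extend w' u' (Function.extend w u y) =
        Function.extend w u (Function.extend w' u' y) := by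
    intro u u' y
    funext q
    by_cases h : ∃ v, w v = q
    · obtain ⟨v, rfl⟩ := h
      rw [hw.extend_apply, Function.extend_apply' _ _ _ (fun ⟨v', h⟩ => hd v v' h.symm),
        hw.extend_apply]
    · rw [Function.extend_apply' (f := w) _ _ q h]
      by_cases h' : ∃ v, w' v = q
      · obtain ⟨v, rfl⟩ := h'
        rw [hw'.extend_apply, hw'.extend_apply]
      · rw [Function.extend_apply' (f := w') _ _ q h', Function.extend_apply' (f := w) _ _ q h,
          Function.extend_apply' (f := w') _ _ q h']
  have h1 : ∀ (u : V → α) (y : Q → α), Function.extend w u y ∘ w' = y ∘ w' := by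
    intro u y
    funext v'
    exact Function.extend_apply' _ _ _ (fun ⟨v, h⟩ => hd v v' h)
  have h2 : ∀ (u : V' → α) (y : Q → α), Function.extend w' u y ∘ w = y ∘ w := by
    intro u y
    funext v
    exact Function.extend_apply' _ _ _ (fun ⟨v', h⟩ => hd v v' h.symm)
  refine Matrix.toLin'.injective (LinearMap.ext fun ψ => ?_)
  simp only [Matrix.toLin'_apply, ← Matrix.mulVec_mulVec]
  funext y
  simp only [embed_mulVec hw, embed_mulVec hw', h1, h2, Finset.mul_sum]
  rw [Finset.sum_comm]
  refine Finset.sum_congr rfl fun u _ => Finset.sum_congr rfl fun u' _ => ?_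
  rw [hx]
  ring

end Sites

/-! ## Circuits as matrices -/

namespace Circuit

variable {S : GateSet} {W : Type}

/-- The locations in the order in which they are executed. -/
def order (C : Circuit S W) : List C.Loc := (List.range C.depth).flatMap C.layerLocs

theorem mem_layerLocs (C : Circuit S W) {t : ℕ} {ℓ : C.Loc} :
    ℓ ∈ C.layerLocs t ↔ C.layer ℓ = t := by
  simp [layerLocs]

theorem mem_order (C : Circuit S W) (h : ∀ ℓ, C.layer ℓ < C.depth) (ℓ : C.Loc) :
    ℓ ∈ C.order := by
  simp only [order, List.mem_flatMap, List.mem_range, mem_layerLocs]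
  exact ⟨_, h ℓ, rfl⟩

theorem order_pairwise (C : Circuit S W) :
    C.order.Pairwise fun ℓ ℓ' => ℓ ≠ ℓ' ∧ C.layer ℓ ≤ C.layer ℓ' := by
  rw [order, List.pairwise_flatMap]
  constructor
  · intro t _
    have h1 : (C.layerLocs t).Nodup := Finset.nodup_toList _
    refine List.Pairwise.imp_of_mem (fun {a b} ha hb hab => ⟨hab, ?_⟩) h1
    rw [(C.mem_layerLocs).1 ha, (C.mem_layerLocs).1 hb]
  · refine List.Pairwise.imp (fun {s t} hst => ?_) List.pairwise_lt_range
    intro a ha b hb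
    rw [C.mem_layerLocs] at ha hb
    exact ⟨fun h => by subst h; omega, by omega⟩

theorem order_nodup (C : Circuit S W) : C.order.Nodup :=
  C.order_pairwise.imp fun h => h.1

variable [Fintype W] [DecidableEq W]

/-- The matrix of the operation `ops ℓ` at `ℓ`. -/
def locMat (C : Circuit S W) (ops : (ℓ : C.Loc) → QMatrix (C.kind ℓ).arity) (ℓ : C.Loc) :
    Matrix (Config W) (Config W) ℂ :=
  embed (C.wire ℓ) (ops ℓ)

/-- The matrix of the evolution. -/
def runMat (C : Circuit S W) (ops : (ℓ : C.Loc) → QMatrix (C.kind ℓ).arity) :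
    Matrix (Config W) (Config W) ℂ :=
  timeOrdered (C.order.map (C.locMat ops))

theorem localOp_matrixOp_amp {n : ℕ} {e : Fin n → W} (he : Function.Injective e) (M : QMatrix n)
    (ψ : QState W ℂ) :
    (localOp e (matrixOp M) ψ).amp = (embed e M).mulVec ψ.amp := by
  funext x
  rw [embed_mulVec he]
  rfl

theorem run_amp (C : Circuit S W) (hw : ∀ ℓ, Function.Injective (C.wire ℓ))
    (ops : (ℓ : C.Loc) → QMatrix (C.kind ℓ).arity) (ψ : QState W ℂ) :
    (C.run ops ψ).amp = (C.runMat ops).mulVec ψ.amp := by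
  have h : ∀ (l : List C.Loc) (ψ : QState W ℂ),
      (timeOrdered (l.map fun ℓ => localOp (B := ℂ) (C.wire ℓ) (matrixOp (ops ℓ))) ψ).amp =
      (timeOrdered (l.map (C.locMat ops))).mulVec ψ.amp := by
    intro l
    induction l with
    | nil => intro ψ; simp
    | cons a l ih =>
      intro ψ
      simp only [List.map_cons, timeOrdered_cons, mul_apply_eq_comp, ih,
        ← Matrix.mulVec_mulVec]
      rw [localOp_matrixOp_amp (hw a)]
      rfl
  rw [run, runMat, ← h, order, List.map_flatMap]

theorem locMat_commute (C : Circuit S W) (hw : ∀ ℓ, Function.Injective (C.wire ℓ))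
    (ops : (ℓ : C.Loc) → QMatrix (C.kind ℓ).arity) {ℓ ℓ' : C.Loc}
    (h : ∀ q, C.Touches ℓ q → ¬ C.Touches ℓ' q) :
    Commute (C.locMat ops ℓ) (C.locMat ops ℓ') :=
  embed_commute (hw ℓ) (hw ℓ') (fun v v' hv => h _ ⟨v, rfl⟩ ⟨v', hv.symm⟩) _ _

end Circuit
end

noncomputable section

/-! ## The code -/

theorem QState.inner_eq {W : Type} [Fintype W] [DecidableEq W] {B : Type*} [NormedAddCommGroup B]
    [InnerProductSpace ℂ B] (ψ φ : QState W B) :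
    inner ℂ ψ φ = ∑ x, inner ℂ (ψ x) (φ x) := rfl

section Update

variable {Q : Type} [Fintype Q] [DecidableEq Q] {α : Type} [DecidableEq α]

theorem siteProd_update_apply (b : Q) (M : Matrix α α ℂ) (x y : Q → α) :
    siteProd (Function.update (fun _ => (1 : Matrix α α ℂ)) b M) x y =
      if ∀ q, q ≠ b → x q = y q then M (x b) (y b) else 0 := by
  simp only [siteProd, Matrix.of_apply]
  rw [← Finset.mul_prod_erase Finset.univ _ (Finset.mem_univ b), Function.update_self]
  have h : ∀ q ∈ Finset.univ.erase b,
      Function.update (fun _ => (1 : Matrix α α ℂ)) b M q (x q) (y q) =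
        if x q = y q then 1 else 0 := by
    intro q hq
    rw [Function.update_of_ne (Finset.ne_of_mem_erase hq), Matrix.one_apply]
  rw [Finset.prod_congr rfl h, Finset.prod_ite_zero, Finset.prod_const_one]
  simp

theorem embed_singleton_eq_siteProd (b : Q) (M : Matrix (Fin 1 → α) (Fin 1 → α) ℂ) :
    embed (fun _ : Fin 1 => b) M =
      siteProd (Function.update (fun _ => (1 : Matrix α α ℂ)) b
        (M.submatrix (fun a _ => a) (fun a _ => a))) := by
  ext x y
  rw [siteProd_update_apply, embed_apply]
  refine if_congr ?_ rfl rfl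
  simp [eq_comm]

theorem siteProd_conjTranspose {α β : Type} (L : Q → Matrix α β ℂ) :
    (siteProd L).conjTranspose = siteProd fun q => (L q).conjTranspose := by
  ext x y
  simp [siteProd, Matrix.conjTranspose_apply]

end Update

namespace Scheme

variable {S : GateSet} (F : Scheme S)

/-- Configurations of a block. -/
abbrev Block : Type := Config (Fin F.m)

/-- The operator `E` on the `i`-th qubit of a block. -/
def err (i : Fin F.m) (E : QMatrix 1) : Matrix F.Block F.Block ℂ :=
  embed (fun _ : Fin 1 => i) E

theorem encodeState_apply {n : ℕ} (c : QState (Fin n) ℂ) (x : Config (Fin n × Fin F.m)) :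
    F.encodeState c x = (siteProd fun _ => F.enc).mulVec c.amp (Function.curry x) := rfl

theorem errorAt_apply {n : ℕ} (b : Fin n) (i : Fin F.m) (E : QMatrix 1)
    (φ : QState (Fin n × Fin F.m) ℂ) (x : Config (Fin n × Fin F.m)) :
    F.errorAt b i E φ x =
      (siteProd (Function.update (fun _ => 1) b (F.err i E))).mulVec
        (fun u => φ (Function.uncurry u)) (Function.curry x) := by
  have h := congrFun (Circuit.localOp_matrixOp_amp (e := fun _ : Fin 1 => (b, i))
    (fun _ _ _ => Subsingleton.elim _ _) E φ) x
  refine Eq.trans h ?_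
  simp only [Matrix.mulVec, dotProduct]
  rw [← (Equiv.curry (Fin n) (Fin F.m) Bool).symm.sum_comp]
  refine Finset.sum_congr rfl fun u _ => ?_
  rw [siteProd_update_apply, err, embed_apply, embed_apply, ← ite_and]
  congr 1
  have hsplit : (∀ q, q ∉ Set.range (fun _ : Fin 1 => (b, i)) →
      x q = (Equiv.curry (Fin n) (Fin F.m) Bool).symm u q) ↔
      (∀ q, q ≠ b → Function.curry x q = u q) ∧
        ∀ j, j ∉ Set.range (fun _ : Fin 1 => i) → Function.curry x b j = u b j := ?_
  · by_cases hc : ∀ q, q ∉ Set.range (fun _ : Fin 1 => (b, i)) →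
      x q = (Equiv.curry (Fin n) (Fin F.m) Bool).symm u q
    · rw [if_pos hc, if_pos (hsplit.1 hc)]
      rfl
    · rw [if_neg hc, if_neg fun h => hc (hsplit.2 h)]
  constructor
  · intro h
    refine ⟨fun q hq => funext fun j => h (q, j) ?_, fun j hj => h (b, j) ?_⟩
    · rintro ⟨_, hv⟩
      exact hq (congrArg Prod.fst hv).symm
    · rintro ⟨v, hv⟩
      exact hj ⟨v, congrArg Prod.snd hv⟩
  · rintro ⟨h1, h2⟩ ⟨q, j⟩ hq
    by_cases hqb : q = b
    · subst hqb
      refine h2 j ?_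
      rintro ⟨v, hv⟩
      exact hq ⟨v, by simp [← hv]⟩
    · exact congrFun (h1 q hqb) j

theorem err_one (i : Fin F.m) : F.err i 1 = 1 := embed_one _

/-- The one-qubit state with amplitudes `v`. -/
def qubitState (v : Bool → ℂ) : QState (Fin 1) ℂ := QState.mk fun l => v (l 0)

theorem siteProd_fin_one_mulVec {α β : Type} [Fintype β] (L : Fin 1 → Matrix α β ℂ) (v : β → ℂ)
    (x : Fin 1 → α) :
    (siteProd L).mulVec (fun l => v (l 0)) x = (L 0).mulVec v (x 0) := by
  simp only [Matrix.mulVec, dotProduct]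
  rw [← (Equiv.funUnique (Fin 1) β).symm.sum_comp]
  refine Finset.sum_congr rfl fun u _ => ?_
  simp [siteProd]

theorem errorAt_encodeState_one (i : Fin F.m) (E : QMatrix 1) (v : Bool → ℂ)
    (x : Config (Fin 1 × Fin F.m)) :
    F.errorAt 0 i E (F.encodeState (qubitState v)) x =
      (F.err i E * F.enc).mulVec v fun j => x (0, j) := by
  rw [errorAt_apply]
  have h : (fun u => F.encodeState (qubitState v) (Function.uncurry u)) =
      (siteProd fun _ => F.enc).mulVec (qubitState v).amp := by
    funext u
    rw [encodeState_apply]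
    rfl
  rw [h, Matrix.mulVec_mulVec, siteProd_mul]
  exact siteProd_fin_one_mulVec _ v _

theorem sum_config_fin_one {m : ℕ} {M : Type*} [AddCommMonoid M] (f : Config (Fin m) → M) :
    ∑ x : Config (Fin 1 × Fin m), f (fun j => x (0, j)) = ∑ x, f x := by
  rw [← (Equiv.curry (Fin 1) (Fin m) Bool).symm.sum_comp,
    ← (Equiv.funUnique (Fin 1) (Config (Fin m))).symm.sum_comp]
  rfl

variable {F} (hF : F.FaultTolerant)
include hF

theorem FaultTolerant.inner_encodeState (v v' : Bool → ℂ) :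
    inner ℂ (F.encodeState (qubitState v)) (F.encodeState (qubitState v')) =
      dotProduct (star v) v' := by
  have h : ∀ v x, F.encodeState (qubitState v) x = F.enc.mulVec v fun j => x (0, j) := by
    intro v x
    rw [encodeState_apply]
    exact siteProd_fin_one_mulVec _ v _
  rw [QState.inner_eq]
  simp only [h]
  rw [sum_config_fin_one fun x => inner ℂ (F.enc.mulVec v x) (F.enc.mulVec v' x)]
  have : ∑ x, inner ℂ (F.enc.mulVec v x) (F.enc.mulVec v' x) =
      dotProduct (star (F.enc.mulVec v)) (F.enc.mulVec v') := by
    simp only [dotProduct]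
    refine Finset.sum_congr rfl fun x _ => ?_
    rw [RCLike.inner_apply', Pi.star_apply]
    rfl
  rw [this, Matrix.star_mulVec, ← Matrix.dotProduct_mulVec, Matrix.mulVec_mulVec,
    hF.enc_isometry, Matrix.one_mulVec]

/-- The Knill–Laflamme condition. -/
theorem FaultTolerant.knillLaflamme (i j : Fin F.m) (E E' : QMatrix 1) :
    ∃ r : ℂ, (F.err i E * F.enc).conjTranspose * (F.err j E' * F.enc) = r • 1 := by
  set G := (F.err i E * F.enc).conjTranspose * (F.err j E' * F.enc) with hG
  have key : ∀ v v' : Bool → ℂ, dotProduct (star v) v' = 0 →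
      dotProduct (star v) (G.mulVec v') = 0 := by
    intro v v' hv
    have h := hF.corrects i j E E' (qubitState v) (qubitState v')
      ((hF.inner_encodeState v v').trans hv)
    rw [QState.inner_eq] at h
    simp only [errorAt_encodeState_one] at h
    rw [sum_config_fin_one fun x => inner ℂ ((F.err i E * F.enc).mulVec v x)
      ((F.err j E' * F.enc).mulVec v' x)] at h
    rw [hG, ← Matrix.mulVec_mulVec, Matrix.dotProduct_mulVec, ← Matrix.star_mulVec, ← h]
    simp only [dotProduct]
    refine Finset.sum_congr rfl fun x _ => ?_
    rw [RCLike.inner_apply', Pi.star_apply]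
    rfl
  -- Two orthogonal pairs of basis vectors make the off-diagonal entries vanish. The pair `(1, 1)`,
  -- `(1, -1)` makes the diagonal entries equal.
  have h01 := key (fun b => if b then 0 else 1) (fun b => if b then 1 else 0) (by simp [dotProduct])
  have h10 := key (fun b => if b then 1 else 0) (fun b => if b then 0 else 1) (by simp [dotProduct])
  have hd := key (fun _ => 1) (fun b => if b then 1 else -1) (by simp [dotProduct])
  simp only [dotProduct, Matrix.mulVec, Fintype.sum_bool, Pi.star_apply, star_one, star_zero,
    if_true, Bool.false_eq_true, if_false, zero_mul, one_mul, mul_zero, mul_one, zero_add,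
    add_zero, mul_neg] at h01 h10 hd
  refine ⟨G true true, ?_⟩
  ext a b
  cases a <;> cases b <;> simp only [Matrix.smul_apply, Matrix.one_apply_eq, smul_eq_mul, mul_one]
  · rw [h01, h10] at hd
    linear_combination -hd
  · simpa using h01
  · simpa using h10

theorem FaultTolerant.err_enc_support (i : Fin F.m) (E : QMatrix 1) (x : F.Block) (b : Bool)
    (h : (F.err i E * F.enc) x b ≠ 0) : F.dec x = b := by
  have h' := hF.meas_correct i E b (fun p => x p.2)
  have e : F.errorAt 0 i E (F.encodeState (QState.mk fun l => if l 0 = b then 1 else 0 : QState (Fin 1) ℂ))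
      (fun p => x p.2) = (F.err i E * F.enc) x b := by
    refine (F.errorAt_encodeState_one i E (fun c => if c = b then 1 else 0) _).trans ?_
    simp [Matrix.mulVec, dotProduct]
  exact h' (by rwa [e])

/-- The state space of a register without qubits is one-dimensional and cannot contain two
orthonormal codewords. -/
theorem FaultTolerant.m_ne_zero : F.m ≠ 0 := by
  intro h
  have : IsEmpty (Fin F.m) := by rw [h]; infer_instance
  have h1 := hF.enc_isometry
  have e : ∀ a b, (F.enc.conjTranspose * F.enc) a b =
      star (F.enc (fun i => isEmptyElim i) a) * F.enc (fun i => isEmptyElim i) b := by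
    intro a b
    rw [Matrix.mul_apply, Fintype.sum_unique]
    congr!
  have h00 := congrFun (congrFun h1 false) false
  have h11 := congrFun (congrFun h1 true) true
  have h01 := congrFun (congrFun h1 false) true
  rw [e] at h00 h11 h01
  simp only [Matrix.one_apply_eq] at h00 h11
  rw [Matrix.one_apply_ne (by simp)] at h01
  rcases mul_eq_zero.1 h01 with h | h
  · rw [h] at h00; simp at h00
  · rw [h] at h11; simp at h11

/-- A product operator supported on two qubits is `E_i^* E_j`, the form to which the Knill–Laflamme
condition applies; if the two qubits coincide, one of the errors is the identity. -/
theorem FaultTolerant.siteProd_two (i j : Fin F.m) (N : Fin F.m → Matrix Bool Bool ℂ)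
    (hN : ∀ q, q ≠ i → q ≠ j → N q = 1) :
    ∃ r : ℂ, F.enc.conjTranspose * siteProd N * F.enc = r • 1 := by
  have herr : ∀ (i : Fin F.m) (A : Matrix Bool Bool ℂ),
      F.err i (A.submatrix (fun l => l 0) (fun l => l 0)) =
        siteProd (Function.update (fun _ => (1 : Matrix Bool Bool ℂ)) i A) := by
    intro i A
    rw [err, embed_singleton_eq_siteProd]
    rfl
  by_cases hij : i = j
  · subst hij
    have e : siteProd N = F.err i ((N i).submatrix (fun l => l 0) (fun l => l 0)) := by
      rw [herr]
      congr 1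
      funext q
      by_cases hq : q = i
      · subst hq; simp
      · rw [Function.update_of_ne hq, hN q hq hq]
    obtain ⟨r, hr⟩ := hF.knillLaflamme i i 1 ((N i).submatrix (fun l => l 0) (fun l => l 0))
    refine ⟨r, ?_⟩
    rw [← hr, err_one, Matrix.one_mul, e, Matrix.mul_assoc]
  · have e : siteProd N = (F.err i ((N i).conjTranspose.submatrix (fun l => l 0)
        (fun l => l 0))).conjTranspose * F.err j ((N j).submatrix (fun l => l 0) (fun l => l 0)) := by
      rw [herr, herr, siteProd_conjTranspose, siteProd_mul]
      congr 1
      funext q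
      by_cases hq : q = i
      · subst hq
        simp [Function.update_of_ne hij]
      · by_cases hq' : q = j
        · subst hq'
          simp [Function.update_of_ne hq]
        · rw [Function.update_of_ne hq, Function.update_of_ne hq', hN q hq hq']
          simp
    obtain ⟨r, hr⟩ := hF.knillLaflamme i j ((N i).conjTranspose.submatrix (fun l => l 0)
        (fun l => l 0)) ((N j).submatrix (fun l => l 0) (fun l => l 0))
    refine ⟨r, ?_⟩
    rw [← hr, e, Matrix.conjTranspose_mul]
    simp only [Matrix.mul_assoc]

/-- The Knill–Laflamme condition for operators on the qubits satisfying `p`, in terms of the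
amplitudes. -/
theorem FaultTolerant.sum_split (p : Fin F.m → Prop) [DecidablePred p] (i j : Fin F.m)
    (hp : ∀ q, p q → q = i ∨ q = j) (u u' : {q // p q} → Bool) :
    ∃ r : ℂ, ∀ b b', ∑ v : {q // ¬ p q} → Bool,
      star (F.enc ((Equiv.piEquivPiSubtypeProd p fun _ => Bool).symm (u, v)) b) *
        F.enc ((Equiv.piEquivPiSubtypeProd p fun _ => Bool).symm (u', v)) b' =
      if b = b' then r else 0 := by
  set g := (Equiv.piEquivPiSubtypeProd p fun _ => Bool).symm with hg
  -- Matrix units on the qubits satisfying `p` single out the rows `u` and `u'`; the identity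
  -- elsewhere sums over the remaining qubits.
  let N : Fin F.m → Matrix Bool Bool ℂ := fun q =>
    if h : p q then Matrix.single (u ⟨q, h⟩) (u' ⟨q, h⟩) 1 else 1
  obtain ⟨r, hr⟩ := hF.siteProd_two i j N fun q h1 h2 =>
    dif_neg fun h => (hp q h).elim h1 h2
  refine ⟨r, fun b b' => ?_⟩
  have h := congrFun (congrFun hr b) b'
  have e : (r • (1 : Matrix Bool Bool ℂ)) b b' = if b = b' then r else 0 := by
    simp [Matrix.one_apply]
  rw [← e, ← h, Matrix.mul_assoc, Matrix.mul_apply, ← g.sum_comp]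
  have hs : ∀ a a' : {q // p q} → Bool, ∀ v v' : {q // ¬ p q} → Bool,
      siteProd N (g (a, v)) (g (a', v')) =
        if a = u ∧ a' = u' ∧ v = v' then 1 else 0 := by
    intro a a' v v'
    simp only [siteProd, Matrix.of_apply]
    rw [← Fintype.prod_subtype_mul_prod_subtype p]
    have h1 : ∀ q : {q // p q}, N q (g (a, v) q) (g (a', v') q) =
        if u q = a q ∧ u' q = a' q then 1 else 0 := by
      intro q
      simp [N, hg, q.2, Matrix.single_apply]
    have h2 : ∀ q : {q // ¬ p q}, N q (g (a, v) q) (g (a', v') q) =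
        if v q = v' q then 1 else 0 := by
      intro q
      simp [N, hg, q.2, Matrix.one_apply]
    simp only [h1, h2, Finset.prod_ite_zero, Finset.prod_const_one]
    rw [mul_ite, mul_one, mul_zero, ← ite_and]
    refine @if_congr _ _ _ _ _ _ _ _ _ ?_ rfl rfl
    simp only [Finset.mem_univ, true_implies, funext_iff]
    constructor
    · rintro ⟨h2, h1⟩
      exact ⟨fun q => (h1 q).1.symm, fun q => (h1 q).2.symm, h2⟩
    · rintro ⟨h1, h2, h3⟩
      exact ⟨h3, fun q => ⟨(h1 q).symm, (h2 q).symm⟩⟩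
  rw [Fintype.sum_prod_type, Finset.sum_eq_single u]
  · refine Finset.sum_congr rfl fun v _ => ?_
    rw [Matrix.mul_apply, ← g.sum_comp, Finset.sum_eq_single (u', v)]
    · rw [hs]; simp [Matrix.conjTranspose_apply]
    · rintro ⟨a', v'⟩ _ hne
      rw [hs, if_neg, zero_mul]
      rintro ⟨-, h1, h2⟩
      exact hne (by rw [h1, h2])
    · simp
  · intro a _ ha
    refine Finset.sum_eq_zero fun v _ => ?_
    rw [Matrix.mul_apply, ← g.sum_comp, Finset.sum_eq_zero, mul_zero]
    rintro ⟨a', v'⟩ _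
    rw [hs, if_neg, zero_mul]
    rintro ⟨h1, -⟩
    exact ha h1
  · simp

open scoped ComplexOrder in
/-- A code that corrects an error on one qubit has at least five qubits. -/
theorem FaultTolerant.five_le_m : 5 ≤ F.m := by
  by_contra hm
  have h0 : 0 < F.m := Nat.pos_of_ne_zero hF.m_ne_zero
  -- A block of at most four qubits splits into two parts of at most two qubits each, and no
  -- operator on either part can distinguish codewords. `Φ b` is the codeword `b`, as a matrix
  -- between the two parts.
  let p : Fin F.m → Prop := fun q => q.1 < 2
  set g := (Equiv.piEquivPiSubtypeProd p fun _ => Bool).symm with hg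
  let Φ : Bool → Matrix ({q // p q} → Bool) ({q // ¬ p q} → Bool) ℂ := fun b u v =>
    F.enc (g (u, v)) b
  -- The reduced state `Φ_b Φ_b^*` of the first part does not depend on `b`, whereas `hcol` gives
  -- `Φ_0^* Φ_1 = 0` from the second part. The minima keep the indices in range when the block has
  -- fewer than four qubits.
  have hrow := hF.sum_split p ⟨0, h0⟩ ⟨min 1 (F.m - 1), by omega⟩ (by
    intro q hq
    have : q.1 < 2 := hq
    have := q.2
    simp only [Fin.ext_iff]
    omega)
  have hcol : ∀ v v' : {q // ¬ p q} → Bool, ∑ u, star (Φ false u v) * Φ true u v' = 0 := by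
    intro v v'
    let p' : Fin F.m → Prop := fun q => ¬ q.1 < 2
    obtain ⟨r, hr⟩ := hF.sum_split p' ⟨min 2 (F.m - 1), by omega⟩ ⟨min 3 (F.m - 1), by omega⟩ (by
      intro q hq
      have : ¬ q.1 < 2 := hq
      have := q.2
      simp only [Fin.ext_iff]
      omega) v v'
    have h := hr false true
    simp only [Bool.false_eq_true, if_false] at h
    rw [← h]
    have hp : ∀ q, p q ↔ ¬ p' q := fun q => by simp [p, p']
    refine Fintype.sum_equiv (Equiv.arrowCongr (Equiv.subtypeEquivRight hp) (Equiv.refl _)) _ _ ?_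
    intro u
    have e : ∀ v : {q // ¬ p q} → Bool, g (u, v) =
        (Equiv.piEquivPiSubtypeProd p' fun _ => Bool).symm
          (v, (Equiv.arrowCongr (Equiv.subtypeEquivRight hp) (Equiv.refl _)) u) := by
      intro v
      funext q
      by_cases hq : q.1 < 2
      · simp [hg, p, p', hq, Equiv.arrowCongr]
        rfl
      · simp [hg, p, p', hq]
    simp only [Φ, e]
  have h1 : (Φ false).conjTranspose * Φ true = 0 := by
    ext v v'
    rw [Matrix.mul_apply]
    exact hcol v v'
  have h2 : Φ false * (Φ false).conjTranspose = Φ true * (Φ true).conjTranspose := by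
    ext u' u
    obtain ⟨r, hr⟩ := hrow u u'
    have ha := hr false false
    have hb := hr true true
    simp only [if_true] at ha hb
    rw [Matrix.mul_apply, Matrix.mul_apply]
    refine Eq.trans (Eq.trans ?_ (ha.trans hb.symm)) ?_
    · exact Finset.sum_congr rfl fun v _ => mul_comm _ _
    · exact Finset.sum_congr rfl fun v _ => mul_comm _ _
  -- `(Φ_0^* Φ_0)² = Φ_0^* (Φ_1 Φ_1^*) Φ_0 = 0`, which forces `Φ_0 = 0` and contradicts
  -- normalisation.
  have h3 : ((Φ false).conjTranspose * Φ false).conjTranspose *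
      ((Φ false).conjTranspose * Φ false) = 0 := by
    have e : ((Φ false).conjTranspose * Φ false).conjTranspose = (Φ false).conjTranspose * Φ false := by
      simp
    rw [e, Matrix.mul_assoc, ← Matrix.mul_assoc (Φ false), h2]
    rw [← Matrix.mul_assoc, ← Matrix.mul_assoc, h1, Matrix.zero_mul, Matrix.zero_mul]
  have h4 : Φ false = 0 :=
    Matrix.conjTranspose_mul_self_eq_zero.1 (Matrix.conjTranspose_mul_self_eq_zero.1 h3)
  have h5 := congrFun (congrFun hF.enc_isometry false) false
  rw [Matrix.mul_apply, Matrix.one_apply_eq, Finset.sum_eq_zero] at h5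
  · exact zero_ne_one h5
  · intro x _
    have : F.enc x false = Φ false (g.symm x).1 (g.symm x).2 := by simp [Φ]
    rw [this, h4]
    simp

end Scheme
end

noncomputable section

/-! ## Decoders -/

namespace Scheme

variable {S : GateSet} (F : Scheme S)

/-- Operators from a block to a qubit that map the encoded states with an error on one qubit to the
encoded ones, up to a factor that only depends on the error. -/
def IsDecoder (L : Matrix Bool F.Block ℂ) : Prop :=
  ∀ i E, ∃ r : ℂ, L * (F.err i E * F.enc) = r • 1

variable {F} (hF : F.FaultTolerant)

theorem IsDecoder.mul_enc (hF : F.FaultTolerant) {L : Matrix Bool F.Block ℂ} (hL : F.IsDecoder L) :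
    ∃ r : ℂ, L * F.enc = r • 1 := by
  obtain ⟨r, hr⟩ := hL ⟨0, Nat.pos_of_ne_zero hF.m_ne_zero⟩ 1
  rw [err_one, Matrix.one_mul] at hr
  exact ⟨r, hr⟩

include hF

theorem FaultTolerant.isDecoder_enc : F.IsDecoder F.enc.conjTranspose := by
  intro i E
  obtain ⟨r, hr⟩ := hF.knillLaflamme i i 1 E
  rw [err_one, Matrix.one_mul] at hr
  exact ⟨r, hr⟩

/-- An isometry, on each of the two spaces spanned by the configurations with the same decoded value,
after which the logical value is erased from encoded states with at most one error. -/
theorem FaultTolerant.exists_erasure : ∃ J : Matrix F.Block F.Block ℂ,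
    (∀ x x', F.dec x = F.dec x' → ∑ y, star (J y x) * J y x' = if x = x' then 1 else 0) ∧
    ∀ i E y, (J * (F.err i E * F.enc)) y false = (J * (F.err i E * F.enc)) y true := by
  classical
  -- `T b` sends a family of errors to the sum of their actions on the codeword `b`. By the
  -- Knill–Laflamme condition the Gram matrices of `T false` and `T true` agree.
  let T : Bool → (Fin F.m → QMatrix 1) →ₗ[ℂ] EuclideanSpace ℂ F.Block := fun b =>
    { toFun := fun f => WithLp.toLp 2 fun x => ∑ i, (F.err i (f i) * F.enc) x b
      map_add' := by
        intro f g
        ext x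
        rw [PiLp.add_apply]
        dsimp only
        rw [← Finset.sum_add_distrib]
        refine Finset.sum_congr rfl fun i _ => ?_
        have : F.err i ((f + g) i) = F.err i (f i) + F.err i (g i) := by
          ext u v
          simp only [err, embed_apply, Pi.add_apply, Matrix.add_apply]
          split_ifs <;> simp
        rw [this, Matrix.add_mul, Matrix.add_apply]
      map_smul' := by
        intro c f
        ext x
        rw [RingHom.id_apply, PiLp.smul_apply, smul_eq_mul]
        dsimp only
        rw [Finset.mul_sum]
        refine Finset.sum_congr rfl fun i _ => ?_
        have : F.err i ((c • f) i) = c • F.err i (f i) := by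
          ext u v
          simp only [err, embed_apply, Pi.smul_apply, Matrix.smul_apply]
          split_ifs <;> simp
        rw [this, Matrix.smul_mul, Matrix.smul_apply, smul_eq_mul] }
  have hT : ∀ b f x, T b f x = ∑ i, (F.err i (f i) * F.enc) x b := fun b f x => rfl
  have hinner : ∀ f g, inner ℂ (T false f) (T false g) = inner ℂ (T true f) (T true g) := by
    have h : ∀ b f g, inner ℂ (T b f) (T b g) = ∑ i, ∑ j,
        ((F.err i (f i) * F.enc).conjTranspose * (F.err j (g j) * F.enc)) b b := by
      intro b f g
      simp only [PiLp.inner_apply, hT, RCLike.inner_apply', map_sum, Finset.sum_mul_sum]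
      rw [Finset.sum_comm]
      refine Finset.sum_congr rfl fun i _ => ?_
      rw [Finset.sum_comm]
      rfl
    intro f g
    rw [h, h]
    refine Finset.sum_congr rfl fun i _ => Finset.sum_congr rfl fun j _ => ?_
    obtain ⟨r, hr⟩ := hF.knillLaflamme i j (f i) (g j)
    rw [hr]
    simp
  have hnorm : ∀ f, ‖T false f‖ = ‖T true f‖ := by
    intro f
    rw [@norm_eq_sqrt_re_inner ℂ, @norm_eq_sqrt_re_inner ℂ, hinner]
  obtain ⟨g, hg⟩ := (T false).rangeRestrict.exists_rightInverse_of_surjective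
    (LinearMap.range_rangeRestrict _)
  have hg' : ∀ v : LinearMap.range (T false), T false (g v) = v := fun v =>
    congrArg Subtype.val (LinearMap.congr_fun hg v)
  -- Equal Gram matrices make `T false f ↦ T true f` a well-defined isometry on the range, through
  -- any linear section `g`; it extends to the whole block space.
  let w : LinearMap.range (T false) →ₗᵢ[ℂ] EuclideanSpace ℂ F.Block :=
    { toLinearMap := (T true).comp g
      norm_map' := by
        intro v
        rw [LinearMap.comp_apply, ← hnorm, hg']
        rfl }
  have hw : ∀ f, w.extend (T false f) = T true f := by
    intro f
    have h1 := w.extend_apply ⟨T false f, LinearMap.mem_range_self _ f⟩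
    have h2 : w ⟨T false f, LinearMap.mem_range_self _ f⟩ = T true f := by
      refine sub_eq_zero.1 (norm_eq_zero.1 ?_)
      change ‖T true (g ⟨T false f, _⟩) - T true f‖ = 0
      rw [← map_sub, ← hnorm, map_sub, hg', sub_self, norm_zero]
    exact h1.trans h2
  -- The extended isometry acts on configurations decoded to `false`, the identity on those decoded
  -- to `true`. By `meas_correct` the erroneous codeword `b` is supported on configurations decoded
  -- to `b`, so both codewords end up in the same vector.
  let J : Matrix F.Block F.Block ℂ := Matrix.of fun y x =>
    if F.dec x = false then w.extend (EuclideanSpace.single x 1) y else if y = x then 1 else 0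
  have hJ : ∀ y x, J y x = if F.dec x = false then w.extend (EuclideanSpace.single x 1) y
      else if y = x then 1 else 0 := fun _ _ => rfl
  refine ⟨J, ?_, ?_⟩
  · intro x x' hx
    by_cases h : F.dec x = false
    · have h' : F.dec x' = false := hx ▸ h
      have e := w.extend.inner_map_map (EuclideanSpace.single x (1 : ℂ))
        (EuclideanSpace.single x' (1 : ℂ))
      simp only [PiLp.inner_apply, RCLike.inner_apply'] at e
      simp only [hJ, h, h', if_true]
      refine e.trans ?_
      simp only [PiLp.single_apply, apply_ite (starRingEnd ℂ), map_one, map_zero,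
        ite_mul, one_mul, zero_mul, Finset.sum_ite_eq', Finset.mem_univ, if_true]
    · have h' : ¬ F.dec x' = false := hx ▸ h
      simp [hJ, h, h', eq_comm]
  · intro i E y
    have hf : ∀ b x, T b (Pi.single i E) x = (F.err i E * F.enc) x b := by
      intro b x
      rw [hT, Finset.sum_eq_single i]
      · rw [Pi.single_eq_same]
      · intro j _ hj
        have : F.err j (0 : QMatrix 1) = 0 := by
          ext u v
          simp [err, embed_apply]
        rw [Pi.single_eq_of_ne hj, this, Matrix.zero_mul, Matrix.zero_apply]
      · simp
    have h0 : (J * (F.err i E * F.enc)) y false = T true (Pi.single i E) y := by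
      have e : T false (Pi.single i E) = ∑ x, (F.err i E * F.enc) x false •
          (EuclideanSpace.single x (1 : ℂ)) := by
        ext x
        rw [hf]
        simp [Pi.single_apply]
      rw [← hw, e, map_sum, Matrix.mul_apply]
      rw [WithLp.ofLp_sum, Finset.sum_apply]
      refine Finset.sum_congr rfl fun x _ => ?_
      rw [map_smul, PiLp.smul_apply, smul_eq_mul, mul_comm]
      by_cases hx : (F.err i E * F.enc) x false = 0
      · rw [hx, zero_mul, zero_mul]
      · simp [hJ, hF.err_enc_support i E x false hx]
    have h1 : (J * (F.err i E * F.enc)) y true = T true (Pi.single i E) y := by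
      rw [hf, Matrix.mul_apply, Finset.sum_eq_single y]
      · by_cases hx : (F.err i E * F.enc) y true = 0
        · rw [hx, mul_zero]
        · simp [hJ, hF.err_enc_support i E y true hx]
      · intro x _ hxy
        by_cases hx : (F.err i E * F.enc) x true = 0
        · rw [hx, mul_zero]
        · simp [hJ, hF.err_enc_support i E x true hx, hxy.symm]
      · simp
    rw [h0, h1]

/-- A complete family of decoders. -/
theorem FaultTolerant.exists_decoders : ∃ L : F.Block → Matrix Bool F.Block ℂ,
    (∀ y, F.IsDecoder (L y)) ∧
    ∀ b x x', ∑ y, star (L y b x) * L y b x' = if b = F.dec x ∧ x = x' then 1 else 0 := by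
  obtain ⟨J, h1, h2⟩ := hF.exists_erasure
  -- The decoded bit is kept in the output and the row `y` of `J` serves as the syndrome. As `J`
  -- erases the logical value from the syndrome, the amplitude of `y` is the same for both
  -- codewords.
  refine ⟨fun y => Matrix.of fun b x => if F.dec x = b then J y x else 0, ?_, ?_⟩
  · intro y i E
    refine ⟨(J * (F.err i E * F.enc)) y true, ?_⟩
    have h : ∀ b', (J * (F.err i E * F.enc)) y b' = (J * (F.err i E * F.enc)) y true := by
      rintro (_ | _)
      · exact h2 i E y
      · rfl
    ext b b'
    rw [Matrix.smul_apply, ← h b', Matrix.mul_apply, Matrix.mul_apply, Matrix.one_apply,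
      smul_eq_mul, mul_ite, mul_one, mul_zero]
    have : ∀ x, (Matrix.of fun b x => if F.dec x = b then J y x else 0) b x *
        (F.err i E * F.enc) x b' =
          if b = b' then J y x * (F.err i E * F.enc) x b' else 0 := by
      intro x
      by_cases hx : (F.err i E * F.enc) x b' = 0
      · simp [hx]
      · have := hF.err_enc_support i E x b' hx
        simp [this, eq_comm (a := b')]
    rw [Finset.sum_congr rfl fun x _ => this x]
    split_ifs <;> simp
  · intro b x x'
    simp only [Matrix.of_apply]
    by_cases hx : F.dec x = b
    · by_cases hx' : F.dec x' = b
      · simp only [hx, hx', if_true, true_and]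
        exact h1 x x' (hx.trans hx'.symm)
      · have : x ≠ x' := fun h => hx' (h ▸ hx)
        simp [hx', this]
    · simp [hx, Ne.symm hx]

end Scheme
end

noncomputable section

/-! ## Gadgets with fixed final states of the ancillas -/

/-- The conditions on gadgets allow the final state of the ancillas to depend on the encoded state.
Linearity rules this out: an operator for which every vector is an eigenvector is a scalar. -/
theorem Matrix.exists_eq_smul_one {ι : Type} [Fintype ι] [DecidableEq ι] (M : Matrix ι ι ℂ)
    (h : ∀ v, ∃ r : ℂ, M.mulVec v = r • v) : ∃ r : ℂ, M = r • 1 := by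
  obtain ⟨r, hr⟩ := LinearMap.exists_eq_smul_id_of_forall_notLinearIndependent
    (f := Matrix.toLin' M) (fun v => by
      obtain ⟨r, hr⟩ := h v
      rw [Matrix.toLin'_apply, hr, LinearIndependent.pair_iff]
      intro hc
      have := (hc r (-1) (by simp)).2
      simp at this)
  refine ⟨r, Matrix.toLin'.injective ?_⟩
  rw [hr, map_smul, Matrix.toLin'_one]
  rfl

theorem Matrix.exists_eq_smul {ι : Type} [Fintype ι] [DecidableEq ι] {M U V : Matrix ι ι ℂ}
    (hVU : V * U = 1)
    (h : ∀ v, ∃ r : ℂ, M.mulVec v = r • U.mulVec v) : ∃ r : ℂ, M = r • U := by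
  obtain ⟨r, hr⟩ := Matrix.exists_eq_smul_one (V * M) fun v => by
    obtain ⟨r, hr⟩ := h v
    refine ⟨r, ?_⟩
    rw [← Matrix.mulVec_mulVec, hr, Matrix.mulVec_smul, Matrix.mulVec_mulVec, hVU,
      Matrix.one_mulVec]
  refine ⟨r, ?_⟩
  have hUV : U * V = 1 := mul_eq_one_comm.1 hVU
  calc M = U * (V * M) := by rw [← Matrix.mul_assoc, hUV, Matrix.one_mul]
    _ = r • U := by rw [hr, Matrix.mul_smul, Matrix.mul_one]

section SiteProd

variable {Q : Type} [Fintype Q] [DecidableEq Q] {α β : Type}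

theorem siteProd_update (L : Q → Matrix α β ℂ) (b : Q) (D : Matrix α β ℂ) (y : Q → α) (x : Q → β) :
    siteProd (Function.update L b D) y x =
      D (y b) (x b) * ∏ q ∈ Finset.univ.erase b, L q (y q) (x q) := by
  simp only [siteProd, Matrix.of_apply]
  rw [← Finset.mul_prod_erase Finset.univ _ (Finset.mem_univ b), Function.update_self]
  congr 1
  exact Finset.prod_congr rfl fun q hq => by rw [Function.update_of_ne (Finset.ne_of_mem_erase hq)]

/-- The tensor product of operators, as a linear function of one of its factors. -/
def siteProdLin (L : Q → Matrix α β ℂ) (b : Q) : Matrix α β ℂ →ₗ[ℂ] Matrix (Q → α) (Q → β) ℂ where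
  toFun D := siteProd (Function.update L b D)
  map_add' D D' := by
    ext y x
    simp only [siteProd_update, Matrix.add_apply, add_mul]
  map_smul' c D := by
    ext y x
    simp only [siteProd_update, Matrix.smul_apply, smul_eq_mul, RingHom.id_apply, mul_assoc]

theorem siteProd_smul (r : Q → ℂ) (L : Q → Matrix α β ℂ) :
    siteProd (fun q => r q • L q) = (∏ q, r q) • siteProd L := by
  ext y x
  simp [siteProd, Finset.prod_mul_distrib]

end SiteProd

namespace Scheme

variable {S : GateSet} (F : Scheme S) {n : ℕ}

/-- The encoding of `n` qubits. -/
abbrev encs (n : ℕ) : Matrix (Fin n → F.Block) (Config (Fin n)) ℂ := siteProd fun _ => F.enc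

/-- The operator `D` on the block `b`. -/
abbrev atBlock (b : Fin n) (D : Matrix F.Block F.Block ℂ) :
    Matrix (Fin n → F.Block) (Fin n → F.Block) ℂ :=
  siteProd (Function.update (fun _ => 1) b D)

/-- The encoded states with at most one error per block. -/
def errSpan (v : Config (Fin n) → ℂ) : Submodule ℂ ((Fin n → F.Block) → ℂ) :=
  Submodule.span ℂ {φ | ∃ (i : Fin n → Fin F.m) (E : Fin n → QMatrix 1),
    φ = (siteProd fun b => F.err (i b) (E b) * F.enc).mulVec v}

/-- An error correction without faults. -/
structure ECPerfect (C : Matrix F.Block F.Block ℂ) : Prop where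
  project : ∀ v, ∃ c, C.mulVec v = F.enc.mulVec c
  correct : ∀ i E c, ∃ r : ℂ, (C * (F.err i E * F.enc)).mulVec c = r • F.enc.mulVec c

/-- An error correction with at most one fault. -/
structure ECGood (C : Matrix F.Block F.Block ℂ) : Prop where
  filter : ∀ v, C.mulVec v ∈ Submodule.span ℂ {φ | ∃ i E c, φ = (F.err i E * F.enc).mulVec c}
  fault : ∀ c, (C * F.enc).mulVec c ∈
    Submodule.span ℂ {φ | ∃ i E, φ = (F.err i E * F.enc).mulVec c}

/-- A gate gadget without faults. -/
structure BodyPerfect (U : QMatrix n) (A : Matrix (Fin n → F.Block) (Fin n → F.Block) ℂ) :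
    Prop where
  ideal : ∀ c, ∃ r : ℂ, (A * F.encs n).mulVec c =
    r • (F.encs n).mulVec (U.mulVec c)
  propagate : ∀ b i E c, A.mulVec ((F.atBlock b (F.err i E)).mulVec
    ((F.encs n).mulVec c)) ∈ F.errSpan (U.mulVec c)

/-- A gate gadget with at most one fault. -/
def BodyGood (U : QMatrix n) (A : Matrix (Fin n → F.Block) (Fin n → F.Block) ℂ) : Prop :=
  ∀ c, (A * F.encs n).mulVec c ∈ F.errSpan (U.mulVec c)

variable {F} (hF : F.FaultTolerant)

theorem siteProd_mul_errSpan {T : Fin n → Matrix Bool F.Block ℂ} (hT : ∀ i, F.IsDecoder (T i))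
    {v : Config (Fin n) → ℂ} {φ : (Fin n → F.Block) → ℂ} (hφ : φ ∈ F.errSpan v) :
    ∃ r : ℂ, (siteProd T).mulVec φ = r • v := by
  induction hφ using Submodule.span_induction with
  | mem φ h =>
    obtain ⟨i, E, rfl⟩ := h
    choose r hr using fun b => hT b (i b) (E b)
    refine ⟨∏ b, r b, ?_⟩
    rw [Matrix.mulVec_mulVec, siteProd_mul]
    simp only [hr]
    rw [siteProd_smul, siteProd_one, Matrix.smul_mulVec, Matrix.one_mulVec]
  | zero => exact ⟨0, by simp⟩
  | add x y _ _ hx hy =>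
    obtain ⟨r, hr⟩ := hx
    obtain ⟨s, hs⟩ := hy
    exact ⟨r + s, by rw [Matrix.mulVec_add, hr, hs, add_smul]⟩
  | smul a x _ hx =>
    obtain ⟨r, hr⟩ := hx
    exact ⟨a * r, by rw [Matrix.mulVec_smul, hr, mul_smul]⟩

include hF

theorem ECPerfect.eq {C : Matrix F.Block F.Block ℂ} (hC : F.ECPerfect C) :
    C = F.enc * (F.enc.conjTranspose * C) := by
  refine Matrix.toLin'.injective (LinearMap.ext fun v => ?_)
  obtain ⟨c, hc⟩ := hC.project v
  simp only [Matrix.toLin'_apply]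
  rw [← Matrix.mulVec_mulVec, ← Matrix.mulVec_mulVec, hc, Matrix.mulVec_mulVec (N := F.enc),
    hF.enc_isometry, Matrix.one_mulVec]

theorem IsDecoder.mul_perfect {L C : Matrix _ F.Block ℂ} (hL : F.IsDecoder L)
    (hC : F.ECPerfect C) : F.IsDecoder (L * C) := by
  intro i E
  obtain ⟨s, hs⟩ := hL.mul_enc hF
  refine Matrix.exists_eq_smul_one _ fun v => ?_
  obtain ⟨r, hr⟩ := hC.correct i E v
  refine ⟨r * s, ?_⟩
  rw [Matrix.mul_assoc, ← Matrix.mulVec_mulVec, hr, Matrix.mulVec_smul, Matrix.mulVec_mulVec, hs,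
    Matrix.smul_mulVec, Matrix.one_mulVec, mul_smul]

-- An error correction with one fault can turn an input that already has an error into one with an
-- undecodable error, hence the conclusion is only about inputs in the code. The product is not
-- claimed to be a decoder.
omit hF in
theorem IsDecoder.mul_good {L : Matrix Bool F.Block ℂ} {C : Matrix F.Block F.Block ℂ}
    (hL : F.IsDecoder L) (hC : F.ECGood C) : ∃ r : ℂ, L * C * F.enc = r • 1 := by
  refine Matrix.exists_eq_smul_one _ fun v => ?_
  rw [Matrix.mul_assoc, ← Matrix.mulVec_mulVec]
  have h := hC.fault v
  generalize (C * F.enc).mulVec v = φ at h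
  induction h using Submodule.span_induction with
  | mem φ h =>
    obtain ⟨i, E, rfl⟩ := h
    obtain ⟨r, hr⟩ := hL i E
    exact ⟨r, by rw [Matrix.mulVec_mulVec, hr, Matrix.smul_mulVec, Matrix.one_mulVec]⟩
  | zero => exact ⟨0, by simp⟩
  | add x y _ _ hx hy =>
    obtain ⟨r, hr⟩ := hx
    obtain ⟨s, hs⟩ := hy
    exact ⟨r + s, by rw [Matrix.mulVec_add, hr, hs, add_smul]⟩
  | smul a x _ hx =>
    obtain ⟨r, hr⟩ := hx
    exact ⟨a * r, by rw [Matrix.mulVec_smul, hr, mul_smul]⟩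

/-- A rectangle with correctly decoded output, preceded by perfect error corrections. -/
theorem rec_of_perfect_leads {U V : QMatrix n} (hVU : V * U = 1)
    {Z : Matrix (Config (Fin n)) (Fin n → F.Block) ℂ}
    (hZ : ∀ c, ∃ r : ℂ, (Z * F.encs n).mulVec c = r • U.mulVec c)
    {C : Fin n → Matrix F.Block F.Block ℂ} (hC : ∀ i, F.ECPerfect (C i)) :
    ∃ L : Fin n → Matrix Bool F.Block ℂ, (∀ i, F.IsDecoder (L i)) ∧
      ∃ r : ℂ, Z * siteProd C = r • (U * siteProd fun i => L i * C i) := by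
  obtain ⟨r, hr⟩ := Matrix.exists_eq_smul hVU hZ
  refine ⟨fun _ => F.enc.conjTranspose, fun _ => hF.isDecoder_enc, r, ?_⟩
  have e : siteProd C = F.encs n *
      siteProd fun i => F.enc.conjTranspose * C i := by
    rw [siteProd_mul]
    congr 1
    funext i
    exact (hC i).eq hF
  calc Z * siteProd C = (Z * F.encs n) *
        siteProd fun i => F.enc.conjTranspose * C i := by rw [Matrix.mul_assoc, ← e]
    _ = _ := by rw [hr, Matrix.smul_mul]

/-- This serves the case in which the trailing error corrections may each have a fault. The body
then delivers encoded states without errors, so the pulled-back decoders `T` need to be correct on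
the code only. -/
theorem rec_perfect {U V : QMatrix n} (hVU : V * U = 1)
    {A : Matrix (Fin n → F.Block) (Fin n → F.Block) ℂ} (hA : F.BodyPerfect U A)
    {T : Fin n → Matrix Bool F.Block ℂ} (hT : ∀ i, ∃ r : ℂ, T i * F.enc = r • 1)
    {C : Fin n → Matrix F.Block F.Block ℂ} (hC : ∀ i, F.ECPerfect (C i)) :
    ∃ L : Fin n → Matrix Bool F.Block ℂ, (∀ i, F.IsDecoder (L i)) ∧
      ∃ r : ℂ, siteProd T * A * siteProd C = r • (U * siteProd fun i => L i * C i) := by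
  refine rec_of_perfect_leads hF hVU (fun c => ?_) hC
  obtain ⟨r, hr⟩ := hA.ideal c
  choose s hs using hT
  refine ⟨r * ∏ i, s i, ?_⟩
  rw [Matrix.mul_assoc, ← Matrix.mulVec_mulVec, hr, Matrix.mulVec_smul, Matrix.mulVec_mulVec,
    siteProd_mul]
  simp only [hs]
  rw [siteProd_smul, siteProd_one, Matrix.smul_mulVec, Matrix.one_mulVec, mul_smul]

/-- The body may produce one error in each block; as the trailing error corrections are then
perfect, `T` consists of decoders and removes these errors. -/
theorem rec_fault_body {U V : QMatrix n} (hVU : V * U = 1)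
    {A : Matrix (Fin n → F.Block) (Fin n → F.Block) ℂ} (hA : F.BodyGood U A)
    {T : Fin n → Matrix Bool F.Block ℂ} (hT : ∀ i, F.IsDecoder (T i))
    {C : Fin n → Matrix F.Block F.Block ℂ} (hC : ∀ i, F.ECPerfect (C i)) :
    ∃ L : Fin n → Matrix Bool F.Block ℂ, (∀ i, F.IsDecoder (L i)) ∧
      ∃ r : ℂ, siteProd T * A * siteProd C = r • (U * siteProd fun i => L i * C i) := by
  refine rec_of_perfect_leads hF hVU (fun c => ?_) hC
  rw [Matrix.mul_assoc, ← Matrix.mulVec_mulVec]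
  exact siteProd_mul_errSpan hT (hA c)

-- Applying the filter property to the columns turns it into a statement about operators: each term
-- first extracts a logical qubit from the arbitrary input, then encodes it, then makes one error.
omit hF in
theorem ECGood.mem_span {C : Matrix F.Block F.Block ℂ} (hC : F.ECGood C) :
    C ∈ Submodule.span ℂ {D : Matrix F.Block F.Block ℂ |
      ∃ i E, ∃ M : Matrix Bool F.Block ℂ, D = F.err i E * F.enc * M} := by
  have e : C = ∑ x, Matrix.vecMulVec (C.mulVec (Pi.single x 1)) (Pi.single x 1) := by
    ext u v
    simp [Matrix.sum_apply, Matrix.vecMulVec_apply, Pi.single_apply]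
  rw [e]
  refine Submodule.sum_mem _ fun x _ => ?_
  have h := hC.filter (Pi.single x 1)
  generalize C.mulVec (Pi.single x 1) = φ at h
  induction h using Submodule.span_induction with
  | mem φ h =>
    obtain ⟨i, E, c, rfl⟩ := h
    refine Submodule.subset_span ⟨i, E, Matrix.vecMulVec c (Pi.single x 1), ?_⟩
    rw [Matrix.mul_vecMulVec]
  | zero => simp
  | add a b _ _ ha hb =>
    rw [Matrix.add_vecMulVec]
    exact Submodule.add_mem _ ha hb
  | smul a b _ hb =>
    rw [Matrix.smul_vecMulVec]
    exact Submodule.smul_mem _ _ hb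

/-- Block `b` arrives with one error, which the perfect body spreads to at most one error per block.
For each error on `b` the decoded rectangle therefore equals `r • U` with a scalar `r` depending on
the error. A decoder for `b` with these same scalars has to be found, so that superpositions of
errors are treated coherently. -/
theorem rec_fault_lead {U V : QMatrix n} (hVU : V * U = 1)
    {A : Matrix (Fin n → F.Block) (Fin n → F.Block) ℂ} (hA : F.BodyPerfect U A)
    {T : Fin n → Matrix Bool F.Block ℂ} (hT : ∀ i, F.IsDecoder (T i))
    {C : Fin n → Matrix F.Block F.Block ℂ} (b : Fin n) (hb : F.ECGood (C b))
    (hC : ∀ i, i ≠ b → F.ECPerfect (C i)) :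
    ∃ L : Fin n → Matrix Bool F.Block ℂ, (∀ i, F.IsDecoder (L i)) ∧
      ∃ r : ℂ, siteProd T * A * siteProd C = r • (U * siteProd fun i => L i * C i) := by
  set Z := siteProd T * A with hZ
  have hr : ∀ i E, ∃ r : ℂ, Z * (F.atBlock b (F.err i E) *
      F.encs n) = r • U := by
    intro i E
    refine Matrix.exists_eq_smul hVU fun c => ?_
    rw [hZ, Matrix.mul_assoc, ← Matrix.mulVec_mulVec, ← Matrix.mulVec_mulVec,
      ← Matrix.mulVec_mulVec]
    exact siteProd_mul_errSpan hT (hA.propagate b i E c)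
  -- `Pin` completes block `b` by encoded zeros in the other blocks, `Pin'` is its logical
  -- counterpart, and `Pout` reads the qubit `b`.
  let Pin : Matrix (Fin n → F.Block) F.Block ℂ := Matrix.of fun u x =>
    (if u b = x then 1 else 0) * ∏ i ∈ Finset.univ.erase b, F.enc (u i) false
  let Pin' : Matrix (Config (Fin n)) Bool ℂ := Matrix.of fun y c =>
    if y = Function.update (fun _ => false) b c then 1 else 0
  let Pout : Matrix Bool (Config (Fin n)) ℂ := Pin'.transpose
  have hP : Pout * Pin' = 1 := by
    ext c c'
    simp only [Pout, Pin', Matrix.mul_apply, Matrix.transpose_apply, Matrix.of_apply, ite_mul,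
      one_mul, zero_mul, Finset.sum_ite_eq', Finset.mem_univ, if_true, Matrix.one_apply]
    refine if_congr ⟨fun h => ?_, fun h => by rw [h]⟩ rfl rfl
    simpa using congrFun h b
  have hPin : ∀ i E, Pin * (F.err i E * F.enc) =
      F.atBlock b (F.err i E) * F.encs n * Pin' := by
    intro i E
    have e : (fun q => Function.update (fun _ => (1 : Matrix F.Block F.Block ℂ)) b (F.err i E) q *
        F.enc) = Function.update (fun _ : Fin n => F.enc) b (F.err i E * F.enc) := by
      funext q
      by_cases hq : q = b
      · subst hq; simp
      · simp [Function.update_of_ne hq]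
    rw [siteProd_mul, e]
    ext u c
    rw [Matrix.mul_apply, Matrix.mul_apply]
    simp only [Pin, Pin', Matrix.of_apply, mul_ite, mul_one, mul_zero, Finset.sum_ite_eq',
      Finset.mem_univ, if_true, ite_mul, one_mul, zero_mul, Finset.sum_ite_eq]
    rw [siteProd_update, Function.update_self, mul_comm]
    congr 1
    exact Finset.prod_congr rfl fun q hq => by
      rw [Function.update_of_ne (Finset.ne_of_mem_erase hq)]
  -- Running the decoded rectangle, undoing `U` by `V` and reading the qubit `b` yields exactly the
  -- scalar that belongs to the error.
  set L₁ : Matrix Bool F.Block ℂ := Pout * (V * Z * Pin) with hL₁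
  have hL : ∀ i E (r : ℂ), Z * (F.atBlock b (F.err i E) *
      F.encs n) = r • U → L₁ * (F.err i E * F.enc) = r • 1 := by
    intro i E r h
    rw [hL₁, Matrix.mul_assoc, Matrix.mul_assoc, hPin, Matrix.mul_assoc V, ← Matrix.mul_assoc Z, h,
      Matrix.smul_mul, Matrix.mul_smul, ← Matrix.mul_assoc V, hVU, Matrix.one_mul, Matrix.mul_smul,
      hP]
  have hdec : F.IsDecoder L₁ := fun i E => by
    obtain ⟨r, h⟩ := hr i E
    exact ⟨r, hL i E r h⟩
  refine ⟨Function.update (fun _ => F.enc.conjTranspose) b L₁, fun i => ?_, 1, ?_⟩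
  · by_cases hi : i = b
    · subst hi; simpa using hdec
    · simpa [Function.update_of_ne hi] using hF.isDecoder_enc
  -- Both sides are linear in the operator at block `b`, so the operators `err * enc * M` that span
  -- it suffice; for these both sides carry the same scalar.
  have key : ∀ D ∈ Submodule.span ℂ {D : Matrix F.Block F.Block ℂ |
      ∃ i E, ∃ M : Matrix Bool F.Block ℂ, D = F.err i E * F.enc * M},
      Z * siteProdLin C b D =
        U * siteProdLin (fun i => F.enc.conjTranspose * C i) b (L₁ * D) := by
    intro D hD
    induction hD using Submodule.span_induction with
    | mem D h =>
      obtain ⟨i, E, M, rfl⟩ := h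
      obtain ⟨r, h⟩ := hr i E
      have e : siteProdLin C b (F.err i E * F.enc * M) =
          F.atBlock b (F.err i E) * F.encs n *
            siteProdLin (fun i => F.enc.conjTranspose * C i) b M := by
        change siteProd _ = _ * siteProd _
        rw [siteProd_mul, siteProd_mul]
        congr 1
        funext q
        by_cases hq : q = b
        · subst hq; simp
        · simp only [Function.update_of_ne hq, Matrix.one_mul]
          exact (hC q hq).eq hF
      rw [e, ← Matrix.mul_assoc Z, h, ← Matrix.mul_assoc L₁, hL i E r h, Matrix.smul_mul,
        Matrix.smul_mul, Matrix.one_mul, map_smul, Matrix.mul_smul]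
    | zero => simp
    | add x y _ _ hx hy => rw [map_add, Matrix.mul_add, hx, hy, Matrix.mul_add, map_add,
        Matrix.mul_add]
    | smul a x _ hx => rw [map_smul, Matrix.mul_smul, hx, Matrix.mul_smul, map_smul,
        Matrix.mul_smul]
  have h := key _ hb.mem_span
  have e1 : siteProdLin C b (C b) = siteProd C := by
    change siteProd _ = _
    rw [Function.update_eq_self]
  rw [e1] at h
  rw [one_smul, h]
  congr 1
  change siteProd _ = _
  congr 1
  funext q
  by_cases hq : q = b
  · subst hq; simp
  · simp [Function.update_of_ne hq]

/-- Every operator from blocks to qubits is a combination of operators that first decode. -/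
theorem mem_span_decoders {V : Type} [Fintype V] [DecidableEq V]
    (Z : Matrix (V → Bool) (V → F.Block) ℂ) :
    Z ∈ Submodule.span ℂ {Z' : Matrix (V → Bool) (V → F.Block) ℂ |
      ∃ (M : Matrix (V → Bool) (V → Bool) ℂ) (L : V → Matrix Bool F.Block ℂ),
        (∀ v, F.IsDecoder (L v)) ∧ Z' = M * siteProd L} := by
  obtain ⟨L, hL, hc⟩ := hF.exists_decoders
  -- Completeness of the family gives `⟨x| = ∑ y, conj (L_y (dec x) x) ⟨dec x| L_y` in each block;
  -- inserting it into `Z = ∑ x, Z |x⟩⟨x|` exhibits the combination.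
  have e : Z = ∑ x : V → F.Block, ∑ y : V → F.Block, (∏ v, star (L (y v) (F.dec (x v)) (x v))) •
      ((Matrix.of fun b c => if c = (fun v => F.dec (x v)) then Z b x else 0) *
        siteProd fun v => L (y v)) := by
    ext b x'
    simp only [Matrix.sum_apply, Matrix.smul_apply, Matrix.mul_apply, Matrix.of_apply, ite_mul,
      zero_mul, Finset.sum_ite_eq', Finset.mem_univ, if_true, siteProd, smul_eq_mul]
    have h : ∀ x : V → F.Block, ∑ y : V → F.Block, (∏ v, star (L (y v) (F.dec (x v)) (x v))) *
        (Z b x * ∏ v, L (y v) (F.dec (x v)) (x' v)) = if x = x' then Z b x else 0 := by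
      intro x
      have : ∀ y : V → F.Block, (∏ v, star (L (y v) (F.dec (x v)) (x v))) *
        (Z b x * ∏ v, L (y v) (F.dec (x v)) (x' v)) = Z b x *
          ∏ v, (star (L (y v) (F.dec (x v)) (x v)) * L (y v) (F.dec (x v)) (x' v)) := by
        intro y
        rw [Finset.prod_mul_distrib]
        ring
      rw [Finset.sum_congr rfl fun y _ => this y, ← Finset.mul_sum, ← Fintype.piFinset_univ,
        ← Finset.prod_univ_sum (fun _ => Finset.univ)
          (fun v y => star (L y (F.dec (x v)) (x v)) * L y (F.dec (x v)) (x' v))]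
      simp only [hc, true_and]
      rw [Finset.prod_ite_zero, Finset.prod_const_one]
      simp [funext_iff]
    rw [Finset.sum_congr rfl fun x _ => h x]
    simp
  rw [e]
  exact Submodule.sum_mem _ fun x _ => Submodule.sum_mem _ fun y _ =>
    Submodule.smul_mem _ _ (Submodule.subset_span ⟨_, _, fun v => hL (y v), rfl⟩)

end Scheme
end

/-! ### Conditions on the gadgets in terms of the operators on blocks -/

noncomputable section

theorem ite_eq_of_iff {α : Sort*} {p q : Prop} {hp : Decidable p} {hq : Decidable q} (h : p ↔ q)
    (a b : α) : ite p a b = ite q a b := by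
  by_cases hq' : q
  · rw [if_pos hq', if_pos (h.2 hq')]
  · rw [if_neg hq', if_neg fun hp' => hq' (h.1 hp')]

theorem timeOrdered_eq_single {ι R : Type*} [Monoid R] {l : List ι} (hl : l.Nodup) (f : ι → R)
    {i : ι} (hi : i ∈ l) (h : ∀ j, j ≠ i → f j = 1) : timeOrdered (l.map f) = f i := by
  have h1 : ∀ l : List ι, i ∉ l → timeOrdered (l.map f) = 1 := by
    intro l
    induction l with
    | nil => simp
    | cons j l ih =>
      intro hj
      rw [List.mem_cons, not_or] at hj
      rw [List.map_cons, timeOrdered_cons, ih hj.2, h j (Ne.symm hj.1), one_mul]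
  induction l with
  | nil => simp at hi
  | cons j l ih =>
    rw [List.map_cons, timeOrdered_cons]
    by_cases hj : j = i
    · subst hj
      rw [h1 l (List.nodup_cons.1 hl).1, one_mul]
    · rw [h j hj, mul_one]
      exact ih (List.nodup_cons.1 hl).2 (by simpa [Ne.symm hj] using hi)

theorem timeOrdered_eq_one {ι R : Type*} [Monoid R] (l : List ι) (f : ι → R)
    (h : ∀ j ∈ l, f j = 1) : timeOrdered (l.map f) = 1 := by
  induction l with
  | nil => simp
  | cons j l ih =>
    rw [List.map_cons, timeOrdered_cons, ih fun j hj => h j (List.mem_cons_of_mem _ hj),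
      h j List.mem_cons_self, one_mul]

theorem Circuit.AtMostFaults.exists_forall {S : GateSet} {W : Type} {C : Circuit S W}
    {ops : (ℓ : C.Loc) → QMatrix (C.kind ℓ).arity} (h : C.AtMostFaults 1 ops) :
    ops = C.idealOps ∨ ∃ ℓ, ∀ ℓ', ℓ' ≠ ℓ → ops ℓ' = C.idealOps ℓ' := by
  rcases Nat.le_one_iff_eq_zero_or_eq_one.1 h with h | h
  · left
    rw [Set.ncard_eq_zero (Set.toFinite _)] at h
    funext ℓ
    by_contra hℓ
    have : ℓ ∈ {ℓ | ops ℓ ≠ C.idealOps ℓ} := hℓ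
    rw [h] at this
    exact this
  · right
    obtain ⟨ℓ, hℓ⟩ := Set.ncard_eq_one.1 h
    refine ⟨ℓ, fun ℓ' h' => ?_⟩
    by_contra hne
    have : ℓ' ∈ {ℓ | ops ℓ ≠ C.idealOps ℓ} := hne
    rw [hℓ] at this
    exact h' this

namespace Gadget

variable {S : GateSet} {n m : ℕ}

/-- The operation on the blocks, given the final state of the ancillas. -/
def kraus (G : Gadget S n m) (ops : (ℓ : G.circ.Loc) → QMatrix (G.circ.kind ℓ).arity)
    (z : Config G.Anc) : Matrix (Fin n → Config (Fin m)) (Fin n → Config (Fin m)) ℂ :=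
  Matrix.of fun u u' => G.circ.runMat ops (Sum.elim (Function.uncurry u) z)
    (Sum.elim (Function.uncurry u') fun _ => false)

theorem output_apply (G : Gadget S n m) (hw : ∀ ℓ, Function.Injective (G.circ.wire ℓ))
    (ops : (ℓ : G.circ.Loc) → QMatrix (G.circ.kind ℓ).arity) (φ : QState (Fin n × Fin m) ℂ)
    (u : Fin n → Config (Fin m)) (z : Config G.Anc) :
    G.output ops φ (Sum.elim (Function.uncurry u) z) =
      (G.kraus ops z).mulVec (fun u' => φ (Function.uncurry u')) u := by
  refine (congrFun (G.circ.run_amp hw ops _) _).trans ?_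
  simp only [Matrix.mulVec, dotProduct]
  rw [← (Equiv.sumArrowEquivProdArrow _ _ _).symm.sum_comp, Fintype.sum_prod_type,
    ← (Equiv.curry (Fin n) (Fin m) Bool).symm.sum_comp]
  refine Finset.sum_congr rfl fun u' _ => ?_
  rw [Finset.sum_eq_single fun _ => false]
  · change _ * (φ _ * (if _ then (1 : ℂ) else 0)) = _
    rw [if_pos, mul_one]
    · rfl
    · rfl
  · intro z' _ hz'
    change _ * (φ _ * (if _ then (1 : ℂ) else 0)) = _
    rw [if_neg, mul_zero, mul_zero]
    exact hz'
  · simp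

end Gadget

namespace Scheme

variable {S : GateSet} (F : Scheme S) {n : ℕ}

/-- The part of a state of blocks and ancillas in which the ancillas are in the basis state `z`. -/
def slice {Anc : Type} (z : Config Anc) :
    (Config ((Fin n × Fin F.m) ⊕ Anc) → ℂ) →ₗ[ℂ] ((Fin n → F.Block) → ℂ) where
  toFun v u := v (Sum.elim (Function.uncurry u) z)
  map_add' _ _ := rfl
  map_smul' _ _ := rfl

theorem slice_tensorState {Anc : Type} [Fintype Anc] [DecidableEq Anc] (z : Config Anc)
    (c : QState (Fin n) ℂ) (χ : QState Anc ℂ) :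
    F.slice z (tensorState (F.encodeState c) χ).amp = χ z • (F.encs n).mulVec c.amp := by
  funext u
  change F.encodeState c _ * χ z = χ z * _
  rw [mul_comm]
  rfl

theorem embed_eq_sum {W : Type} [Fintype W] [DecidableEq W] (w : Fin n → W) (E : QMatrix n) :
    embed w E = ∑ u, ∑ v, E u v • embed w (Matrix.single u v (1 : ℂ)) := by
  ext y x
  simp only [Matrix.sum_apply, Matrix.smul_apply, embed_apply, smul_eq_mul, mul_ite, mul_zero,
    Matrix.single_apply]
  split_ifs with h
  · rw [Finset.sum_eq_single (y ∘ w), Finset.sum_eq_single (x ∘ w)]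
    · simp
    · intro v _ hv
      rw [if_neg fun h => hv h.2]
    · simp
    · intro u _ hu
      exact Finset.sum_eq_zero fun v _ => by rw [if_neg fun h => hu h.1]
    · simp
  · simp

/-- An operator acting jointly on one qubit of each block is a combination of matrix units, and a
matrix unit is a product over the blocks. Fixing the ancilla configuration leaves only the amplitude
`χ z`. -/
theorem slice_oneError {Anc : Type} [Fintype Anc] [DecidableEq Anc] {c : QState (Fin n) ℂ}
    {v : QState ((Fin n × Fin F.m) ⊕ Anc) ℂ} (hv : v ∈ F.oneError Anc c) (z : Config Anc) :
    F.slice z v.amp ∈ F.errSpan c.amp := by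
  have hv : v ∈ Submodule.span ℂ {v | ∃ (i : Fin n → Fin F.m) (E : QMatrix n) (χ : QState Anc ℂ),
    v = localOp (fun b => Sum.inl (b, i b)) (matrixOp E) (tensorState (F.encodeState c) χ)} := hv
  induction hv using Submodule.span_induction with
  | mem v h =>
    obtain ⟨i, E, χ, rfl⟩ := h
    have hinj : Function.Injective fun b => (Sum.inl (b, i b) : (Fin n × Fin F.m) ⊕ Anc) :=
      fun b b' h => congrArg Prod.fst (Sum.inl_injective h)
    rw [Circuit.localOp_matrixOp_amp hinj, embed_eq_sum, Matrix.sum_mulVec, map_sum]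
    refine Submodule.sum_mem _ fun u _ => ?_
    rw [Matrix.sum_mulVec, map_sum]
    refine Submodule.sum_mem _ fun w _ => ?_
    rw [Matrix.smul_mulVec, map_smul]
    refine Submodule.smul_mem _ _ ?_
    have e : F.slice z ((embed (fun b => (Sum.inl (b, i b) : (Fin n × Fin F.m) ⊕ Anc))
        (Matrix.single u w 1)).mulVec (tensorState (F.encodeState c) χ).amp) =
        χ z • (siteProd fun b => F.err (i b) (Matrix.single (fun _ => u b) (fun _ => w b) 1) *
          F.enc).mulVec c.amp := by
      funext x
      rw [← siteProd_mul, ← Matrix.mulVec_mulVec, ← Matrix.mulVec_smul, ← slice_tensorState]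
      change Matrix.mulVec _ _ _ = _
      rw [embed_mulVec hinj, Finset.sum_eq_single w]
      · simp only [Matrix.mulVec, dotProduct]
        -- The matrix unit reads only the configuration in which the chosen qubit of each block has
        -- been set to `w`.
        rw [Finset.sum_eq_single fun b => Function.update (x b) (i b) (w b)]
        · congr 1
          · rw [Matrix.single_apply, siteProd, Matrix.of_apply]
            have : ∀ b, F.err (i b) (Matrix.single (fun _ => u b) (fun _ => w b) 1) (x b)
                (Function.update (x b) (i b) (w b)) = if u b = x b (i b) then 1 else 0 := by
              intro b
              rw [err, embed_apply, if_pos, Matrix.single_apply]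
              · refine if_congr ?_ rfl rfl
                simp [funext_iff]
              · intro q hq
                rw [Function.update_of_ne]
                rintro rfl
                exact hq ⟨0, rfl⟩
            simp only [this]
            by_cases hu : u = fun b => x b (i b)
            · rw [if_pos ⟨hu, trivial⟩]
              exact (Finset.prod_eq_one fun b _ => if_pos (congrFun hu b)).symm
            · obtain ⟨b, hb⟩ := Function.ne_iff.1 hu
              rw [if_neg fun h => hu h.1]
              exact (Finset.prod_eq_zero (Finset.mem_univ b) (if_neg hb)).symm
          · change (tensorState (F.encodeState c) χ).amp _ =
              (tensorState (F.encodeState c) χ).amp _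
            congr 1
            funext q
            rcases q with ⟨b, j⟩ | a
            · by_cases hj : j = i b
              · subst hj
                rw [hinj.extend_apply (g := w) (a := b)]
                simp
              · rw [Function.extend_apply']
                · simp [Function.update_of_ne hj]
                · rintro ⟨b', hb'⟩
                  simp only [Sum.inl.injEq, Prod.mk.injEq] at hb'
                  obtain ⟨rfl, rfl⟩ := hb'
                  exact hj rfl
            · rw [Function.extend_apply']
              · rfl
              · rintro ⟨b', hb'⟩
                simp at hb'
        · intro x' _ hx'
          have : ∃ b, x' b ≠ Function.update (x b) (i b) (w b) := by
            by_contra! h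
            exact hx' (funext h)
          obtain ⟨b, hb⟩ := this
          have h0 : siteProd (fun b => F.err (i b) (Matrix.single (fun _ => u b) (fun _ => w b) 1))
              x x' = 0 := by
            refine Finset.prod_eq_zero (Finset.mem_univ b) ?_
            change F.err (i b) _ (x b) (x' b) = 0
            rw [err, embed_apply]
            split_ifs with h
            · rw [Matrix.single_apply, if_neg]
              rintro ⟨-, h'⟩
              refine hb (funext fun j => ?_)
              by_cases hj : j = i b
              · subst hj
                rw [Function.update_self]
                exact (congrFun h' 0).symm
              · rw [Function.update_of_ne hj]
                refine (h j ?_).symm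
                rintro ⟨_, rfl⟩
                exact hj rfl
            · rfl
          rw [h0, zero_mul]
        · simp
      · intro v _ hv
        rw [Matrix.single_apply, if_neg fun h => hv h.2.symm, zero_mul]
      · simp
    rw [e]
    exact Submodule.smul_mem _ _ (Submodule.subset_span ⟨_, _, rfl⟩)
  | zero => exact Submodule.zero_mem (F.errSpan c.amp)
  | add x y _ _ hx hy =>
    have : F.slice z (x + y).amp = F.slice z x.amp + F.slice z y.amp := rfl
    rw [this]
    exact Submodule.add_mem _ (hx ‹_›) (hy ‹_›)
  | smul a x _ hx =>
    have : F.slice z (a • x).amp = a • F.slice z x.amp := rfl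
    rw [this]
    exact Submodule.smul_mem _ _ (hx ‹_›)

theorem errorAt_encodeState (b : Fin n) (i : Fin F.m) (E : QMatrix 1) (c : QState (Fin n) ℂ) :
    (fun u => F.errorAt b i E (F.encodeState c) (Function.uncurry u)) =
      (F.atBlock b (F.err i E)).mulVec ((F.encs n).mulVec c.amp) := by
  funext u
  rw [errorAt_apply]
  rfl

theorem slice_output (G : Gadget S n F.m) (hw : ∀ ℓ, Function.Injective (G.circ.wire ℓ))
    (ops : (ℓ : G.circ.Loc) → QMatrix (G.circ.kind ℓ).arity) (φ : QState (Fin n × Fin F.m) ℂ)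
    (z : Config G.Anc) :
    F.slice z (G.output ops φ).amp =
      (G.kraus ops z).mulVec fun u' => φ (Function.uncurry u') :=
  funext fun u => G.output_apply hw ops φ u z

/-- The operation of an error correction on its block, given the final state of the ancillas. -/
def ecKraus (ops : (ℓ : F.ec.circ.Loc) → QMatrix (F.ec.circ.kind ℓ).arity) (z : Config F.ec.Anc) :
    Matrix F.Block F.Block ℂ :=
  (F.ec.kraus ops z).submatrix (fun x _ => x) (fun x _ => x)

theorem fin_one_mulVec {α β : Type} [Fintype β] (M : Matrix (Fin 1 → α) (Fin 1 → β) ℂ)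
    (v : (Fin 1 → β) → ℂ) (x : α) :
    M.mulVec v (fun _ => x) =
      (M.submatrix (fun x _ => x) (fun x _ => x)).mulVec (fun x' => v fun _ => x') x := by
  simp only [Matrix.mulVec, dotProduct]
  rw [← (Equiv.funUnique (Fin 1) β).symm.sum_comp]
  rfl

theorem fin_one_siteProd {α β : Type} (L : Fin 1 → Matrix α β ℂ) :
    (siteProd L).submatrix (fun x _ => x) (fun x _ => x) = L 0 := by
  ext x y
  simp [siteProd]

variable {F} (hF : F.FaultTolerant)
include hF

theorem FaultTolerant.ecKraus_mulVec (ops) (z : Config F.ec.Anc) (v : F.Block → ℂ) :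
    (F.ecKraus ops z).mulVec v =
      fun x => F.slice z (F.ec.output ops (QState.mk fun x => v fun j => x (0, j))).amp
        fun _ => x := by
  funext x
  rw [slice_output F _ hF.ec_wf.wire_injective, fin_one_mulVec]
  rfl

theorem FaultTolerant.ecPerfect (z : Config F.ec.Anc) :
    F.ECPerfect (F.ecKraus F.ec.circ.idealOps z) where
  project v := by
    rw [hF.ecKraus_mulVec]
    have h := hF.ec_project (QState.mk fun x => v fun j => x (0, j))
    generalize F.ec.output _ _ = ψ at h
    induction h using Submodule.span_induction with
    | mem ψ h =>
      obtain ⟨c, χ, rfl⟩ := Set.mem_iUnion.1 h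
      refine ⟨fun b => χ z * c fun _ => b, ?_⟩
      rw [slice_tensorState]
      funext x
      rw [Pi.smul_apply, fin_one_mulVec, fin_one_siteProd]
      simp only [Matrix.mulVec, dotProduct, smul_eq_mul, Finset.mul_sum]
      exact Finset.sum_congr rfl fun b _ => mul_left_comm _ _ _
    | zero => exact ⟨0, by simp; rfl⟩
    | add x y _ _ hx hy =>
      obtain ⟨c, hc⟩ := hx
      obtain ⟨c', hc'⟩ := hy
      exact ⟨c + c', by rw [Matrix.mulVec_add, ← hc, ← hc']; rfl⟩
    | smul a x _ hx =>
      obtain ⟨c, hc⟩ := hx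
      exact ⟨a • c, by rw [Matrix.mulVec_smul, ← hc]; rfl⟩
  correct i E c := by
    obtain ⟨χ, hχ⟩ := hF.ec_correct i E (qubitState c)
    refine ⟨χ z, ?_⟩
    rw [← Matrix.mulVec_mulVec, hF.ecKraus_mulVec]
    have e : (QState.mk fun x => (F.err i E * F.enc).mulVec c fun j => x (0, j)) =
        F.errorAt 0 i E (F.encodeState (qubitState c)) := by
      ext x
      exact (F.errorAt_encodeState_one i E c x).symm
    rw [e, hχ, slice_tensorState]
    funext x
    rw [Pi.smul_apply, fin_one_mulVec, fin_one_siteProd]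
    rfl

theorem FaultTolerant.errSpan_one (v : Config (Fin 1) → ℂ) {φ : (Fin 1 → F.Block) → ℂ}
    (h : φ ∈ F.errSpan v) :
    (fun x => φ fun _ => x) ∈ Submodule.span ℂ
      {φ | ∃ i E, φ = (F.err i E * F.enc).mulVec fun b => v fun _ => b} := by
  induction h using Submodule.span_induction with
  | mem φ h =>
    obtain ⟨i, E, rfl⟩ := h
    refine Submodule.subset_span ⟨i 0, E 0, ?_⟩
    funext x
    rw [fin_one_mulVec, fin_one_siteProd]
  | zero => exact Submodule.zero_mem _
  | add x y _ _ hx hy => exact Submodule.add_mem _ hx hy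
  | smul a x _ hx => exact Submodule.smul_mem _ a hx

theorem FaultTolerant.ecGood {ops} (h : F.ec.circ.AtMostFaults 1 ops) (z : Config F.ec.Anc) :
    F.ECGood (F.ecKraus ops z) where
  filter v := by
    rw [hF.ecKraus_mulVec]
    have h := hF.ec_filter ops h (QState.mk fun x => v fun j => x (0, j))
    generalize F.ec.output _ _ = ψ at h
    induction h using Submodule.span_induction with
    | mem ψ h =>
      obtain ⟨c, h⟩ := Set.mem_iUnion.1 h
      refine Submodule.span_mono ?_ (hF.errSpan_one _ (F.slice_oneError h z))
      rintro φ ⟨i, E, rfl⟩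
      exact ⟨i, E, _, rfl⟩
    | zero => exact Submodule.zero_mem _
    | add x y _ _ hx hy => exact Submodule.add_mem _ hx hy
    | smul a x _ hx => exact Submodule.smul_mem _ a hx
  fault c := by
    rw [← Matrix.mulVec_mulVec, hF.ecKraus_mulVec]
    have e : (QState.mk fun x => F.enc.mulVec c fun j => x (0, j)) =
        F.encodeState (qubitState c) := by
      ext x
      rw [encodeState_apply]
      exact (siteProd_fin_one_mulVec (fun _ => F.enc) c (Function.curry x)).symm
    rw [e]
    have h' := hF.errSpan_one _ (F.slice_oneError (hF.ec_fault ops h (qubitState c)) z)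
    exact h'

theorem FaultTolerant.ga_bodyPerfect (g : S.Gate) (z : Config (F.ga g).Anc) :
    F.BodyPerfect (S.mat g) ((F.ga g).kraus (F.ga g).circ.idealOps z) where
  ideal c := by
    obtain ⟨χ, hχ⟩ := hF.ga_ideal g (QState.mk c)
    refine ⟨χ z, ?_⟩
    rw [← Matrix.mulVec_mulVec]
    have h := F.slice_output (F.ga g) (hF.ga_wf g).wire_injective (F.ga g).circ.idealOps
      (F.encodeState (QState.mk c)) z
    rw [hχ, slice_tensorState] at h
    exact h.symm
  propagate b i E c := by
    have h := F.slice_oneError (hF.ga_propagate g b i E (QState.mk c)) z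
    rw [F.slice_output (F.ga g) (hF.ga_wf g).wire_injective, errorAt_encodeState] at h
    exact h

theorem FaultTolerant.ga_bodyGood (g : S.Gate) {ops} (h : (F.ga g).circ.AtMostFaults 1 ops)
    (z : Config (F.ga g).Anc) : F.BodyGood (S.mat g) ((F.ga g).kraus ops z) := by
  intro c
  have h := F.slice_oneError (hF.ga_fault g ops h (QState.mk c)) z
  rw [F.slice_output (F.ga g) (hF.ga_wf g).wire_injective] at h
  rw [← Matrix.mulVec_mulVec]
  exact h

/-- The basis state in which all qubits are in the state `0`. -/
theorem FaultTolerant.prep_perfect (z : Config F.prepGa.Anc) :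
    ∃ r : ℂ, (F.prepGa.kraus F.prepGa.circ.idealOps z).mulVec (Pi.single (fun _ _ => false) 1) =
      r • (F.encs 1).mulVec (Pi.single (fun _ => false) 1) := by
  obtain ⟨χ, hχ⟩ := hF.prep_ideal
  refine ⟨χ z, ?_⟩
  have h := F.slice_output F.prepGa hF.prep_wf.wire_injective F.prepGa.circ.idealOps
    (zeroState _ (1 : ℂ)) z
  rw [hχ, slice_tensorState] at h
  have e1 : (fun u' : Fin 1 → Config (Fin F.m) => (zeroState (Fin 1 × Fin F.m) (1 : ℂ))
      (Function.uncurry u')) = Pi.single (fun _ _ => false) 1 := by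
    funext u
    rw [Pi.single_apply]
    exact if_congr (Equiv.apply_eq_iff_eq (Equiv.curry (Fin 1) (Fin F.m) Bool).symm
      (x := u) (y := fun _ _ => false)) rfl rfl
  have e2 : (zeroState (Fin 1) (1 : ℂ)).amp = Pi.single (fun _ => false) 1 := by
    funext u
    rw [Pi.single_apply]
    rfl
  rw [e1, e2] at h
  exact h.symm

theorem FaultTolerant.prep_good {ops} (h : F.prepGa.circ.AtMostFaults 1 ops)
    (z : Config F.prepGa.Anc) :
    (F.prepGa.kraus ops z).mulVec (Pi.single (fun _ _ => false) 1) ∈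
      F.errSpan (Pi.single (fun _ => false) 1) := by
  have h := F.slice_oneError (hF.prep_fault ops h) z
  rw [F.slice_output F.prepGa hF.prep_wf.wire_injective] at h
  have e1 : (fun u' : Fin 1 → Config (Fin F.m) => (zeroState (Fin 1 × Fin F.m) (1 : ℂ))
      (Function.uncurry u')) = Pi.single (fun _ _ => false) 1 := by
    funext u
    rw [Pi.single_apply]
    exact if_congr (Equiv.apply_eq_iff_eq (Equiv.curry (Fin 1) (Fin F.m) Bool).symm
      (x := u) (y := fun _ _ => false)) rfl rfl
  have e2 : (zeroState (Fin 1) (1 : ℂ)).amp = Pi.single (fun _ => false) 1 := by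
    funext u
    rw [Pi.single_apply]
    rfl
  rw [e1, e2] at h
  exact h

omit hF in
theorem measureBlock_runMat_ideal :
    (Gadget.measureBlock S F.m).circ.runMat (Gadget.measureBlock S F.m).circ.idealOps = 1 :=
  timeOrdered_eq_one _ _ fun _ _ => embed_one _

theorem FaultTolerant.bodyPerfect_one : F.BodyPerfect (n := 1) 1 1 where
  ideal c := ⟨1, by rw [Matrix.one_mul, Matrix.one_mulVec, one_smul]⟩
  propagate b i E c := by
    rw [Matrix.one_mulVec, Matrix.one_mulVec, Matrix.mulVec_mulVec, siteProd_mul]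
    refine Submodule.subset_span ⟨fun _ => i, fun _ => E, ?_⟩
    congr 2
    funext q
    rw [Subsingleton.elim q b, Function.update_self]

omit hF in
theorem measureBlock_kraus_ideal (z : Config (Gadget.measureBlock S F.m).Anc) :
    (Gadget.measureBlock S F.m).kraus (Gadget.measureBlock S F.m).circ.idealOps z = 1 := by
  ext u u'
  rw [Gadget.kraus, measureBlock_runMat_ideal, Matrix.of_apply, Matrix.one_apply, Matrix.one_apply]
  refine if_congr ⟨fun h => ?_, fun h => ?_⟩ rfl rfl
  · funext b j
    exact congrFun h (Sum.inl (b, j))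
  · subst h
    congr 1
    funext a
    exact a.elim

/-- Ideal measurements act as the identity, so the run with one fault is just an operator on one
qubit of the block. -/
theorem FaultTolerant.meas_bodyGood {ops}
    (h : (Gadget.measureBlock S F.m).circ.AtMostFaults 1 ops)
    (z : Config (Gadget.measureBlock S F.m).Anc) :
    F.BodyGood (n := 1) 1 ((Gadget.measureBlock S F.m).kraus ops z) := by
  intro c
  have hid : ∀ c : Config (Fin 1) → ℂ, (F.encs 1).mulVec c ∈ F.errSpan c := fun c =>
    Submodule.subset_span ⟨fun _ => ⟨0, Nat.pos_of_ne_zero hF.m_ne_zero⟩, fun _ => 1, by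
      simp only [err_one, Matrix.one_mul]⟩
  rcases h.exists_forall with rfl | ⟨ℓ, hℓ⟩
  · rw [measureBlock_kraus_ideal, Matrix.one_mul, Matrix.one_mulVec]
    exact hid c
  · have hr : (Gadget.measureBlock S F.m).circ.runMat ops =
        (Gadget.measureBlock S F.m).circ.locMat ops ℓ := by
      refine timeOrdered_eq_single (Circuit.order_nodup _) _
        (Circuit.mem_order _ (fun _ => Nat.zero_lt_one) ℓ) fun ℓ' h' => ?_
      rw [Circuit.locMat, hℓ ℓ' h']
      exact embed_one _
    have hk : (Gadget.measureBlock S F.m).kraus ops z =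
        siteProd fun _ => F.err ℓ (ops ℓ : QMatrix 1) := by
      ext u u'
      have key : ∀ (j : Fin F.m) (M : QMatrix 1) (z z' : Empty → Bool),
          embed (fun _ : Fin 1 => (Sum.inl (0, j) : (Fin 1 × Fin F.m) ⊕ Empty)) M
            (Sum.elim (Function.uncurry u) z) (Sum.elim (Function.uncurry u') z') =
          F.err j M (u 0) (u' 0) := by
        intro j M z z'
        rw [err, embed_apply, embed_apply]
        refine ite_eq_of_iff ⟨fun h k hk => ?_, fun h q hq => ?_⟩ _ _
        · refine h (Sum.inl (0, k)) ?_
          rintro ⟨v, hv⟩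
          exact hk ⟨0, congrArg Prod.snd (Sum.inl_injective hv)⟩
        · rcases q with ⟨b, k⟩ | a
          · obtain rfl : b = 0 := Subsingleton.elim _ _
            refine h k ?_
            rintro ⟨v, rfl⟩
            exact hq ⟨0, rfl⟩
          · exact a.elim
      rw [Gadget.kraus, hr, Matrix.of_apply]
      refine (key ℓ (ops ℓ) _ _).trans ?_
      simp only [siteProd, Matrix.of_apply, Fintype.prod_unique]
      rfl
    rw [hk, siteProd_mul, Matrix.one_mulVec]
    exact Submodule.subset_span ⟨fun _ => ℓ, fun _ => ops ℓ, rfl⟩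

end Scheme
end

noncomputable section

/-! ## Well-formedness of the simulation -/

/-- `hall` is needed for preparations: a fresh block qubit that the body does not touch would have
its first location in the error correction, which takes its block as an input and does not prepare
it. -/
theorem Gadget.withEC_wellFormed {S : GateSet} {n m : ℕ} {G : Gadget S n m} {ec : Gadget S 1 m}
    {fresh : Prop} (hG : G.WellFormed fresh) (hE : ec.WellFormed False) (hG' : G.circ.NoMeas)
    (hE' : ec.circ.NoMeas) (hall : fresh → ∀ q, ∃ ℓ, G.circ.Touches ℓ (Sum.inl q)) :
    (G.withEC ec).WellFormed fresh where
  layer_lt := by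
    rintro (ℓ | ⟨b, ℓ⟩)
    · exact (hG.layer_lt ℓ).trans_le (Nat.le_add_right _ _)
    · exact Nat.add_lt_add_left (hE.layer_lt ℓ) _
  wire_injective := by
    rintro (ℓ | ⟨b, ℓ⟩)
    · exact (Function.Injective.sumMap Function.injective_id Sum.inl_injective).comp
        (hG.wire_injective ℓ)
    · refine Function.Injective.comp (g := Sum.elim (fun p : Fin 1 × Fin m => Sum.inl (b, p.2))
        fun a => Sum.inr (Sum.inr (b, a))) ?_ (hE.wire_injective ℓ)
      rintro (⟨i, p⟩ | a) (⟨i', p'⟩ | a') h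
      · have := congrArg Prod.snd (Sum.inl_injective h)
        exact congrArg Sum.inl (Prod.ext (Subsingleton.elim _ _) this)
      · simp at h
      · simp at h
      · exact congrArg Sum.inr (congrArg Prod.snd (Sum.inr_injective (Sum.inr_injective h)))
  disjoint := by
    rintro (ℓ | ⟨b, ℓ⟩) (ℓ' | ⟨b', ℓ'⟩) q hl ⟨i, hi⟩ ⟨i', hi'⟩
    · refine congrArg Sum.inl (hG.disjoint ℓ ℓ' (G.circ.wire ℓ i) hl ⟨i, rfl⟩ ⟨i', ?_⟩)
      exact Function.Injective.sumMap Function.injective_id Sum.inl_injective (hi'.trans hi.symm)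
    · have h1 : G.circ.layer ℓ = G.circ.depth + ec.circ.layer ℓ' := hl
      have := hG.layer_lt ℓ
      omega
    · have h1 : G.circ.depth + ec.circ.layer ℓ = G.circ.layer ℓ' := hl
      have := hG.layer_lt ℓ'
      omega
    · have h1 : ec.circ.layer ℓ = ec.circ.layer ℓ' := Nat.add_left_cancel hl
      have h : Sum.elim (fun p : Fin 1 × Fin m => Sum.inl (b, p.2))
          (fun a => Sum.inr (Sum.inr (b, a))) (ec.circ.wire ℓ i) =
        Sum.elim (fun p : Fin 1 × Fin m => Sum.inl (b', p.2))
          (fun a => (Sum.inr (Sum.inr (b', a)) : _ ⊕ G.Anc ⊕ Fin n × ec.Anc))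
          (ec.circ.wire ℓ' i') := hi.trans hi'.symm
      have h2 : b = b' ∧ ec.circ.wire ℓ i = ec.circ.wire ℓ' i' := by
        rcases h3 : ec.circ.wire ℓ i with ⟨k, p⟩ | a <;>
          rcases h4 : ec.circ.wire ℓ' i' with ⟨k', p'⟩ | a' <;>
          simp only [h3, h4, Sum.elim_inl, Sum.elim_inr, Sum.inl.injEq, Sum.inr.injEq,
            Prod.mk.injEq, reduceCtorEq] at h
        · exact ⟨h.1, by rw [h.2, Subsingleton.elim k k']⟩
        · exact ⟨h.1, by rw [h.2]⟩
      obtain ⟨rfl, h2⟩ := h2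
      rw [hE.disjoint ℓ ℓ' _ h1 ⟨i, rfl⟩ ⟨i', h2.symm⟩]
  prep_of_first := by
    rintro (ℓ | ⟨b, ℓ⟩) q hq ⟨i, hi⟩ hfirst
    · refine hG.prep_of_first ℓ (G.circ.wire ℓ i) ?_ ⟨i, rfl⟩ fun ℓ' ⟨i', h'⟩ =>
        hfirst (Sum.inl ℓ') ⟨i', ?_⟩
      · subst hi
        change Sum.elim _ _ (Sum.map id Sum.inl (G.circ.wire ℓ i)) at hq
        revert hq
        rcases G.circ.wire ℓ i with p | a
        · exact id
        · exact id
      · rw [← hi]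
        exact congrArg (Sum.map id Sum.inl) h'
    · refine hE.prep_of_first ℓ (ec.circ.wire ℓ i) ?_ ⟨i, rfl⟩ fun ℓ' ⟨i', h'⟩ => ?_
      · subst hi
        change Sum.elim _ _ (Sum.elim _ _ (ec.circ.wire ℓ i)) at hq
        revert hq hfirst
        rcases h : ec.circ.wire ℓ i with p | a
        · intro hfirst hq
          obtain ⟨ℓ', i', h'⟩ := hall hq (b, p.2)
          have h2 := hfirst (Sum.inl ℓ') ⟨i', by
            change Sum.map id Sum.inl (G.circ.wire ℓ' i') = Sum.elim _ _ (ec.circ.wire ℓ i)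
            rw [h', h]
            rfl⟩
          have h3 : G.circ.depth + ec.circ.layer ℓ ≤ G.circ.layer ℓ' := h2
          have := hG.layer_lt ℓ'
          omega
        · exact fun _ h => h
      · have h2 := hfirst (Sum.inr (b, ℓ')) ⟨i', by
          rw [← hi]
          change Sum.elim _ _ (ec.circ.wire ℓ' i') = Sum.elim _ _ (ec.circ.wire ℓ i)
          rw [h']⟩
        exact Nat.le_of_add_le_add_left h2
  first_of_prep := by
    rintro (ℓ | ⟨b, ℓ⟩) q hk ⟨i, hi⟩
    · obtain ⟨h1, h2⟩ := hG.first_of_prep ℓ (G.circ.wire ℓ i) hk ⟨i, rfl⟩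
      subst hi
      refine ⟨?_, ?_⟩
      · change Sum.elim _ _ (Sum.map id Sum.inl (G.circ.wire ℓ i))
        revert h1
        rcases G.circ.wire ℓ i with p | a
        · exact id
        · exact id
      · rintro (ℓ' | ⟨b', ℓ'⟩) ⟨i', hi'⟩
        · exact h2 ℓ' ⟨i', Function.Injective.sumMap Function.injective_id Sum.inl_injective hi'⟩
        · exact (hG.layer_lt ℓ).le.trans (Nat.le_add_right _ _)
    · obtain ⟨h1, h2⟩ := hE.first_of_prep ℓ (ec.circ.wire ℓ i) hk ⟨i, rfl⟩
      subst hi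
      revert h1 h2
      rcases h : ec.circ.wire ℓ i with p | a
      · exact fun h _ => h.elim
      · intro _ h2
        have e : (G.withEC ec).circ.wire (Sum.inr (b, ℓ)) i = Sum.inr (Sum.inr (b, a)) := by
          change Sum.elim _ _ (ec.circ.wire ℓ i) = _
          rw [h]
          rfl
        rw [e]
        refine ⟨trivial, ?_⟩
        rintro (ℓ' | ⟨b', ℓ'⟩) ⟨i', hi'⟩
        · have hi' : Sum.map id Sum.inl (G.circ.wire ℓ' i') = Sum.inr (Sum.inr (b, a)) := hi'
          rcases h' : G.circ.wire ℓ' i' with p | a'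
          · rw [h'] at hi'
            exact absurd hi' Sum.inl_ne_inr
          · rw [h'] at hi'
            exact absurd (Sum.inr_injective hi') Sum.inl_ne_inr
        · refine Nat.add_le_add_left (h2 ℓ' ⟨i', ?_⟩) _
          have hi' : Sum.elim (fun p : Fin 1 × Fin m => Sum.inl (b', p.2))
              (fun a => (Sum.inr (Sum.inr (b', a)) : _ ⊕ G.Anc ⊕ Fin n × ec.Anc))
              (ec.circ.wire ℓ' i') = Sum.inr (Sum.inr (b, a)) := hi'
          rcases h' : ec.circ.wire ℓ' i' with p | a'
          · rw [h'] at hi'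
            exact absurd hi' Sum.inl_ne_inr
          · rw [h'] at hi'
            exact congrArg Sum.inr (congrArg Prod.snd (Sum.inr_injective (Sum.inr_injective hi')))
  last_of_meas := by
    rintro (ℓ | ⟨b, ℓ⟩) q hk
    · exact absurd hk (hG' ℓ)
    · exact absurd hk (hE' ℓ)

namespace Scheme

variable {S : GateSet} {F : Scheme S} (hF : F.FaultTolerant)
include hF

theorem FaultTolerant.rec1_wellFormed (κ : LocKind S) :
    (F.rec1 κ).WellFormed (κ = LocKind.prep) := by
  cases κ with
  | gate g =>
    have h := Gadget.withEC_wellFormed (hF.ga_wf g) hF.ec_wf (hF.ga_noMeas g) hF.ec_noMeas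
      fun h => h.elim
    have e : (LocKind.gate g = LocKind.prep) = False := by simp
    rw [e]
    exact h
  | prep =>
    have h := Gadget.withEC_wellFormed hF.prep_wf hF.ec_wf hF.prep_noMeas hF.ec_noMeas
      fun _ => hF.prep_all
    have e : ((LocKind.prep : LocKind S) = LocKind.prep) = True := by simp
    rw [e]
    exact h
  | meas =>
    have e : ((LocKind.meas : LocKind S) = LocKind.prep) = False := by simp
    rw [e]
    refine ⟨fun _ => Nat.zero_lt_one, fun _ i j _ => ?_, ?_, ?_, ?_, ?_⟩
    · have hs : Subsingleton (Fin 1) := inferInstance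
      exact hs.elim i j
    · rintro ℓ ℓ' q - ⟨i, hi⟩ ⟨i', hi'⟩
      have h : (Sum.inl ((0 : Fin 1), ℓ) : _ ⊕ Empty) = Sum.inl ((0 : Fin 1), ℓ') :=
        hi.trans hi'.symm
      exact congrArg Prod.snd (Sum.inl_injective h)
    · rintro ℓ (q | a) h
      · exact h.elim
      · exact a.elim
    · intro ℓ q h
      exact absurd h (by simp [rec1, Gadget.measureBlock])
    · intro _ _ _ _ _ _
      exact le_rfl

theorem FaultTolerant.rec1_meas {κ : LocKind S} {ρ : (F.rec1 κ).circ.Loc}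
    (h : (F.rec1 κ).circ.kind ρ = LocKind.meas) : κ = LocKind.meas := by
  cases κ with
  | gate g =>
    rcases ρ with ℓ | ⟨b, ℓ⟩
    · exact absurd h (hF.ga_noMeas g ℓ)
    · exact absurd h (hF.ec_noMeas ℓ)
  | prep =>
    rcases ρ with ℓ | ⟨b, ℓ⟩
    · exact absurd h (hF.prep_noMeas ℓ)
    · exact absurd h (hF.ec_noMeas ℓ)
  | meas => rfl

omit hF in
theorem rec1_depth_le (κ : LocKind S) : (F.rec1 κ).circ.depth ≤ F.recDepth := by
  cases κ with
  | gate g =>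
    exact (Finset.le_sup (f := fun g : S.Gate => (F.rec1 (.gate g)).circ.depth)
      (Finset.mem_univ g)).trans (le_max_left _ _)
  | prep => exact (le_max_left _ _).trans (le_max_right _ _)
  | meas => exact (le_max_right _ _).trans (le_max_right _ _)

/-- The embedding of the register of a rectangle. -/
def recEmb (F : Scheme S) (P : Program S) (a : P.circ.Loc) :
    (Fin (P.circ.kind a).arity × Fin F.m) ⊕ (F.rec1 (P.circ.kind a)).Anc → (F.encode P).Qubit :=
  Sum.elim (fun q => Sum.inl (P.circ.wire a q.1, q.2)) fun a' => Sum.inr ⟨a, a'⟩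

omit hF in
theorem recEmb_injective {P : Program S} (hP : P.WellFormed) (a : P.circ.Loc) :
    Function.Injective (F.recEmb P a) := by
  rintro (⟨i, j⟩ | x) (⟨i', j'⟩ | x') h
  · have h1 := Sum.inl_injective h
    rw [Prod.mk.injEq] at h1
    exact congrArg Sum.inl (Prod.ext (hP.wire_injective a h1.1) h1.2)
  · exact absurd h Sum.inl_ne_inr
  · exact absurd h Sum.inr_ne_inl
  · have h1 := Sum.inr_injective h
    rw [Sigma.mk.injEq] at h1
    rw [eq_of_heq h1.2]

omit hF in
theorem encode_touches {P : Program S} {a : P.circ.Loc}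
    {ρ : (F.rec1 (P.circ.kind a)).circ.Loc} {x : (F.encode P).Qubit} :
    (F.encode P).circ.Touches ⟨a, ρ⟩ x ↔
      ∃ y, (F.rec1 (P.circ.kind a)).circ.Touches ρ y ∧ F.recEmb P a y = x :=
  ⟨fun ⟨i, hi⟩ => ⟨_, ⟨i, rfl⟩, hi⟩, fun ⟨_, ⟨i, hi⟩, h⟩ => ⟨i, by rw [← h, ← hi]; rfl⟩⟩

omit hF in
/-- Locations that act on a common qubit belong to rectangles that act on a common qubit. -/
theorem recEmb_eq {P : Program S} {a b : P.circ.Loc} {y y'} (h : F.recEmb P a y = F.recEmb P b y') :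
    a = b ∨ ∃ q, P.circ.Touches a q ∧ P.circ.Touches b q := by
  rcases y with ⟨i, j⟩ | x <;> rcases y' with ⟨i', j'⟩ | x'
  · have h1 := Sum.inl_injective h
    rw [Prod.mk.injEq] at h1
    exact Or.inr ⟨_, ⟨i, rfl⟩, ⟨i', h1.1.symm⟩⟩
  · exact absurd h Sum.inl_ne_inr
  · exact absurd h Sum.inr_ne_inl
  · have h1 := Sum.inr_injective h
    rw [Sigma.mk.injEq] at h1
    exact Or.inl h1.1

/-- Every rectangle fits into a window of `recDepth` time steps, so the time order of the simulation
is lexicographic. -/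
theorem FaultTolerant.encode_layer {P : Program S} {a b : P.circ.Loc} {ρ ρ'}
    (h : (F.encode P).circ.layer ⟨a, ρ⟩ ≤ (F.encode P).circ.layer ⟨b, ρ'⟩) :
    P.circ.layer a < P.circ.layer b ∨ (P.circ.layer a = P.circ.layer b ∧
      (F.rec1 (P.circ.kind a)).circ.layer ρ ≤ (F.rec1 (P.circ.kind b)).circ.layer ρ') := by
  have h1 : P.circ.layer a * F.recDepth + (F.rec1 (P.circ.kind a)).circ.layer ρ ≤
    P.circ.layer b * F.recDepth + (F.rec1 (P.circ.kind b)).circ.layer ρ' := h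
  have h2 := ((hF.rec1_wellFormed (P.circ.kind b)).layer_lt ρ').trans_le
    (rec1_depth_le (F := F) (P.circ.kind b))
  rcases lt_trichotomy (P.circ.layer a) (P.circ.layer b) with h3 | h3 | h3
  · exact Or.inl h3
  · refine Or.inr ⟨h3, ?_⟩
    rw [h3] at h1
    omega
  · exfalso
    have : (P.circ.layer b + 1) * F.recDepth ≤ P.circ.layer a * F.recDepth :=
      Nat.mul_le_mul_right _ h3
    rw [Nat.add_mul, Nat.one_mul] at this
    omega

theorem FaultTolerant.encode_layer_of_lt {P : Program S} {a b : P.circ.Loc} (ρ ρ')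
    (h : P.circ.layer a < P.circ.layer b) :
    (F.encode P).circ.layer ⟨a, ρ⟩ < (F.encode P).circ.layer ⟨b, ρ'⟩ := by
  by_contra hc
  rcases hF.encode_layer (not_lt.1 hc) with h' | h' <;> omega

omit hF in
theorem exists_first {P : Program S} (hP : P.WellFormed) {b : P.circ.Loc} {q : P.Qubit}
    (hb : P.circ.Touches b q) : ∃ a, P.circ.kind a = LocKind.prep ∧ P.circ.Touches a q ∧
      ∀ a', P.circ.Touches a' q → P.circ.layer a ≤ P.circ.layer a' := by
  classical
  obtain ⟨a, ha, hmin⟩ := Finset.exists_min_image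
    (Finset.univ.filter fun a => P.circ.Touches a q) P.circ.layer ⟨b, by simpa using hb⟩
  simp only [Finset.mem_filter, Finset.mem_univ, true_and] at ha hmin
  exact ⟨a, hP.prep_of_first a q trivial ha hmin, ha, hmin⟩

theorem FaultTolerant.prep_touches {P : Program S} {a : P.circ.Loc}
    (ha : P.circ.kind a = LocKind.prep) {q : P.Qubit} (hq : P.circ.Touches a q) (j : Fin F.m) :
    ∃ ρ, (F.encode P).circ.Touches ⟨a, ρ⟩ (Sum.inl (q, j)) := by
  obtain ⟨i, rfl⟩ := hq
  have key : ∀ κ : LocKind S, κ = LocKind.prep → ∀ i : Fin κ.arity,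
      ∃ ρ, (F.rec1 κ).circ.Touches ρ (Sum.inl (i, j)) := by
    rintro κ rfl i
    have hs : Subsingleton (Fin (LocKind.prep : LocKind S).arity) :=
      inferInstanceAs (Subsingleton (Fin 1))
    obtain ⟨ℓ, k, hk⟩ := hF.prep_all (i, j)
    refine ⟨Sum.inl ℓ, k, ?_⟩
    change Sum.map id Sum.inl (F.prepGa.circ.wire ℓ k) = _
    rw [hk]
    rfl
  obtain ⟨ρ, hρ⟩ := key _ ha i
  exact ⟨ρ, encode_touches.2 ⟨_, hρ, rfl⟩⟩

theorem FaultTolerant.encode_wellFormed {P : Program S} (hP : P.WellFormed) :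
    (F.encode P).WellFormed where
  layer_lt := by
    rintro ⟨a, ρ⟩
    have h1 := ((hF.rec1_wellFormed (P.circ.kind a)).layer_lt ρ).trans_le
      (rec1_depth_le (F := F) (P.circ.kind a))
    have h2 : (P.circ.layer a + 1) * F.recDepth ≤ P.circ.depth * F.recDepth :=
      Nat.mul_le_mul_right _ (hP.layer_lt a)
    rw [Nat.add_mul, Nat.one_mul] at h2
    exact lt_of_lt_of_le (Nat.add_lt_add_left h1 _) h2
  wire_injective := by
    rintro ⟨a, ρ⟩
    exact (recEmb_injective hP a).comp
      ((hF.rec1_wellFormed (P.circ.kind a)).wire_injective ρ)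
  disjoint := by
    rintro ⟨a, ρ⟩ ⟨b, ρ'⟩ x hl hx hx'
    obtain ⟨y, hy, rfl⟩ := encode_touches.1 hx
    obtain ⟨y', hy', h⟩ := encode_touches.1 hx'
    have hab : P.circ.layer a = P.circ.layer b := by
      rcases hF.encode_layer hl.le with h1 | h1 <;> rcases hF.encode_layer hl.ge with h2 | h2 <;>
        omega
    have : a = b := by
      rcases recEmb_eq h with h | ⟨q, h1, h2⟩
      · exact h.symm
      · exact (hP.disjoint _ _ q hab.symm h1 h2).symm
    subst this
    rw [recEmb_injective hP a h] at hy'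
    rw [(hF.rec1_wellFormed (P.circ.kind a)).disjoint ρ ρ' y (Nat.add_left_cancel hl) hy hy']
  prep_of_first := by
    rintro ⟨a, ρ⟩ x - hx hfirst
    obtain ⟨y, hy, rfl⟩ := encode_touches.1 hx
    refine (hF.rec1_wellFormed (P.circ.kind a)).prep_of_first ρ y ?_ hy fun ρ' h' => ?_
    · rcases y with ⟨i, j⟩ | x
      -- The rectangle of the preparation of the logical qubit touches every qubit of its block. So
      -- a first location on a block qubit belongs to a rectangle no later than it, and hence to a
      -- preparation.
      · obtain ⟨b, hb, hbq, hmin⟩ := exists_first hP ⟨i, rfl⟩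
        obtain ⟨ρ', h'⟩ := hF.prep_touches hb hbq j
        refine hP.prep_of_first a (P.circ.wire a i) trivial ⟨i, rfl⟩ fun a' ha' => ?_
        have h1 := hmin a' ha'
        rcases hF.encode_layer (hfirst ⟨b, ρ'⟩ h') with h2 | h2 <;> omega
      · trivial
    · exact Nat.le_of_add_le_add_left (hfirst ⟨a, ρ'⟩ (encode_touches.2 ⟨y, h', rfl⟩))
  first_of_prep := by
    rintro ⟨a, ρ⟩ x hk hx
    obtain ⟨y, hy, rfl⟩ := encode_touches.1 hx
    obtain ⟨h1, h2⟩ := (hF.rec1_wellFormed (P.circ.kind a)).first_of_prep ρ y hk hy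
    refine ⟨trivial, ?_⟩
    rintro ⟨b, ρ'⟩ hx'
    obtain ⟨y', hy', h⟩ := encode_touches.1 hx'
    by_cases hba : b = a
    · subst hba
      rw [recEmb_injective hP b h] at hy'
      exact Nat.add_le_add_left (h2 ρ' hy') _
    · rcases y with ⟨i, j⟩ | x <;> rcases y' with ⟨i', j'⟩ | x'
      · have h4 := Sum.inl_injective h
        rw [Prod.mk.injEq] at h4
        have h3 := (hP.first_of_prep a (P.circ.wire a i) h1 ⟨i, rfl⟩).2 b ⟨i', h4.1⟩
        rcases h3.lt_or_eq with h3 | h3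
        · exact (hF.encode_layer_of_lt ρ ρ' h3).le
        · exact absurd (hP.disjoint a b _ h3 ⟨i, rfl⟩ ⟨i', h4.1⟩).symm hba
      · exact absurd h Sum.inr_ne_inl
      · exact absurd h Sum.inl_ne_inr
      · have h4 := Sum.inr_injective h
        rw [Sigma.mk.injEq] at h4
        exact absurd h4.1 hba
  last_of_meas := by
    rintro ⟨a, ρ⟩ x hk hx
    obtain ⟨y, hy, rfl⟩ := encode_touches.1 hx
    have ha := hF.rec1_meas hk
    rintro ⟨b, ρ'⟩ hx'
    obtain ⟨y', hy', h⟩ := encode_touches.1 hx'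
    by_cases hba : b = a
    · subst hba
      rw [recEmb_injective hP b h] at hy'
      exact Nat.add_le_add_left
        ((hF.rec1_wellFormed (P.circ.kind b)).last_of_meas ρ y hk hy ρ' hy') _
    · rcases recEmb_eq h with h | ⟨q, h1, h2⟩
      · exact absurd h hba
      · have h3 := hP.last_of_meas a q ha h2 b h1
        rcases h3.lt_or_eq with h3 | h3
        · exact (hF.encode_layer_of_lt ρ' ρ h3).le
        · exact absurd (hP.disjoint b a q h3 h1 h2) hba

theorem FaultTolerant.level_wellFormed {P : Program S} (hP : P.WellFormed) (k : ℕ) :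
    (F.level P k).WellFormed := by
  induction k with
  | zero => exact hP
  | succ k ih => exact hF.encode_wellFormed ih

end Scheme
end

noncomputable section

/-! ## The parts of a rectangle -/

theorem embed_timeOrdered {V Q α ι : Type} [Fintype V] [DecidableEq V] [Fintype Q] [DecidableEq Q]
    [Fintype α] [DecidableEq α] {w : V → Q} (hw : Function.Injective w) (l : List ι)
    (f : ι → Matrix (V → α) (V → α) ℂ) :
    embed w (timeOrdered (l.map f)) = timeOrdered (l.map fun i => embed w (f i)) := by
  induction l with
  | nil => simp [embed_one]
  | cons i l ih => simp only [List.map_cons, timeOrdered_cons, ← embed_mul hw, ih]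

namespace Scheme

variable {S : GateSet}

/-- The number of error corrections at the end of a rectangle. -/
def tails : LocKind S → ℕ
  | .gate g => S.arity g
  | .prep => 1
  | .meas => 0

/-- The blocks on which they act. -/
def port : (κ : LocKind S) → Fin (tails κ) → Fin κ.arity
  | .gate _ => id
  | .prep => id
  | .meas => Fin.elim0

theorem port_injective : ∀ κ : LocKind S, Function.Injective (port κ)
  | .gate _ => Function.injective_id
  | .prep => Function.injective_id
  | .meas => fun i => i.elim0

theorem port_surjective : ∀ {κ : LocKind S}, κ ≠ LocKind.meas → Function.Surjective (port κ)
  | .gate _, _ => Function.surjective_id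
  | .prep, _ => Function.surjective_id
  | .meas, h => (h rfl).elim

variable (F : Scheme S)

/-- The part of a rectangle that precedes its error corrections. -/
def body : (κ : LocKind S) → Gadget S κ.arity F.m
  | .gate g => F.ga g
  | .prep => F.prepGa
  | .meas => Gadget.measureBlock S F.m

/-- The locations of a rectangle. -/
def locEquiv : (κ : LocKind S) →
    (F.body κ).circ.Loc ⊕ (Fin (tails κ) × F.ec.circ.Loc) ≃ (F.rec1 κ).circ.Loc
  | .gate _ => Equiv.refl _
  | .prep => Equiv.refl _
  | .meas =>
    { toFun := Sum.elim id fun p => p.1.elim0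
      invFun := Sum.inl
      left_inv := by
        rintro (ℓ | p)
        · rfl
        · exact p.1.elim0
      right_inv := fun _ => rfl }

/-- The ancillas of a rectangle. -/
def ancEquiv : (κ : LocKind S) →
    (F.body κ).Anc ⊕ (Fin (tails κ) × F.ec.Anc) ≃ (F.rec1 κ).Anc
  | .gate _ => Equiv.refl _
  | .prep => Equiv.refl _
  | .meas =>
    { toFun := Sum.elim id fun p => p.1.elim0
      invFun := Sum.inl
      left_inv := by
        rintro (ℓ | p)
        · rfl
        · exact p.1.elim0
      right_inv := fun _ => rfl }

/-- The register of the body of a rectangle. -/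
def bodyEmb (κ : LocKind S) : (Fin κ.arity × Fin F.m) ⊕ (F.body κ).Anc →
    (Fin κ.arity × Fin F.m) ⊕ (F.rec1 κ).Anc :=
  Sum.map id fun a => F.ancEquiv κ (Sum.inl a)

/-- The register of an error correction of a rectangle. -/
def tailEmb (κ : LocKind S) (i : Fin (tails κ)) : (Fin 1 × Fin F.m) ⊕ F.ec.Anc →
    (Fin κ.arity × Fin F.m) ⊕ (F.rec1 κ).Anc :=
  Sum.map (fun p => (port κ i, p.2)) fun a => F.ancEquiv κ (Sum.inr (i, a))

theorem bodyEmb_injective (κ : LocKind S) : Function.Injective (F.bodyEmb κ) :=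
  Function.Injective.sumMap Function.injective_id
    ((F.ancEquiv κ).injective.comp Sum.inl_injective)

theorem tailEmb_injective (κ : LocKind S) (i : Fin (tails κ)) :
    Function.Injective (F.tailEmb κ i) := by
  refine Function.Injective.sumMap (fun p p' h => ?_) fun a a' h => ?_
  · have h : (port κ i, p.2) = (port κ i, p'.2) := h
    exact Prod.ext (Subsingleton.elim _ _) (Prod.mk.inj h).2
  · exact congrArg Prod.snd (Sum.inr_injective ((F.ancEquiv κ).injective h))

/-- The operations in the body of a rectangle. -/
def bodyOps : (κ : LocKind S) →
    ((ρ : (F.rec1 κ).circ.Loc) → QMatrix ((F.rec1 κ).circ.kind ρ).arity) →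
    (ℓ : (F.body κ).circ.Loc) → QMatrix ((F.body κ).circ.kind ℓ).arity
  | .gate _, ops, ℓ => ops (Sum.inl ℓ)
  | .prep, ops, ℓ => ops (Sum.inl ℓ)
  | .meas, ops, ℓ => ops ℓ

/-- The operations in an error correction of a rectangle. -/
def tailOps : (κ : LocKind S) →
    ((ρ : (F.rec1 κ).circ.Loc) → QMatrix ((F.rec1 κ).circ.kind ρ).arity) → Fin (tails κ) →
    (ℓ : F.ec.circ.Loc) → QMatrix (F.ec.circ.kind ℓ).arity
  | .gate _, ops, i, ℓ => ops (Sum.inr (i, ℓ))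
  | .prep, ops, i, ℓ => ops (Sum.inr (i, ℓ))
  | .meas, _, i, _ => i.elim0

theorem bodyOps_ideal {κ : LocKind S}
    {ops : (ρ : (F.rec1 κ).circ.Loc) → QMatrix ((F.rec1 κ).circ.kind ρ).arity}
    {ℓ : (F.body κ).circ.Loc}
    (h : ops (F.locEquiv κ (Sum.inl ℓ)) = (F.rec1 κ).circ.idealOps _) :
    F.bodyOps κ ops ℓ = (F.body κ).circ.idealOps ℓ := by
  cases κ <;> exact h

theorem tailOps_ideal {κ : LocKind S}
    {ops : (ρ : (F.rec1 κ).circ.Loc) → QMatrix ((F.rec1 κ).circ.kind ρ).arity}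
    {i : Fin (tails κ)} {ℓ : F.ec.circ.Loc}
    (h : ops (F.locEquiv κ (Sum.inr (i, ℓ))) = (F.rec1 κ).circ.idealOps _) :
    F.tailOps κ ops i ℓ = F.ec.circ.idealOps ℓ := by
  cases κ with
  | gate g => exact h
  | prep => exact h
  | meas => exact i.elim0

theorem locMat_body (κ : LocKind S)
    (ops : (ρ : (F.rec1 κ).circ.Loc) → QMatrix ((F.rec1 κ).circ.kind ρ).arity)
    (ℓ : (F.body κ).circ.Loc) :
    (F.rec1 κ).circ.locMat ops (F.locEquiv κ (Sum.inl ℓ)) =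
      embed (F.bodyEmb κ) ((F.body κ).circ.locMat (F.bodyOps κ ops) ℓ) := by
  rw [Circuit.locMat, Circuit.locMat, embed_embed (F.bodyEmb_injective κ)]
  cases κ <;> rfl

theorem locMat_tail (κ : LocKind S)
    (ops : (ρ : (F.rec1 κ).circ.Loc) → QMatrix ((F.rec1 κ).circ.kind ρ).arity)
    (i : Fin (tails κ)) (ℓ : F.ec.circ.Loc) :
    (F.rec1 κ).circ.locMat ops (F.locEquiv κ (Sum.inr (i, ℓ))) =
      embed (F.tailEmb κ i) (F.ec.circ.locMat (F.tailOps κ ops i) ℓ) := by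
  rw [Circuit.locMat, Circuit.locMat, embed_embed (F.tailEmb_injective κ i)]
  have hc : ∀ (g : Fin 1 × Fin F.m ⊕ F.ec.Anc → (Fin κ.arity × Fin F.m) ⊕ (F.rec1 κ).Anc)
      (h : ∀ x, g x = F.tailEmb κ i x), g ∘ F.ec.circ.wire ℓ = F.tailEmb κ i ∘ F.ec.circ.wire ℓ :=
    fun g h => funext fun x => h _
  cases κ with
  | gate g =>
    rw [← hc (Sum.elim (fun p => Sum.inl (i, p.2)) (fun a => Sum.inr (Sum.inr (i, a))))
      (by rintro (x | x) <;> rfl)]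
    rfl
  | prep =>
    rw [← hc (Sum.elim (fun p => Sum.inl (i, p.2)) (fun a => Sum.inr (Sum.inr (i, a))))
      (by rintro (x | x) <;> rfl)]
    rfl
  | meas => exact i.elim0

theorem touches_body (κ : LocKind S) (ℓ : (F.body κ).circ.Loc) {x}
    (h : (F.rec1 κ).circ.Touches (F.locEquiv κ (Sum.inl ℓ)) x) :
    ∃ y, (F.body κ).circ.Touches ℓ y ∧ F.bodyEmb κ y = x := by
  cases κ <;> exact ⟨_, ⟨h.choose, rfl⟩, h.choose_spec⟩

theorem touches_tail (κ : LocKind S) (i : Fin (tails κ)) (ℓ : F.ec.circ.Loc) {x}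
    (h : (F.rec1 κ).circ.Touches (F.locEquiv κ (Sum.inr (i, ℓ))) x) :
    ∃ y, F.ec.circ.Touches ℓ y ∧ F.tailEmb κ i y = x := by
  have hc : ∀ (g : Fin 1 × Fin F.m ⊕ F.ec.Anc → (Fin κ.arity × Fin F.m) ⊕ (F.rec1 κ).Anc),
      (∀ x, g x = F.tailEmb κ i x) → (∃ k, g (F.ec.circ.wire ℓ k) = x) →
      ∃ y, F.ec.circ.Touches ℓ y ∧ F.tailEmb κ i y = x := by
    rintro g hg ⟨k, hk⟩
    exact ⟨_, ⟨k, rfl⟩, by rw [← hg, hk]⟩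
  cases κ with
  | gate g =>
    exact hc (Sum.elim (fun p => Sum.inl (i, p.2)) (fun a => Sum.inr (Sum.inr (i, a))))
      (by rintro (x | x) <;> rfl) h
  | prep =>
    exact hc (Sum.elim (fun p => Sum.inl (i, p.2)) (fun a => Sum.inr (Sum.inr (i, a))))
      (by rintro (x | x) <;> rfl) h
  | meas => exact i.elim0

theorem layer_body (κ : LocKind S) (ℓ : (F.body κ).circ.Loc) :
    (F.rec1 κ).circ.layer (F.locEquiv κ (Sum.inl ℓ)) = (F.body κ).circ.layer ℓ := by
  cases κ <;> rfl

theorem layer_tail (κ : LocKind S) (i : Fin (tails κ)) (ℓ : F.ec.circ.Loc) :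
    (F.rec1 κ).circ.layer (F.locEquiv κ (Sum.inr (i, ℓ))) =
      (F.body κ).circ.depth + F.ec.circ.layer ℓ := by
  cases κ with
  | gate g => rfl
  | prep => rfl
  | meas => exact i.elim0

variable {F} (hF : F.FaultTolerant)

theorem FaultTolerant.body_wellFormed (hF : F.FaultTolerant) (κ : LocKind S) :
    (F.body κ).WellFormed (κ = LocKind.prep) := by
  cases κ with
  | gate g =>
    have e : (LocKind.gate g = LocKind.prep) = False := by simp
    rw [e]
    exact hF.ga_wf g
  | prep =>
    have e : ((LocKind.prep : LocKind S) = LocKind.prep) = True := by simp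
    rw [e]
    exact hF.prep_wf
  | meas => exact hF.rec1_wellFormed LocKind.meas

/-! ## The order of execution -/

variable (F) (P : Program S)

/-- The error corrections in the simulation of `P`. -/
abbrev Tail : Type := Σ a : P.circ.Loc, Fin (tails (P.circ.kind a))

variable {P}

/-- The qubit of `P` that is encoded in the block of an error correction. -/
def Tail.qubit (t : Tail P) : P.Qubit := P.circ.wire t.1 (port _ t.2)

theorem Tail.touches (t : Tail P) : P.circ.Touches t.1 t.qubit := ⟨_, rfl⟩

/-- The error correction `t` immediately precedes the rectangle of `b`. -/
def IsNext (t : Tail P) (b : P.circ.Loc) : Prop :=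
  P.circ.layer t.1 < P.circ.layer b ∧ P.circ.Touches b t.qubit ∧
    ∀ b', P.circ.Touches b' t.qubit → P.circ.layer t.1 < P.circ.layer b' →
      P.circ.layer b ≤ P.circ.layer b'

section Next

variable (hP : P.WellFormed)
include hP

theorem Tail.ext_of_qubit {t t' : Tail P} (h : t.1 = t'.1) (hq : t.qubit = t'.qubit) : t = t' := by
  obtain ⟨a, i⟩ := t
  obtain ⟨a', i'⟩ := t'
  obtain rfl : a = a' := h
  exact congrArg (Sigma.mk a) (port_injective _ (hP.wire_injective a hq))

theorem IsNext.unique {t : Tail P} {b b' : P.circ.Loc} (h : IsNext t b) (h' : IsNext t b') :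
    b = b' :=
  hP.disjoint b b' t.qubit (le_antisymm (h.2.2 b' h'.2.1 h'.1) (h'.2.2 b h.2.1 h.1)) h.2.1 h'.2.1

theorem IsNext.unique_tail {t t' : Tail P} {b : P.circ.Loc} (h : IsNext t b) (h' : IsNext t' b)
    (hq : t.qubit = t'.qubit) : t = t' := by
  rcases lt_trichotomy (P.circ.layer t.1) (P.circ.layer t'.1) with hl | hl | hl
  · exact absurd (h.2.2 t'.1 (hq ▸ t'.touches) hl) (not_le.2 h'.1)
  · exact Tail.ext_of_qubit hP (hP.disjoint _ _ t.qubit hl t.touches (hq ▸ t'.touches)) hq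
  · exact absurd (h'.2.2 t.1 (hq ▸ t.touches) hl) (not_le.2 h.1)

omit hP in
theorem exists_isNext {t : Tail P} {b : P.circ.Loc} (hb : P.circ.Touches b t.qubit)
    (hl : P.circ.layer t.1 < P.circ.layer b) :
    ∃ b', IsNext t b' ∧ P.circ.layer b' ≤ P.circ.layer b := by
  classical
  obtain ⟨b', hb', hmin⟩ := Finset.exists_min_image
    (Finset.univ.filter fun b => P.circ.Touches b t.qubit ∧ P.circ.layer t.1 < P.circ.layer b)
    P.circ.layer ⟨b, by simp [hb, hl]⟩
  simp only [Finset.mem_filter, Finset.mem_univ, true_and] at hb' hmin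
  exact ⟨b', ⟨hb'.2, hb'.1, fun b hb hl => hmin b ⟨hb, hl⟩⟩, hmin b ⟨hb, hl⟩⟩

/-- Every input of a location is preceded by an error correction. -/
theorem exists_lead {b : P.circ.Loc} (hb : P.circ.kind b ≠ LocKind.prep) {q : P.Qubit}
    (hq : P.circ.Touches b q) : ∃ t : Tail P, t.qubit = q ∧ IsNext t b := by
  classical
  obtain ⟨a₀, h₀, h₀q, h₀min⟩ := exists_first hP hq
  have h₀b : P.circ.layer a₀ < P.circ.layer b := by
    refine lt_of_le_of_ne (h₀min b hq) fun h => hb ?_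
    rw [← hP.disjoint a₀ b q h h₀q hq, h₀]
  obtain ⟨a, ha, hmax⟩ := Finset.exists_max_image
    (Finset.univ.filter fun a => P.circ.Touches a q ∧ P.circ.layer a < P.circ.layer b)
    P.circ.layer ⟨a₀, by simp [h₀q, h₀b]⟩
  simp only [Finset.mem_filter, Finset.mem_univ, true_and] at ha hmax
  obtain ⟨⟨i, hi⟩, hab⟩ := ha
  -- The preceding location cannot be a measurement, as its qubit is used again; so its rectangle
  -- ends with an error correction on that block.
  have hm : P.circ.kind a ≠ LocKind.meas := fun hm =>
    absurd (hP.last_of_meas a q hm ⟨i, hi⟩ b hq) (not_le.2 hab)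
  obtain ⟨j, rfl⟩ := port_surjective hm i
  refine ⟨⟨a, j⟩, hi, hab, ?_, fun b' hb' hl => ?_⟩
  · rw [Tail.qubit, hi]
    exact hq
  · rw [Tail.qubit, hi] at hb'
    by_contra hc
    exact absurd (hmax b' ⟨hb', not_le.1 hc⟩) (not_le.2 hl)

end Next

variable (P)

/-- The bodies of the rectangles, and the error corrections. -/
abbrev Item : Type := P.circ.Loc ⊕ Tail P

open Classical in
/-- The error corrections that immediately precede the rectangle of `b`. -/
def leads (b : P.circ.Loc) : List (Tail P) := (Finset.univ.filter fun t => IsNext t b).toList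

open Classical in
/-- The error corrections that are not followed by a rectangle. -/
def finals : List (Tail P) := (Finset.univ.filter fun t => ∀ b, ¬ IsNext t b).toList

/-- The bodies of the rectangles, each preceded by the error corrections on its blocks. -/
def itemList : List (Item P) :=
  (P.circ.order.flatMap fun b => (leads P b).map Sum.inr ++ [Sum.inl b]) ++
    (finals P).map Sum.inr

variable {P}

/-- The location of `P` to whose rectangle the item belongs. -/
def Item.src : Item P → P.circ.Loc := Sum.elim id fun t => t.1

/-- The item acts on the block that encodes `q`. -/
def Item.Touches : Item P → P.Qubit → Prop :=
  Sum.elim (fun a q => P.circ.Touches a q) fun t q => t.qubit = q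

/-- The order of items. -/
def Item.Before (j j' : Item P) : Prop :=
  P.circ.layer (Item.src j) < P.circ.layer (Item.src j') ∨
    (∃ a, j = Sum.inl a ∧ Item.src j' = a)

theorem mem_leads {t : Tail P} {b : P.circ.Loc} : t ∈ leads P b ↔ IsNext t b := by
  simp [leads]

theorem mem_finals {t : Tail P} : t ∈ finals P ↔ ∀ b, ¬ IsNext t b := by
  simp [finals]

theorem mem_itemList (hP : P.WellFormed) (j : Item P) : j ∈ itemList P := by
  simp only [itemList, List.mem_append, List.mem_flatMap, List.mem_map, List.mem_singleton]
  rcases j with a | t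
  · exact Or.inl ⟨a, P.circ.mem_order hP.layer_lt a, Or.inr rfl⟩
  · by_cases h : ∃ b, IsNext t b
    · obtain ⟨b, hb⟩ := h
      exact Or.inl ⟨b, P.circ.mem_order hP.layer_lt b, Or.inl ⟨t, mem_leads.2 hb, rfl⟩⟩
    · exact Or.inr ⟨t, mem_finals.2 (not_exists.1 h), rfl⟩

/-- Error corrections are postponed until just before the next rectangle on their block. This is
harmless because it changes the order only relative to items on other blocks; items with a common
block stay in causal order. -/
theorem itemList_pairwise (hP : P.WellFormed) : (itemList P).Pairwise fun j j' =>
    j ≠ j' ∧ ∀ q, Item.Touches j q → Item.Touches j' q → Item.Before j j' := by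
  have hchunk : ∀ b j, j ∈ (leads P b).map Sum.inr ++ [Sum.inl b] →
      (∃ t, IsNext t b ∧ j = Sum.inr t) ∨ j = Sum.inl b := by
    intro b j hj
    simp only [List.mem_append, List.mem_map, List.mem_singleton] at hj
    rcases hj with ⟨t, ht, rfl⟩ | rfl
    · exact Or.inl ⟨t, mem_leads.1 ht, rfl⟩
    · exact Or.inr rfl
  have hafter : ∀ (b : P.circ.Loc) (t' : Tail P) (j : Item P) (q : P.Qubit),
      (∃ t, IsNext t b ∧ j = Sum.inr t) ∨ j = Sum.inl b → P.circ.Touches b q → t'.qubit = q →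
      P.circ.layer b ≤ P.circ.layer t'.1 → Item.Before j (Sum.inr t') := by
    intro b t' j q hj hb hq hl
    rcases hj with ⟨t, ht, rfl⟩ | rfl
    · exact Or.inl (ht.1.trans_le hl)
    · rcases hl.lt_or_eq with hl | hl
      · exact Or.inl hl
      · exact Or.inr ⟨b, rfl, (hP.disjoint b t'.1 q hl hb (hq ▸ t'.touches)).symm⟩
  have htouch : ∀ b j q, (∃ t : Tail P, IsNext t b ∧ j = Sum.inr t) ∨ j = Sum.inl b →
      Item.Touches j q → P.circ.Touches b q := by
    rintro b j q (⟨t, ht, rfl⟩ | rfl) hj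
    · obtain rfl : t.qubit = q := hj
      exact ht.2.1
    · exact hj
  rw [itemList, List.pairwise_append, List.pairwise_flatMap]
  refine ⟨⟨fun b _ => ?_, ?_⟩, ?_, ?_⟩
  · rw [List.pairwise_append]
    refine ⟨?_, List.pairwise_singleton _ _, ?_⟩
    · rw [List.pairwise_map]
      have hn : (leads P b).Nodup := Finset.nodup_toList _
      refine List.Pairwise.imp_of_mem (fun {t t'} ht ht' hne => ?_) hn
      refine ⟨fun h => hne (Sum.inr_injective h), fun q hq hq' => ?_⟩
      exact absurd ((mem_leads.1 ht).unique_tail hP (mem_leads.1 ht') (hq.trans hq'.symm)) hne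
    · intro j hj j' hj'
      rw [List.mem_map] at hj
      obtain ⟨t, ht, rfl⟩ := hj
      rw [List.mem_singleton] at hj'
      subst hj'
      exact ⟨Sum.inr_ne_inl, fun q _ _ => Or.inl (mem_leads.1 ht).1⟩
  · refine List.Pairwise.imp (fun {b b'} hb j hj j' hj' => ?_) P.circ.order_pairwise
    have hj := hchunk b j hj
    have hj' := hchunk b' j' hj'
    refine ⟨?_, fun q hq hq' => ?_⟩
    · rintro rfl
      rcases hj with ⟨t, ht, rfl⟩ | rfl <;> rcases hj' with ⟨t', ht', h⟩ | h
      · obtain rfl := Sum.inr_injective h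
        exact hb.1 (ht.unique hP ht')
      · exact absurd h Sum.inr_ne_inl
      · exact absurd h Sum.inl_ne_inr
      · exact hb.1 (Sum.inl_injective h)
    · have hbq := htouch b j q hj hq
      have hbq' := htouch b' j' q hj' hq'
      have hl : P.circ.layer b < P.circ.layer b' :=
        lt_of_le_of_ne hb.2 fun h => hb.1 (hP.disjoint b b' q h hbq hbq')
      rcases hj' with ⟨t', ht', rfl⟩ | rfl
      · have hq' : t'.qubit = q := hq'
        refine hafter b t' j q hj hbq hq' (not_lt.1 fun h => ?_)
        exact absurd (ht'.2.2 b (hq' ▸ hbq) h) (not_le.2 hl)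
      · rcases hj with ⟨t, ht, rfl⟩ | rfl
        · exact Or.inl (ht.1.trans hl)
        · exact Or.inl hl
  · rw [List.pairwise_map]
    have hn : (finals P).Nodup := Finset.nodup_toList _
    refine List.Pairwise.imp_of_mem (fun {t t'} ht ht' hne => ?_) hn
    refine ⟨fun h => hne (Sum.inr_injective h), fun q hq hq' => ?_⟩
    have hq : t.qubit = q := hq
    have hq' : t'.qubit = q := hq'
    have hlast : ∀ t t' : Tail P, t ∈ finals P → t.qubit = t'.qubit →
        P.circ.layer t'.1 ≤ P.circ.layer t.1 := by
      intro t t' ht h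
      by_contra hc
      obtain ⟨b', hb', -⟩ := exists_isNext (t := t) (h ▸ t'.touches) (not_le.1 hc)
      exact mem_finals.1 ht b' hb'
    have hl := le_antisymm (hlast t' t ht' (hq'.trans hq.symm)) (hlast t t' ht (hq.trans hq'.symm))
    refine absurd (Tail.ext_of_qubit hP (hP.disjoint _ _ q hl ?_ ?_) (hq.trans hq'.symm)) hne
    · exact hq ▸ t.touches
    · exact hq' ▸ t'.touches
  · intro j hj j' hj'
    rw [List.mem_flatMap] at hj
    obtain ⟨b, -, hj⟩ := hj
    have hj := hchunk b j hj
    rw [List.mem_map] at hj'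
    obtain ⟨t', ht', rfl⟩ := hj'
    refine ⟨?_, fun q hq hq' => ?_⟩
    · rcases hj with ⟨t, ht, rfl⟩ | rfl
      · intro h
        obtain rfl := Sum.inr_injective h
        exact mem_finals.1 ht' b ht
      · exact Sum.inl_ne_inr
    · have hq' : t'.qubit = q := hq'
      have hbq := htouch b j q hj hq
      refine hafter b t' j q hj hbq hq' (not_lt.1 fun h => ?_)
      obtain ⟨b', hb', -⟩ := exists_isNext (t := t') (hq' ▸ hbq) h
      exact mem_finals.1 ht' b' hb'

end Scheme
end

noncomputable section

/-! ## Elimination of the ancillas -/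

section Dilation

variable {Q Γ ι μ : Type} [Fintype Q] [DecidableEq Q] [Fintype Γ] [DecidableEq Γ]
  [Fintype μ] [DecidableEq μ]
variable {V A : ι → Type} [∀ j, Fintype (V j)] [∀ j, DecidableEq (V j)] [∀ j, Fintype (A j)]
  [∀ j, DecidableEq (A j)]

/-- The part of an operator on blocks and ancillas that leads from the state `0…0` of the ancillas to
the state `z`. -/
def krausPart {V A : Type} (G : Matrix (Config ((V × μ) ⊕ A)) (Config ((V × μ) ⊕ A)) ℂ)
    (z : Config A) : Matrix (V → Config μ) (V → Config μ) ℂ :=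
  Matrix.of fun u u' => G (Sum.elim (Function.uncurry u) z)
    (Sum.elim (Function.uncurry u') fun _ => false)

/-- Operators that act on disjoint sets of ancillas, which initially are in the state `0…0`, can be
replaced by operators on the blocks. -/
theorem dilation (w : ∀ j, V j → Q) (hw : ∀ j, Function.Injective (w j)) (anc : ∀ j, A j → Γ)
    (hanc : ∀ j, Function.Injective (anc j))
    (hd : ∀ j j' a a', anc j a = anc j' a' → j = j')
    (G : ∀ j, Matrix (Config ((V j × μ) ⊕ A j)) (Config ((V j × μ) ⊕ A j)) ℂ) {l : List ι}
    (hl : l.Nodup) (x : Q → Config μ) (z : Config Γ) :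
    (timeOrdered (l.map fun j =>
      embed (Sum.map (fun p : V j × μ => (w j p.1, p.2)) (anc j)) (G j))).mulVec
        (Pi.single (fun _ => false) 1) (Sum.elim (Function.uncurry x) z) =
    (timeOrdered (l.map fun j => embed (w j) (krausPart (G j) (z ∘ anc j)))).mulVec
        (Pi.single (fun _ _ => false) 1) x *
      if ∀ γ, (∀ j ∈ l, ∀ a, anc j a ≠ γ) → z γ = false then 1 else 0 := by
  classical
  induction l using List.reverseRecOn generalizing x z with
  | nil =>
    simp only [List.map_nil, timeOrdered_nil, Matrix.one_mulVec, Pi.single_apply, List.not_mem_nil,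
      false_implies, implies_true, true_implies, mul_ite, mul_one, mul_zero]
    rw [← ite_and]
    refine ite_eq_of_iff ⟨fun h => ⟨fun γ => congrFun h (Sum.inr γ), funext fun q => funext fun k =>
      congrFun h (Sum.inl (q, k))⟩, fun h => ?_⟩ _ _
    · refine funext fun s => ?_
      rcases s with ⟨q, j⟩ | γ
      · exact congrFun (congrFun h.2 q) j
      · exact h.1 γ
  | append_singleton l j ih =>
    have hl' : l.Nodup := hl.of_append_left
    have hj : j ∉ l := fun h => by
      rw [List.nodup_append] at hl
      exact hl.2.2 j h j (List.mem_singleton_self j) rfl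
    have hinj : Function.Injective (Sum.map (fun p : V j × μ => (w j p.1, p.2)) (anc j)) := by
      refine Function.Injective.sumMap (fun p p' h => ?_) (hanc j)
      have h : (w j p.1, p.2) = (w j p'.1, p'.2) := h
      exact Prod.ext (hw j (Prod.mk.inj h).1) (Prod.mk.inj h).2
    rw [List.map_append, List.map_append, timeOrdered_append, timeOrdered_append,
      List.map_singleton, List.map_singleton, timeOrdered_cons, timeOrdered_cons, timeOrdered_nil,
      timeOrdered_nil, one_mul, one_mul, ← Matrix.mulVec_mulVec, ← Matrix.mulVec_mulVec,
      embed_mulVec hinj, embed_mulVec (hw j)]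
    rw [← (Equiv.sumArrowEquivProdArrow _ _ _).symm.sum_comp, Fintype.sum_prod_type,
      ← (Equiv.curry (V j) μ Bool).symm.sum_comp, Finset.sum_mul]
    refine Finset.sum_congr rfl fun u _ => ?_
    have hext : ∀ ζ : Config (A j), Function.extend
        (Sum.map (fun p : V j × μ => (w j p.1, p.2)) (anc j))
        ((Equiv.sumArrowEquivProdArrow (V j × μ) (A j) Bool).symm
          ((Equiv.curry (V j) μ Bool).symm u, ζ)) (Sum.elim (Function.uncurry x) z) =
        Sum.elim (Function.uncurry (Function.extend (w j) u x)) (Function.extend (anc j) ζ z) := by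
      intro ζ
      funext s
      rcases s with ⟨q, k⟩ | γ
      · by_cases hq : ∃ v, w j v = q
        · obtain ⟨v, rfl⟩ := hq
          have := hinj.extend_apply ((Equiv.sumArrowEquivProdArrow (V j × μ) (A j) Bool).symm
            ((Equiv.curry (V j) μ Bool).symm u, ζ)) (Sum.elim (Function.uncurry x) z)
            (Sum.inl (v, k))
          refine Eq.trans this ?_
          change u v k = Function.extend (w j) u x (w j v) k
          rw [(hw j).extend_apply]
        · rw [Function.extend_apply']
          · change x q k = Function.extend (w j) u x q k
            rw [Function.extend_apply' _ _ _ hq]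
          · rintro ⟨⟨v, k'⟩ | a, h⟩
            · exact hq ⟨v, congrArg Prod.fst (Sum.inl_injective h)⟩
            · exact absurd h Sum.inr_ne_inl
      · by_cases hγ : ∃ a, anc j a = γ
        · obtain ⟨a, rfl⟩ := hγ
          have := hinj.extend_apply ((Equiv.sumArrowEquivProdArrow (V j × μ) (A j) Bool).symm
            ((Equiv.curry (V j) μ Bool).symm u, ζ)) (Sum.elim (Function.uncurry x) z)
            (Sum.inr a)
          refine Eq.trans this ?_
          change ζ a = Function.extend (anc j) ζ z (anc j a)
          rw [(hanc j).extend_apply]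
        · rw [Function.extend_apply']
          · change z γ = Function.extend (anc j) ζ z γ
            rw [Function.extend_apply' _ _ _ hγ]
          · rintro ⟨⟨v, k'⟩ | a, h⟩
            · exact absurd h Sum.inl_ne_inr
            · exact hγ ⟨a, Sum.inr_injective h⟩
    simp only [hext]
    have hz : ∀ ζ : Config (A j), ∀ j' ∈ l, Function.extend (anc j) ζ z ∘ anc j' = z ∘ anc j' := by
      intro ζ j' hj'
      funext a
      refine Function.extend_apply' _ _ _ ?_
      rintro ⟨a', h⟩
      exact hj (hd _ _ _ _ h ▸ hj')
    have hz' : ∀ ζ : Config (A j), (l.map fun j' =>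
        embed (w j') (krausPart (G j') (Function.extend (anc j) ζ z ∘ anc j'))) =
        l.map fun j' => embed (w j') (krausPart (G j') (z ∘ anc j')) := fun ζ =>
      List.map_congr_left fun j' hj' => by rw [hz ζ j' hj']
    -- No earlier operator acts on the ancillas of `j`, so they are still in `0…0` when `j` acts and
    -- a single term survives. The final configuration `z` of the other ancillas is unaffected.
    rw [Finset.sum_eq_single fun _ => false]
    · rw [ih hl', hz']
      have e1 : (Sum.elim (Function.uncurry x) z ∘
          Sum.map (fun p : V j × μ => (w j p.1, p.2)) (anc j)) =
          Sum.elim (Function.uncurry (x ∘ w j)) (z ∘ anc j) := by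
        funext s
        rcases s with ⟨v, k⟩ | a <;> rfl
      rw [e1, ← mul_assoc]
      congr 1
      refine ite_eq_of_iff ⟨fun h γ hγ => ?_, fun h γ hγ => ?_⟩ _ _
      · have h' := h γ fun j' hj' => hγ j' (List.mem_append_left _ hj')
        rwa [Function.extend_apply'] at h'
        rintro ⟨a, ha⟩
        exact hγ j (by simp) a ha
      · by_cases ha : ∃ a, anc j a = γ
        · obtain ⟨a, rfl⟩ := ha
          rw [(hanc j).extend_apply]
        · rw [Function.extend_apply' _ _ _ ha]
          refine h γ fun j' hj' a => ?_
          rw [List.mem_append, List.mem_singleton] at hj'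
          rcases hj' with hj' | rfl
          · exact hγ j' hj' a
          · exact fun h => ha ⟨a, h⟩
    · intro ζ _ hζ
      rw [ih hl', if_neg, mul_zero, mul_zero]
      intro h
      refine hζ (funext fun a => ?_)
      have h' := h (anc j a) fun j' hj' a' h => hj (hd _ _ _ _ h ▸ hj')
      rwa [(hanc j).extend_apply] at h'
    · simp

end Dilation

namespace Scheme

variable {S : GateSet} (F : Scheme S) {P : Program S}

/-- Number of blocks of an item. -/
def itemArity : Item P → ℕ := Sum.elim (fun a => (P.circ.kind a).arity) fun _ => 1

/-- The gadget of an item. -/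
def itemGadget : (j : Item P) → Gadget S (itemArity j) F.m
  | .inl a => F.body (P.circ.kind a)
  | .inr _ => F.ec

/-- The blocks of an item. -/
def itemWire : (j : Item P) → Fin (itemArity j) → P.Qubit
  | .inl a => P.circ.wire a
  | .inr t => fun _ => t.qubit

/-- The ancillas of an item. -/
def itemAnc : (j : Item P) → (F.itemGadget j).Anc → Σ a : P.circ.Loc, (F.rec1 (P.circ.kind a)).Anc
  | .inl a => fun x => ⟨a, F.ancEquiv _ (Sum.inl x)⟩
  | .inr t => fun x => ⟨t.1, F.ancEquiv _ (Sum.inr (t.2, x))⟩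

/-- The register of an item. -/
def itemEmb (j : Item P) : (Fin (itemArity j) × Fin F.m) ⊕ (F.itemGadget j).Anc →
    (F.encode P).Qubit :=
  Sum.map (fun p => (itemWire j p.1, p.2)) (F.itemAnc j)

/-- The locations of an item. -/
def itemLoc : (j : Item P) → (F.itemGadget j).circ.Loc → (F.encode P).circ.Loc
  | .inl a => fun ℓ => ⟨a, F.locEquiv _ (Sum.inl ℓ)⟩
  | .inr t => fun ℓ => ⟨t.1, F.locEquiv _ (Sum.inr (t.2, ℓ))⟩

/-- The operations of an item. -/
def itemOps (ops : (ℓ : (F.encode P).circ.Loc) → QMatrix ((F.encode P).circ.kind ℓ).arity) :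
    (j : Item P) → (ℓ : (F.itemGadget j).circ.Loc) → QMatrix ((F.itemGadget j).circ.kind ℓ).arity
  | .inl a => F.bodyOps _ fun ρ => ops ⟨a, ρ⟩
  | .inr t => F.tailOps _ (fun ρ => ops ⟨t.1, ρ⟩) t.2

theorem itemOps_ideal {ops : (ℓ : (F.encode P).circ.Loc) → QMatrix ((F.encode P).circ.kind ℓ).arity}
    {j : Item P} {ℓ : (F.itemGadget j).circ.Loc}
    (h : ops (F.itemLoc j ℓ) = (F.encode P).circ.idealOps _) :
    F.itemOps ops j ℓ = (F.itemGadget j).circ.idealOps ℓ := by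
  rcases j with a | t
  · exact F.bodyOps_ideal h
  · exact F.tailOps_ideal h

theorem itemLoc_src (j : Item P) (ℓ : (F.itemGadget j).circ.Loc) :
    (F.itemLoc j ℓ).1 = Item.src j := by
  rcases j with a | t <;> rfl

theorem itemLoc_injective {j j' : Item P} {ℓ : (F.itemGadget j).circ.Loc}
    {ℓ' : (F.itemGadget j').circ.Loc} (h : F.itemLoc j ℓ = F.itemLoc j' ℓ') :
    (⟨j, ℓ⟩ : Σ j : Item P, (F.itemGadget j).circ.Loc) = ⟨j', ℓ'⟩ := by
  rcases j with a | ⟨a, i⟩ <;> rcases j' with a' | ⟨a', i'⟩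
  · obtain rfl : a = a' := congrArg Sigma.fst h
    have h1 := Sum.inl_injective ((F.locEquiv _).injective (eq_of_heq (Sigma.mk.inj h).2))
    rw [h1]
  · obtain rfl : a = a' := congrArg Sigma.fst h
    exact absurd ((F.locEquiv _).injective (eq_of_heq (Sigma.mk.inj h).2)) Sum.inl_ne_inr
  · obtain rfl : a = a' := congrArg Sigma.fst h
    exact absurd ((F.locEquiv _).injective (eq_of_heq (Sigma.mk.inj h).2)) Sum.inr_ne_inl
  · obtain rfl : a = a' := congrArg Sigma.fst h
    have h1 := Sum.inr_injective ((F.locEquiv _).injective (eq_of_heq (Sigma.mk.inj h).2))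
    obtain ⟨rfl, rfl⟩ := Prod.mk.inj h1
    rfl

theorem itemLoc_surjective (ℓ : (F.encode P).circ.Loc) :
    ∃ (j : Item P) (ℓ' : (F.itemGadget j).circ.Loc), F.itemLoc j ℓ' = ℓ := by
  obtain ⟨a, ρ⟩ := ℓ
  rcases h : (F.locEquiv _).symm ρ with ℓ | ⟨i, ℓ⟩
  · exact ⟨Sum.inl a, ℓ, congrArg (Sigma.mk a) (by rw [← h, Equiv.apply_symm_apply])⟩
  · exact ⟨Sum.inr ⟨a, i⟩, ℓ, congrArg (Sigma.mk a) (by rw [← h, Equiv.apply_symm_apply])⟩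

theorem itemAnc_injective (j : Item P) : Function.Injective (F.itemAnc j) := by
  rcases j with a | t
  · intro x x' h
    exact Sum.inl_injective ((F.ancEquiv _).injective (eq_of_heq (Sigma.mk.inj h).2))
  · intro x x' h
    exact congrArg Prod.snd
      (Sum.inr_injective ((F.ancEquiv _).injective (eq_of_heq (Sigma.mk.inj h).2)))

theorem itemAnc_disjoint {j j' : Item P} {x x'} (h : F.itemAnc j x = F.itemAnc j' x') : j = j' := by
  rcases j with a | ⟨a, i⟩ <;> rcases j' with a' | ⟨a', i'⟩
  · exact congrArg Sum.inl (congrArg Sigma.fst h)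
  · obtain rfl : a = a' := congrArg Sigma.fst h
    exact absurd ((F.ancEquiv _).injective (eq_of_heq (Sigma.mk.inj h).2)) Sum.inl_ne_inr
  · obtain rfl : a = a' := congrArg Sigma.fst h
    exact absurd ((F.ancEquiv _).injective (eq_of_heq (Sigma.mk.inj h).2)) Sum.inr_ne_inl
  · obtain rfl : a = a' := congrArg Sigma.fst h
    have h1 := Sum.inr_injective ((F.ancEquiv _).injective (eq_of_heq (Sigma.mk.inj h).2))
    exact congrArg (fun i => (Sum.inr ⟨a, i⟩ : Item P)) (Prod.mk.inj h1).1

theorem itemWire_injective (hP : P.WellFormed) (j : Item P) : Function.Injective (itemWire j) := by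
  rcases j with a | t
  · exact hP.wire_injective a
  · intro i i' _
    have hs : Subsingleton (Fin 1) := inferInstance
    exact hs.elim i i'

theorem itemEmb_injective (hP : P.WellFormed) (j : Item P) : Function.Injective (F.itemEmb j) := by
  refine Function.Injective.sumMap (fun p p' h => ?_) (F.itemAnc_injective j)
  have h : (itemWire j p.1, p.2) = (itemWire j p'.1, p'.2) := h
  exact Prod.ext (itemWire_injective hP j (Prod.mk.inj h).1) (Prod.mk.inj h).2

theorem itemEmb_inl (a : P.circ.Loc) :
    F.itemEmb (.inl a) = F.recEmb P a ∘ F.bodyEmb (P.circ.kind a) := by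
  funext x
  rcases x with x | x <;> rfl

theorem itemEmb_inr (t : Tail P) :
    F.itemEmb (.inr t) = F.recEmb P t.1 ∘ F.tailEmb (P.circ.kind t.1) t.2 := by
  funext x
  rcases x with x | x <;> rfl

theorem locMat_item (hP : P.WellFormed)
    (ops : (ℓ : (F.encode P).circ.Loc) → QMatrix ((F.encode P).circ.kind ℓ).arity) (j : Item P)
    (ℓ : (F.itemGadget j).circ.Loc) :
    (F.encode P).circ.locMat ops (F.itemLoc j ℓ) =
      embed (F.itemEmb j) ((F.itemGadget j).circ.locMat (F.itemOps ops j) ℓ) := by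
  have h : ∀ a ρ, (F.encode P).circ.locMat ops ⟨a, ρ⟩ =
      embed (F.recEmb P a) ((F.rec1 (P.circ.kind a)).circ.locMat (fun ρ => ops ⟨a, ρ⟩) ρ) := by
    intro a ρ
    exact (embed_embed (recEmb_injective hP a) _).symm
  rcases j with a | t
  · refine (h _ _).trans ((congrArg (embed (F.recEmb P a)) (F.locMat_body _ _ ℓ)).trans ?_)
    refine (embed_embed (recEmb_injective hP a) _).trans ?_
    rw [itemEmb_inl]
    rfl
  · refine (h _ _).trans ((congrArg (embed (F.recEmb P t.1)) (F.locMat_tail _ _ t.2 ℓ)).trans ?_)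
    refine (embed_embed (recEmb_injective hP t.1) _).trans ?_
    rw [itemEmb_inr]
    rfl

theorem touches_item {j : Item P} {ℓ : (F.itemGadget j).circ.Loc} {x : (F.encode P).Qubit}
    (h : (F.encode P).circ.Touches (F.itemLoc j ℓ) x) : ∃ y, F.itemEmb j y = x := by
  rcases j with a | t
  · obtain ⟨y, hy, rfl⟩ := encode_touches.1 h
    obtain ⟨y', -, rfl⟩ := F.touches_body _ _ hy
    exact ⟨y', congrFun (F.itemEmb_inl a) y'⟩
  · obtain ⟨y, hy, rfl⟩ := encode_touches.1 h
    obtain ⟨y', -, rfl⟩ := F.touches_tail _ _ _ hy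
    exact ⟨y', congrFun (F.itemEmb_inr t) y'⟩

theorem item_touches_wire (j : Item P) (i : Fin (itemArity j)) : Item.Touches j (itemWire j i) := by
  rcases j with a | t
  · exact ⟨i, rfl⟩
  · rfl

variable {F} (hF : F.FaultTolerant)
include hF

theorem FaultTolerant.layer_before {j j' : Item P} (hne : j ≠ j') (h : Item.Before j j')
    (ℓ : (F.itemGadget j).circ.Loc) (ℓ' : (F.itemGadget j').circ.Loc) :
    (F.encode P).circ.layer (F.itemLoc j ℓ) ≤ (F.encode P).circ.layer (F.itemLoc j' ℓ') := by
  rcases h with h | ⟨a, rfl, h⟩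
  · rw [← F.itemLoc_src j ℓ, ← F.itemLoc_src j' ℓ'] at h
    exact (hF.encode_layer_of_lt _ _ h).le
  · rcases j' with a' | ⟨a', i⟩
    · exact absurd (congrArg Sum.inl (h : a' = a)).symm hne
    · obtain rfl : a' = a := h
      refine Nat.add_le_add_left ?_ _
      have h1 := F.layer_body (P.circ.kind a') ℓ
      have h2 := F.layer_tail (P.circ.kind a') i ℓ'
      have h3 := (hF.body_wellFormed (P.circ.kind a')).layer_lt ℓ
      change (F.rec1 (P.circ.kind a')).circ.layer (F.locEquiv _ (Sum.inl ℓ)) ≤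
        (F.rec1 (P.circ.kind a')).circ.layer (F.locEquiv _ (Sum.inr (i, ℓ')))
      omega

theorem FaultTolerant.layer_item {j : Item P} {ℓ ℓ' : (F.itemGadget j).circ.Loc}
    (h : (F.itemGadget j).circ.layer ℓ ≤ (F.itemGadget j).circ.layer ℓ') :
    (F.encode P).circ.layer (F.itemLoc j ℓ) ≤ (F.encode P).circ.layer (F.itemLoc j ℓ') := by
  rcases j with a | t
  · refine Nat.add_le_add_left ?_ _
    exact (F.layer_body _ ℓ).trans_le (le_trans h (F.layer_body _ ℓ').ge)
  · refine Nat.add_le_add_left ?_ _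
    exact (F.layer_tail _ t.2 ℓ).trans_le
      (le_trans (Nat.add_le_add_left h _) (F.layer_tail _ t.2 ℓ').ge)

theorem FaultTolerant.item_layer_lt {j : Item P} (ℓ : (F.itemGadget j).circ.Loc) :
    (F.itemGadget j).circ.layer ℓ < (F.itemGadget j).circ.depth := by
  rcases j with a | t
  · exact (hF.body_wellFormed _).layer_lt ℓ
  · exact hF.ec_wf.layer_lt ℓ

/-- The evolution of the simulation, in the order of the items. -/
theorem FaultTolerant.runMat_encode (hP : P.WellFormed)
    (ops : (ℓ : (F.encode P).circ.Loc) → QMatrix ((F.encode P).circ.kind ℓ).arity) :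
    (F.encode P).circ.runMat ops = timeOrdered ((itemList P).map fun j =>
      embed (F.itemEmb j) ((F.itemGadget j).circ.runMat (F.itemOps ops j))) := by
  have hM := hF.encode_wellFormed hP
  let l := (itemList P).flatMap fun j => (F.itemGadget j).circ.order.map (F.itemLoc j)
  -- Time order is required only for locations with a common qubit. Within an item it is the order
  -- of its circuit; between items only block qubits can be shared, and `itemList_pairwise` applies.
  have hpw : l.Pairwise fun x y => x ≠ y ∧ ((∃ q, (F.encode P).circ.Touches x q ∧
      (F.encode P).circ.Touches y q) → (F.encode P).circ.layer x ≤ (F.encode P).circ.layer y) := by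
    rw [List.pairwise_flatMap]
    constructor
    · intro j _
      rw [List.pairwise_map]
      refine (F.itemGadget j).circ.order_pairwise.imp fun {ℓ ℓ'} h => ⟨fun he => ?_, fun _ => ?_⟩
      · have := F.itemLoc_injective he
        exact h.1 (eq_of_heq (Sigma.mk.inj this).2)
      · exact hF.layer_item h.2
    · refine (itemList_pairwise hP).imp fun {j j'} h x hx y hy => ?_
      rw [List.mem_map] at hx hy
      obtain ⟨ℓ, -, rfl⟩ := hx
      obtain ⟨ℓ', -, rfl⟩ := hy
      refine ⟨fun he => h.1 (congrArg Sigma.fst (F.itemLoc_injective he)), ?_⟩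
      rintro ⟨q, h1, h2⟩
      obtain ⟨y, rfl⟩ := F.touches_item h1
      obtain ⟨y', hy'⟩ := F.touches_item h2
      rcases y with ⟨i, k⟩ | x <;> rcases y' with ⟨i', k'⟩ | x'
      · have h3 : itemWire j' i' = itemWire j i := congrArg Prod.fst (Sum.inl_injective hy')
        exact hF.layer_before h.1 (h.2 _ (item_touches_wire j i) (h3 ▸ item_touches_wire j' i')) _ _
      · exact absurd hy' Sum.inr_ne_inl
      · exact absurd hy' Sum.inl_ne_inr
      · exact absurd (F.itemAnc_disjoint (Sum.inr_injective hy')).symm h.1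
  have hmem : ∀ ℓ, ℓ ∈ l := by
    intro ℓ
    obtain ⟨j, ℓ', rfl⟩ := F.itemLoc_surjective ℓ
    rw [List.mem_flatMap]
    exact ⟨j, mem_itemList hP j, List.mem_map.2 ⟨ℓ', Circuit.mem_order _ hF.item_layer_lt ℓ', rfl⟩⟩
  have hperm : (F.encode P).circ.order.Perm l := by
    rw [List.perm_ext_iff_of_nodup (Circuit.order_nodup _) (hpw.imp fun h => h.1)]
    intro ℓ
    exact ⟨fun _ => hmem ℓ, fun _ => Circuit.mem_order _ hM.layer_lt ℓ⟩
  rw [Circuit.runMat, timeOrdered_eq_of_perm _ hperm (Circuit.order_pairwise _) hpw]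
  · rw [List.map_flatMap, timeOrdered_flatMap]
    congr 1
    refine List.map_congr_left fun j _ => ?_
    rw [Circuit.runMat, embed_timeOrdered (F.itemEmb_injective hP j), List.map_map]
    congr 1
    refine List.map_congr_left fun ℓ _ => ?_
    exact F.locMat_item hP ops j ℓ
  -- A pair that is ordered differently in the two lists and shares a qubit would lie in one time
  -- step, against disjointness. So the pair commutes.
  · rintro x y ⟨hxy, hl⟩ ⟨-, hs⟩
    refine Circuit.locMat_commute _ hM.wire_injective ops fun q hq hq' => ?_
    exact hxy (hM.disjoint x y q (le_antisymm hl (hs ⟨q, hq', hq⟩)) hq hq')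

/-- The operation of an item on its blocks. -/
def itemKraus (F : Scheme S)
    (ops : (ℓ : (F.encode P).circ.Loc) → QMatrix ((F.encode P).circ.kind ℓ).arity)
    (z : Config (Σ a : P.circ.Loc, (F.rec1 (P.circ.kind a)).Anc)) (j : Item P) :
    Matrix (Fin (itemArity j) → F.Block) (Fin (itemArity j) → F.Block) ℂ :=
  (F.itemGadget j).kraus (F.itemOps ops j) (z ∘ F.itemAnc j)

/-- Every ancilla belongs to some item, so the indicator in `dilation` is always 1 and only
operators on blocks are left. -/
theorem FaultTolerant.runMat_encode_apply (hP : P.WellFormed)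
    (ops : (ℓ : (F.encode P).circ.Loc) → QMatrix ((F.encode P).circ.kind ℓ).arity)
    (x : P.Qubit → F.Block) (z : Config (Σ a : P.circ.Loc, (F.rec1 (P.circ.kind a)).Anc)) :
    ((F.encode P).circ.runMat ops).mulVec (Pi.single (fun _ => false) 1)
      (Sum.elim (Function.uncurry x) z) =
    (timeOrdered ((itemList P).map fun j =>
      embed (itemWire j) (F.itemKraus ops z j))).mulVec (Pi.single (fun _ _ => false) 1) x := by
  rw [hF.runMat_encode hP]
  refine (dilation (itemWire (P := P)) (itemWire_injective hP) F.itemAnc F.itemAnc_injective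
    (fun j j' a a' h => F.itemAnc_disjoint h) _
    ((itemList_pairwise hP).imp fun h => h.1) x z).trans ?_
  rw [if_pos, mul_one]
  · rfl
  · rintro ⟨a, y⟩ h
    exfalso
    rcases hy : (F.ancEquiv _).symm y with x | ⟨i, x⟩
    · refine h (.inl a) (mem_itemList hP _) x (congrArg (Sigma.mk a) ?_)
      rw [← hy, Equiv.apply_symm_apply]
    · refine h (.inr ⟨a, i⟩) (mem_itemList hP _) x (congrArg (Sigma.mk a) ?_)
      rw [← hy, Equiv.apply_symm_apply]

end Scheme
end

noncomputable section

/-! ## Simulation of a program -/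

section SiteUpdate

variable {Q α ι : Type} [Fintype Q] [DecidableEq Q] [Fintype α] [DecidableEq α]

theorem timeOrdered_siteProd_update (l : List ι) (q : ι → Q) (C : ι → Matrix α α ℂ) :
    timeOrdered (l.map fun i => siteProd (Function.update (fun _ => (1 : Matrix α α ℂ)) (q i) (C i))) =
      siteProd fun s => timeOrdered
        (l.map fun i => Function.update (fun _ => (1 : Matrix α α ℂ)) (q i) (C i) s) := by
  induction l with
  | nil => simp [siteProd_one]
  | cons i l ih => simp only [List.map_cons, timeOrdered_cons, ih, siteProd_mul]

theorem embed_mulVec_support {V : Type} [Fintype V] [DecidableEq V] {w : V → Q}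
    (hw : Function.Injective w) (Z : Matrix (V → α) (V → α) ℂ) {Φ : (Q → α) → ℂ} {q : Q} {a : α}
    (hΦ : ∀ x, Φ x ≠ 0 → x q = a) (hq : ∀ v, w v ≠ q) (x : Q → α)
    (hx : (embed w Z).mulVec Φ x ≠ 0) : x q = a := by
  rw [embed_mulVec hw] at hx
  obtain ⟨u, -, hu⟩ := Finset.exists_ne_zero_of_sum_ne_zero hx
  have h := hΦ _ (right_ne_zero_of_mul hu)
  rwa [Function.extend_apply'] at h
  rintro ⟨v, hv⟩
  exact hq v hv

theorem siteProd_mul_embed_mul_siteProd {V β : Type} [Fintype V] [DecidableEq V] {w : V → Q}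
    (hw : Function.Injective w) (T : Q → Matrix β α ℂ) (A : Matrix (V → α) (V → α) ℂ)
    (C : Q → Matrix α α ℂ) (hC : ∀ q, (∀ v, w v ≠ q) → C q = 1) :
    siteProd T * embed w A * siteProd C =
      locProd w ((siteProd fun v => T (w v)) * A * siteProd fun v => C (w v)) T := by
  rw [← locProd_siteProd hw T, ← locProd_siteProd hw C, embed, locProd_mul hw, locProd_mul hw]
  refine locProd_congr _ fun q hq => ?_
  rw [hC q fun v h => hq ⟨v, h⟩, Matrix.mul_one, Matrix.mul_one]

open Classical in
/-- The operators `L` on the sites `w v`, and `T` on the other sites. -/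
def patch {V β : Type} (w : V → Q) (L : V → Matrix β α ℂ) (T : Q → Matrix β α ℂ) (q : Q) :
    Matrix β α ℂ :=
  if h : ∃ v, w v = q then L h.choose else T q

theorem patch_apply {V β : Type} {w : V → Q} (hw : Function.Injective w) (L : V → Matrix β α ℂ)
    (T : Q → Matrix β α ℂ) (v : V) : patch w L T (w v) = L v := by
  have h : ∃ v', w v' = w v := ⟨v, rfl⟩
  rw [patch, dif_pos h, hw h.choose_spec]

theorem patch_of_ne {V β : Type} {w : V → Q} (L : V → Matrix β α ℂ) (T : Q → Matrix β α ℂ) {q : Q}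
    (hq : ∀ v, w v ≠ q) : patch w L T q = T q :=
  dif_neg fun ⟨v, hv⟩ => hq v hv

theorem locProd_mul_siteProd {V β : Type} [Fintype V] [DecidableEq V] [Fintype β] [DecidableEq β]
    {w : V → Q} (hw : Function.Injective w) (M : Matrix (V → β) (V → β) ℂ)
    (L : V → Matrix β α ℂ) (T : Q → Matrix β α ℂ) :
    locProd w (M * siteProd L) T = embed w M * siteProd (patch w L T) := by
  rw [← locProd_siteProd hw (patch w L T), embed, locProd_mul hw]
  simp only [patch_apply hw, Matrix.one_mul]
  refine locProd_congr _ fun q hq => ?_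
  rw [patch_of_ne]
  exact fun v h => hq ⟨v, h⟩

end SiteUpdate

/-- The states that a program can reach, if the operations at the locations in `R` are arbitrary. -/
def Program.reach {S : GateSet} (P : Program S) (R : Set P.circ.Loc) :
    Submodule ℂ (Config P.Qubit → ℂ) :=
  Submodule.span ℂ {ψ | ∃ ops : (ℓ : P.circ.Loc) → QMatrix (P.circ.kind ℓ).arity,
    (∀ ℓ, ℓ ∉ R → ops ℓ = P.circ.idealOps ℓ) ∧
    ψ = (P.circ.runMat ops).mulVec (Pi.single (fun _ => false) 1)}

namespace Scheme

variable {S : GateSet} {F : Scheme S}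

theorem FaultTolerant.body_perfect (hF : F.FaultTolerant) {κ : LocKind S}
    (hκ : κ ≠ LocKind.prep) (z : Config (F.body κ).Anc) :
    F.BodyPerfect κ.ideal ((F.body κ).kraus (F.body κ).circ.idealOps z) := by
  cases κ with
  | gate g => exact hF.ga_bodyPerfect g z
  | prep => exact absurd rfl hκ
  | meas =>
    have h := hF.bodyPerfect_one
    rw [← F.measureBlock_kraus_ideal z] at h
    exact h

theorem FaultTolerant.body_good (hF : F.FaultTolerant) {κ : LocKind S}
    (hκ : κ ≠ LocKind.prep) {ops} (h : (F.body κ).circ.AtMostFaults 1 ops)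
    (z : Config (F.body κ).Anc) : F.BodyGood κ.ideal ((F.body κ).kraus ops z) := by
  cases κ with
  | gate g => exact hF.ga_bodyGood g h z
  | prep => exact absurd rfl hκ
  | meas => exact hF.meas_bodyGood h z

theorem exists_ideal_inverse (κ : LocKind S) : ∃ V, V * κ.ideal = 1 := by
  cases κ with
  | gate g => exact ⟨star (S.mat g), (S.unitary g).1⟩
  | prep => exact ⟨1, one_mul _⟩
  | meas => exact ⟨1, one_mul _⟩

variable (F) {P : Program S}

/-- The error correction `t` is not followed by a location in `R`. -/
def Live (R : Set P.circ.Loc) (t : Tail P) : Prop := ∀ b, IsNext t b → b ∉ R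

section Faults

variable (ops : (ℓ : (F.encode P).circ.Loc) → QMatrix ((F.encode P).circ.kind ℓ).arity)

/-- The item has no faults. -/
def Perfect (j : Item P) : Prop := F.itemOps ops j = (F.itemGadget j).circ.idealOps

/-- The item has at most one fault. -/
def One (j : Item P) : Prop := (F.itemGadget j).circ.AtMostFaults 1 (F.itemOps ops j)

/-- The extended rectangle of `b`, without the error corrections that precede the rectangles of
locations in `R`, has at most one fault, or at most one fault in each of the error corrections at
its end. -/
def GoodLoc (R : Set P.circ.Loc) (b : P.circ.Loc) : Prop :=
  ((∀ t, IsNext t b → F.Perfect ops (.inr t)) ∧ F.Perfect ops (.inl b) ∧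
    ∀ t : Tail P, t.1 = b → Live R t → F.One ops (.inr t)) ∨
  ((∀ t, IsNext t b → F.Perfect ops (.inr t)) ∧ F.One ops (.inl b) ∧
    ∀ t : Tail P, t.1 = b → Live R t → F.Perfect ops (.inr t)) ∨
  ∃ t₀, IsNext t₀ b ∧ F.One ops (.inr t₀) ∧
    (∀ t, IsNext t b → t ≠ t₀ → F.Perfect ops (.inr t)) ∧ F.Perfect ops (.inl b) ∧
    ∀ t : Tail P, t.1 = b → Live R t → F.Perfect ops (.inr t)

variable (z : Config (Σ a : P.circ.Loc, (F.rec1 (P.circ.kind a)).Anc))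

/-- The operation of an error correction. -/
def tailKraus (t : Tail P) : Matrix F.Block F.Block ℂ :=
  F.ecKraus (F.itemOps ops (.inr t)) (z ∘ F.itemAnc (.inr t))

/-- The operation of the rectangle of `b` without its error corrections. -/
def bodyKraus (b : P.circ.Loc) :
    Matrix (Fin (P.circ.kind b).arity → F.Block) (Fin (P.circ.kind b).arity → F.Block) ℂ :=
  F.itemKraus ops z (.inl b)

/-- The effect on the site `q` of the error corrections in a list. -/
def tailsOp (l : List (Tail P)) (q : P.Qubit) : Matrix F.Block F.Block ℂ :=
  timeOrdered (l.map fun t =>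
    Function.update (fun _ => (1 : Matrix F.Block F.Block ℂ)) t.qubit (F.tailKraus ops z t) q)

theorem timeOrdered_tails (l : List (Tail P)) :
    timeOrdered ((l.map Sum.inr).map fun j => embed (itemWire j) (F.itemKraus ops z j)) =
      siteProd (F.tailsOp ops z l) := by
  refine Eq.trans ?_ (timeOrdered_siteProd_update l Tail.qubit (F.tailKraus ops z))
  rw [List.map_map]
  congr 1
  refine List.map_congr_left fun t _ => ?_
  exact embed_singleton_eq_siteProd t.qubit _

theorem tailsOp_of_mem {l : List (Tail P)} (hl : l.Nodup) {t : Tail P} (ht : t ∈ l)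
    (hu : ∀ t' ∈ l, t'.qubit = t.qubit → t' = t) :
    F.tailsOp ops z l t.qubit = F.tailKraus ops z t := by
  have e : F.tailsOp ops z l t.qubit =
      timeOrdered (l.map fun t' => if t' = t then F.tailKraus ops z t else 1) := by
    rw [tailsOp]
    congr 1
    refine List.map_congr_left fun t' ht' => ?_
    by_cases h : t' = t
    · subst h; simp
    · rw [if_neg h, Function.update_of_ne]
      exact fun hq => h (hu t' ht' hq.symm)
  rw [e, timeOrdered_eq_single hl _ ht]
  · simp
  · intro j hj
    rw [if_neg hj]

theorem tailsOp_of_not_mem {l : List (Tail P)} {q : P.Qubit} (hq : ∀ t ∈ l, t.qubit ≠ q) :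
    F.tailsOp ops z l q = 1 :=
  timeOrdered_eq_one _ _ fun t ht => by rw [Function.update_of_ne (hq t ht).symm]

end Faults

section Simulation

variable (ops : (ℓ : (F.encode P).circ.Loc) → QMatrix ((F.encode P).circ.kind ℓ).arity)
variable (z : Config (Σ a : P.circ.Loc, (F.rec1 (P.circ.kind a)).Anc))
variable (R : Set P.circ.Loc)

/-- The decoding of a block that has not been used yet. -/
def freshOp : Matrix Bool F.Block ℂ := Matrix.single false (fun _ => false) 1

/-- The ways of decoding the block of the qubit `q`, after the locations in `done`. -/
def Allowed (done : List P.circ.Loc) (q : P.Qubit) (T : Matrix Bool F.Block ℂ) : Prop :=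
  ((∀ b ∈ done, ¬ P.circ.Touches b q) ∧ T = F.freshOp) ∨
  (∃ t : Tail P, t.qubit = q ∧ t.1 ∈ done ∧ (∀ b ∈ done, ¬ IsNext t b) ∧
    ((¬ Live R t ∧ F.IsDecoder T) ∨
      (Live R t ∧ ∃ L, F.IsDecoder L ∧ T = L * F.tailKraus ops z t))) ∨
  ∃ a ∈ done, P.circ.kind a = LocKind.meas ∧ P.circ.Touches a q ∧ F.IsDecoder T

/-- The states of the blocks after the rectangles of the locations in `done`. -/
def simState (done : List P.circ.Loc) : (P.Qubit → F.Block) → ℂ :=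
  (timeOrdered ((done.flatMap fun b => (leads P b).map Sum.inr ++ [Sum.inl b]).map fun j =>
    embed (itemWire j) (F.itemKraus ops z j))).mulVec (Pi.single (fun _ _ => false) 1)

/-- The states that the program can reach after the locations in `done`. -/
def partialReach (done : List P.circ.Loc) : Submodule ℂ (Config P.Qubit → ℂ) :=
  Submodule.span ℂ {ψ | ∃ ops' : (ℓ : P.circ.Loc) → QMatrix (P.circ.kind ℓ).arity,
    (∀ ℓ, ℓ ∉ R → ops' ℓ = P.circ.idealOps ℓ) ∧
    ψ = (timeOrdered (done.map (P.circ.locMat ops'))).mulVec (Pi.single (fun _ => false) 1)}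

variable {F ops z R}

theorem simState_support (hP : P.WellFormed) {done : List P.circ.Loc} {q : P.Qubit}
    (hq : ∀ b ∈ done, ¬ P.circ.Touches b q) (x : P.Qubit → F.Block)
    (hx : F.simState ops z done x ≠ 0) : x q = fun _ => false := by
  have key : ∀ (l : List (Item P)) (Φ : (P.Qubit → F.Block) → ℂ),
      (∀ x, Φ x ≠ 0 → x q = fun _ => false) → (∀ j ∈ l, ¬ Item.Touches j q) →
      ∀ x, (timeOrdered (l.map fun j =>
        embed (itemWire j) (F.itemKraus ops z j))).mulVec Φ x ≠ 0 → x q = fun _ => false := by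
    intro l
    induction l with
    | nil =>
      intro Φ hΦ _ x hx
      exact hΦ x (by simpa using hx)
    | cons j l ih =>
      intro Φ hΦ hl x hx
      rw [List.map_cons, timeOrdered_cons, ← Matrix.mulVec_mulVec] at hx
      refine ih _ (fun x hx => ?_) (fun j hj => hl j (List.mem_cons_of_mem _ hj)) x hx
      refine embed_mulVec_support (itemWire_injective hP j) _ hΦ (fun v hv => ?_) x hx
      exact hl j List.mem_cons_self (hv ▸ item_touches_wire j v)
  refine key _ _ (fun x hx => ?_) (fun j hj => ?_) x hx
  · rw [Pi.single_apply] at hx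
    by_cases h : x = fun _ _ => false
    · rw [h]
    · rw [if_neg h] at hx
      exact absurd rfl hx
  · rw [List.mem_flatMap] at hj
    obtain ⟨b, hb, hj⟩ := hj
    rw [List.mem_append, List.mem_map, List.mem_singleton] at hj
    rcases hj with ⟨t, ht, rfl⟩ | rfl
    · rintro h
      obtain rfl : t.qubit = q := h
      exact hq b hb (mem_leads.1 ht).2.1
    · exact hq b hb

theorem simState_append (done : List P.circ.Loc) (b : P.circ.Loc) :
    F.simState ops z (done ++ [b]) =
      (embed (P.circ.wire b) (F.bodyKraus ops z b) *
        siteProd (F.tailsOp ops z (leads P b))).mulVec (F.simState ops z done) := by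
  rw [simState, simState, Matrix.mulVec_mulVec, List.flatMap_append, List.map_append,
    timeOrdered_append]
  congr 2
  rw [List.flatMap_singleton, List.map_append, timeOrdered_append, timeOrdered_tails]
  refine congrArg (· * _) ?_
  rw [List.map_singleton, timeOrdered_cons, timeOrdered_nil, one_mul]
  exact rfl

theorem partialReach_append {done : List P.circ.Loc} {b : P.circ.Loc} (hb : b ∉ done)
    {M : QMatrix (P.circ.kind b).arity} (hM : b ∉ R → M = P.circ.idealOps b)
    {ψ : Config P.Qubit → ℂ} (hψ : ψ ∈ partialReach R done) :
    (embed (P.circ.wire b) M).mulVec ψ ∈ partialReach R (done ++ [b]) := by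
  classical
  induction hψ using Submodule.span_induction with
  | mem ψ h =>
    obtain ⟨ops', hops, rfl⟩ := h
    refine Submodule.subset_span ⟨Function.update ops' b M, fun ℓ hℓ => ?_, ?_⟩
    · by_cases h : ℓ = b
      · subst h
        rw [Function.update_self, hM hℓ]
      · rw [Function.update_of_ne h, hops ℓ hℓ]
    · rw [List.map_append, timeOrdered_append, ← Matrix.mulVec_mulVec, List.map_singleton,
        timeOrdered_cons, timeOrdered_nil, one_mul]
      congr 2
      · exact (Function.update_self b M ops').symm
      · congr 1
        refine List.map_congr_left fun ℓ hℓ => ?_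
        refine congrArg (embed (P.circ.wire ℓ)) (Function.update_of_ne (a := ℓ) (a' := b) ?_ M ops').symm
        rintro rfl
        exact hb hℓ
  | zero => rw [Matrix.mulVec_zero]; exact Submodule.zero_mem _
  | add x y _ _ hx hy => rw [Matrix.mulVec_add]; exact Submodule.add_mem _ hx hy
  | smul a x _ hx => rw [Matrix.mulVec_smul]; exact Submodule.smul_mem _ a hx

/-- The shape of every simulation step: once the decoded rectangle is written as `M` after decoders
admissible before `b`, the invariant yields a reachable state and `M` becomes the operation at `b`.
-/
theorem locProd_mem_partialReach {done : List P.circ.Loc} (hP : P.WellFormed)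
    (hI : ∀ T : P.Qubit → Matrix Bool F.Block ℂ, (∀ q, F.Allowed ops z R done q (T q)) →
      (siteProd T).mulVec (F.simState ops z done) ∈ partialReach R done)
    {b : P.circ.Loc} (hb : b ∉ done) {M : QMatrix (P.circ.kind b).arity}
    (hM : b ∉ R → M = P.circ.idealOps b)
    {L : Fin (P.circ.kind b).arity → Matrix Bool F.Block ℂ}
    (hL : ∀ i, F.Allowed ops z R done (P.circ.wire b i) (L i))
    {T : P.Qubit → Matrix Bool F.Block ℂ}
    (hT : ∀ q, ¬ P.circ.Touches b q → F.Allowed ops z R done q (T q)) :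
    (locProd (P.circ.wire b) (M * siteProd L) T).mulVec (F.simState ops z done) ∈
      partialReach R (done ++ [b]) := by
  rw [locProd_mul_siteProd (hP.wire_injective b), ← Matrix.mulVec_mulVec]
  refine partialReach_append hb hM (hI _ fun q => ?_)
  by_cases hq : P.circ.Touches b q
  · obtain ⟨i, rfl⟩ := hq
    rw [patch_apply (hP.wire_injective b)]
    exact hL i
  · rw [patch_of_ne _ _ fun v hv => hq ⟨v, hv⟩]
    exact hT q hq

theorem FaultTolerant.tailKraus_perfect (hF : F.FaultTolerant) {t : Tail P}
    (h : F.Perfect ops (.inr t)) : F.ECPerfect (F.tailKraus ops z t) := by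
  rw [tailKraus, show F.itemOps ops (.inr t) = _ from h]
  exact hF.ecPerfect _

theorem FaultTolerant.tailKraus_good (hF : F.FaultTolerant) {t : Tail P}
    (h : F.One ops (.inr t)) : F.ECGood (F.tailKraus ops z t) :=
  hF.ecGood h _

theorem siteProd_mul_encs {n : ℕ} {T : Fin n → Matrix Bool F.Block ℂ}
    (hT : ∀ i, ∃ r : ℂ, T i * F.enc = r • 1) {A : Matrix (Fin n → F.Block) (Fin n → F.Block) ℂ}
    {φ : (Fin n → F.Block) → ℂ} {c : Config (Fin n) → ℂ}
    (hA : ∃ r : ℂ, A.mulVec φ = r • (F.encs n).mulVec c) :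
    ∃ r : ℂ, (siteProd T * A).mulVec φ = r • c := by
  obtain ⟨r, hr⟩ := hA
  choose s hs using hT
  refine ⟨r * ∏ i, s i, ?_⟩
  have e : siteProd T * F.encs n = (∏ i, s i) • 1 := by
    refine (siteProd_mul T _).trans ?_
    simp only [hs]
    rw [siteProd_smul, siteProd_one]
  rw [← Matrix.mulVec_mulVec, hr, Matrix.mulVec_smul, Matrix.mulVec_mulVec, e,
    Matrix.smul_mulVec, Matrix.one_mulVec, mul_smul]

/-- The simulation of the rectangle of `b`. -/
theorem FaultTolerant.sim_step (hF : F.FaultTolerant) (hP : P.WellFormed)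
    (hR : ∀ b, b ∉ R → F.GoodLoc ops R b) {done : List P.circ.Loc} {b : P.circ.Loc}
    (hb : b ∉ done) (hle : ∀ a ∈ done, P.circ.layer a ≤ P.circ.layer b)
    (hlt : ∀ a, P.circ.layer a < P.circ.layer b → a ∈ done)
    (hI : ∀ T : P.Qubit → Matrix Bool F.Block ℂ, (∀ q, F.Allowed ops z R done q (T q)) →
      (siteProd T).mulVec (F.simState ops z done) ∈ partialReach R done)
    {T : P.Qubit → Matrix Bool F.Block ℂ} (hT : ∀ q, F.Allowed ops z R (done ++ [b]) q (T q)) :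
    (siteProd T).mulVec (F.simState ops z (done ++ [b])) ∈ partialReach R (done ++ [b]) := by
  have hw := hP.wire_injective b
  set C := F.tailsOp ops z (leads P b) with hC
  have hC1 : ∀ q, ¬ P.circ.Touches b q → C q = 1 := fun q hq =>
    F.tailsOp_of_not_mem ops z fun t ht h => hq (h ▸ (mem_leads.1 ht).2.1)
  have hCt : ∀ t, IsNext t b → C t.qubit = F.tailKraus ops z t := fun t ht =>
    F.tailsOp_of_mem ops z (Finset.nodup_toList _) (mem_leads.2 ht) fun t' ht' h =>
      (mem_leads.1 ht').unique_tail hP ht h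
  have hdone : ∀ a ∈ done ++ [b], ∀ q, P.circ.Touches a q → P.circ.Touches b q →
      a ≠ b → P.circ.layer a < P.circ.layer b := by
    intro a ha q hq hbq hab
    rw [List.mem_append, List.mem_singleton] at ha
    rcases ha with ha | rfl
    · exact lt_of_le_of_ne (hle a ha) fun h => hab (hP.disjoint a b q h hq hbq)
    · exact absurd rfl hab
  have hToff : ∀ q, ¬ P.circ.Touches b q → F.Allowed ops z R done q (T q) := by
    intro q hq
    rcases hT q with ⟨h, h'⟩ | ⟨t, htq, ht, hn, h⟩ | ⟨a, ha, hm, haq, h⟩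
    · exact Or.inl ⟨fun a ha => h a (List.mem_append_left _ ha), h'⟩
    · refine Or.inr (Or.inl ⟨t, htq, ?_, fun a ha => hn a (List.mem_append_left _ ha), h⟩)
      rw [List.mem_append, List.mem_singleton] at ht
      rcases ht with ht | ht
      · exact ht
      · exact absurd (htq ▸ ht ▸ t.touches) hq
    · refine Or.inr (Or.inr ⟨a, ?_, hm, haq, h⟩)
      rw [List.mem_append, List.mem_singleton] at ha
      rcases ha with ha | rfl
      · exact ha
      · exact absurd haq hq
  -- On a block of `b` a pending error correction is one of the rectangle of `b` itself: an earlier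
  -- one would be followed by a location already done.
  have hTon : ∀ i, (∃ t : Tail P, t.1 = b ∧ Live R t ∧ ∃ L, F.IsDecoder L ∧
      T (P.circ.wire b i) = L * F.tailKraus ops z t) ∨ F.IsDecoder (T (P.circ.wire b i)) := by
    intro i
    have hbi : P.circ.Touches b (P.circ.wire b i) := ⟨i, rfl⟩
    rcases hT (P.circ.wire b i) with ⟨h, -⟩ | ⟨t, htq, ht, hn, h⟩ | ⟨a, ha, hm, haq, h⟩
    · exact absurd hbi (h b (by simp))
    · rcases h with ⟨-, h⟩ | ⟨hlive, h⟩
      · exact Or.inr h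
      · refine Or.inl ⟨t, ?_, hlive, h⟩
        by_contra htb
        have hl := hdone _ ht _ (htq ▸ t.touches) hbi htb
        obtain ⟨b', hb', hb'l⟩ := exists_isNext (t := t) (htq ▸ hbi) hl
        refine hn b' ?_ hb'
        rw [List.mem_append, List.mem_singleton]
        by_cases hbb : b' = b
        · exact Or.inr hbb
        · refine Or.inl (hlt b' (lt_of_le_of_ne hb'l fun h => hbb ?_))
          exact hP.disjoint b' b _ h hb'.2.1 (htq ▸ hbi)
    · exact Or.inr h
  -- The step is absorbed into the decoding: on the blocks of `b` the decoders follow the body and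
  -- its leading error corrections, and on the other blocks nothing happens.
  have hsplit : (siteProd T).mulVec (F.simState ops z (done ++ [b])) =
      (locProd (P.circ.wire b) ((siteProd fun v => T (P.circ.wire b v)) *
        F.bodyKraus ops z b * siteProd fun v => C (P.circ.wire b v)) T).mulVec
          (F.simState ops z done) := by
    rw [simState_append, Matrix.mulVec_mulVec, ← Matrix.mul_assoc,
      siteProd_mul_embed_mul_siteProd hw T _ C fun q hq => hC1 q fun ⟨v, hv⟩ => hq v hv]
  rw [hsplit]
  by_cases hprep : P.circ.kind b = LocKind.prep
  · have hnl : ∀ t, ¬ IsNext t b := by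
      intro t ht
      exact absurd ((hP.first_of_prep b t.qubit hprep ht.2.1).2 t.1 t.touches) (not_le.2 ht.1)
    have hC1' : ∀ q, C q = 1 := fun q =>
      F.tailsOp_of_not_mem ops z fun t ht => absurd (mem_leads.1 ht) (hnl t)
    set Z := (siteProd fun v => T (P.circ.wire b v)) *
        F.bodyKraus ops z b * siteProd fun v => C (P.circ.wire b v) with hZ
    set v := Z.mulVec (Pi.single (fun _ _ => false) 1) with hv
    have hfresh : ∀ i, ∀ a ∈ done, ¬ P.circ.Touches a (P.circ.wire b i) := by
      intro i a ha h
      have h1 := (hP.first_of_prep b _ hprep ⟨i, rfl⟩).2 a h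
      have h2 := hdone a (List.mem_append_left _ ha) _ h ⟨i, rfl⟩ fun h => hb (h ▸ ha)
      omega
    -- A block that is about to be prepared is still in `0…0`. Only that column of `Z` matters, so
    -- `Z` can be exchanged for fresh decoding followed by any `M` with the same image of `|0…0⟩`.
    have hvec : ∀ M : Matrix (Fin (P.circ.kind b).arity → Bool)
        (Fin (P.circ.kind b).arity → Bool) ℂ, M.mulVec (Pi.single (fun _ => false) 1) = v →
        (locProd (P.circ.wire b) Z T).mulVec (F.simState ops z done) =
        (locProd (P.circ.wire b) (M * (siteProd fun _ => F.freshOp :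
          Matrix (Fin (P.circ.kind b).arity → Bool) (Fin (P.circ.kind b).arity → F.Block) ℂ)) T).mulVec
          (F.simState ops z done) := by
      intro M hM
      funext y
      simp only [Matrix.mulVec, dotProduct]
      refine Finset.sum_congr rfl fun x _ => ?_
      by_cases hx : F.simState ops z done x = 0
      · rw [hx, mul_zero, mul_zero]
      · congr 1
        simp only [locProd, Matrix.of_apply]
        congr 1
        have hx' : x ∘ P.circ.wire b = fun _ _ => false := by
          funext i
          exact simState_support hP (hfresh i) x hx
        rw [hx']
        have e1 : Z (y ∘ P.circ.wire b) (fun _ _ => false) = v (y ∘ P.circ.wire b) := by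
          rw [hv, Matrix.mulVec_single_one]
          rfl
        have e2 : (fun y => (siteProd fun _ : Fin (P.circ.kind b).arity => F.freshOp) y
            (fun _ _ => false)) = Pi.single (fun _ => false) 1 := by
          funext y
          simp only [siteProd, Matrix.of_apply, freshOp, Matrix.single_apply, Pi.single_apply]
          by_cases hy : y = fun _ => false
          · subst hy; simp
          · rw [if_neg hy]
            obtain ⟨i, hi⟩ := Function.ne_iff.1 hy
            exact Finset.prod_eq_zero (Finset.mem_univ i) (if_neg fun h => hi h.1.symm)
        rw [e1, ← hM, ← e2]
        rfl
    have hL : ∀ i, F.Allowed ops z R done (P.circ.wire b i) F.freshOp := fun i =>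
      Or.inl ⟨hfresh i, rfl⟩
    -- For `b ∈ R` the operation `M` is free and may be the rank-one operator `|v⟩⟨0…0|`; otherwise
    -- `v` has to be a multiple of `|0⟩`.
    by_cases hbR : b ∈ R
    · rw [hvec (Matrix.vecMulVec v (Pi.single (fun _ => false) 1)) (by
        rw [Matrix.vecMulVec_mulVec]; simp)]
      exact locProd_mem_partialReach hP hI hb (fun h => absurd hbR h) hL hToff
    · have hgood : ∃ r : ℂ, v = r • Pi.single (fun _ => false) 1 := by
        have hZ' : Z = (siteProd fun v => T (P.circ.wire b v)) * F.bodyKraus ops z b := by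
          rw [hZ]
          simp only [hC1']
          rw [siteProd_one, Matrix.mul_one]
        have hloc : ∀ κ (hκ : κ = LocKind.prep) (ops' : (ℓ : (F.body κ).circ.Loc) →
            QMatrix ((F.body κ).circ.kind ℓ).arity) (z' : Config (F.body κ).Anc)
            (T' : Fin κ.arity → Matrix Bool F.Block ℂ),
            (ops' = (F.body κ).circ.idealOps ∧ (∀ i, ∃ r : ℂ, T' i * F.enc = r • 1)) ∨
            ((F.body κ).circ.AtMostFaults 1 ops' ∧ (∀ i, F.IsDecoder (T' i))) →
            ∃ r : ℂ, (siteProd T' * (F.body κ).kraus ops' z').mulVec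
              (Pi.single (fun _ _ => false) 1) = r • Pi.single (fun _ => false) 1 := by
          rintro κ rfl ops' z' T' (⟨rfl, h⟩ | ⟨h, h'⟩)
          · exact siteProd_mul_encs (n := 1) h (hF.prep_perfect z')
          · rw [← Matrix.mulVec_mulVec]
            exact siteProd_mul_errSpan h' (hF.prep_good h z')
        rw [hv, hZ']
        refine hloc _ hprep _ _ _ ?_
        rcases hR b hbR with ⟨-, h1, h2⟩ | ⟨-, h1, h2⟩ | ⟨t₀, h0, -⟩
        · refine Or.inl ⟨h1, fun i => ?_⟩
          rcases hTon i with ⟨t, htb, hlive, L, hL, h⟩ | h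
          · rw [h]
            exact hL.mul_good (hF.tailKraus_good (h2 t htb hlive))
          · exact h.mul_enc hF
        · refine Or.inr ⟨h1, fun i => ?_⟩
          rcases hTon i with ⟨t, htb, hlive, L, hL, h⟩ | h
          · rw [h]
            exact hL.mul_perfect hF (hF.tailKraus_perfect (h2 t htb hlive))
          · exact h
        · exact absurd h0 (hnl t₀)
      obtain ⟨r, hr⟩ := hgood
      obtain ⟨I, hI1, hIb⟩ : ∃ I : Matrix (Fin (P.circ.kind b).arity → Bool)
          (Fin (P.circ.kind b).arity → Bool) ℂ, I = 1 ∧ I = P.circ.idealOps b := by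
        refine ⟨1, rfl, ?_⟩
        rw [Circuit.idealOps, hprep]
        rfl
      rw [hvec (r • I) (by rw [hr, hI1, Matrix.smul_mulVec, Matrix.one_mulVec]), Matrix.smul_mul]
      have e : ∀ A : Matrix (Fin (P.circ.kind b).arity → Bool)
          (Fin (P.circ.kind b).arity → F.Block) ℂ,
          locProd (P.circ.wire b) (r • A) T = r • locProd (P.circ.wire b) A T := by
        intro A
        ext y x
        simp only [locProd, Matrix.of_apply, Matrix.smul_apply, smul_eq_mul, mul_assoc]
      rw [e, Matrix.smul_mulVec]
      exact Submodule.smul_mem _ _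
        (locProd_mem_partialReach hP hI hb (fun _ => hIb) hL hToff)
  · have hlead : ∀ i, ∃ t : Tail P, t.qubit = P.circ.wire b i ∧ IsNext t b := fun i =>
      exists_lead hP hprep ⟨i, rfl⟩
    have hpend : ∀ t : Tail P, IsNext t b → t.1 ∈ done ∧ ∀ a ∈ done, ¬ IsNext t a := by
      intro t ht
      refine ⟨hlt _ ht.1, fun a ha h => hb ?_⟩
      rw [ht.unique hP h]
      exact ha
    by_cases hbR : b ∈ R
    -- At a location in `R` the leading error corrections count as part of the arbitrary operation.
    -- Decoders placed in front of them are admissible since an error correction that leads into `R`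
    -- is not live.
    · have hspan := mem_span_decoders hF ((siteProd fun v => T (P.circ.wire b v)) *
        F.bodyKraus ops z b * siteProd fun v => C (P.circ.wire b v))
      generalize (siteProd fun v => T (P.circ.wire b v)) *
        F.bodyKraus ops z b * siteProd (fun v => C (P.circ.wire b v)) = Z at hspan
      induction hspan using Submodule.span_induction with
      | mem Z h =>
        obtain ⟨M, L, hL, rfl⟩ := h
        refine locProd_mem_partialReach hP hI hb (fun h => absurd hbR h) (fun i => ?_) hToff
        obtain ⟨t, htq, ht⟩ := hlead i
        exact Or.inr (Or.inl ⟨t, htq, (hpend t ht).1, (hpend t ht).2,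
          Or.inl ⟨fun h => h b ht hbR, hL i⟩⟩)
      | zero =>
        have e : locProd (P.circ.wire b) 0 T = 0 := by
          ext y x
          simp [locProd]
        rw [e, Matrix.zero_mulVec]
        exact Submodule.zero_mem _
      | add x y _ _ hx hy =>
        have e : locProd (P.circ.wire b) (x + y) T =
            locProd (P.circ.wire b) x T + locProd (P.circ.wire b) y T := by
          ext u v
          simp [locProd, add_mul]
        rw [e, Matrix.add_mulVec]
        exact Submodule.add_mem _ hx hy
      | smul r x _ hx =>
        have e : locProd (P.circ.wire b) (r • x) T = r • locProd (P.circ.wire b) x T := by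
          ext u v
          simp [locProd, mul_assoc]
        rw [e, Matrix.smul_mulVec]
        exact Submodule.smul_mem _ _ hx
    · obtain ⟨V, hV⟩ := exists_ideal_inverse (P.circ.kind b)
      have hCp : ∀ i t, t.qubit = P.circ.wire b i → IsNext t b → F.Perfect ops (.inr t) →
          F.ECPerfect (C (P.circ.wire b i)) := by
        intro i t htq ht h
        rw [← htq, hCt t ht]
        exact hF.tailKraus_perfect h
      have hTp : (∀ t : Tail P, t.1 = b → Live R t → F.Perfect ops (.inr t)) →
          ∀ i, F.IsDecoder (T (P.circ.wire b i)) := by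
        intro h2 i
        rcases hTon i with ⟨t, htb, hlive, L, hL, h⟩ | h
        · rw [h]
          exact hL.mul_perfect hF (hF.tailKraus_perfect (h2 t htb hlive))
        · exact h
      have hbody : F.Perfect ops (.inl b) →
          F.BodyPerfect (P.circ.kind b).ideal (F.bodyKraus ops z b) := by
        intro h
        rw [bodyKraus, itemKraus, show F.itemOps ops (.inl b) = _ from h]
        exact hF.body_perfect hprep _
      have hrec : ∃ L : Fin (P.circ.kind b).arity → Matrix Bool F.Block ℂ,
          (∀ i, F.IsDecoder (L i)) ∧ ∃ r : ℂ, (siteProd fun v => T (P.circ.wire b v)) *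
            F.bodyKraus ops z b * (siteProd fun v => C (P.circ.wire b v)) =
            r • ((P.circ.kind b).ideal * siteProd fun i => L i * C (P.circ.wire b i)) := by
        -- The three ways of being good: faults only in trailing error corrections, one in the body,
        -- or one in a single leading error correction.
        rcases hR b hbR with ⟨h0, h1, h2⟩ | ⟨h0, h1, h2⟩ | ⟨t₀, ht₀, h0, h0', h1, h2⟩
        · refine rec_perfect hF hV (hbody h1) (fun i => ?_) fun i => ?_
          · rcases hTon i with ⟨t, htb, hlive, L, hL, h⟩ | h
            · rw [h]
              exact hL.mul_good (hF.tailKraus_good (h2 t htb hlive))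
            · exact h.mul_enc hF
          · obtain ⟨t, htq, ht⟩ := hlead i
            exact hCp i t htq ht (h0 t ht)
        · refine rec_fault_body hF hV (hF.body_good hprep h1 _) (hTp h2) fun i => ?_
          obtain ⟨t, htq, ht⟩ := hlead i
          exact hCp i t htq ht (h0 t ht)
        · obtain ⟨i₀, hi₀⟩ := ht₀.2.1
          refine rec_fault_lead hF hV (hbody h1) (hTp h2) i₀ ?_ fun i hi => ?_
          · rw [hi₀, hCt t₀ ht₀]
            exact hF.tailKraus_good h0
          · obtain ⟨t, htq, ht⟩ := hlead i
            refine hCp i t htq ht (h0' t ht ?_)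
            rintro rfl
            exact hi (hw (htq.symm.trans hi₀.symm))
      obtain ⟨L, hL, r, hr⟩ := hrec
      have e : ∀ A : Matrix (Fin (P.circ.kind b).arity → Bool)
          (Fin (P.circ.kind b).arity → F.Block) ℂ,
          locProd (P.circ.wire b) (r • A) T = r • locProd (P.circ.wire b) A T := by
        intro A
        ext y x
        simp only [locProd, Matrix.of_apply, Matrix.smul_apply, smul_eq_mul, mul_assoc]
      have hmem := locProd_mem_partialReach hP hI hb (M := (P.circ.kind b).ideal) (fun _ => rfl)
        (L := fun i => L i * C (P.circ.wire b i)) (fun i => ?_) hToff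
      · have e2 : (locProd (P.circ.wire b) ((siteProd fun v => T (P.circ.wire b v)) *
          F.bodyKraus ops z b * siteProd fun v => C (P.circ.wire b v)) T) = r •
          locProd (P.circ.wire b) ((P.circ.kind b).ideal *
            siteProd fun i => L i * C (P.circ.wire b i)) T :=
          (congrArg (fun A => locProd (P.circ.wire b) A T) hr).trans (e _)
        rw [e2, Matrix.smul_mulVec]
        exact Submodule.smul_mem _ _ hmem
      · obtain ⟨t, htq, ht⟩ := hlead i
        refine Or.inr (Or.inl ⟨t, htq, (hpend t ht).1, (hpend t ht).2, Or.inr ⟨fun b' hb' => ?_,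
          L i, hL i, ?_⟩⟩)
        · rw [← ht.unique hP hb']
          exact hbR
        · rw [← htq, hCt t ht]

end Simulation

end Scheme
end

/-! ### Simulation of the whole circuit -/

noncomputable section

namespace Scheme

variable {S : GateSet} {F : Scheme S} {P : Program S}
variable {ops : (ℓ : (F.encode P).circ.Loc) → QMatrix ((F.encode P).circ.kind ℓ).arity}
variable {z : Config (Σ a : P.circ.Loc, (F.rec1 (P.circ.kind a)).Anc)}
variable {R : Set P.circ.Loc}

theorem siteProd_freshOp_mulVec :
    (siteProd fun _ : P.Qubit => F.freshOp).mulVec (Pi.single (fun _ _ => false) 1) =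
      Pi.single (fun _ => false) 1 := by
  funext y
  rw [Matrix.mulVec_single_one]
  simp only [Matrix.col_apply, siteProd, Matrix.of_apply, freshOp, Matrix.single_apply,
    Pi.single_apply]
  by_cases hy : y = fun _ => false
  · subst hy
    simp
  · rw [if_neg hy]
    obtain ⟨i, hi⟩ := Function.ne_iff.1 hy
    exact Finset.prod_eq_zero (Finset.mem_univ i) (if_neg fun h => hi h.1.symm)

/-- Induction along the order of execution. At the start every block is fresh; a prefix contains all
locations of smaller layer and none of larger layer, which `sim_step` uses to identify pending error
corrections. -/
theorem FaultTolerant.sim_prefix (hF : F.FaultTolerant) (hP : P.WellFormed)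
    (hR : ∀ b, b ∉ R → F.GoodLoc ops R b) (done : List P.circ.Loc)
    (hpre : done <+: P.circ.order) :
    ∀ T : P.Qubit → Matrix Bool F.Block ℂ, (∀ q, F.Allowed ops z R done q (T q)) →
      (siteProd T).mulVec (F.simState ops z done) ∈ partialReach R done := by
  induction done using List.reverseRecOn with
  | nil =>
    intro T hT
    have hT' : T = fun _ => F.freshOp := by
      funext q
      rcases hT q with ⟨-, h⟩ | ⟨t, -, h, -⟩ | ⟨a, h, -⟩
      · exact h
      · exact absurd h List.not_mem_nil
      · exact absurd h List.not_mem_nil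
    rw [hT']
    refine Submodule.subset_span ⟨P.circ.idealOps, fun _ _ => rfl, ?_⟩
    have e : F.simState ops z ([] : List P.circ.Loc) = Pi.single (fun _ _ => false) 1 :=
      Matrix.one_mulVec _
    rw [e, siteProd_freshOp_mulVec]
    exact (Matrix.one_mulVec _).symm
  | append_singleton done b ih =>
    intro T hT
    obtain ⟨l, hl⟩ := hpre
    have hpw := P.circ.order_pairwise
    rw [← hl, List.append_assoc, List.pairwise_append] at hpw
    obtain ⟨-, hpw2, hpw3⟩ := hpw
    rw [List.singleton_append, List.pairwise_cons] at hpw2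
    refine hF.sim_step hP hR (fun h => ?_) (fun a ha => ?_) (fun a ha => ?_)
      (ih ⟨[b] ++ l, by rw [← List.append_assoc, hl]⟩) hT
    · exact (hpw3 b h b (by simp)).1 rfl
    · exact (hpw3 a ha b (by simp)).2
    · have h := P.circ.mem_order hP.layer_lt a
      rw [← hl, List.mem_append, List.mem_append, List.mem_singleton] at h
      rcases h with (h | rfl) | h
      · exact h
      · exact absurd ha (lt_irrefl _)
      · exact absurd ha (not_lt.2 (hpw2.1 a h).2)

theorem finals_unique (hP : P.WellFormed) {t t' : Tail P} (ht : t ∈ finals P) (ht' : t' ∈ finals P)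
    (h : t'.qubit = t.qubit) : t' = t := by
  have hlast : ∀ t t' : Tail P, t ∈ finals P → t.qubit = t'.qubit →
      P.circ.layer t'.1 ≤ P.circ.layer t.1 := by
    intro t t' ht h
    by_contra hc
    obtain ⟨b', hb', -⟩ := exists_isNext (t := t) (h ▸ t'.touches) (not_le.1 hc)
    exact mem_finals.1 ht b' hb'
  have hl := le_antisymm (hlast t t' ht h.symm) (hlast t' t ht' h)
  exact Tail.ext_of_qubit hP (hP.disjoint _ _ t.qubit hl (h ▸ t'.touches) t.touches) h

/-- Decoding maps the states that the encoded program can reach to states that the program can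
reach, if the faults are arbitrary at the locations whose extended rectangles are bad. -/
theorem FaultTolerant.decode_mem_reach (hF : F.FaultTolerant) (hP : P.WellFormed)
    (hR : ∀ b, b ∉ R → F.GoodLoc ops R b) {T : P.Qubit → Matrix Bool F.Block ℂ}
    (hT : ∀ q, (∃ a, P.circ.Touches a q) → F.IsDecoder (T q))
    (hT' : ∀ q, (¬ ∃ a, P.circ.Touches a q) → ∃ Y, T q = Matrix.single false Y 1) :
    ((siteProd T).mulVec fun x => ((F.encode P).circ.runMat ops).mulVec
      (Pi.single (fun _ => false) 1) (Sum.elim (Function.uncurry x) z)) ∈ P.reach R := by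
  have e : (fun x => ((F.encode P).circ.runMat ops).mulVec
      (Pi.single (fun _ => false) 1) (Sum.elim (Function.uncurry x) z)) =
      (siteProd (F.tailsOp ops z (finals P))).mulVec (F.simState ops z P.circ.order) := by
    funext x
    refine (hF.runMat_encode_apply hP ops x z).trans ?_
    rw [itemList, List.map_append, timeOrdered_append, timeOrdered_tails, ← Matrix.mulVec_mulVec]
    rfl
  rw [e, Matrix.mulVec_mulVec, siteProd_mul]
  have hfin : ∀ q, (¬ ∃ t ∈ finals P, t.qubit = q) → F.tailsOp ops z (finals P) q = 1 :=
    fun q hq => F.tailsOp_of_not_mem ops z fun t ht h => hq ⟨t, ht, h⟩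
  have huntouched : ∀ q, (¬ ∃ a, P.circ.Touches a q) → F.tailsOp ops z (finals P) q = 1 :=
    fun q hq => hfin q fun ⟨t, _, h⟩ => hq ⟨t.1, h ▸ t.touches⟩
  -- A block that is never used stays in `0…0`. With the syndrome `0…0` its decoder is `freshOp` and
  -- the invariant applies; with any other syndrome the amplitude is zero.
  by_cases hfresh : ∀ q, (¬ ∃ a, P.circ.Touches a q) → T q = F.freshOp
  · refine hF.sim_prefix hP hR P.circ.order List.prefix_rfl _ fun q => ?_
    by_cases hq : ∃ a, P.circ.Touches a q
    · obtain ⟨a, ha⟩ := hq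
      classical
      obtain ⟨a, ha, hmax⟩ := Finset.exists_max_image
        (Finset.univ.filter fun a => P.circ.Touches a q) P.circ.layer ⟨a, by simpa using ha⟩
      rw [Finset.mem_filter] at ha
      have hmax : ∀ b, P.circ.Touches b q → P.circ.layer b ≤ P.circ.layer a := fun b hb =>
        hmax b (by simpa using hb)
      have hmem : ∀ a, a ∈ P.circ.order := P.circ.mem_order hP.layer_lt
      -- The last location `a` on the qubit decides: after a measurement no error correction is
      -- pending, otherwise the final error correction on the block still has to be applied, and it
      -- is live because nothing follows.
      by_cases hm : P.circ.kind a = LocKind.meas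
      · rw [hfin q, Matrix.mul_one]
        · exact Or.inr (Or.inr ⟨a, hmem a, hm, ha.2, hT q ⟨a, ha.2⟩⟩)
        · rintro ⟨t, ht, rfl⟩
          have hta : t.1 = a := by
            refine hP.disjoint t.1 a t.qubit (le_antisymm (hmax _ t.touches) ?_) t.touches ha.2
            by_contra hc
            obtain ⟨b', hb', -⟩ := exists_isNext (t := t) ha.2 (not_le.1 hc)
            exact mem_finals.1 ht b' hb'
          have : IsEmpty (Fin (tails (P.circ.kind a))) := by
            rw [hm]
            exact inferInstanceAs (IsEmpty (Fin 0))
          exact this.elim (hta ▸ t.2)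
      · obtain ⟨i, hi⟩ := ha.2
        obtain ⟨i', rfl⟩ := port_surjective hm i
        have hfinal : (⟨a, i'⟩ : Tail P) ∈ finals P := by
          refine mem_finals.2 fun b hb => ?_
          have hb2 : P.circ.Touches b q := hi ▸ hb.2.1
          exact absurd hb.1 (not_lt.2 (hmax b hb2))
        have hq : Tail.qubit (⟨a, i'⟩ : Tail P) = q := hi
        refine Or.inr (Or.inl ⟨⟨a, i'⟩, hq, hmem a, fun b _ => mem_finals.1 hfinal b,
          Or.inr ⟨fun b hb => absurd hb (mem_finals.1 hfinal b), T q, hT q ⟨a, ha.2⟩, ?_⟩⟩)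
        rw [← hq, F.tailsOp_of_mem ops z (l := finals P) (Finset.nodup_toList _) hfinal
          fun t' ht' h => finals_unique hP hfinal ht' h]
    · rw [huntouched q hq, Matrix.mul_one]
      exact Or.inl ⟨fun b _ h => hq ⟨b, h⟩, hfresh q hq⟩
  · push Not at hfresh
    obtain ⟨q, hq, hTq⟩ := hfresh
    obtain ⟨Y, hY⟩ := hT' q (by simpa using hq)
    have hY0 : Y ≠ fun _ => false := fun h => hTq (by rw [hY, h]; rfl)
    convert Submodule.zero_mem _ using 1
    funext y
    refine Finset.sum_eq_zero fun x _ => ?_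
    by_cases hx : F.simState ops z P.circ.order x = 0
    · rw [hx, mul_zero]
    · have hxq := simState_support hP (fun b _ => hq b) x hx
      have h0 : siteProd (fun q => T q * F.tailsOp ops z (finals P) q) y x = 0 := by
        refine Finset.prod_eq_zero (Finset.mem_univ q) ?_
        change (T q * F.tailsOp ops z (finals P) q) (y q) (x q) = 0
        rw [huntouched q (by simpa using hq), Matrix.mul_one, hY, hxq, Matrix.single_apply,
          if_neg fun h => hY0 h.2]
      exact mul_eq_zero_of_left h0 _

end Scheme
end

/-! ### Extended rectangles as fault regions, and their sizes -/

noncomputable section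

namespace Scheme

variable {S : GateSet} (F : Scheme S) {P : Program S}

section Items

/-- The item to which a location of the simulation belongs. -/
def itemOf (ℓ : (F.encode P).circ.Loc) : Item P := (F.itemLoc_surjective ℓ).choose

theorem exists_itemLoc (ℓ : (F.encode P).circ.Loc) : ∃ ℓ', F.itemLoc (F.itemOf ℓ) ℓ' = ℓ :=
  (F.itemLoc_surjective ℓ).choose_spec

theorem itemOf_itemLoc (j : Item P) (ℓ : (F.itemGadget j).circ.Loc) :
    F.itemOf (F.itemLoc j ℓ) = j := by
  obtain ⟨ℓ', h⟩ := F.exists_itemLoc (F.itemLoc j ℓ)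
  exact congrArg Sigma.fst (F.itemLoc_injective h)

theorem itemOf_src (ℓ : (F.encode P).circ.Loc) : Item.src (F.itemOf ℓ) = ℓ.1 := by
  obtain ⟨ℓ', h⟩ := F.exists_itemLoc ℓ
  rw [← F.itemLoc_src (F.itemOf ℓ) ℓ', h]

open Classical in
theorem card_itemOf (j : Item P) :
    (Finset.univ.filter fun ℓ => F.itemOf ℓ = j).card = (F.itemGadget j).circ.size := by
  have e : (Finset.univ.filter fun ℓ => F.itemOf ℓ = j) = Finset.univ.image (F.itemLoc j) := by
    ext ℓ
    simp only [Finset.mem_filter, Finset.mem_univ, true_and, Finset.mem_image]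
    constructor
    · rintro rfl
      exact F.exists_itemLoc ℓ
    · rintro ⟨ℓ', rfl⟩
      exact F.itemOf_itemLoc j ℓ'
  rw [e, Finset.card_image_of_injective]
  · rfl
  · intro ℓ ℓ' h
    exact eq_of_heq (Sigma.mk.inj (F.itemLoc_injective h)).2

open Classical in
/-- The location of `P` in whose extended rectangle, but not in the extended rectangle of a later
location, the item is contained. -/
def itemReg : Item P → P.circ.Loc
  | .inl a => a
  | .inr t => if h : ∃ b, IsNext t b then h.choose else t.1

open Classical in
/-- The earlier location in whose extended rectangle the item is contained. -/
def itemPar : Item P → Option P.circ.Loc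
  | .inl _ => none
  | .inr t => if ∃ b, IsNext t b then some t.1 else none

theorem itemReg_of_isNext (hP : P.WellFormed) {t : Tail P} {b : P.circ.Loc} (h : IsNext t b) :
    itemReg (.inr t) = b := by
  have h' : ∃ b, IsNext t b := ⟨b, h⟩
  rw [itemReg, dif_pos h']
  exact h'.choose_spec.unique hP h

theorem itemPar_of_isNext {t : Tail P} {b : P.circ.Loc} (h : IsNext t b) :
    itemPar (.inr t) = some t.1 :=
  if_pos ⟨b, h⟩

theorem itemReg_of_final {t : Tail P} (h : ∀ b, ¬ IsNext t b) : itemReg (.inr t) = t.1 :=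
  dif_neg (not_exists.2 h)

theorem itemPar_eq_some {j : Item P} {a : P.circ.Loc} (h : itemPar j = some a) :
    ∃ t b, j = .inr t ∧ t.1 = a ∧ IsNext t b ∧ itemReg j = b := by
  classical
  rcases j with a' | t
  · exact absurd h (by simp [itemPar])
  · rw [itemPar] at h
    by_cases hb : ∃ b, IsNext t b
    · rw [if_pos hb] at h
      refine ⟨t, hb.choose, rfl, Option.some_injective _ h, hb.choose_spec, ?_⟩
      rw [itemReg, dif_pos hb]
    · rw [if_neg hb] at h
      exact absurd h (by simp)

theorem itemReg_eq {j : Item P} {a : P.circ.Loc} (h : itemReg j = a) :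
    j = .inl a ∨ (∃ t, j = .inr t ∧ IsNext t a) ∨
      ∃ t : Tail P, j = .inr t ∧ t.1 = a ∧ ∀ b, ¬ IsNext t b := by
  classical
  rcases j with a' | t
  · exact Or.inl (congrArg Sum.inl h)
  · by_cases hb : ∃ b, IsNext t b
    · rw [itemReg, dif_pos hb] at h
      exact Or.inr (Or.inl ⟨t, rfl, h ▸ hb.choose_spec⟩)
    · rw [itemReg, dif_neg hb] at h
      exact Or.inr (Or.inr ⟨t, rfl, h, not_exists.1 hb⟩)

variable (P)

/-- The extended rectangles in the simulation of `P`. -/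
def regions : FaultRegions (F.encode P).circ.Loc P.circ.Loc where
  reg ℓ := itemReg (F.itemOf ℓ)
  par ℓ := itemPar (F.itemOf ℓ)
  rank := P.circ.layer
  rank_lt ℓ a h := by
    obtain ⟨t, b, -, rfl, hb, hr⟩ := itemPar_eq_some h
    rw [hr]
    exact hb.1

variable {P}

end Items

section Good

variable {F} {ops : (ℓ : (F.encode P).circ.Loc) → QMatrix ((F.encode P).circ.kind ℓ).arity}
variable {c : Finset (F.encode P).circ.Loc}

theorem perfect_of_faults (hops : ∀ ℓ, ℓ ∉ c → ops ℓ = (F.encode P).circ.idealOps ℓ) {j : Item P}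
    (h : ∀ ℓ ∈ c, F.itemOf ℓ ≠ j) : F.Perfect ops j := by
  funext ℓ
  refine F.itemOps_ideal (hops _ fun hc => ?_)
  exact h _ hc (F.itemOf_itemLoc j ℓ)

theorem one_of_faults (hops : ∀ ℓ, ℓ ∉ c → ops ℓ = (F.encode P).circ.idealOps ℓ) {j : Item P}
    (h : ∀ ℓ ∈ c, ∀ ℓ' ∈ c, F.itemOf ℓ = j → F.itemOf ℓ' = j → ℓ = ℓ') : F.One ops j := by
  rw [One, Circuit.AtMostFaults, Set.ncard_le_one]
  have key : ∀ ℓ, F.itemOps ops j ℓ ≠ (F.itemGadget j).circ.idealOps ℓ → F.itemLoc j ℓ ∈ c := by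
    intro ℓ hℓ
    by_contra hc
    exact hℓ (F.itemOps_ideal (hops _ hc))
  intro ℓ hℓ ℓ' hℓ'
  have := h _ (key ℓ hℓ) _ (key ℓ' hℓ') (F.itemOf_itemLoc j ℓ) (F.itemOf_itemLoc j ℓ')
  exact eq_of_heq (Sigma.mk.inj (F.itemLoc_injective this)).2

/-- If the own region has no fault, leading error corrections and body are perfect, and each live
trailing one has at most one fault because it lies in a region that is not bad. If the region has
one fault, faults in trailing error corrections are confined to those leading to bad locations,
which are not live. The position of the single fault then selects the alternative of `GoodLoc`. -/
theorem goodLoc_of_not_bad (hP : P.WellFormed)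
    (hops : ∀ ℓ, ℓ ∉ c → ops ℓ = (F.encode P).circ.idealOps ℓ) {b : P.circ.Loc}
    (hb : ¬ (F.regions P).Bad ∅ c b) :
    F.GoodLoc ops {a | (F.regions P).Bad ∅ c a} b := by
  have hle : ∀ a, ¬ (F.regions P).Bad ∅ c a → ∀ ℓ ∈ c, ∀ ℓ' ∈ c, itemReg (F.itemOf ℓ) = a →
      itemReg (F.itemOf ℓ') = a → ℓ = ℓ' := by
    intro a ha ℓ hℓ ℓ' hℓ' h h'
    rw [FaultRegions.bad_empty_iff, FaultRegions.BadCond, not_or, not_le] at ha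
    refine Finset.card_le_one.1 (Nat.lt_succ_iff.1 ha.1) ℓ ?_ ℓ' ?_
    · exact Finset.mem_inter.2 ⟨hℓ, (F.regions P).mem_cell.2 h⟩
    · exact Finset.mem_inter.2 ⟨hℓ', (F.regions P).mem_cell.2 h'⟩
  have hone : ∀ t : Tail P, t.1 = b → Live {a | (F.regions P).Bad ∅ c a} t →
      F.One ops (.inr t) := by
    intro t ht hlive
    refine one_of_faults hops fun ℓ hℓ ℓ' hℓ' h h' => ?_
    by_cases hn : ∃ b', IsNext t b'
    · obtain ⟨b', hb'⟩ := hn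
      refine hle b' (hlive b' hb') ℓ hℓ ℓ' hℓ' ?_ ?_
      · rw [h, itemReg_of_isNext hP hb']
      · rw [h', itemReg_of_isNext hP hb']
    · refine hle b hb ℓ hℓ ℓ' hℓ' ?_ ?_
      · rw [h, itemReg_of_final (not_exists.1 hn), ht]
      · rw [h', itemReg_of_final (not_exists.1 hn), ht]
  by_cases h0 : ∃ ℓ₀ ∈ c, itemReg (F.itemOf ℓ₀) = b
  · obtain ⟨ℓ₀, hℓ₀, hr⟩ := h0
    have huniq : ∀ ℓ ∈ c, itemReg (F.itemOf ℓ) = b → F.itemOf ℓ = F.itemOf ℓ₀ := fun ℓ hℓ h => by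
      rw [hle b hb ℓ hℓ ℓ₀ hℓ₀ h hr]
    have hcard : (c ∩ (F.regions P).cell b).card = 1 := by
      refine le_antisymm (Finset.card_le_one.2 fun ℓ hℓ ℓ' hℓ' => ?_) ?_
      · rw [Finset.mem_inter, FaultRegions.mem_cell] at hℓ hℓ'
        exact hle b hb ℓ hℓ.1 ℓ' hℓ'.1 hℓ.2 hℓ'.2
      · exact Finset.card_pos.2 ⟨ℓ₀, Finset.mem_inter.2 ⟨hℓ₀, (F.regions P).mem_cell.2 hr⟩⟩
    -- Otherwise the fault in the region and this one would together make `b` bad.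
    have hchild : ∀ ℓ ∈ c, ∀ t : Tail P, F.itemOf ℓ = .inr t → t.1 = b →
        ∀ b', IsNext t b' → (F.regions P).Bad ∅ c b' := by
      intro ℓ hℓ t ht htb b' hb'
      by_contra hbad
      have h := hb
      rw [FaultRegions.bad_empty_iff] at h
      refine h (Or.inr ⟨hcard, ℓ, hℓ, ?_, ?_⟩)
      · change itemPar (F.itemOf ℓ) = some b
        rw [ht, itemPar_of_isNext hb', htb]
      · change ¬ (F.regions P).Bad ∅ c (itemReg (F.itemOf ℓ))
        rwa [ht, itemReg_of_isNext hP hb']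
    have hlead : ∀ t : Tail P, IsNext t b → .inr t ≠ F.itemOf ℓ₀ → F.Perfect ops (.inr t) := by
      intro t ht hne
      refine perfect_of_faults hops fun ℓ hℓ h => hne ?_
      rw [← h]
      exact huniq ℓ hℓ (by rw [h, itemReg_of_isNext hP ht])
    have hbody : .inl b ≠ F.itemOf ℓ₀ → F.Perfect ops (.inl b) := by
      intro hne
      refine perfect_of_faults hops fun ℓ hℓ h => hne ?_
      rw [← h]
      exact huniq ℓ hℓ (by rw [h]; rfl)
    have htail : ∀ t : Tail P, t.1 = b → Live {a | (F.regions P).Bad ∅ c a} t →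
        .inr t ≠ F.itemOf ℓ₀ → F.Perfect ops (.inr t) := by
      intro t ht hlive hne
      refine perfect_of_faults hops fun ℓ hℓ h => ?_
      by_cases hn : ∃ b', IsNext t b'
      · obtain ⟨b', hb'⟩ := hn
        exact hlive b' hb' (hchild ℓ hℓ t h ht b' hb')
      · refine hne ?_
        rw [← h]
        exact huniq ℓ hℓ (by rw [h, itemReg_of_final (not_exists.1 hn), ht])
    rcases itemReg_eq hr with h | ⟨t₀, h, ht₀⟩ | ⟨t₁, h, ht₁, hfin⟩
    · refine Or.inr (Or.inl ⟨fun t ht => hlead t ht ?_, ?_, fun t ht hl => htail t ht hl ?_⟩)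
      · rw [h]; exact Sum.inr_ne_inl
      · refine one_of_faults hops fun ℓ hℓ ℓ' hℓ' h1 h2 => hle b hb ℓ hℓ ℓ' hℓ' ?_ ?_
        · rw [h1]; rfl
        · rw [h2]; rfl
      · rw [h]; exact Sum.inr_ne_inl
    · refine Or.inr (Or.inr ⟨t₀, ht₀, ?_, fun t ht hne => hlead t ht ?_, hbody ?_,
        fun t ht hl => htail t ht hl ?_⟩)
      · refine one_of_faults hops fun ℓ hℓ ℓ' hℓ' h1 h2 => hle b hb ℓ hℓ ℓ' hℓ' ?_ ?_
        · rw [h1, itemReg_of_isNext hP ht₀]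
        · rw [h2, itemReg_of_isNext hP ht₀]
      · rw [h]; exact fun h' => hne (Sum.inr_injective h')
      · rw [h]; exact Sum.inl_ne_inr
      · rw [h]
        rintro h'
        obtain rfl := Sum.inr_injective h'
        rw [← ht] at ht₀
        exact absurd ht₀.1 (lt_irrefl _)
    · refine Or.inl ⟨fun t ht => hlead t ht ?_, hbody ?_, hone⟩
      · rw [h]
        rintro h'
        obtain rfl := Sum.inr_injective h'
        exact hfin b ht
      · rw [h]; exact Sum.inl_ne_inr
  · push Not at h0
    refine Or.inl ⟨fun t ht => ?_, ?_, hone⟩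
    · exact perfect_of_faults hops fun ℓ hℓ h => h0 ℓ hℓ (by rw [h, itemReg_of_isNext hP ht])
    · exact perfect_of_faults hops fun ℓ hℓ h => h0 ℓ hℓ (by rw [h]; rfl)

end Good

section Counts

open Classical in
/-- The locations in the error corrections of the rectangle of `a` which are followed by another
rectangle. -/
def parCell (a : P.circ.Loc) : Finset (F.encode P).circ.Loc :=
  Finset.univ.filter fun ℓ => (F.regions P).par ℓ = some a

theorem mem_parCell {a : P.circ.Loc} {ℓ : (F.encode P).circ.Loc} :
    ℓ ∈ F.parCell a ↔ itemPar (F.itemOf ℓ) = some a := by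
  rw [parCell, Finset.mem_filter]
  exact ⟨fun h => h.2, fun h => ⟨Finset.mem_univ _, h⟩⟩

theorem card_leads_le (hP : P.WellFormed) (a : P.circ.Loc) :
    (leads P a).toFinset.card ≤ (P.circ.kind a).inputs := by
  classical
  by_cases hprep : P.circ.kind a = LocKind.prep
  · have h : (leads P a).toFinset = ∅ := by
      refine Finset.eq_empty_of_forall_notMem fun t ht => ?_
      have ht := mem_leads.1 (List.mem_toFinset.1 ht)
      exact absurd ((hP.first_of_prep a t.qubit hprep ht.2.1).2 t.1 t.touches) (not_le.2 ht.1)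
    rw [h, Finset.card_empty]
    exact Nat.zero_le _
  · have h : (leads P a).toFinset.card ≤ (Finset.univ.image (P.circ.wire a)).card := by
      refine Finset.card_le_card_of_injOn Tail.qubit (fun t ht => ?_) fun t ht t' ht' h => ?_
      · obtain ⟨i, hi⟩ := (mem_leads.1 (List.mem_toFinset.1 ht)).2.1
        exact Finset.mem_coe.2 (Finset.mem_image.2 ⟨i, Finset.mem_univ _, hi⟩)
      · exact (mem_leads.1 (List.mem_toFinset.1 ht)).unique_tail hP
          (mem_leads.1 (List.mem_toFinset.1 ht')) h
    refine h.trans (Finset.card_image_le.trans ?_)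
    rw [Finset.card_univ, Fintype.card_fin]
    generalize P.circ.kind a = κ at hprep ⊢
    cases κ with
    | gate g => exact le_rfl
    | prep => exact absurd rfl hprep
    | meas => exact le_rfl

theorem exRecSize_le (κ : LocKind S) : F.exRecSize κ ≤ F.maxExRecSize := by
  cases κ with
  | gate g => exact (Finset.le_sup (f := fun g => F.exRecSize (.gate g))
      (Finset.mem_univ g)).trans (le_max_left _ _)
  | prep => exact (le_max_left _ _).trans (le_max_right _ _)
  | meas => exact (le_max_right _ _).trans (le_max_right _ _)

/-- The region consists of the leading error corrections, the body and those trailing error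
corrections that nothing follows; `parCell` consists of the other trailing ones. Together they lie
in the extended rectangle, which gives `t + e ≤ A`. -/
theorem card_cell_add_card_parCell_le (hP : P.WellFormed) (a : P.circ.Loc) :
    ((F.regions P).cell a).card + (F.parCell a).card ≤ F.maxExRecSize := by
  classical
  have hd : Disjoint ((F.regions P).cell a) (F.parCell a) := by
    refine Finset.disjoint_left.2 fun ℓ h h' => ?_
    rw [FaultRegions.mem_cell] at h
    have := (F.regions P).rank_lt ℓ a (F.mem_parCell.1 h')
    rw [h] at this
    exact lt_irrefl _ this
  rw [← Finset.card_union_of_disjoint hd]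
  have hsub : (F.regions P).cell a ∪ F.parCell a ⊆
      (leads P a).toFinset.biUnion (fun t => Finset.univ.filter fun ℓ => F.itemOf ℓ = .inr t) ∪
        Finset.univ.image fun ρ : (F.rec1 (P.circ.kind a)).circ.Loc =>
          (⟨a, ρ⟩ : (F.encode P).circ.Loc) := by
    have hown : ∀ ℓ : (F.encode P).circ.Loc, Item.src (F.itemOf ℓ) = a →
        ℓ ∈ Finset.univ.image fun ρ : (F.rec1 (P.circ.kind a)).circ.Loc =>
          (⟨a, ρ⟩ : (F.encode P).circ.Loc) := by
      intro ℓ h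
      rw [itemOf_src] at h
      obtain ⟨a', ρ⟩ := ℓ
      obtain rfl : a' = a := h
      exact Finset.mem_image.2 ⟨ρ, Finset.mem_univ _, rfl⟩
    intro ℓ hℓ
    rw [Finset.mem_union]
    rcases Finset.mem_union.1 hℓ with h | h
    · rw [FaultRegions.mem_cell] at h
      rcases itemReg_eq h with h | ⟨t, h, ht⟩ | ⟨t, h, ht, -⟩
      · exact Or.inr (hown ℓ (by rw [h]; rfl))
      · refine Or.inl (Finset.mem_biUnion.2 ⟨t, List.mem_toFinset.2 (mem_leads.2 ht), ?_⟩)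
        simpa using h
      · exact Or.inr (hown ℓ (by rw [h]; exact ht))
    · obtain ⟨t, b, h, ht, -⟩ := itemPar_eq_some (j := F.itemOf ℓ) (F.mem_parCell.1 h)
      exact Or.inr (hown ℓ (by rw [h]; exact ht))
  refine le_trans ((Finset.card_le_card hsub).trans (Finset.card_union_le _ _))
    (le_trans (Nat.add_le_add ?_ ?_) (F.exRecSize_le (P.circ.kind a)))
  · refine (Finset.card_biUnion_le_card_mul _ _ F.ec.circ.size fun t _ => ?_).trans
      (Nat.mul_le_mul_right _ (card_leads_le hP a))
    exact (F.card_itemOf (.inr t)).le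
  · exact Finset.card_image_le

/-- `parCell` is a union of whole error corrections. This provides the alternative `e = 0 ∨ 5 ≤ e`
in `bad_weight_le`. -/
theorem parCell_card (a : P.circ.Loc) :
    (F.parCell a).card = 0 ∨ F.ec.circ.size ≤ (F.parCell a).card := by
  classical
  by_cases h : (F.parCell a).card = 0
  · exact Or.inl h
  · obtain ⟨ℓ, hℓ⟩ := Finset.card_pos.1 (Nat.pos_of_ne_zero h)
    have hℓ : itemPar (F.itemOf ℓ) = some a := F.mem_parCell.1 hℓ
    obtain ⟨t, b, ht, -⟩ := itemPar_eq_some hℓ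
    refine Or.inr ((F.card_itemOf (.inr t)).ge.trans (Finset.card_le_card fun ℓ' h' => ?_))
    have h' : F.itemOf ℓ' = .inr t := by simpa using h'
    have : itemPar (F.itemOf ℓ') = some a := by rw [h', ← ht, hℓ]
    exact F.mem_parCell.2 this

theorem card_children_le (R : Finset P.circ.Loc) (a : P.circ.Loc) :
    ((F.regions P).children R a).card ≤ (F.parCell a).card := by
  classical
  refine Finset.card_le_card fun ℓ h => ?_
  have h : (F.regions P).par ℓ = some a := by
    have h' := h
    simp only [FaultRegions.children, Finset.mem_filter] at h'
    exact h'.2.1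
  exact F.mem_parCell.2 h

end Counts

end Scheme
end

/-! ### Lower bounds for the size of an error correction -/

noncomputable section

namespace Circuit

variable {S : GateSet} {W : Type} [Fintype W] [DecidableEq W] (C : Circuit S W)
variable (ops : (ℓ : C.Loc) → QMatrix (C.kind ℓ).arity)

theorem runMat_untouched {q : W} (hq : ∀ ℓ, ¬ C.Touches ℓ q) {y x : Config W}
    (h : C.runMat ops y x ≠ 0) : y q = x q := by
  have key : ∀ (l : List C.Loc) (y x : Config W),
      timeOrdered (l.map (C.locMat ops)) y x ≠ 0 → y q = x q := by
    intro l
    induction l with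
    | nil =>
      intro y x h
      rw [List.map_nil, timeOrdered_nil, Matrix.one_apply] at h
      by_cases hyx : y = x
      · rw [hyx]
      · exact absurd (if_neg hyx) h
    | cons ℓ l ih =>
      intro y x h
      rw [List.map_cons, timeOrdered_cons, Matrix.mul_apply] at h
      obtain ⟨u, -, hu⟩ := Finset.exists_ne_zero_of_sum_ne_zero h
      rw [ih y u (left_ne_zero_of_mul hu)]
      have h2 := right_ne_zero_of_mul hu
      rw [locMat, embed_apply] at h2
      by_contra hne
      refine h2 (if_neg fun h => hne (h q ?_))
      rintro ⟨v, hv⟩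
      exact hq ℓ ⟨v, hv⟩
  exact key _ y x h

theorem exists_runMat_inverse (hw : ∀ ℓ, Function.Injective (C.wire ℓ))
    (hops : ∀ ℓ, ∃ V, V * ops ℓ = 1) : ∃ V, V * C.runMat ops = 1 := by
  have key : ∀ l : List C.Loc, ∃ V, V * timeOrdered (l.map (C.locMat ops)) = 1 := by
    intro l
    induction l with
    | nil => exact ⟨1, one_mul _⟩
    | cons ℓ l ih =>
      obtain ⟨V, hV⟩ := ih
      obtain ⟨V', hV'⟩ := hops ℓ
      refine ⟨embed (C.wire ℓ) V' * V, ?_⟩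
      rw [List.map_cons, timeOrdered_cons, Matrix.mul_assoc, ← Matrix.mul_assoc V, hV,
        Matrix.one_mul, locMat, embed_mul (hw ℓ), hV', embed_one]
  exact key _

end Circuit

namespace Scheme

variable {S : GateSet} {F : Scheme S} (hF : F.FaultTolerant)
include hF

/-- The number of ancillas of an error correction is large enough to take up the errors. -/
theorem FaultTolerant.m_le_of_support (p : F.ec.Anc → Prop)
    (hp : ∀ z, (∃ q, ¬ p q ∧ z q = true) → F.ecKraus F.ec.circ.idealOps z = 0) :
    F.m ≤ {q | p q}.ncard + 1 := by
  classical
  let K := fun z => F.ecKraus F.ec.circ.idealOps z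
  let z' : ({q // p q} → Bool) → Config F.ec.Anc := fun u q => if h : p q then u ⟨q, h⟩ else false
  let Lin : (F.Block → ℂ) →ₗ[ℂ] ((({q // p q} → Bool) × Bool) → ℂ) :=
    { toFun := fun v ub => (F.enc.conjTranspose * K (z' ub.1)).mulVec v ub.2
      map_add' := fun v w => by
        funext ub
        exact congrFun (Matrix.mulVec_add _ v w) ub.2
      map_smul' := fun c v => by
        funext ub
        exact congrFun (Matrix.mulVec_smul _ c v) ub.2 }
  -- If all decoded slices vanish then so do the slices, which lie in the code space. The ideal
  -- circuit is invertible, hence the input was zero. Comparing dimensions, `2 ^ m ≤ 2 ^ (n + 1)`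
  -- with `n` the number of ancillas satisfying `p`: one logical qubit and `n` ancillas hold the
  -- entire input.
  have hinj : Function.Injective Lin := by
    rw [← LinearMap.ker_eq_bot, LinearMap.ker_eq_bot']
    intro v hv
    have hK : ∀ z, (K z).mulVec v = 0 := by
      intro z
      by_cases hz : ∃ q, ¬ p q ∧ z q = true
      · rw [show K z = 0 from hp z hz, Matrix.zero_mulVec]
      · push Not at hz
        have e : z' (fun q => z q.1) = z := by
          funext q
          by_cases hq : p q
          · exact dif_pos hq
          · exact (dif_neg hq).trans (by simpa using (hz q hq).symm)
        have h0 : (F.enc.conjTranspose * K z).mulVec v = 0 := by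
          funext b
          have := congrFun hv (fun q => z q.1, b)
          rw [← e]
          exact this
        rw [show K z = F.enc * (F.enc.conjTranspose * K z) from (hF.ecPerfect z).eq hF,
          ← Matrix.mulVec_mulVec, h0, Matrix.mulVec_zero]
    obtain ⟨V, hV⟩ := F.ec.circ.exists_runMat_inverse F.ec.circ.idealOps hF.ec_wf.wire_injective
      fun ℓ => exists_ideal_inverse _
    let φ : Config ((Fin 1 × Fin F.m) ⊕ F.ec.Anc) → ℂ := fun x =>
      if x ∘ Sum.inr = fun _ => false then v fun j => x (Sum.inl (0, j)) else 0
    have hφ : (F.ec.circ.runMat F.ec.circ.idealOps).mulVec φ = 0 := by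
      funext y
      have h := congrFun (hK (y ∘ Sum.inr)) fun j => y (Sum.inl (0, j))
      have hsum : (F.ec.circ.runMat F.ec.circ.idealOps).mulVec φ y =
          (K (y ∘ Sum.inr)).mulVec v fun j => y (Sum.inl (0, j)) := by
        simp only [Matrix.mulVec, dotProduct]
        refine (Finset.sum_of_injOn (fun x : F.Block => (Sum.elim (fun p => x p.2) fun _ => false :
          Config ((Fin 1 × Fin F.m) ⊕ F.ec.Anc))) ?_ ?_ ?_ ?_).symm
        · intro x _ x' _ h
          funext j
          exact congrFun h (Sum.inl (0, j))
        · intro x _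
          exact Finset.mem_coe.2 (Finset.mem_univ _)
        · intro x _ hx
          refine mul_eq_zero_of_right _ (if_neg fun h => hx ?_)
          refine ⟨fun j => x (Sum.inl (0, j)), Finset.mem_coe.2 (Finset.mem_univ _), ?_⟩
          funext q
          rcases q with ⟨i, j⟩ | q
          · rw [Subsingleton.elim i 0]
            rfl
          · exact (congrFun h q).symm
        · intro x _
          have e1 : φ (Sum.elim (fun p => x p.2) fun _ => false) = v x := if_pos rfl
          rw [e1]
          refine congrArg (· * v x) ?_
          change F.ec.circ.runMat _ _ _ = F.ec.circ.runMat _ _ _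
          congr 1
          funext q
          rcases q with ⟨i, j⟩ | q
          · rw [Subsingleton.elim i 0]
            rfl
          · rfl
      rw [hsum, h]
      rfl
    have hφ0 : φ = 0 := by
      rw [← Matrix.one_mulVec φ, ← hV, ← Matrix.mulVec_mulVec, hφ, Matrix.mulVec_zero]
    funext x
    have := congrFun hφ0 (Sum.elim (fun p => x p.2) fun _ => false)
    exact (if_pos rfl).symm.trans this
  have h := LinearMap.finrank_le_finrank_of_injective hinj
  rw [Module.finrank_fintype_fun_eq_card, Module.finrank_fintype_fun_eq_card, Fintype.card_prod,
    Fintype.card_fun, Fintype.card_fun, Fintype.card_bool, Fintype.card_fin, ← pow_succ] at h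
  have h := (Nat.pow_le_pow_iff_right (by norm_num)).1 h
  rwa [← Nat.card_eq_fintype_card] at h

/-- An error correction has at least five locations. -/
theorem FaultTolerant.five_le_ec_size : 5 ≤ F.ec.circ.size := by
  classical
  by_contra hlt
  have hm := hF.five_le_m
  -- Ancillas that are touched by some location. There are at least `m - 1 ≥ 4` of them, and each
  -- has its own preparation.
  let p : F.ec.Anc → Prop := fun q => ∃ ℓ, F.ec.circ.Touches ℓ (Sum.inr q)
  have h1 := hF.m_le_of_support p fun z ⟨q, hq, hz⟩ => by
    ext y x
    by_contra h
    have := F.ec.circ.runMat_untouched F.ec.circ.idealOps (q := Sum.inr q)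
      (fun ℓ hℓ => hq ⟨ℓ, hℓ⟩) h
    exact Bool.noConfusion (hz.symm.trans this)
  have hprep : ∀ q : {q // p q}, ∃ ℓ, F.ec.circ.kind ℓ = LocKind.prep ∧
      F.ec.circ.Touches ℓ (Sum.inr q.1) := by
    rintro ⟨q, ℓ, hℓ⟩
    obtain ⟨a, ha, hmin⟩ := Finset.exists_min_image
      (Finset.univ.filter fun a => F.ec.circ.Touches a (Sum.inr q)) F.ec.circ.layer
      ⟨ℓ, by simpa using hℓ⟩
    simp only [Finset.mem_filter, Finset.mem_univ, true_and] at ha hmin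
    exact ⟨a, hF.ec_wf.prep_of_first a (Sum.inr q) trivial ha hmin, ha⟩
  choose f hf using hprep
  have harity : ∀ ℓ, F.ec.circ.kind ℓ = LocKind.prep → ∀ q q', F.ec.circ.Touches ℓ q →
      F.ec.circ.Touches ℓ q' → q = q' := by
    rintro ℓ hℓ q q' ⟨i, rfl⟩ ⟨i', rfl⟩
    have : Subsingleton (Fin (F.ec.circ.kind ℓ).arity) := by
      rw [hℓ]
      exact inferInstanceAs (Subsingleton (Fin 1))
    rw [this.elim i i']
  have hfinj : Function.Injective f := by
    intro q q' h
    exact Subtype.ext (Sum.inr_injective (harity (f q) (hf q).1 _ _ (hf q).2 (h ▸ (hf q').2)))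
  have hcard : Fintype.card {q // p q} = {q | p q}.ncard := (Nat.card_eq_fintype_card).symm
  -- With fewer than five locations the preparations exhaust the circuit, which then acts as the
  -- identity and leaves all ancillas in `0`. The dimension count with no ancillas gives `m ≤ 1`.
  have hsurj : Function.Surjective f := by
    refine ((Fintype.bijective_iff_injective_and_card f).2 ⟨hfinj, ?_⟩).2
    have h2 := Fintype.card_le_of_injective f hfinj
    have h3 : Fintype.card F.ec.circ.Loc = F.ec.circ.size := rfl
    omega
  have hall : ∀ ℓ, F.ec.circ.idealOps ℓ = 1 := by
    intro ℓ
    obtain ⟨q, rfl⟩ := hsurj ℓ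
    rw [Circuit.idealOps, (hf q).1]
    rfl
  have hrun : F.ec.circ.runMat F.ec.circ.idealOps = 1 := by
    refine timeOrdered_eq_one _ _ fun ℓ _ => ?_
    rw [Circuit.locMat, hall, embed_one]
  have h2 := hF.m_le_of_support (fun _ => False) fun z ⟨q, _, hz⟩ => by
    ext y x
    refine (congrFun (congrFun hrun _) _).trans (Matrix.one_apply_ne fun h => ?_)
    exact Bool.noConfusion (hz.symm.trans (congrFun h (Sum.inr q)))
  simp at h2
  omega

/-- The extended rectangle of a measurement has at least five locations in its error correction and
measures at least five qubits. -/
theorem FaultTolerant.ten_le_maxExRecSize : 10 ≤ F.maxExRecSize := by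
  refine le_trans ?_ (F.exRecSize_le .meas)
  have h1 := hF.five_le_ec_size
  have h2 := hF.five_le_m
  have h3 : (F.rec1 (LocKind.meas : LocKind S)).circ.size = F.m := Fintype.card_fin F.m
  have h4 : (LocKind.meas : LocKind S).inputs = 1 := rfl
  rw [exRecSize, h3, h4]
  omega

/-- The strength of the faults of a simulation. -/
theorem FaultTolerant.norm_sum_bad_le {P : Program S} (hP : P.WellFormed) {E : Type*}
    [NormedAddCommGroup E] [NormedSpace ℝ E] {η : ℝ} (hη : 0 ≤ η)
    (hη' : (F.maxExRecSize.choose 2 : ℝ) * Real.exp (((F.maxExRecSize : ℝ) - 2) * η) * η < 1)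
    (Φ : Finset (F.encode P).circ.Loc → E)
    (hΦ : ∀ J : Finset (F.encode P).circ.Loc, J.Nonempty →
      ‖∑ c ∈ Finset.univ.filter (fun c => J ⊆ c), Φ c‖ ≤ η ^ J.card)
    (R : Finset P.circ.Loc) (hR : R.Nonempty)
    [DecidablePred fun c : Finset (F.encode P).circ.Loc => ∀ a ∈ R, (F.regions P).Bad ∅ c a] :
    ‖∑ c ∈ Finset.univ.filter (fun c => ∀ a ∈ R, (F.regions P).Bad ∅ c a), Φ c‖ ≤
      (F.maxExRecSize.choose 2 * Real.exp (((F.maxExRecSize : ℝ) - 2) * η) * η ^ 2) ^ R.card := by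
  have hA := hF.ten_le_maxExRecSize
  have hA' : (10 : ℝ) ≤ F.maxExRecSize := by exact_mod_cast hA
  have hh : 0 ≤ ((F.maxExRecSize : ℝ) - 1) * η := mul_nonneg (by linarith) hη
  refine FaultRegions.norm_sum_bad_le (G := F.regions P) (η := η)
    (w := chainRatio (((F.maxExRecSize : ℝ) - 1) * η) * η) (e := fun a => (F.parCell a).card)
    hη ?_ (F.card_children_le) (fun x => ?_) (fun a => ?_) Φ hΦ R hR
  · unfold chainRatio
    positivity
  · refine chain_weight_le hA hη hη' (Finset.card_pos.2 ⟨x, ?_⟩) _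
      (F.card_cell_add_card_parCell_le hP _)
    exact (F.regions P).mem_cell.2 rfl
  · refine bad_weight_le hA hη hη' _ _ (F.card_cell_add_card_parCell_le hP a) ?_
    have := hF.five_le_ec_size
    rcases F.parCell_card a with h | h
    · exact Or.inl h
    · exact Or.inr (this.trans h)

end Scheme
end

/-! ### States of register and bath -/

noncomputable section

section Bath

variable {W : Type} [Fintype W] [DecidableEq W]
variable {B : Type*} [NormedAddCommGroup B] [InnerProductSpace ℂ B]

/-- The product state `φ ⊗ β`. -/
def QState.pure (φ : Config W → ℂ) (β : B) : QState W B := QState.mk fun x => φ x • β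

@[simp] theorem QState.pure_apply (φ : Config W → ℂ) (β : B) (x : Config W) :
    QState.pure φ β x = φ x • β := rfl

theorem QState.sum_apply {ι : Type*} (s : Finset ι) (f : ι → QState W B) (x : Config W) :
    (∑ i ∈ s, f i) x = ∑ i ∈ s, f i x := by
  classical
  induction s using Finset.induction_on with
  | empty => rfl
  | insert i s hi ih => rw [Finset.sum_insert hi, Finset.sum_insert hi, ← ih, QState.add_apply]

variable (B) in
/-- The tensor product of a space of states of the register with the bath. -/
def bathSpan (V : Submodule ℂ (Config W → ℂ)) : Submodule ℂ (QState W B) :=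
  Submodule.span ℂ {ψ | ∃ φ ∈ V, ∃ β, ψ = QState.pure φ β}

theorem pure_mem_bathSpan {V : Submodule ℂ (Config W → ℂ)} {φ : Config W → ℂ} (h : φ ∈ V) (β : B) :
    QState.pure φ β ∈ bathSpan B V :=
  Submodule.subset_span ⟨φ, h, β, rfl⟩

theorem bathSpan_mono {V V' : Submodule ℂ (Config W → ℂ)} (h : V ≤ V') :
    bathSpan B V ≤ bathSpan B V' :=
  Submodule.span_mono fun _ ⟨φ, hφ, β, e⟩ => ⟨φ, h hφ, β, e⟩

theorem map_mem_bathSpan {B' : Type*} [AddCommGroup B'] [Module ℂ B']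
    {V : Submodule ℂ (Config W → ℂ)} {V' : Submodule ℂ B'}
    (L : QState W B →ₗ[ℂ] B') (h : ∀ φ ∈ V, ∀ β, L (QState.pure φ β) ∈ V') {ψ : QState W B}
    (hψ : ψ ∈ bathSpan B V) : L ψ ∈ V' := by
  induction hψ using Submodule.span_induction with
  | mem ψ hψ =>
    obtain ⟨φ, hφ, β, rfl⟩ := hψ
    exact h φ hφ β
  | zero => rw [map_zero]; exact Submodule.zero_mem _
  | add x y _ _ hx hy => rw [map_add]; exact Submodule.add_mem _ hx hy
  | smul a x _ hx => rw [map_smul]; exact Submodule.smul_mem _ a hx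

theorem mem_bathSpan_span {s : Set (Config W → ℂ)} {V' : Submodule ℂ (QState W B)}
    (h : ∀ φ ∈ s, ∀ β, QState.pure φ β ∈ V') : bathSpan B (Submodule.span ℂ s) ≤ V' := by
  refine Submodule.span_le.2 ?_
  rintro _ ⟨φ, hφ, β, rfl⟩
  induction hφ using Submodule.span_induction with
  | mem φ hφ => exact h φ hφ β
  | zero =>
    have e : QState.pure (0 : Config W → ℂ) β = 0 := by
      ext x
      exact zero_smul ℂ β
    exact e ▸ Submodule.zero_mem V'
  | add x y _ _ hx hy =>
    have e : QState.pure (x + y) β = QState.pure x β + QState.pure y β := by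
      ext u
      exact add_smul (x u) (y u) β
    exact e ▸ Submodule.add_mem V' hx hy
  | smul a x _ hx =>
    have e : QState.pure (a • x) β = a • QState.pure x β := by
      ext u
      exact mul_smul a (x u) β
    exact e ▸ Submodule.smul_mem V' a hx

theorem localOp_matrixOp_pure {n : ℕ} {e : Fin n → W} (he : Function.Injective e) (M : QMatrix n)
    (φ : Config W → ℂ) (β : B) :
    localOp e (matrixOp M) (QState.pure φ β) = QState.pure ((embed e M).mulVec φ) β := by
  ext x
  rw [QState.pure_apply, embed_mulVec he, Finset.sum_smul]
  refine Finset.sum_congr rfl fun u _ => ?_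
  exact smul_smul _ _ _

theorem bathOp_pure (u : B →L[ℂ] B) (φ : Config W → ℂ) (β : B) :
    bathOp u (QState.pure φ β) = QState.pure φ (u β) := by
  ext x
  exact map_smul u (φ x) β

theorem localOp_one {n : ℕ} {e : Fin n → W} :
    localOp e (1 : QState (Fin n) B →L[ℂ] QState (Fin n) B) = 1 := by
  ext ψ x
  change ψ (Function.extend e (x ∘ e) x) = ψ x
  congr 1
  funext q
  by_cases hq : ∃ i, e i = q
  · obtain ⟨i, rfl⟩ := hq
    have h : Function.extend e (x ∘ e) x = x := by
      funext q
      classical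
      rw [Function.extend_def]
      split_ifs with h
      · exact congrArg x h.choose_spec
      · rfl
    rw [h]
  · rw [Function.extend_apply' _ _ _ hq]

/-- An operator on qubits and bath is a sum of matrix units on the qubits tensored with operators on
the bath. So even a fault that entangles system and bath is a combination of faults on the system
alone. -/
theorem localOp_pure {n : ℕ} {e : Fin n → W} (he : Function.Injective e)
    (T : QState (Fin n) B →L[ℂ] QState (Fin n) B) (φ : Config W → ℂ) (β : B) :
    localOp e T (QState.pure φ β) = ∑ u, ∑ v,
      QState.pure ((embed e (Matrix.single u v 1)).mulVec φ) (T (QState.mk (Pi.single v β)) u) := by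
  ext x
  have h : (QState.mk (fun y => QState.pure φ β (Function.extend e y x)) : QState (Fin n) B) =
      ∑ v, φ (Function.extend e v x) • QState.mk (Pi.single v β) := by
    ext y
    rw [QState.sum_apply, Finset.sum_eq_single y]
    · simp
    · intro v _ hv
      simp [Pi.single_eq_of_ne' hv]
    · simp
  change T (QState.mk (fun y => QState.pure φ β (Function.extend e y x))) (x ∘ e) = _
  rw [h, map_sum, QState.sum_apply, QState.sum_apply]
  refine Eq.symm ((Finset.sum_eq_single (x ∘ e) (fun u _ hu => ?_) (by simp)).trans ?_)
  · rw [QState.sum_apply]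
    refine Finset.sum_eq_zero fun v _ => ?_
    rw [QState.pure_apply, embed_mulVec he, Finset.sum_eq_zero, zero_smul]
    intro w _
    simp [hu]
  · rw [QState.sum_apply]
    refine Finset.sum_congr rfl fun v _ => ?_
    rw [map_smul, QState.smul_apply, QState.pure_apply, embed_mulVec he, Finset.sum_eq_single v]
    · simp
    · intro w _ hw
      simp [hw.symm]
    · simp

end Bath

/-! ## Fault paths -/

namespace Program

variable {S : GateSet} (P : Program S) (c : Set P.circ.Loc)

/-- The states that are reached when the operations at the locations in `c` are arbitrary, those at
the other locations are `a`, and the locations after time step `t` have not been executed. -/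
def stage (t : ℕ) (a : (ℓ : P.circ.Loc) → QMatrix (P.circ.kind ℓ).arity) :
    Submodule ℂ (Config P.Qubit → ℂ) :=
  Submodule.span ℂ {φ | ∃ ops : (ℓ : P.circ.Loc) → QMatrix (P.circ.kind ℓ).arity,
    (∀ ℓ, ℓ ∉ c → ops ℓ = a ℓ) ∧ (∀ ℓ, t < P.circ.layer ℓ → ops ℓ = 1) ∧
    φ = (P.circ.runMat ops).mulVec (Pi.single (fun _ => false) 1)}

variable {P c}

theorem stage_succ (t : ℕ) (a : (ℓ : P.circ.Loc) → QMatrix (P.circ.kind ℓ).arity) :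
    P.stage c t a ≤ P.stage c (t + 1) a :=
  Submodule.span_mono fun _ ⟨ops, h1, h2, h3⟩ =>
    ⟨ops, h1, fun ℓ hℓ => h2 ℓ ((Nat.lt_succ_self t).trans hℓ), h3⟩

/-- Locations of later time steps still act as the identity, and those of the same step act on other
qubits. So an operator at `ℓ` moves back in time to `ℓ` and is absorbed there. -/
theorem embed_mul_runMat (hP : P.WellFormed) {t : ℕ}
    {ops : (ℓ : P.circ.Loc) → QMatrix (P.circ.kind ℓ).arity}
    (hops : ∀ ℓ, t < P.circ.layer ℓ → ops ℓ = 1) {ℓ : P.circ.Loc} (hℓ : P.circ.layer ℓ = t)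
    (M : QMatrix (P.circ.kind ℓ).arity) :
    embed (P.circ.wire ℓ) M * P.circ.runMat ops =
      P.circ.runMat (Function.update ops ℓ (M * ops ℓ)) := by
  classical
  have hup : ∀ ℓ', ℓ' ≠ ℓ → P.circ.locMat (Function.update ops ℓ (M * ops ℓ)) ℓ' =
      P.circ.locMat ops ℓ' := fun ℓ' h =>
    congrArg (embed (P.circ.wire ℓ')) (Function.update_of_ne h _ ops)
  have key : ∀ l : List P.circ.Loc, l.Pairwise (fun ℓ ℓ' => ℓ ≠ ℓ' ∧
      P.circ.layer ℓ ≤ P.circ.layer ℓ') → ℓ ∈ l →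
      embed (P.circ.wire ℓ) M * timeOrdered (l.map (P.circ.locMat ops)) =
      timeOrdered (l.map (P.circ.locMat (Function.update ops ℓ (M * ops ℓ)))) := by
    intro l hl hmem
    induction l with
    | nil => exact absurd hmem List.not_mem_nil
    | cons ℓ' l ih =>
      rw [List.pairwise_cons] at hl
      simp only [List.map_cons, timeOrdered_cons]
      by_cases h : ℓ' = ℓ
      · subst h
        have h1 : l.map (P.circ.locMat (Function.update ops ℓ' (M * ops ℓ'))) =
            l.map (P.circ.locMat ops) :=
          List.map_congr_left fun ℓ'' h'' => hup ℓ'' (hl.1 ℓ'' h'').1.symm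
        have h2 : Commute (embed (P.circ.wire ℓ') M) (timeOrdered (l.map (P.circ.locMat ops))) := by
          have h3 : ∀ ℓ'' ∈ l, Commute (embed (P.circ.wire ℓ') M) (P.circ.locMat ops ℓ'') := by
            intro ℓ'' h''
            obtain ⟨hne, hle⟩ := hl.1 ℓ'' h''
            rcases hle.lt_or_eq with hlt | heq
            · have : P.circ.locMat ops ℓ'' = 1 := by
                rw [Circuit.locMat, hops ℓ'' (hℓ ▸ hlt), embed_one]
              rw [this]
              exact Commute.one_right _
            · refine embed_commute (hP.wire_injective ℓ') (hP.wire_injective ℓ'')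
                (fun v v' hv => hne ?_) _ _
              exact hP.disjoint ℓ' ℓ'' _ heq ⟨v, rfl⟩ ⟨v', hv.symm⟩
          clear ih hl h1 hmem
          induction l with
          | nil => exact Commute.one_right _
          | cons a l ih =>
            rw [List.map_cons, timeOrdered_cons]
            exact (ih fun b hb => h3 b (List.mem_cons_of_mem _ hb)).mul_right
              (h3 a List.mem_cons_self)
        have h4 : P.circ.locMat (Function.update ops ℓ' (M * ops ℓ')) ℓ' =
            embed (P.circ.wire ℓ') M * P.circ.locMat ops ℓ' := by
          refine Eq.trans ?_ (embed_mul (hP.wire_injective ℓ') M (ops ℓ')).symm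
          exact congrArg (embed (P.circ.wire ℓ')) (Function.update_self ℓ' _ ops)
        rw [h1, h4, ← Matrix.mul_assoc, h2.eq, Matrix.mul_assoc]
      · rw [← Matrix.mul_assoc, hup ℓ' h, ih hl.2 ((List.mem_cons.1 hmem).resolve_left (Ne.symm h))]
  exact key _ P.circ.order_pairwise (P.circ.mem_order hP.layer_lt ℓ)

variable {B : Type*} [NormedAddCommGroup B] [InnerProductSpace ℂ B]

theorem gate_mem_stage (hP : P.WellFormed) {ℓ : P.circ.Loc}
    (M : QMatrix (P.circ.kind ℓ).arity) (a : (ℓ : P.circ.Loc) → QMatrix (P.circ.kind ℓ).arity)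
    {φ : Config P.Qubit → ℂ} (hφ : φ ∈ P.stage c (P.circ.layer ℓ) a) :
    (embed (P.circ.wire ℓ) M).mulVec φ ∈
      P.stage c (P.circ.layer ℓ) (Function.update a ℓ (M * a ℓ)) := by
  classical
  induction hφ using Submodule.span_induction with
  | mem φ hφ =>
    obtain ⟨ops, h1, h2, rfl⟩ := hφ
    refine Submodule.subset_span ⟨Function.update ops ℓ (M * ops ℓ), fun ℓ' hc => ?_,
      fun ℓ' ht => ?_, ?_⟩
    · by_cases h : ℓ' = ℓ
      · subst h
        rw [Function.update_self, Function.update_self, h1 _ hc]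
      · rw [Function.update_of_ne h, Function.update_of_ne h, h1 _ hc]
    · rw [Function.update_of_ne (fun h => by rw [h] at ht; exact lt_irrefl _ ht), h2 _ ht]
    · rw [Matrix.mulVec_mulVec, embed_mul_runMat hP h2 rfl]
  | zero => rw [Matrix.mulVec_zero]; exact Submodule.zero_mem _
  | add x y _ _ hx hy => rw [Matrix.mulVec_add]; exact Submodule.add_mem _ hx hy
  | smul r x _ hx => rw [Matrix.mulVec_smul]; exact Submodule.smul_mem _ r hx

theorem stage_congr {t : ℕ} {a a' : (ℓ : P.circ.Loc) → QMatrix (P.circ.kind ℓ).arity}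
    (h : ∀ ℓ, ℓ ∉ c → a ℓ = a' ℓ) : P.stage c t a = P.stage c t a' := by
  have : ∀ {a a' : (ℓ : P.circ.Loc) → QMatrix (P.circ.kind ℓ).arity},
      (∀ ℓ, ℓ ∉ c → a ℓ = a' ℓ) → P.stage c t a ≤ P.stage c t a' := fun h =>
    Submodule.span_mono fun _ ⟨ops, h1, h2, h3⟩ =>
      ⟨ops, fun ℓ hc => (h1 ℓ hc).trans (h ℓ hc), h2, h3⟩
  exact le_antisymm (this h) (this fun ℓ hc => (h ℓ hc).symm)

theorem matrixOp_mem_bathSpan_stage (hP : P.WellFormed) {ℓ : P.circ.Loc}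
    (M : QMatrix (P.circ.kind ℓ).arity) {a : (ℓ : P.circ.Loc) → QMatrix (P.circ.kind ℓ).arity}
    {ψ : QState P.Qubit B} (hψ : ψ ∈ bathSpan B (P.stage c (P.circ.layer ℓ) a)) :
    localOp (P.circ.wire ℓ) (matrixOp M) ψ ∈
      bathSpan B (P.stage c (P.circ.layer ℓ) (Function.update a ℓ (M * a ℓ))) := by
  refine map_mem_bathSpan
    (localOp (P.circ.wire ℓ) (matrixOp M) : QState P.Qubit B →L[ℂ] QState P.Qubit B).toLinearMap
    (fun φ hφ β => ?_) hψ
  change localOp (P.circ.wire ℓ) (matrixOp M) (QState.pure φ β) ∈ _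
  rw [localOp_matrixOp_pure (hP.wire_injective ℓ)]
  exact pure_mem_bathSpan (gate_mem_stage hP M a hφ) β

/-- At a location of `c` the operation is arbitrary in any case, so absorbing a further operator
there changes nothing. -/
theorem localOp_mem_bathSpan_stage (hP : P.WellFormed) {ℓ : P.circ.Loc} (hℓ : ℓ ∈ c)
    (T : QState (Fin (P.circ.kind ℓ).arity) B →L[ℂ] QState (Fin (P.circ.kind ℓ).arity) B)
    {a : (ℓ : P.circ.Loc) → QMatrix (P.circ.kind ℓ).arity}
    {ψ : QState P.Qubit B} (hψ : ψ ∈ bathSpan B (P.stage c (P.circ.layer ℓ) a)) :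
    localOp (P.circ.wire ℓ) T ψ ∈ bathSpan B (P.stage c (P.circ.layer ℓ) a) := by
  refine map_mem_bathSpan
    (localOp (P.circ.wire ℓ) T : QState P.Qubit B →L[ℂ] QState P.Qubit B).toLinearMap
    (fun φ hφ β => ?_) hψ
  change localOp (P.circ.wire ℓ) T (QState.pure φ β) ∈ _
  rw [localOp_pure (hP.wire_injective ℓ)]
  refine Submodule.sum_mem _ fun u _ => Submodule.sum_mem _ fun v _ => pure_mem_bathSpan ?_ _
  have h := gate_mem_stage hP (Matrix.single u v 1) a hφ
  rwa [stage_congr (a' := a)] at h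
  intro ℓ' hc
  rw [Function.update_of_ne]
  rintro rfl
  exact hc hℓ

theorem mem_bathSpan_stage_of_eq {t : ℕ} {a a' : (ℓ : P.circ.Loc) → QMatrix (P.circ.kind ℓ).arity}
    (h : ∀ ℓ, a ℓ = a' ℓ) {ψ : QState P.Qubit B} (hψ : ψ ∈ bathSpan B (P.stage c t a)) :
    ψ ∈ bathSpan B (P.stage c t a') := by
  obtain rfl : a = a' := funext h
  exact hψ

theorem bathOp_mem_bathSpan {V : Submodule ℂ (Config P.Qubit → ℂ)} (u : B →L[ℂ] B)
    {ψ : QState P.Qubit B} (hψ : ψ ∈ bathSpan B V) : bathOp u ψ ∈ bathSpan B V := by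
  refine map_mem_bathSpan
    (bathOp u : QState P.Qubit B →L[ℂ] QState P.Qubit B).toLinearMap (fun φ hφ β => ?_) hψ
  change bathOp u (QState.pure φ β) ∈ _
  rw [bathOp_pure]
  exact pure_mem_bathSpan hφ _

end Program

namespace Noise

variable {S : GateSet} {P : Program S} {B : Type*} [NormedAddCommGroup B]
  [InnerProductSpace ℂ B] [CompleteSpace B] (N : Noise P B)

/-- The operators of an interval, in chronological order. -/
def interval (factor : (ℓ : P.circ.Loc) → Fin N.steps →
    (QState (Fin (P.circ.kind ℓ).arity) B →L[ℂ] QState (Fin (P.circ.kind ℓ).arity) B))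
    (t : ℕ) (s : Fin N.steps) : List (QState P.Qubit B →L[ℂ] QState P.Qubit B) :=
  ((N.order t s).map fun ℓ => localOp (P.circ.wire ℓ) (factor ℓ s)) ++
    [bathOp (N.bathStep t s : B →L[ℂ] B)] ++
    ((N.order t s).map fun ℓ => localOp (P.circ.wire ℓ) (matrixOp (N.gateStep ℓ s)))

/-- A fault path maps the initial state to a state that is reached by arbitrary operations at its
faulty locations. -/
theorem evolveWith_mem (hP : P.WellFormed) {c : Set P.circ.Loc}
    {factor : (ℓ : P.circ.Loc) → Fin N.steps →
      (QState (Fin (P.circ.kind ℓ).arity) B →L[ℂ] QState (Fin (P.circ.kind ℓ).arity) B)}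
    (hc : ∀ ℓ, ℓ ∉ c → ∀ s, factor ℓ s = 1) (β : B) :
    N.evolveWith factor (zeroState P.Qubit β) ∈ bathSpan B (P.reach c) := by
  classical
  -- Interactions act trivially at locations outside `c` and are absorbed at locations in `c`.
  have hinter : ∀ (t : ℕ) (s : Fin N.steps) (a : (ℓ : P.circ.Loc) → QMatrix (P.circ.kind ℓ).arity)
      (l : List P.circ.Loc), (∀ ℓ ∈ l, P.circ.layer ℓ = t) → ∀ ψ ∈ bathSpan B (P.stage c t a),
      timeOrdered (l.map fun ℓ => localOp (P.circ.wire ℓ) (factor ℓ s)) ψ ∈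
        bathSpan B (P.stage c t a) := by
    intro t s a l hl
    induction l with
    | nil => intro ψ hψ; exact hψ
    | cons ℓ l ih =>
      intro ψ hψ
      rw [List.map_cons, timeOrdered_cons]
      refine ih (fun ℓ' h => hl ℓ' (List.mem_cons_of_mem _ h))
        (localOp (P.circ.wire ℓ) (factor ℓ s) ψ) ?_
      by_cases h : ℓ ∈ c
      · have ht := hl ℓ List.mem_cons_self
        subst ht
        exact Program.localOp_mem_bathSpan_stage hP h _ hψ
      · rw [hc ℓ h s, localOp_one]
        exact hψ
  have hgate : ∀ (t : ℕ) (s : Fin N.steps) (l : List P.circ.Loc), l.Nodup →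
      (∀ ℓ ∈ l, P.circ.layer ℓ = t) →
      ∀ (a : (ℓ : P.circ.Loc) → QMatrix (P.circ.kind ℓ).arity), ∀ ψ ∈ bathSpan B (P.stage c t a),
      timeOrdered (l.map fun ℓ => localOp (P.circ.wire ℓ) (matrixOp (N.gateStep ℓ s))) ψ ∈
        bathSpan B (P.stage c t fun ℓ => if ℓ ∈ l then N.gateStep ℓ s * a ℓ else a ℓ) := by
    intro t s l hn hl
    induction l with
    | nil =>
      intro a ψ hψ
      simpa using hψ
    | cons ℓ l ih =>
      intro a ψ hψ
      rw [List.nodup_cons] at hn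
      have ht := hl ℓ List.mem_cons_self
      subst ht
      have h := ih hn.2 (fun ℓ' h => hl ℓ' (List.mem_cons_of_mem _ h)) _ _
        (Program.matrixOp_mem_bathSpan_stage hP (N.gateStep ℓ s) hψ)
      rw [List.map_cons, timeOrdered_cons]
      refine Program.mem_bathSpan_stage_of_eq (fun ℓ' => ?_) h
      by_cases h' : ℓ' = ℓ
      · subst h'
        rw [if_pos List.mem_cons_self, if_neg hn.1, Function.update_self]
      · rw [Function.update_of_ne h']
        exact ite_eq_of_iff (by simp [h']) _ _
  -- After the intervals in `l`, a location of time step `t` has accumulated the product of its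
  -- partial gates. These intermediate operations are why `stage` is relative to general operations
  -- `a`.
  have hstep : ∀ (t : ℕ) (a : (ℓ : P.circ.Loc) → QMatrix (P.circ.kind ℓ).arity)
      (l : List (Fin N.steps)), ∀ ψ ∈ bathSpan B (P.stage c t a),
      timeOrdered (l.flatMap fun s => N.interval factor t s) ψ ∈
        bathSpan B (P.stage c t fun ℓ => if P.circ.layer ℓ = t then
          timeOrdered (l.map (N.gateStep ℓ)) * a ℓ else a ℓ) := by
    intro t a l
    induction l using List.reverseRecOn with
    | nil =>
      intro ψ hψ
      simpa using hψ
    | append_singleton l s ih =>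
      intro ψ hψ
      rw [List.flatMap_append, timeOrdered_append, List.flatMap_singleton, interval,
        timeOrdered_append, timeOrdered_append]
      have h1 := hinter t s _ (N.order t s) (fun ℓ h => (N.mem_order t s ℓ).1 h) _ (ih ψ hψ)
      have h2 := Program.bathOp_mem_bathSpan (N.bathStep t s : B →L[ℂ] B) h1
      have h3 := hgate t s (N.order t s) (N.order_nodup t s)
        (fun ℓ h => (N.mem_order t s ℓ).1 h) _ _ h2
      refine Program.mem_bathSpan_stage_of_eq (fun ℓ => ?_) h3
      · simp only [N.mem_order]
        by_cases h : P.circ.layer ℓ = t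
        · rw [if_pos h, if_pos h, if_pos h, List.map_append, timeOrdered_append, List.map_singleton,
            timeOrdered_cons, timeOrdered_nil, one_mul, mul_assoc]
        · rw [if_neg h, if_neg h, if_neg h]
  have hlayer : ∀ n : ℕ, timeOrdered ((List.range n).flatMap fun t =>
      (List.finRange N.steps).flatMap fun s => N.interval factor t s)
        (zeroState P.Qubit β) ∈ bathSpan B (P.stage c n fun ℓ =>
          if P.circ.layer ℓ < n then P.circ.idealOps ℓ else 1) := by
    intro n
    induction n with
    | zero =>
      have e : zeroState P.Qubit β = QState.pure ((P.circ.runMat fun _ => 1).mulVec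
          (Pi.single (fun _ => false) 1)) β := by
        have h1 : P.circ.runMat (fun _ => 1) = 1 := by
          refine timeOrdered_eq_one _ _ fun ℓ _ => embed_one _
        rw [h1, Matrix.one_mulVec]
        ext x
        rw [QState.pure_apply, Pi.single_apply, ite_smul, one_smul, zero_smul]
        exact ite_eq_of_iff Iff.rfl _ _
      have hm : (P.circ.runMat fun _ => 1).mulVec (Pi.single (fun _ => false) 1) ∈
          P.stage c 0 fun ℓ => if P.circ.layer ℓ < 0 then P.circ.idealOps ℓ else 1 :=
        Submodule.subset_span ⟨fun _ => 1, fun ℓ _ => (if_neg (Nat.not_lt_zero _)).symm,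
          fun ℓ _ => rfl, rfl⟩
      rw [e]
      exact pure_mem_bathSpan hm β
    | succ n ih =>
      rw [List.range_succ, List.flatMap_append, timeOrdered_append, List.flatMap_singleton]
      have h := hstep n _ (List.finRange N.steps) _ ih
      refine bathSpan_mono (Program.stage_succ n _) ?_
      refine Program.mem_bathSpan_stage_of_eq (fun ℓ => ?_) h
      · by_cases h1 : P.circ.layer ℓ = n
        · have h2 : ¬ P.circ.layer ℓ < n := by omega
          have h3 : P.circ.layer ℓ < n + 1 := by omega
          -- Over a full time step the partial gates multiply to the ideal operation; before its
          -- time step a location counts as the identity.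
          rw [if_pos h1, if_neg h2, if_pos h3, ← List.ofFn_eq_map, N.gateStep_prod, mul_one]
          rfl
        · rw [if_neg h1]
          exact ite_eq_of_iff (by omega) _ _
  refine bathSpan_mono ?_ (hlayer P.circ.depth)
  refine Submodule.span_mono ?_
  rintro _ ⟨ops, h1, -, rfl⟩
  exact ⟨ops, fun ℓ h => (h1 ℓ h).trans (if_pos (hP.layer_lt ℓ)), rfl⟩

end Noise
end

/-! ### Expansion of the noisy evolution into fault paths, and norms -/

noncomputable section

/-- The expansion of a product of sums, each of which occurs at most once. -/
theorem sum_timeOrdered_powerset {R κ Λ : Type*} [Ring R] [DecidableEq Λ] (lab : κ → Option Λ)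
    (X Y : κ → R) (l : List κ) (hn : (l.filterMap lab).Nodup) :
    ∑ p ∈ (l.filterMap lab).toFinset.powerset,
      timeOrdered (l.map fun k => (lab k).elim (X k) fun a => if a ∈ p then Y k else X k) =
    timeOrdered (l.map fun k => (lab k).elim (X k) fun _ => X k + Y k) := by
  induction l with
  | nil => simp
  | cons k l ih =>
    rcases hk : lab k with _ | a
    · rw [List.filterMap_cons_none hk] at hn ⊢
      simp only [List.map_cons, timeOrdered_cons, hk, Option.elim_none]
      rw [← Finset.sum_mul, ih hn]
    · rw [List.filterMap_cons_some hk] at hn ⊢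
      rw [List.nodup_cons] at hn
      have ha : a ∉ (l.filterMap lab).toFinset := fun h => hn.1 (List.mem_toFinset.1 h)
      rw [List.toFinset_cons, Finset.sum_powerset_insert ha]
      simp only [List.map_cons, timeOrdered_cons, hk, Option.elim_some]
      have h1 : ∀ p ∈ (l.filterMap lab).toFinset.powerset, timeOrdered (l.map fun k =>
          (lab k).elim (X k) fun b => if b ∈ p then Y k else X k) * (if a ∈ p then Y k else X k) =
          timeOrdered (l.map fun k =>
            (lab k).elim (X k) fun b => if b ∈ p then Y k else X k) * X k := fun p hp => by
        rw [if_neg fun h => ha (Finset.mem_powerset.1 hp h)]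
      have h2 : ∀ p ∈ (l.filterMap lab).toFinset.powerset, timeOrdered (l.map fun k =>
          (lab k).elim (X k) fun b => if b ∈ insert a p then Y k else X k) *
            (if a ∈ insert a p then Y k else X k) =
          timeOrdered (l.map fun k =>
            (lab k).elim (X k) fun b => if b ∈ p then Y k else X k) * Y k := fun p hp => by
        rw [if_pos (Finset.mem_insert_self a p)]
        congr 2
        refine List.map_congr_left fun k' hk' => ?_
        rcases hb : lab k' with _ | b
        · rfl
        · have hba : b ≠ a := by
            rintro rfl
            exact hn.1 (List.mem_filterMap.2 ⟨k', hk', hb⟩)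
          simp [hba]
      rw [Finset.sum_congr rfl h1, Finset.sum_congr rfl h2, ← Finset.sum_mul, ← Finset.sum_mul,
        ih hn.2, mul_add]

section Norms

variable {W : Type} [Fintype W] [DecidableEq W]
variable {B : Type*} [NormedAddCommGroup B] [InnerProductSpace ℂ B]

theorem localOp_add {n : ℕ} (e : Fin n → W) (T T' : QState (Fin n) B →L[ℂ] QState (Fin n) B) :
    localOp e (T + T') = localOp e T + localOp e T' := by
  ext ψ x
  rfl

/-- For each configuration of the other qubits, the amplitudes form a state of the local qubits and
the bath, on which `T` acts; squared norms add up over these configurations. -/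
theorem norm_le_norm_localOp {n : ℕ} {e : Fin n → W} (he : Function.Injective e)
    {T : QState (Fin n) B →L[ℂ] QState (Fin n) B} (hT : ∀ ψ, ‖ψ‖ ≤ ‖T ψ‖) (ψ : QState W B) :
    ‖ψ‖ ≤ ‖localOp e T ψ‖ := by
  refine (sq_le_sq₀ (norm_nonneg _) (norm_nonneg _)).1 ?_
  rw [QState.norm_sq_eq, QState.norm_sq_eq]
  rw [← (splitEquiv Bool he).symm.sum_comp, ← (splitEquiv Bool he).symm.sum_comp,
    Fintype.sum_prod_type_right, Fintype.sum_prod_type_right]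
  refine Finset.sum_le_sum fun r _ => ?_
  have hx : ∀ u : Config (Fin n), ((splitEquiv Bool he).symm (u, r)) ∘ e = u := fun u =>
    congrArg Prod.fst ((splitEquiv Bool he).apply_symm_apply (u, r))
  have hr : ∀ u : Config (Fin n), ∀ q : Outside e, (splitEquiv Bool he).symm (u, r) q.1 = r q :=
    fun u => congrFun (congrArg Prod.snd ((splitEquiv Bool he).apply_symm_apply (u, r)))
  have hext : ∀ u y : Config (Fin n), Function.extend e y ((splitEquiv Bool he).symm (u, r)) =
      (splitEquiv Bool he).symm (y, r) := by
    intro u y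
    funext q
    by_cases hq : ∃ i, e i = q
    · obtain ⟨i, rfl⟩ := hq
      rw [he.extend_apply]
      exact (congrFun (hx y) i).symm
    · rw [Function.extend_apply' _ _ _ hq]
      exact (hr u ⟨q, hq⟩).trans (hr y ⟨q, hq⟩).symm
  have h := hT (QState.mk fun y => ψ ((splitEquiv Bool he).symm (y, r)))
  have h := pow_le_pow_left₀ (norm_nonneg _) h 2
  rw [QState.norm_sq_eq, QState.norm_sq_eq] at h
  refine h.trans_eq (Finset.sum_congr rfl fun u _ => ?_)
  change _ = ‖T (QState.mk fun y => ψ (Function.extend e y ((splitEquiv Bool he).symm (u, r))))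
    (((splitEquiv Bool he).symm (u, r)) ∘ e)‖ ^ 2
  rw [hx]
  simp only [hext]

theorem norm_bathOp (u : B ≃ₗᵢ[ℂ] B) (ψ : QState W B) : ‖bathOp (u : B →L[ℂ] B) ψ‖ = ‖ψ‖ := by
  rw [← sq_eq_sq₀ (norm_nonneg _) (norm_nonneg _), QState.norm_sq_eq, QState.norm_sq_eq]
  refine Finset.sum_congr rfl fun x _ => ?_
  exact congrArg (· ^ 2) (u.norm_map (ψ x))

/-- Combining vectors with the coefficients in the rows of a matrix with orthogonal columns. -/
theorem sum_norm_sq_combination {ι κ : Type*} [Fintype ι] [Fintype κ] [DecidableEq κ]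
    (M : ι → κ → ℂ) (w : κ → ℝ)
    (hM : ∀ x x', ∑ i, star (M i x) * M i x' = if x = x' then (w x : ℂ) else 0) (v : κ → B) :
    ∑ i, ‖∑ x, M i x • v x‖ ^ 2 = ∑ x, w x * ‖v x‖ ^ 2 := by
  have h : ((∑ i, ‖∑ x, M i x • v x‖ ^ 2 : ℝ) : ℂ) = ((∑ x, w x * ‖v x‖ ^ 2 : ℝ) : ℂ) := by
    push_cast
    have h1 : ∀ i, ((‖∑ x, M i x • v x‖ : ℂ)) ^ 2 =
        ∑ x, ∑ x', star (M i x) * M i x' * inner ℂ (v x) (v x') := by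
      intro i
      have := inner_self_eq_norm_sq_to_K (𝕜 := ℂ) (∑ x, M i x • v x)
      refine this.symm.trans ?_
      rw [sum_inner]
      refine Finset.sum_congr rfl fun x _ => ?_
      rw [inner_sum]
      refine Finset.sum_congr rfl fun x' _ => ?_
      rw [inner_smul_left, inner_smul_right, mul_assoc]
      rfl
    simp only [h1]
    rw [Finset.sum_comm]
    refine Finset.sum_congr rfl fun x _ => ?_
    rw [Finset.sum_comm]
    have h2 : ∀ x', ∑ i, star (M i x) * M i x' * inner ℂ (v x) (v x') =
        (if x = x' then (w x : ℂ) else 0) * inner ℂ (v x) (v x') := fun x' => by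
      rw [← Finset.sum_mul, hM]
    simp only [h2, ite_mul, zero_mul, Finset.sum_ite_eq, Finset.mem_univ, if_true]
    rw [inner_self_eq_norm_sq_to_K]
    rfl
  exact_mod_cast h

theorem norm_matrixOp {n : ℕ} {M : QMatrix n} (hM : M ∈ unitary (QMatrix n))
    (ψ : QState (Fin n) B) : ‖matrixOp M ψ‖ = ‖ψ‖ := by
  rw [← sq_eq_sq₀ (norm_nonneg _) (norm_nonneg _), QState.norm_sq_eq, QState.norm_sq_eq]
  have h := sum_norm_sq_combination M (fun _ => 1) (fun x x' => ?_) ψ.amp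
  · simp only [one_mul] at h
    exact h
  · have := congrFun (congrFun hM.1 x) x'
    rw [Matrix.one_apply] at this
    rw [Complex.ofReal_one, ← this]
    rfl

variable {H : Type*} [NormedAddCommGroup H] [InnerProductSpace ℂ H] [CompleteSpace H]

/-- For self-adjoint `A` the number `⟨ψ, Aψ⟩` is real, so the cross term in the squared norm is
purely imaginary and drops out. -/
theorem norm_le_norm_one_add {A : H →L[ℂ] H} (hA : IsSelfAdjoint A) (r : ℝ) (ψ : H) :
    ‖ψ‖ ≤ ‖(1 + (-(Complex.I * (r : ℂ))) • A) ψ‖ := by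
  refine (sq_le_sq₀ (norm_nonneg _) (norm_nonneg _)).1 ?_
  have e : (1 + (-(Complex.I * (r : ℂ))) • A) ψ = ψ + (-(Complex.I * (r : ℂ))) • A ψ := rfl
  rw [e, norm_add_sq (𝕜 := ℂ), inner_smul_right]
  have h : inner ℂ ψ (A ψ) = ((RCLike.re (inner ℂ ψ (A ψ)) : ℝ) : ℂ) :=
    (hA.isSymmetric.coe_re_inner_self_apply ψ).symm
  have h0 : RCLike.re (-(Complex.I * (r : ℂ)) * inner ℂ ψ (A ψ)) = (0 : ℝ) := by
    rw [h]
    simp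
  rw [h0]
  nlinarith [sq_nonneg ‖(-(Complex.I * (r : ℂ))) • A ψ‖]

theorem norm_exp_apply {A : H →L[ℂ] H} (hA : IsSelfAdjoint A) (r : ℝ) (ψ : H) :
    ‖NormedSpace.exp ((-(Complex.I * (r : ℂ))) • A) ψ‖ = ‖ψ‖ := by
  have h : IsSelfAdjoint ((-(r : ℂ)) • A) := by
    rw [IsSelfAdjoint, star_smul, hA.star_eq]
    simp
  have e : (-(Complex.I * (r : ℂ))) • A = Complex.I • ((-(r : ℂ)) • A) := by
    rw [smul_smul, mul_neg]
  rw [e]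
  exact ContinuousLinearMap.norm_map_of_mem_unitary
    (selfAdjoint.expUnitary (⟨(-(r : ℂ)) • A, h⟩ : selfAdjoint (H →L[ℂ] H))).2 ψ

end Norms

namespace Noise

variable {S : GateSet} {P : Program S} {B : Type*} [NormedAddCommGroup B]
  [InnerProductSpace ℂ B] [CompleteSpace B] (N : Noise P B)

/-- The operators of the evolution: the interactions at the microlocations, the evolution of the
bath, and the gates. -/
abbrev Slot : Type :=
  (P.circ.Loc × Fin N.steps) ⊕ ((ℕ × Fin N.steps) ⊕ (P.circ.Loc × Fin N.steps))

/-- The microlocation to which an operator belongs. -/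
def Slot.label : N.Slot → Option (P.circ.Loc × Fin N.steps) := Sum.elim some fun _ => none

/-- The operators in chronological order. -/
def slots : List N.Slot :=
  (List.range P.circ.depth).flatMap fun t => (List.finRange N.steps).flatMap fun s =>
    ((N.order t s).map fun ℓ => Sum.inl (ℓ, s)) ++ [Sum.inr (Sum.inl (t, s))] ++
      ((N.order t s).map fun ℓ => Sum.inr (Sum.inr (ℓ, s)))

/-- The operator of a slot. -/
def slotOp (factor : (ℓ : P.circ.Loc) → Fin N.steps →
    (QState (Fin (P.circ.kind ℓ).arity) B →L[ℂ] QState (Fin (P.circ.kind ℓ).arity) B)) :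
    N.Slot → (QState P.Qubit B →L[ℂ] QState P.Qubit B)
  | .inl (ℓ, s) => localOp (P.circ.wire ℓ) (factor ℓ s)
  | .inr (.inl (t, s)) => bathOp (N.bathStep t s : B →L[ℂ] B)
  | .inr (.inr (ℓ, s)) => localOp (P.circ.wire ℓ) (matrixOp (N.gateStep ℓ s))

theorem evolveWith_eq (factor : (ℓ : P.circ.Loc) → Fin N.steps →
    (QState (Fin (P.circ.kind ℓ).arity) B →L[ℂ] QState (Fin (P.circ.kind ℓ).arity) B)) :
    N.evolveWith factor = timeOrdered (N.slots.map (N.slotOp factor)) := by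
  rw [evolveWith, slots, List.map_flatMap]
  congr 2
  funext t
  rw [List.map_flatMap]
  congr 1
  funext s
  rw [List.map_append, List.map_append, List.map_map, List.map_map, List.map_singleton]
  rfl

theorem slots_label : N.slots.filterMap (Slot.label N) =
    (List.range P.circ.depth).flatMap fun t => (List.finRange N.steps).flatMap fun s =>
      (N.order t s).map fun ℓ => (ℓ, s) := by
  rw [slots, List.filterMap_flatMap]
  congr 1
  funext t
  rw [List.filterMap_flatMap]
  congr 1
  funext s
  have h1 : ∀ l : List P.circ.Loc, (l.map fun ℓ => (Sum.inl (ℓ, s) : N.Slot)).filterMap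
      (Slot.label N) = l.map fun ℓ => (ℓ, s) := by
    intro l
    induction l with
    | nil => rfl
    | cons a l ih => exact congrArg ((a, s) :: ·) ih
  have h2 : ∀ l : List P.circ.Loc, (l.map fun ℓ => (Sum.inr (Sum.inr (ℓ, s)) : N.Slot)).filterMap
      (Slot.label N) = [] := by
    intro l
    induction l with
    | nil => rfl
    | cons a l ih => rw [List.map_cons, List.filterMap_cons_none rfl, ih]
  rw [List.filterMap_append, List.filterMap_append, h1, h2, List.append_nil]
  exact List.append_nil _

theorem slots_label_nodup : (N.slots.filterMap (Slot.label N)).Nodup := by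
  rw [slots_label, List.nodup_flatMap]
  refine ⟨fun t _ => ?_, ?_⟩
  · rw [List.nodup_flatMap]
    refine ⟨fun s _ => ?_, ?_⟩
    · exact (N.order_nodup t s).map fun ℓ ℓ' h => congrArg Prod.fst h
    · refine (List.nodup_finRange _).imp fun {s s'} h => ?_
      refine List.disjoint_left.2 fun x hx hx' => h ?_
      rw [List.mem_map] at hx hx'
      obtain ⟨ℓ, -, rfl⟩ := hx
      obtain ⟨ℓ', -, h⟩ := hx'
      exact (congrArg Prod.snd h).symm
  · refine List.nodup_range.imp fun {t t'} h => ?_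
    refine List.disjoint_left.2 fun x hx hx' => h ?_
    have key : ∀ t, (x ∈ (List.finRange N.steps).flatMap fun s => (N.order t s).map fun ℓ => (ℓ, s)) →
        P.circ.layer x.1 = t := by
      intro t hx
      rw [List.mem_flatMap] at hx
      obtain ⟨s, -, hx⟩ := hx
      rw [List.mem_map] at hx
      obtain ⟨ℓ, hℓ, rfl⟩ := hx
      exact (N.mem_order t s ℓ).1 hℓ
    rw [← key t hx, ← key t' hx']

theorem slots_label_toFinset (hP : P.WellFormed) :
    (N.slots.filterMap (Slot.label N)).toFinset = Finset.univ := by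
  rw [Finset.eq_univ_iff_forall]
  rintro ⟨ℓ, s⟩
  rw [List.mem_toFinset, slots_label, List.mem_flatMap]
  refine ⟨P.circ.layer ℓ, List.mem_range.2 (hP.layer_lt ℓ), ?_⟩
  rw [List.mem_flatMap]
  exact ⟨s, List.mem_finRange s, List.mem_map.2 ⟨ℓ, (N.mem_order _ _ _).2 rfl, rfl⟩⟩

/-- The evolution is the sum of all fault paths. -/
theorem evolution_eq_sum (hP : P.WellFormed) : N.evolution = ∑ p, N.faultPath p := by
  have h := sum_timeOrdered_powerset (Slot.label N) (N.slotOp fun _ _ => 1) (N.slotOp N.fault)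
    N.slots N.slots_label_nodup
  rw [N.slots_label_toFinset hP, Finset.powerset_univ] at h
  have h1 : ∀ p : Finset (P.circ.Loc × Fin N.steps), (fun k : N.Slot =>
      (Slot.label N k).elim (N.slotOp (fun _ _ => 1) k) fun a =>
        if a ∈ p then N.slotOp N.fault k else N.slotOp (fun _ _ => 1) k) =
      N.slotOp fun ℓ s => if (ℓ, s) ∈ p then N.fault ℓ s else 1 := by
    intro p
    funext k
    rcases k with ⟨ℓ, s⟩ | k
    · change (if (ℓ, s) ∈ p then localOp _ _ else localOp _ _) = localOp _ _
      by_cases h : (ℓ, s) ∈ p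
      · rw [if_pos h]
        exact congrArg _ (if_pos h).symm
      · rw [if_neg h]
        exact congrArg _ (if_neg h).symm
    · rcases k with k | k <;> rfl
  have h2 : (fun k : N.Slot => (Slot.label N k).elim (N.slotOp (fun _ _ => 1) k) fun _ =>
      N.slotOp (fun _ _ => 1) k + N.slotOp N.fault k) = N.slotOp fun ℓ s => 1 + N.fault ℓ s := by
    funext k
    rcases k with ⟨ℓ, s⟩ | k
    · exact (localOp_add _ _ _).symm
    · rcases k with k | k <;> rfl
  rw [h2] at h
  simp only [h1] at h
  rw [evolution, evolveWith_eq, ← h]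
  refine Finset.sum_congr rfl fun p _ => ?_
  rw [faultPath, evolveWith_eq]

/-- In first order the evolution is not unitary, but none of its factors decreases a norm. This
lower bound is all that Born's rule for the normalised state requires. -/
theorem norm_le_norm_evolution (hP : P.WellFormed) (ψ : QState P.Qubit B) :
    ‖ψ‖ ≤ ‖N.evolution ψ‖ := by
  rw [evolution, evolveWith_eq]
  have key : ∀ (l : List N.Slot) (ψ : QState P.Qubit B),
      ‖ψ‖ ≤ ‖timeOrdered (l.map (N.slotOp fun ℓ s => 1 + N.fault ℓ s)) ψ‖ := by
    intro l
    induction l with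
    | nil => exact fun ψ => le_rfl
    | cons k l ih =>
      intro ψ
      rw [List.map_cons, timeOrdered_cons]
      refine le_trans ?_ (ih _)
      rcases k with ⟨ℓ, s⟩ | ⟨t, s⟩ | ⟨ℓ, s⟩
      · refine norm_le_norm_localOp (hP.wire_injective ℓ) (fun φ => ?_) ψ
        unfold fault
        rcases N.splitting with _ | _
        · exact norm_le_norm_one_add (N.HSB_selfAdjoint ℓ s) N.Δ φ
        · change _ ≤ ‖(1 + (NormedSpace.exp ((-(Complex.I * (N.Δ : ℂ))) • N.HSB ℓ s) - 1)) φ‖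
          rw [add_sub_cancel]
          exact (norm_exp_apply (N.HSB_selfAdjoint ℓ s) N.Δ φ).ge
      · exact (norm_bathOp (N.bathStep t s) ψ).ge
      · exact norm_le_norm_localOp (hP.wire_injective ℓ)
          (fun φ => (norm_matrixOp (N.gateStep_unitary ℓ s) φ).ge) ψ
  exact key _ ψ

open Classical in
/-- The sum of the fault paths whose faults are exactly at the locations in `c`. -/
def faultSum (ψ : QState P.Qubit B) (c : Finset P.circ.Loc) : QState P.Qubit B :=
  ∑ p ∈ Finset.univ.filter (fun p : Finset (P.circ.Loc × Fin N.steps) => p.image Prod.fst = c),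
    N.faultPath p ψ

open Classical in
theorem sum_faultSum (ψ : QState P.Qubit B) (R : Finset P.circ.Loc) :
    ∑ c ∈ Finset.univ.filter (fun c => R ⊆ c), N.faultSum ψ c = N.E R ψ := by
  unfold faultSum
  rw [Finset.sum_fiberwise_eq_sum_filter, E, sum_apply]
  refine Finset.sum_congr ?_ fun _ _ => rfl
  ext p
  simp only [Finset.mem_filter, Finset.mem_univ, true_and]
  constructor
  · intro h ℓ hℓ
    obtain ⟨⟨ℓ', s⟩, hp, rfl⟩ := Finset.mem_image.1 (h hℓ)
    exact ⟨s, hp⟩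
  · intro h ℓ hℓ
    obtain ⟨s, hs⟩ := h ℓ hℓ
    exact Finset.mem_image.2 ⟨(ℓ, s), hs, rfl⟩

theorem sum_faultSum_univ (hP : P.WellFormed) (ψ : QState P.Qubit B) :
    ∑ c, N.faultSum ψ c = N.evolution ψ := by
  classical
  unfold faultSum
  rw [N.evolution_eq_sum hP, sum_apply, Finset.sum_fiberwise_eq_sum_filter]
  refine Finset.sum_congr ?_ fun _ _ => rfl
  simp

theorem faultSum_mem (hP : P.WellFormed) (β : B) (c : Finset P.circ.Loc) :
    N.faultSum (zeroState P.Qubit β) c ∈ bathSpan B (P.reach (c : Set P.circ.Loc)) := by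
  classical
  refine Submodule.sum_mem _ fun p hp => N.evolveWith_mem hP (fun ℓ hℓ s => if_neg fun h => hℓ ?_) β
  rw [← (Finset.mem_filter.1 hp).2]
  exact Finset.mem_coe.2 (Finset.mem_image.2 ⟨(ℓ, s), h, rfl⟩)

end Noise
end

/-! ### The decoding isometry between consecutive levels -/

noncomputable section

namespace Scheme

variable {S : GateSet} (F : Scheme S) (P : Program S)

/-- The configurations of the ancillas of the simulation. -/
abbrev AncConfig : Type := Config (Σ a : P.circ.Loc, (F.rec1 (P.circ.kind a)).Anc)

/-- The configurations of the simulation, as configurations of the blocks and of the ancillas. -/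
def splitConfig : (P.Qubit → F.Block) × F.AncConfig P ≃ Config (F.encode P).Qubit where
  toFun p := Sum.elim (Function.uncurry p.1) p.2
  invFun c := (fun q j => c (Sum.inl (q, j)), fun a => c (Sum.inr a))
  left_inv _ := rfl
  right_inv c := by
    funext q
    rcases q with ⟨q, j⟩ | a <;> rfl

open Classical in
/-- The operators by which the block of `q` is decoded; the syndromes are blocks. -/
def siteDecoder (L : F.Block → Matrix Bool F.Block ℂ) (q : P.Qubit) (Y : F.Block) :
    Matrix Bool F.Block ℂ :=
  if ∃ a, P.circ.Touches a q then L Y else Matrix.single false Y 1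

open Classical in
/-- The classical decoding; blocks which are not used at all are decoded to `false`. -/
def siteDec (x : P.Qubit → F.Block) : Config P.Qubit :=
  fun q => if ∃ a, P.circ.Touches a q then F.dec (x q) else false

variable {F P}

/-- Summed over the syndromes, the decoders of a site with output `b` give the projection onto the
configurations decoded to `b`; this factorises over the sites. An unused block keeps its
configuration as the syndrome and outputs `false`. -/
theorem siteDecoder_sum {L : F.Block → Matrix Bool F.Block ℂ}
    (hL : ∀ b x x', ∑ y, star (L y b x) * L y b x' = if b = F.dec x ∧ x = x' then 1 else 0)
    (b : Config P.Qubit) (x x' : P.Qubit → F.Block) :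
    ∑ Y : P.Qubit → F.Block, star (siteProd (fun q => F.siteDecoder P L q (Y q)) b x) *
      siteProd (fun q => F.siteDecoder P L q (Y q)) b x' =
      if x = x' then (((if b = F.siteDec P x then 1 else 0 : ℝ)) : ℂ) else 0 := by
  classical
  have hsite : ∀ q b x x', ∑ y, star (F.siteDecoder P L q y b x) * F.siteDecoder P L q y b x' =
      if (b = if ∃ a, P.circ.Touches a q then F.dec x else false) ∧ x = x' then 1 else 0 := by
    intro q b x x'
    unfold siteDecoder
    by_cases hq : ∃ a, P.circ.Touches a q
    · simp only [if_pos hq]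
      exact hL b x x'
    · simp only [if_neg hq, Matrix.single_apply]
      rw [Finset.sum_eq_single x]
      · by_cases hb : b = false
        · subst hb
          by_cases hx : x = x' <;> simp [hx]
        · simp [hb]
      · intro y _ hy
        simp [hy]
      · simp
  have h1 : ∀ Y : P.Qubit → F.Block, star (siteProd (fun q => F.siteDecoder P L q (Y q)) b x) *
      siteProd (fun q => F.siteDecoder P L q (Y q)) b x' =
      ∏ q, (star (F.siteDecoder P L q (Y q) (b q) (x q)) *
        F.siteDecoder P L q (Y q) (b q) (x' q)) := by
    intro Y
    simp only [siteProd, Matrix.of_apply]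
    rw [Finset.prod_mul_distrib, star_prod]
  rw [Finset.sum_congr rfl fun Y _ => h1 Y, ← Fintype.piFinset_univ,
    ← Finset.prod_univ_sum (fun _ => Finset.univ) (fun q y =>
      star (F.siteDecoder P L q y (b q) (x q)) * F.siteDecoder P L q y (b q) (x' q))]
  simp only [hsite]
  rw [Finset.prod_ite_zero, Finset.prod_const_one]
  by_cases hx : x = x'
  · subst hx
    simp only [Finset.mem_univ, true_implies, and_true, if_true]
    by_cases hb : b = F.siteDec P x
    · rw [if_pos hb, if_pos]
      · simp
      · intro q
        exact congrFun hb q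
    · rw [if_neg hb, if_neg]
      · simp
      · exact fun h => hb (funext h)
  · rw [if_neg hx, if_neg]
    exact fun h => hx (funext fun q => (h q (Finset.mem_univ q)).2)

variable (F P)
variable (B : Type*) [NormedAddCommGroup B] [InnerProductSpace ℂ B]

/-- The bath, together with the syndromes and the ancillas of the simulation. -/
abbrev DecodedBath : Type _ := PiLp 2 fun _ : (P.Qubit → F.Block) × F.AncConfig P => B

variable {B}

/-- The decoding of all blocks. -/
def decodeMap (L : F.Block → Matrix Bool F.Block ℂ) :
    QState (F.encode P).Qubit B →ₗ[ℂ] QState P.Qubit (F.DecodedBath P B) where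
  toFun ψ := QState.mk fun b => WithLp.toLp 2 fun i : (P.Qubit → F.Block) × F.AncConfig P =>
    ∑ x, siteProd (fun q => F.siteDecoder P L q (i.1 q)) b x • ψ (F.splitConfig P (x, i.2))
  map_add' ψ φ := by
    refine QState.ext fun b => PiLp.ext fun i => ?_
    simp [Finset.sum_add_distrib]
  map_smul' c ψ := by
    refine QState.ext fun b => PiLp.ext fun i => ?_
    simp [Finset.smul_sum, smul_comm c]

variable {F P}

theorem decodeMap_apply (L : F.Block → Matrix Bool F.Block ℂ) (ψ : QState (F.encode P).Qubit B)
    (b : Config P.Qubit) (i : (P.Qubit → F.Block) × F.AncConfig P) :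
    WithLp.ofLp (F.decodeMap P L ψ b) i =
      ∑ x, siteProd (fun q => F.siteDecoder P L q (i.1 q)) b x • ψ (F.splitConfig P (x, i.2)) := rfl

section Born

variable {L : F.Block → Matrix Bool F.Block ℂ}
variable (hL : ∀ b x x', ∑ y, star (L y b x) * L y b x' = if b = F.dec x ∧ x = x' then 1 else 0)
include hL

/-- Decoding the state and then measuring it gives the same distribution as measuring the state and
decoding the outcome. -/
theorem sum_decodeMap (p : Config P.Qubit → Prop) [DecidablePred p]
    (ψ : QState (F.encode P).Qubit B) :
    ∑ b, (if p b then ‖F.decodeMap P L ψ b‖ ^ 2 else 0) =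
      ∑ c, if p (F.siteDec P ((F.splitConfig P).symm c).1) then ‖ψ c‖ ^ 2 else 0 := by
  classical
  have h1 : ∀ b, ‖F.decodeMap P L ψ b‖ ^ 2 = ∑ z, ∑ x,
      (if b = F.siteDec P x then 1 else 0 : ℝ) * ‖ψ (F.splitConfig P (x, z))‖ ^ 2 := by
    intro b
    rw [PiLp.norm_sq_eq_of_L2, Fintype.sum_prod_type_right]
    refine Finset.sum_congr rfl fun z _ => ?_
    simp only [decodeMap_apply]
    exact sum_norm_sq_combination _ _ (fun x x' => siteDecoder_sum hL b x x')
      fun x => ψ (F.splitConfig P (x, z))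
  rw [← (F.splitConfig P).sum_comp, Fintype.sum_prod_type_right]
  simp only [h1]
  have h2 : ∀ b, (if p b then ∑ z, ∑ x, (if b = F.siteDec P x then 1 else 0 : ℝ) *
      ‖ψ (F.splitConfig P (x, z))‖ ^ 2 else 0) = ∑ z, ∑ x, if b = F.siteDec P x then
        (if p b then ‖ψ (F.splitConfig P (x, z))‖ ^ 2 else 0) else 0 := by
    intro b
    by_cases hb : p b
    · simp only [if_pos hb, ite_mul, one_mul, zero_mul]
    · simp [hb]
  simp only [h2]
  rw [Finset.sum_comm]
  refine Finset.sum_congr rfl fun z _ => ?_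
  rw [Finset.sum_comm]
  refine Finset.sum_congr rfl fun x _ => ?_
  rw [Finset.sum_ite_eq' Finset.univ (F.siteDec P x), if_pos (Finset.mem_univ _),
    Equiv.symm_apply_apply]

theorem norm_decodeMap (ψ : QState (F.encode P).Qubit B) : ‖F.decodeMap P L ψ‖ = ‖ψ‖ := by
  have h := sum_decodeMap hL (fun _ => True) ψ
  simp only [if_true] at h
  rw [← QState.norm_sq_eq, ← QState.norm_sq_eq] at h
  exact (sq_eq_sq₀ (norm_nonneg _) (norm_nonneg _)).1 h

end Born

open Classical in
/-- The locations whose extended rectangles are bad. -/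
def badSet (c : Finset (F.encode P).circ.Loc) : Finset P.circ.Loc :=
  Finset.univ.filter fun a => (F.regions P).Bad ∅ c a

theorem mem_badSet {c : Finset (F.encode P).circ.Loc} {a : P.circ.Loc} :
    a ∈ badSet c ↔ (F.regions P).Bad ∅ c a := by
  classical
  exact Finset.mem_filter.trans ⟨fun h => h.2, fun h => ⟨Finset.mem_univ _, h⟩⟩

/-- By linearity it suffices to take `c` with definite operations on the register. For fixed
syndromes and ancillas the register part is then treated by `decode_mem_reach`, with the bad
locations as the set of arbitrary operations. -/
theorem FaultTolerant.decodeMap_mem (hF : F.FaultTolerant) (hP : P.WellFormed)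
    {L : F.Block → Matrix Bool F.Block ℂ} (hL : ∀ y, F.IsDecoder (L y))
    (c : Finset (F.encode P).circ.Loc) {ψ : QState (F.encode P).Qubit B}
    (hψ : ψ ∈ bathSpan B ((F.encode P).reach (c : Set (F.encode P).circ.Loc))) :
    F.decodeMap P L ψ ∈
      bathSpan (F.DecodedBath P B) (P.reach (badSet c : Set P.circ.Loc)) := by
  classical
  refine mem_bathSpan_span (V' := Submodule.comap (F.decodeMap P L)
    (bathSpan (F.DecodedBath P B) (P.reach (badSet c : Set P.circ.Loc)))) ?_ hψ
  rintro _ ⟨ops, hops, rfl⟩ β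
  set φ := ((F.encode P).circ.runMat ops).mulVec (Pi.single (fun _ => false) 1) with hφ
  -- A product state decodes to one product state for every syndrome and ancilla configuration, the
  -- bath vector being moved to the corresponding copy of the bath.
  have e : F.decodeMap P L (QState.pure φ β) = ∑ i : (P.Qubit → F.Block) × F.AncConfig P,
      QState.pure ((siteProd fun q => F.siteDecoder P L q (i.1 q)).mulVec fun x =>
        φ (Sum.elim (Function.uncurry x) i.2)) (WithLp.toLp 2 (Pi.single i β)) := by
    refine QState.ext fun b => PiLp.ext fun i => ?_
    rw [decodeMap_apply, QState.sum_apply]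
    simp only [WithLp.ofLp_sum, Finset.sum_apply, QState.pure_apply, WithLp.ofLp_smul,
      Pi.smul_apply]
    rw [Finset.sum_eq_single i]
    · rw [Pi.single_eq_same, Matrix.mulVec, dotProduct, Finset.sum_smul]
      refine Finset.sum_congr rfl fun x _ => ?_
      exact smul_smul _ _ _
    · intro j _ hj
      rw [Pi.single_eq_of_ne (Ne.symm hj), smul_zero]
    · simp
  rw [Submodule.mem_comap, e]
  refine Submodule.sum_mem _ fun i _ => pure_mem_bathSpan ?_ _
  have hbad : (badSet c : Set P.circ.Loc) = {a | (F.regions P).Bad ∅ c a} := by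
    ext a
    exact mem_badSet
  rw [hbad]
  refine hF.decode_mem_reach hP (ops := ops) (fun b hb => ?_) (fun q hq => ?_) fun q hq => ?_
  · exact goodLoc_of_not_bad hP (fun ℓ hℓ => hops ℓ fun h => hℓ (Finset.mem_coe.1 h)) hb
  · rw [siteDecoder, if_pos hq]
    exact hL _
  · rw [siteDecoder, if_neg hq]
    exact ⟨_, rfl⟩

/-- The decoded outcome depends only on qubits that are used. -/
theorem FaultTolerant.decode_congr (hF : F.FaultTolerant) (hP : P.WellFormed) (k : ℕ)
    {x x' : Config (F.level P k).Qubit}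
    (h : ∀ q, (∃ a, (F.level P k).circ.Touches a q) → x q = x' q) {q : P.Qubit}
    (hq : ∃ a, P.circ.Touches a q) : F.decode P k x q = F.decode P k x' q := by
  induction k with
  | zero => exact h q hq
  | succ k ih =>
    refine ih fun r hr => ?_
    refine congrArg F.dec (funext fun j => h (Sum.inl (r, j)) ?_)
    obtain ⟨a, ha⟩ := hr
    obtain ⟨a₀, h₀, h₀r, -⟩ := exists_first (hF.level_wellFormed hP k) ha
    obtain ⟨ρ, hρ⟩ := hF.prep_touches h₀ h₀r j
    exact ⟨⟨a₀, ρ⟩, hρ⟩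

/-- `siteDec` deviates from `dec` on unused blocks only, and by `decode_congr` these do not
influence the outcomes of measured qubits. -/
theorem FaultTolerant.outcomeProb_decodeMap (hF : F.FaultTolerant) (hP : P.WellFormed) (k : ℕ)
    {L : F.Block → Matrix Bool F.Block ℂ}
    (hL : ∀ b x x', ∑ y, star (L y b x) * L y b x' = if b = F.dec x ∧ x = x' then 1 else 0)
    (ψ : QState (F.level P (k + 1)).Qubit B) (z : P.Outcome) :
    F.outcomeProb P k (F.decodeMap (F.level P k) L ψ) z = F.outcomeProb P (k + 1) ψ z := by
  classical
  unfold outcomeProb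
  rw [norm_decodeMap hL ψ]
  congr 1
  refine Eq.trans ?_ ((sum_decodeMap hL (fun b => ∀ q : P.Measured, F.decode P k b q.1 = z q)
    ψ).trans ?_)
  · exact Finset.sum_congr rfl fun b _ => ite_eq_of_iff Iff.rfl _ _
  · refine Finset.sum_congr rfl fun c _ => ite_eq_of_iff (forall_congr' fun q => ?_) _ _
    obtain ⟨q, a, -, ha⟩ := q
    have h : F.decode P k (F.siteDec (F.level P k) ((F.splitConfig (F.level P k)).symm c).1) q =
        F.decode P (k + 1) c q := by
      refine hF.decode_congr hP k (fun r hr => ?_) ⟨a, ha⟩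
      exact if_pos hr
    rw [h]

end Scheme
end

/-! ### Born's rule and the recursion over the levels -/

noncomputable section

section Born

variable {W : Type} [Fintype W] [DecidableEq W]
variable {B : Type*} [NormedAddCommGroup B] [InnerProductSpace ℂ B]

/-- Factor the difference of squares, then apply the reverse triangle inequality in each component
and Cauchy–Schwarz to the sum. -/
theorem QState.sum_abs_norm_sq_sub_le (ψ θ : QState W B) :
    ∑ x, |‖ψ x‖ ^ 2 - ‖θ x‖ ^ 2| ≤ ‖ψ - θ‖ * (‖ψ‖ + ‖θ‖) := by
  have hsub : ∀ x, (ψ - θ) x = ψ x - θ x := fun _ => rfl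
  have h1 : ∀ x, |‖ψ x‖ ^ 2 - ‖θ x‖ ^ 2| ≤ ‖(ψ - θ) x‖ * ‖ψ x‖ + ‖(ψ - θ) x‖ * ‖θ x‖ := by
    intro x
    rw [hsub, sq_sub_sq, abs_mul, abs_of_nonneg (by positivity : 0 ≤ ‖ψ x‖ + ‖θ x‖), ← mul_add,
      mul_comm]
    exact mul_le_mul_of_nonneg_right (abs_norm_sub_norm_le _ _) (by positivity)
  have h2 : ∀ φ χ : QState W B, ∑ x, ‖φ x‖ * ‖χ x‖ ≤ ‖φ‖ * ‖χ‖ := by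
    intro φ χ
    refine (sq_le_sq₀ (Finset.sum_nonneg fun _ _ => by positivity) (by positivity)).1 ?_
    rw [mul_pow, QState.norm_sq_eq, QState.norm_sq_eq]
    exact Finset.sum_mul_sq_le_sq_mul_sq _ _ _
  refine (Finset.sum_le_sum fun x _ => h1 x).trans ?_
  rw [Finset.sum_add_distrib, mul_add]
  exact add_le_add (h2 _ _) (h2 _ _)

theorem QState.norm_sq_pure (φ : Config W → ℂ) (β : B) (x : Config W) :
    ‖QState.pure φ β x‖ ^ 2 = ‖φ x‖ ^ 2 * ‖β‖ ^ 2 := by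
  rw [QState.pure_apply, norm_smul, mul_pow]

end Born

/-- Inclusion and exclusion: a sum over the nonempty subsets is small if its sums over all supersets
of a nonempty set are. -/
theorem norm_sum_sub_empty_le {α : Type*} [Fintype α] [DecidableEq α] {E : Type*}
    [NormedAddCommGroup E] {ε : ℝ} (hε : 0 ≤ ε) (Φ : Finset α → E)
    (hΦ : ∀ J : Finset α, J.Nonempty → ‖∑ c ∈ Finset.univ.filter (fun c => J ⊆ c), Φ c‖ ≤ ε) :
    ‖∑ c, Φ c - Φ ∅‖ ≤ 2 ^ Fintype.card α * ε := by
  -- Möbius inversion on the lattice of subsets; the term `J = ∅` is the full sum.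
  have h1 : ∑ J, (-1 : ℤ) ^ J.card • ∑ c ∈ Finset.univ.filter (fun c => J ⊆ c), Φ c = Φ ∅ := by
    simp only [Finset.sum_filter, Finset.smul_sum, smul_ite, smul_zero]
    rw [Finset.sum_comm]
    have h2 : ∀ c : Finset α, (∑ J, if J ⊆ c then (-1 : ℤ) ^ J.card • Φ c else 0) =
        if c = ∅ then Φ c else 0 := by
      intro c
      rw [← Finset.sum_filter, ← Finset.sum_smul]
      have h3 : Finset.univ.filter (fun J => J ⊆ c) = c.powerset := by
        ext J
        simp
      rw [h3, Finset.sum_powerset_neg_one_pow_card, ite_smul, one_smul, zero_smul]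
    simp only [h2, Finset.sum_ite_eq', Finset.mem_univ, if_true]
  rw [← Finset.add_sum_erase _ _ (Finset.mem_univ ∅)] at h1
  simp only [Finset.card_empty, pow_zero, one_smul, Finset.empty_subset, Finset.filter_true] at h1
  rw [← h1, sub_add_cancel_left, norm_neg]
  have h4 : ∀ J ∈ Finset.univ.erase (∅ : Finset α),
      ‖(-1 : ℤ) ^ J.card • ∑ c ∈ Finset.univ.filter (fun c => J ⊆ c), Φ c‖ ≤ ε := by
    intro J hJ
    have hJ' := Finset.nonempty_iff_ne_empty.2 (Finset.ne_of_mem_erase hJ)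
    rcases neg_one_pow_eq_or ℤ J.card with h | h
    · rw [h, one_smul]
      exact hΦ J hJ'
    · rw [h, neg_one_smul, norm_neg]
      exact hΦ J hJ'
  refine (norm_sum_le_of_le _ h4).trans ?_
  rw [Finset.sum_const, nsmul_eq_mul, Finset.card_erase_of_mem (Finset.mem_univ _),
    Finset.card_univ, Fintype.card_finset]
  refine mul_le_mul_of_nonneg_right ?_ hε
  exact_mod_cast Nat.sub_le _ _

namespace Scheme

variable {S : GateSet} {F : Scheme S} {P : Program S}

/-- States that are close give rise to distributions that are close. -/
theorem sum_abs_outcomeProb_sub_le {B : Type*} [NormedAddCommGroup B] [InnerProductSpace ℂ B]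
    (ψ θ : QState P.Qubit B) (hψ : ψ ≠ 0) (hθ : θ ≠ 0) :
    ∑ z, |F.outcomeProb P 0 ψ z - F.outcomeProb P 0 θ z| ≤
      2 * (‖ψ - θ‖ * (‖ψ‖ + ‖θ‖)) / ‖ψ‖ ^ 2 := by
  classical
  have hT := QState.sum_abs_norm_sq_sub_le ψ θ
  have hψ' : 0 < ‖ψ‖ ^ 2 := by positivity
  have hθ' : 0 < ‖θ‖ ^ 2 := by positivity
  set T := ∑ x, |‖ψ x‖ ^ 2 - ‖θ x‖ ^ 2| with hTdef
  have hout : ∀ (φ : QState P.Qubit B) z, F.outcomeProb P 0 φ z =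
      (∑ x : Config P.Qubit, if (fun q : P.Measured => x q.1) = z then ‖φ x‖ ^ 2 else 0) /
        ‖φ‖ ^ 2 := by
    intro φ z
    unfold outcomeProb
    congr 1
    exact Finset.sum_congr rfl fun x _ => ite_eq_of_iff (Iff.symm funext_iff) _ _
  have hsum : ∀ f : Config P.Qubit → ℝ,
      ∑ z : P.Outcome, ∑ x, (if (fun q : P.Measured => x q.1) = z then f x else 0) = ∑ x, f x := by
    intro f
    rw [Finset.sum_comm]
    refine Finset.sum_congr rfl fun x _ => ?_
    rw [Finset.sum_ite_eq]
    simp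
  set a : P.Outcome → ℝ := fun z =>
    ∑ x : Config P.Qubit, if (fun q : P.Measured => x q.1) = z then ‖ψ x‖ ^ 2 else 0 with ha
  set b : P.Outcome → ℝ := fun z =>
    ∑ x : Config P.Qubit, if (fun q : P.Measured => x q.1) = z then ‖θ x‖ ^ 2 else 0 with hb
  have hb0 : ∀ z, 0 ≤ b z := fun z => Finset.sum_nonneg fun x _ => by split_ifs <;> positivity
  have hbs : ∑ z, b z = ‖θ‖ ^ 2 := by rw [QState.norm_sq_eq]; exact hsum _
  have hab : ∑ z, |a z - b z| ≤ T := by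
    rw [hTdef, ← hsum]
    refine Finset.sum_le_sum fun z _ => ?_
    rw [ha, hb, ← Finset.sum_sub_distrib]
    refine (Finset.abs_sum_le_sum_abs _ _).trans (Finset.sum_le_sum fun x _ => ?_)
    split_ifs
    · exact le_rfl
    · simp
  have hN : |‖θ‖ ^ 2 - ‖ψ‖ ^ 2| ≤ T := by
    rw [abs_sub_comm, QState.norm_sq_eq, QState.norm_sq_eq, ← Finset.sum_sub_distrib]
    exact Finset.abs_sum_le_sum_abs _ _
  -- The difference of the normalisations is split off. Numerators and normalisations each
  -- contribute at most `T`, whence the factor 2.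
  have hz : ∀ z, |F.outcomeProb P 0 ψ z - F.outcomeProb P 0 θ z| ≤
      (|a z - b z| + b z / ‖θ‖ ^ 2 * |‖θ‖ ^ 2 - ‖ψ‖ ^ 2|) / ‖ψ‖ ^ 2 := by
    intro z
    rw [hout, hout, le_div_iff₀ hψ', ← abs_of_pos hψ', ← abs_mul, abs_of_pos hψ']
    have e : (a z / ‖ψ‖ ^ 2 - b z / ‖θ‖ ^ 2) * ‖ψ‖ ^ 2 =
        (a z - b z) + b z / ‖θ‖ ^ 2 * (‖θ‖ ^ 2 - ‖ψ‖ ^ 2) := by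
      field_simp
      ring
    refine (congrArg abs e).trans_le ((abs_add_le _ _).trans ?_)
    rw [abs_mul, abs_of_nonneg (div_nonneg (hb0 z) hθ'.le)]
  refine (Finset.sum_le_sum fun z _ => hz z).trans ?_
  rw [← Finset.sum_div, Finset.sum_add_distrib, ← Finset.sum_mul, ← Finset.sum_div, hbs,
    div_self hθ'.ne', one_mul]
  gcongr
  linarith

theorem outcomeProb_pure {B : Type*} [NormedAddCommGroup B] [InnerProductSpace ℂ B]
    (φ : QState P.Qubit ℂ) {β : B} (hβ : β ≠ 0) (z : P.Outcome) :
    F.outcomeProb P 0 (QState.pure φ.amp β : QState P.Qubit B) z = F.outcomeProb P 0 φ z := by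
  have hβ' : ‖β‖ ^ 2 ≠ 0 := by positivity
  have h : ‖(QState.pure φ.amp β : QState P.Qubit B)‖ ^ 2 = ‖φ‖ ^ 2 * ‖β‖ ^ 2 := by
    rw [QState.norm_sq_eq, QState.norm_sq_eq, Finset.sum_mul]
    exact Finset.sum_congr rfl fun x _ => QState.norm_sq_pure _ _ x
  unfold outcomeProb
  refine Eq.trans ?_ (mul_div_mul_right _ (‖φ‖ ^ 2) hβ')
  refine congrArg₂ (· / ·) ?_ h
  rw [Finset.sum_mul]
  refine Finset.sum_congr rfl fun x _ => ?_
  rw [ite_mul, zero_mul]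
  congr 1
  exact QState.norm_sq_pure _ _ x

/-- The states reached without faults. -/
theorem exists_eq_pure_of_mem (hP : P.WellFormed) {B : Type*} [NormedAddCommGroup B]
    [InnerProductSpace ℂ B] {ψ : QState P.Qubit B}
    (hψ : ψ ∈ bathSpan B (P.reach ((∅ : Finset P.circ.Loc) : Set P.circ.Loc))) :
    ∃ β : B, ψ = QState.pure P.idealState.amp β := by
  have hamp : P.idealState.amp =
      (P.circ.runMat P.circ.idealOps).mulVec (Pi.single (fun _ => false) 1) := by
    refine (Circuit.run_amp P.circ hP.wire_injective P.circ.idealOps _).trans (congrArg _ ?_)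
    funext x
    rw [Pi.single_apply]
    rfl
  let V : Submodule ℂ (QState P.Qubit B) :=
    { carrier := {ψ | ∃ β : B, ψ = QState.pure P.idealState.amp β}
      zero_mem' := ⟨0, by ext x; exact (smul_zero _).symm⟩
      add_mem' := by
        rintro _ _ ⟨β, rfl⟩ ⟨β', rfl⟩
        exact ⟨β + β', by ext x; exact (smul_add _ _ _).symm⟩
      smul_mem' := by
        rintro c _ ⟨β, rfl⟩
        exact ⟨c • β, by ext x; exact smul_comm _ _ _⟩ }
  refine mem_bathSpan_span (V' := V) ?_ hψ
  rintro _ ⟨ops, hops, rfl⟩ β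
  have : ops = P.circ.idealOps := funext fun ℓ => hops ℓ (by simp)
  subst this
  exact ⟨β, by rw [hamp]⟩

/-- With `d = ‖ψ - θ‖` the error is at most `2 d (2 ‖ψ‖ + d) / ‖ψ‖²`, and `d < 1 ≤ ‖ψ‖` bounds this
by `6 d`. The vector `θ` is the ideal state tensored with a bath vector, whose norm cancels in the
normalisation. -/
theorem computationError_zero_le (hP : P.WellFormed) {B : Type*} [NormedAddCommGroup B]
    [InnerProductSpace ℂ B] {ε : ℝ} (hε : ε < 1) {ψ θ : QState P.Qubit B} (hψ : 1 ≤ ‖ψ‖)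
    (hθ : θ ∈ bathSpan B (P.reach ((∅ : Finset P.circ.Loc) : Set P.circ.Loc)))
    (h : ‖ψ - θ‖ ≤ ε) : F.computationError P 0 ψ ≤ 6 * ε := by
  have hψ0 : ψ ≠ 0 := norm_pos_iff.1 (one_pos.trans_le hψ)
  have hle : ‖θ‖ ≤ ‖ψ‖ + ‖ψ - θ‖ := by
    have := norm_sub_le ψ (ψ - θ)
    rwa [sub_sub_cancel] at this
  have hθ0 : θ ≠ 0 := by
    rintro rfl
    rw [sub_zero] at h
    linarith
  obtain ⟨β, rfl⟩ := exists_eq_pure_of_mem hP hθ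
  have hβ : β ≠ 0 := by
    rintro rfl
    refine hθ0 ?_
    ext x
    exact smul_zero _
  have h1 := sum_abs_outcomeProb_sub_le (F := F) ψ _ hψ0 hθ0
  simp only [outcomeProb_pure _ hβ] at h1
  refine h1.trans ?_
  rw [div_le_iff₀ (by positivity)]
  set d := ‖ψ - QState.pure P.idealState.amp β‖
  have hd : 0 ≤ d := norm_nonneg _
  nlinarith [mul_le_mul_of_nonneg_left hle hd, mul_nonneg hd (sub_nonneg.2 hψ),
    mul_nonneg (sub_nonneg.2 h) (sq_nonneg ‖ψ‖), mul_nonneg hd (norm_nonneg ψ),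
    mul_nonneg (mul_nonneg hd (sub_nonneg.2 hψ)) (norm_nonneg ψ)]

/-- If the sums of a family of states over the supersets of a set of locations are small, then so are
those of the decoded family, sorted by the bad locations. -/
theorem FaultTolerant.norm_sum_decodeMap_le (hF : F.FaultTolerant) (hP : P.WellFormed)
    {B : Type*} [NormedAddCommGroup B] [InnerProductSpace ℂ B]
    {L : F.Block → Matrix Bool F.Block ℂ}
    (hL : ∀ b x x', ∑ y, star (L y b x) * L y b x' = if b = F.dec x ∧ x = x' then 1 else 0)
    {η : ℝ} (hη : 0 ≤ η)
    (hη' : (F.maxExRecSize.choose 2 : ℝ) * Real.exp (((F.maxExRecSize : ℝ) - 2) * η) * η < 1)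
    (Φ : Finset (F.encode P).circ.Loc → QState (F.encode P).Qubit B)
    (hΦ : ∀ J : Finset (F.encode P).circ.Loc, J.Nonempty →
      ‖∑ c ∈ Finset.univ.filter (fun c => J ⊆ c), Φ c‖ ≤ η ^ J.card)
    (R : Finset P.circ.Loc) (hR : R.Nonempty) :
    ‖∑ c' ∈ Finset.univ.filter (fun c' => R ⊆ c'),
        ∑ c ∈ Finset.univ.filter (fun c => badSet c = c'), F.decodeMap P L (Φ c)‖ ≤
      (F.maxExRecSize.choose 2 * Real.exp (((F.maxExRecSize : ℝ) - 2) * η) * η ^ 2) ^ R.card := by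
  classical
  rw [Finset.sum_fiberwise_eq_sum_filter, ← map_sum, norm_decodeMap hL]
  have h := hF.norm_sum_bad_le hP hη hη' Φ hΦ R hR
  refine (congrArg norm (Finset.sum_congr ?_ fun _ _ => rfl)).trans_le h
  ext c
  simp only [Finset.mem_filter, Finset.mem_univ, true_and]
  exact forall₂_congr fun a _ => mem_badSet

/-- The bath and the strength are quantified inside the induction since decoding enlarges the one
and replaces the other by `K η² ≤ ρ η`. The strength only decreases, so the same `ρ` serves at all
levels. The factor `2 ^ n` occurs once, at level 0, where `n` does not depend on `k`. -/
theorem FaultTolerant.computationError_le (hF : F.FaultTolerant) (hP : P.WellFormed) {ρ : ℝ}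
    (hρ : ρ < 1) (k : ℕ) : ∀ (B : Type*) [NormedAddCommGroup B] [InnerProductSpace ℂ B] (η : ℝ),
    0 ≤ η → η ≤ 1 →
    (F.maxExRecSize.choose 2 : ℝ) * Real.exp (((F.maxExRecSize : ℝ) - 2) * η) * η ≤ ρ →
    2 ^ Fintype.card P.circ.Loc * (ρ ^ k * η) < 1 →
    ∀ Φ : Finset (F.level P k).circ.Loc → QState (F.level P k).Qubit B,
      (∀ c : Finset (F.level P k).circ.Loc,
        Φ c ∈ bathSpan B ((F.level P k).reach (c : Set (F.level P k).circ.Loc))) →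
      (∀ J : Finset (F.level P k).circ.Loc, J.Nonempty →
        ‖∑ c ∈ Finset.univ.filter (fun c => J ⊆ c), Φ c‖ ≤ η ^ J.card) →
      1 ≤ ‖∑ c, Φ c‖ →
      F.computationError P k (∑ c, Φ c) ≤ 6 * (2 ^ Fintype.card P.circ.Loc * (ρ ^ k * η)) := by
  classical
  induction k with
  | zero =>
    intro B _ _ η hη hη1 hK hlt Φ hmem hΦ hnorm
    rw [pow_zero, one_mul] at hlt ⊢
    refine computationError_zero_le hP hlt hnorm (hmem ∅) ?_
    refine norm_sum_sub_empty_le hη Φ fun J hJ => (hΦ J hJ).trans ?_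
    exact pow_le_of_le_one hη hη1 (Finset.card_ne_zero.2 hJ)
  | succ k ih =>
    intro B _ _ η hη hη1 hK hlt
      (Φ : Finset (F.encode (F.level P k)).circ.Loc → QState (F.encode (F.level P k)).Qubit B)
      (hmem : ∀ c : Finset (F.encode (F.level P k)).circ.Loc, Φ c ∈ bathSpan B
        ((F.encode (F.level P k)).reach (c : Set (F.encode (F.level P k)).circ.Loc)))
      (hΦ : ∀ J : Finset (F.encode (F.level P k)).circ.Loc, J.Nonempty →
        ‖∑ c ∈ Finset.univ.filter (fun c => J ⊆ c), Φ c‖ ≤ η ^ J.card)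
      (hnorm : 1 ≤ ‖∑ c, Φ c‖)
    obtain ⟨L, hL, hL'⟩ := hF.exists_decoders
    have hA : (10 : ℝ) ≤ F.maxExRecSize := by exact_mod_cast hF.ten_le_maxExRecSize
    set K : ℝ := (F.maxExRecSize.choose 2 : ℝ) * Real.exp (((F.maxExRecSize : ℝ) - 2) * η) with hKdef
    have hK0 : 0 ≤ K := by positivity
    have hρ0 : 0 ≤ ρ := (mul_nonneg hK0 hη).trans hK
    have hη'0 : 0 ≤ K * η ^ 2 := by positivity
    have hη'ρ : K * η ^ 2 ≤ ρ * η := by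
      rw [sq, ← mul_assoc]
      exact mul_le_mul_of_nonneg_right hK hη
    have hη'η : K * η ^ 2 ≤ η := hη'ρ.trans (mul_le_of_le_one_left hη hρ.le)
    have hstep : 2 ^ Fintype.card P.circ.Loc * (ρ ^ k * (K * η ^ 2)) ≤
        2 ^ Fintype.card P.circ.Loc * (ρ ^ (k + 1) * η) := by
      rw [pow_succ ρ k, mul_assoc (ρ ^ k)]
      gcongr
    -- The family for the lower level: decoded vectors, grouped by their sets of bad locations.
    set Ψ : Finset (F.level P k).circ.Loc →
        QState (F.level P k).Qubit (F.DecodedBath (F.level P k) B) := fun c' =>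
      ∑ c ∈ Finset.univ.filter (fun c => badSet (P := F.level P k) c = c'),
        F.decodeMap (F.level P k) L (Φ c) with hΨ
    have hsum : ∑ c', Ψ c' = F.decodeMap (F.level P k) L (∑ c, Φ c) := by
      refine Eq.trans ?_ (map_sum (F.decodeMap (F.level P k) L) Φ Finset.univ).symm
      exact Finset.sum_fiberwise _ _ _
    have hP' := hF.level_wellFormed hP k
    have h := ih (F.DecodedBath (F.level P k) B) (K * η ^ 2) hη'0 (hη'η.trans hη1) ?_
      (hstep.trans_lt hlt) Ψ (fun c' => Submodule.sum_mem _ fun c hc => ?_)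
      (hF.norm_sum_decodeMap_le hP' hL' hη (hK.trans_lt hρ) Φ hΦ) ?_
    · rw [hsum] at h
      have e : F.computationError P (k + 1) (∑ c, Φ c) =
          F.computationError P k (F.decodeMap (F.level P k) L (∑ c, Φ c)) := by
        unfold computationError
        refine Finset.sum_congr rfl fun z _ => ?_
        exact congrArg (fun p => |p - F.outcomeProb P 0 P.idealState z|)
          (hF.outcomeProb_decodeMap hP k hL' _ z).symm
      exact e.trans_le (h.trans (mul_le_mul_of_nonneg_left hstep (by norm_num)))
    · refine le_trans ?_ hK
      rw [hKdef]
      gcongr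
      linarith
    · have := hF.decodeMap_mem hP' hL c (hmem c)
      rwa [(Finset.mem_filter.1 hc).2] at this
    · rw [hsum]
      exact hnorm.trans_eq (norm_decodeMap hL' _).symm

end Scheme

/-- A negative strength is impossible as soon as there is one location, since it would bound a norm;
without locations the condition is empty. -/
theorem Noise.HasStrength.max_zero {S : GateSet} {P : Program S} {B : Type*} [NormedAddCommGroup B]
    [InnerProductSpace ℂ B] [CompleteSpace B] {N : Noise P B} {η : ℝ} (h : N.HasStrength η) :
    N.HasStrength (max η 0) := by
  intro R hR
  rcases le_total 0 η with h0 | h0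
  · rw [max_eq_left h0]
    exact h R hR
  · rw [max_eq_right h0]
    obtain ⟨ℓ, -⟩ := id hR
    have h1 := (norm_nonneg _).trans (h {ℓ} (Finset.singleton_nonempty ℓ))
    rw [Finset.card_singleton, pow_one] at h1
    rw [← h0.antisymm h1]
    exact h R hR

theorem norm_zeroState {W : Type} [Fintype W] [DecidableEq W] {B : Type*} [NormedAddCommGroup B]
    (β : B) : ‖zeroState W β‖ = ‖β‖ := by
  rw [← sq_eq_sq₀ (norm_nonneg _) (norm_nonneg _), QState.norm_sq_eq,
    Finset.sum_eq_single (fun _ => false)]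
  · simp [zeroState]
  · intro x _ hx
    simp [zeroState, hx]
  · simp

end

/-! ### The threshold theorem -/

theorem mainTheorem2 (S : GateSet) (F : Scheme S) (hF : F.FaultTolerant)
    (M₀ : Program S) (hM₀ : M₀.WellFormed) (η : ℝ)
    (hη : η < 1 / ((F.maxExRecSize.choose 2 : ℝ) * Real.exp (((F.maxExRecSize : ℝ) - 2) * η)))
    (δ : ℝ) (hδ : 0 < δ) :
    ∃ k : ℕ, ∀ (B : Type*) [NormedAddCommGroup B] [InnerProductSpace ℂ B] [CompleteSpace B]
      (N : Noise (F.level M₀ k) B), N.HasStrength η →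
      ∀ β : B, ‖β‖ = 1 →
        F.computationError M₀ k (N.evolution (zeroState (F.level M₀ k).Qubit β)) ≤ δ := by
  classical
  have hA : (10 : ℝ) ≤ F.maxExRecSize := by exact_mod_cast hF.ten_le_maxExRecSize
  have hC : (1 : ℝ) ≤ F.maxExRecSize.choose 2 := by
    exact_mod_cast Nat.choose_pos (le_trans (by norm_num) hF.ten_le_maxExRecSize)
  -- For negative `η` the hypothesis is automatic, so the argument runs with the nonnegative
  -- strength `ζ`.
  set ζ := max η 0 with hζ
  have hζ0 : 0 ≤ ζ := le_max_right _ _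
  set ρ : ℝ := (F.maxExRecSize.choose 2 : ℝ) * Real.exp (((F.maxExRecSize : ℝ) - 2) * ζ) * ζ with hρ
  have hρ0 : 0 ≤ ρ := by positivity
  have hρ1 : ρ < 1 := by
    rw [hρ]
    rcases le_total 0 η with h0 | h0
    · rw [hζ, max_eq_left h0, mul_comm]
      exact (lt_div_iff₀ (by positivity)).1 hη
    · rw [hζ, max_eq_right h0, mul_zero]
      exact one_pos
  have hζ1 : ζ ≤ 1 := by
    refine le_trans ?_ hρ1.le
    refine le_mul_of_one_le_left hζ0 (one_le_mul_of_one_le_of_one_le hC (Real.one_le_exp ?_))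
    exact mul_nonneg (by linarith) hζ0
  have hlim : Filter.Tendsto (fun k : ℕ => 6 * (2 ^ Fintype.card M₀.circ.Loc * (ρ ^ k * ζ)))
      Filter.atTop (nhds 0) := by
    have h := tendsto_pow_atTop_nhds_zero_of_lt_one hρ0 hρ1
    have h := ((h.mul_const ζ).const_mul (2 ^ Fintype.card M₀.circ.Loc : ℝ)).const_mul (6 : ℝ)
    simpa using h
  -- The bound depends on the scheme, the program and `η` only, so `k` is chosen before the noise
  -- and its bath. Lying below 1 as well as below `δ` is needed to apply `computationError_le`.
  obtain ⟨k, hk⟩ := (hlim.eventually_lt_const (lt_min hδ one_pos)).exists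
  obtain ⟨hk1, hk2⟩ := lt_min_iff.1 hk
  refine ⟨k, fun B _ _ _ N hN β hβ => ?_⟩
  have hP := hF.level_wellFormed hM₀ k
  have hβ' : ‖zeroState (F.level M₀ k).Qubit β‖ = 1 := (norm_zeroState β).trans hβ
  -- The initial family consists of the fault paths grouped by their sets of faulty locations; its
  -- sums over supersets of `J` are `E(J)` applied to the initial state.
  have h := hF.computationError_le hM₀ hρ1 k B ζ hζ0 hζ1 le_rfl ?_
    (N.faultSum (zeroState (F.level M₀ k).Qubit β)) (N.faultSum_mem hP β) (fun J hJ => ?_) ?_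
  · rw [N.sum_faultSum_univ hP] at h
    exact h.trans hk1.le
  · have : 0 ≤ 2 ^ Fintype.card M₀.circ.Loc * (ρ ^ k * ζ) := by positivity
    linarith
  · have h1 := (N.E J).le_opNorm (zeroState (F.level M₀ k).Qubit β)
    rw [hβ', mul_one, ← N.sum_faultSum] at h1
    refine Eq.trans_le (congrArg norm (Finset.sum_congr ?_ fun _ _ => rfl))
      (h1.trans (hN.max_zero J hJ))
    exact Finset.filter_congr_decidable _ _ _
  · rw [N.sum_faultSum_univ hP]
    exact hβ'.symm.trans_le (N.norm_le_norm_evolution hP _)
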